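/- For $f\in L^2(\mathbb R)$ (complex-valued) let $\widehat f(\xi)=\int_{\mathbb R}e^{-ix\xi}f(x)\,dx$, and let $$D_0^{1/3}e^{it\partial_x^4}f(x)=\frac1{2\pi}\int_{\mathbb R}e^{ix\xi}\,(6\xi^2)^{1/6}\,e^{it\xi^4}\,\widehat f(\xi)\,d\xi ,\qquad (x,t)\in\mathbb R^2,$$ understood as a distribution on $\mathbb R^2$. Its $L^6(\mathbb R^2)$ norm is taken to be $\infty$ if it is not a function in $L^6(\mathbb R^2)$. Let $$\mathbf M:=\sup_{0\neq f\in L^2(\mathbb R)}\frac{\|D_0^{1/3}e^{it\partial_x^4}f\|_{L^6_{x,t}(\mathbb R^{2})}}{\|f\|_{L^2(\mathbb R)}} .$$ Then $\mathbf M<\infty$, so that the Strichartz inequality for the fourth order Schrödinger equation $$\|D_0^{1/3}e^{it\partial_x^4}f\|_{L^6_{x,t}(\mathbb R^{2})}\le\mathbf M\,\|f\|_{L^2(\mathbb R)}\qquad\text{for all } f\in L^2(\mathbb R)$$ holds with the finite optimal constant $\mathbf M$. Moreover, this inequality has an extremizer: there exists $f\in L^2(\mathbb R)$, $f\neq0$,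 for which equality holds. -/

import Mathlib

open MeasureTheory FourierTransform
open scoped ENNReal ContDiff

/-- The Fourier transform of `f ∈ L²(ℝ)` in the normalization
`f̂(ξ) = ∫ e^{-ixξ} f(x) dx`. Mathlib's Plancherel extension `𝓕` is built on the
kernel `e^{-2πixξ}`, hence the rescaling of the variable. -/
noncomputable def angularFourier (f : Lp ℂ 2 (volume : Measure ℝ)) : ℝ → ℂ :=
  fun ξ => (𝓕 f : Lp ℂ 2 (volume : Measure ℝ)) (ξ / (2 * Real.pi))

/-- The symbol `(6ξ²)^{α/2} e^{itξ⁴}` of the Fourier multiplier `D₀^α e^{it∂ₓ⁴}`. -/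
noncomputable def evolutionSymbol (α t ξ : ℝ) : ℂ :=
  (((6 * ξ ^ 2) ^ (α / 2) : ℝ) : ℂ) * Complex.exp (Complex.I * (t * ξ ^ 4 : ℝ))

/-- `u = D₀^α e^{it∂ₓ⁴} f` on `ℝ × ℝ ∋ (x, t)`, in the sense of distributions.
Formally, `u(x,t) = (1/2π) ∫ e^{ixξ} (6ξ²)^{α/2} e^{itξ⁴} f̂(ξ) dξ`; for a general
`f ∈ L²(ℝ)` that integral need not converge absolutely, so it is tested against
`φ ∈ C_c^∞(ℝ²)`. The inner integral is rapidly decreasing in `ξ`, so that the right-hand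
side is an absolutely convergent integral in `ξ` for every `f ∈ L²(ℝ)` and `α ≥ 0`. -/
def IsEvolution (α : ℝ) (f : Lp ℂ 2 (volume : Measure ℝ)) (u : ℝ × ℝ → ℂ) : Prop :=
  LocallyIntegrable u ∧
    ∀ φ : ℝ × ℝ → ℂ, ContDiff ℝ ∞ φ → HasCompactSupport φ →
      ∫ z : ℝ × ℝ, u z * φ z =
        (1 / (2 * Real.pi) : ℂ) * ∫ ξ : ℝ, angularFourier f ξ *
          ∫ z : ℝ × ℝ, Complex.exp (Complex.I * (z.1 * ξ : ℝ)) *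
            evolutionSymbol α z.2 ξ * φ z

/-- The norm `‖D₀^{1/3} e^{it∂ₓ⁴} f‖_{L⁶(ℝ²)}`, equal to `∞` if the distribution
`D₀^{1/3} e^{it∂ₓ⁴} f` is not a function in `L⁶(ℝ²)`. Locally integrable representatives
of a distribution agree almost everywhere, so the infimum is over at most one value. -/
noncomputable def strichartzNorm (f : Lp ℂ 2 (volume : Measure ℝ)) : ℝ≥0∞ :=
  ⨅ (u : ℝ × ℝ → ℂ) (_ : IsEvolution (1 / 3) f u), eLpNorm u 6 volume

/-- The optimal constant
`M = sup_{0 ≠ f ∈ L²} ‖D₀^{1/3} e^{it∂ₓ⁴} f‖_{L⁶(ℝ²)} / ‖f‖_{L²(ℝ)}`. -/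
noncomputable def strichartzConstant : ℝ≥0∞ :=
  ⨆ (f : Lp ℂ 2 (volume : Measure ℝ)) (_ : f ≠ 0), strichartzNorm f / ‖f‖ₑ

/-!
On the Fourier side the evolution is a constant multiple of the extension operator of the quartic
curve `(η, η⁴)` with weight `|η|^{1/3}` (`strichartzNorm_eq`), and the angular Fourier transform is
a multiple of a unitary operator. The statement therefore says that this operator
`extOp 0 1 : L²(ℝ) → L⁶(ℝ²)` is bounded and attains its norm `quarticNorm`. It is studied inside the
family `extOp α β`, with phase `6α²η² + 4αβη³ + β²η⁴` and weight `|α + βη|^{1/3}`. Up to terms affine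
in `η`, this phase is a multiple of `(α + βη)⁴`, so that translations and dilations of the frequency
carry `extOp 0 1` to the operators with `β ≠ 0` (`norm_extOp_rescale`), while `extOp 1 0` is the
extension operator of a parabola, that is, the Schrödinger evolution.

The only possible failure of compactness beyond the symmetries is a maximizing sequence whose
frequency runs off to infinity relative to its scale; its profile is then governed by `extOp 1 0`.
The proof shows that this is the only obstruction (`exists_extremizer_extOp`) and that it does not
occur, because `extOp 1 0` has strictly smaller norm (`norm_extOp_schrodinger_lt`).

*Concentration.* The square of an extension is the extension of a tensor square along sums of two
points of the curve. The Hausdorff–Young inequality turns its `L³` norm into a fractional energy of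
`|g|^{3/2}`: the weight is exactly the one for which the Jacobian leaves the kernel `|ξ - η|^{-1/2}`.
A Hardy–Littlewood–Sobolev inequality with a gain (`refined_hls`) shows that the `L⁶` norm can only
be large if `|g|` has large mean at some location and scale (`refined_strichartz`). Replacing `g` by
`|g|` does not decrease the `L⁶` norm, since that norm is, after Gaussian regularization, a form
with positive kernel (`lintegral_ext_le_norm`); so a maximizing sequence may be taken nonnegative,
and then a large mean of `|g|` produces a nonzero weak limit after rescaling.

*Compactness.* Local smoothing makes the contribution of high frequencies small in a weighted `L²`
space, hence images of weakly null sequences tend to zero almost everywhere along a subsequence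
(`exists_subseq_extOp_tendsto_ae`). By the Brezis–Lieb lemma and the superadditivity of the cube,
the weak limit saturates the norm (`exists_saturating_of_concentrating`). If the frequency location
stays bounded relative to the scale, this is an extremizer. Otherwise the limiting operator is
`extOp 1 0`, by strong convergence of `extOp 1 ε` as `ε → 0`, which van der Corput's lemma supplies
(`tendsto_extOp_one`), and `extOp 1 0` would have norm at least `quarticNorm`.

*Strict inequality.* The threefold convolution of the measure on the parabola is bounded by the
constant `π / (6√3)`, which bounds `‖extOp 1 0‖⁶` by `(2π)² π / (6√3)`
(`norm_extOp_schrodinger_pow_le`). For the quartic curve the trial function is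
`|ξ|^{1/3} e^{-ξ⁴}`. The cube of its extension has an `L²` norm bounded below by duality
(`sq_lintegral_le_lintegral_oscInt`), with test density `e^{-τ} (1 - s/12 + s²/300)`, `s = ξ⁴/τ`, on
the set of sums of three points of the curve. All integrals are then values of `Γ`, and the required
inequality between `Γ(5/12)`, `Γ(11/12)` and `Γ(5/4)`, which holds with a margin of less than two
per cent, follows from log-convexity of `Γ` (`numerical_threshold`).
-/

/-! ### Oscillatory integrals and Gaussian regularization -/

/-- The character `e^{i z·p}` of `ℝ²`. -/
noncomputable def planeChar (z p : ℝ × ℝ) : ℂ :=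
  Complex.exp ((z.1 * p.1 + z.2 * p.2 : ℝ) * Complex.I)

/-- The oscillatory integral `∫ e^{i z·Φ(s)} b(s) dm(s)`, i.e. the Fourier transform of the
push-forward of `b dm` to the plane under `Φ`. -/
noncomputable def oscInt {Ω : Type*} [MeasurableSpace Ω] (m : Measure Ω) (Φ : Ω → ℝ × ℝ)
    (b : Ω → ℂ) (z : ℝ × ℝ) : ℂ :=
  ∫ s, planeChar z (Φ s) * b s ∂m

/-- The Gaussian weight `e^{-δ|z|²}` on the plane. -/
noncomputable def gaussWeight (δ : ℝ) (z : ℝ × ℝ) : ℝ :=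
  Real.exp (-δ * (z.1 ^ 2 + z.2 ^ 2))

/-- The Fourier transform `(π/δ) e^{-|p|²/4δ}` of `gaussWeight δ`. Its positivity is what makes
majorant arguments possible. -/
noncomputable def gaussKernel (δ : ℝ) (p : ℝ × ℝ) : ℝ :=
  Real.pi / δ * Real.exp (-(p.1 ^ 2 + p.2 ^ 2) / (4 * δ))

lemma norm_planeChar (z p : ℝ × ℝ) : ‖planeChar z p‖ = 1 := by
  rw [planeChar, Complex.norm_exp_ofReal_mul_I]

lemma enorm_planeChar (z p : ℝ × ℝ) : ‖planeChar z p‖ₑ = 1 := by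
  rw [← ofReal_norm, norm_planeChar, ENNReal.ofReal_one]

lemma continuous_planeChar : Continuous fun q : (ℝ × ℝ) × (ℝ × ℝ) => planeChar q.1 q.2 := by
  unfold planeChar; fun_prop

lemma measurable_planeChar_comp {α : Type*} [MeasurableSpace α] {f g : α → ℝ × ℝ}
    (hf : Measurable f) (hg : Measurable g) : Measurable fun a => planeChar (f a) (g a) :=
  continuous_planeChar.measurable.comp (hf.prodMk hg)

lemma planeChar_mul_conj (z p q : ℝ × ℝ) :
    planeChar z p * (starRingEnd ℂ) (planeChar z q) = planeChar z (p - q) := by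
  simp only [planeChar, ← Complex.exp_conj, ← Complex.exp_add, map_mul, Complex.conj_ofReal,
    Complex.conj_I, Prod.fst_sub, Prod.snd_sub]
  congr 1; push_cast; ring

lemma planeChar_add (z p q : ℝ × ℝ) :
    planeChar z (p + q) = planeChar z p * planeChar z q := by
  simp only [planeChar, ← Complex.exp_add, Prod.fst_add, Prod.snd_add]
  congr 1; push_cast; ring

lemma gaussWeight_pos (δ : ℝ) (z : ℝ × ℝ) : 0 < gaussWeight δ z := Real.exp_pos _

lemma gaussKernel_nonneg {δ : ℝ} (hδ : 0 < δ) (p : ℝ × ℝ) : 0 ≤ gaussKernel δ p := by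
  unfold gaussKernel; positivity

lemma continuous_gaussWeight (δ : ℝ) : Continuous (gaussWeight δ) := by
  unfold gaussWeight; fun_prop

lemma continuous_gaussKernel (δ : ℝ) : Continuous (gaussKernel δ) := by
  unfold gaussKernel; fun_prop

lemma gaussWeight_eq (δ : ℝ) (z : ℝ × ℝ) :
    gaussWeight δ z = Real.exp (-δ * z.1 ^ 2) * Real.exp (-δ * z.2 ^ 2) := by
  rw [gaussWeight, ← Real.exp_add]; congr 1; ring

lemma integrable_gaussWeight {δ : ℝ} (hδ : 0 < δ) : Integrable (gaussWeight δ) := by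
  have h := (integrable_exp_neg_mul_sq hδ).mul_prod (integrable_exp_neg_mul_sq hδ)
  refine h.congr (ae_of_all _ fun z => ?_)
  simp [gaussWeight_eq]

lemma integral_exp_mul_gaussian {δ : ℝ} (hδ : 0 < δ) (p : ℝ) :
    ∫ x : ℝ, Complex.exp ((x * p : ℝ) * Complex.I) * (Real.exp (-δ * x ^ 2) : ℂ) =
      ((Real.sqrt (Real.pi / δ) * Real.exp (-p ^ 2 / (4 * δ)) : ℝ) : ℂ) := by
  have h := fourierIntegral_gaussian (b := (δ : ℂ)) (by simpa using hδ) (p : ℂ)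
  have e : ∀ x : ℝ, Complex.exp ((x * p : ℝ) * Complex.I) * (Real.exp (-δ * x ^ 2) : ℂ) =
      Complex.exp (Complex.I * p * x) * Complex.exp (-δ * x ^ 2) := by
    intro x
    push_cast
    congr 2; ring
  simp_rw [e, h]
  have : ((Real.pi : ℂ) / δ) ^ (1 / 2 : ℂ) = ((Real.sqrt (Real.pi / δ) : ℝ) : ℂ) := by
    rw [Real.sqrt_eq_rpow, Complex.ofReal_cpow (by positivity)]
    push_cast; rfl
  rw [this]; push_cast; rfl

lemma integral_planeChar_mul_gaussWeight {δ : ℝ} (hδ : 0 < δ) (p : ℝ × ℝ) :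
    ∫ z : ℝ × ℝ, planeChar z p * (gaussWeight δ z : ℂ) = (gaussKernel δ p : ℂ) := by
  have e : ∀ z : ℝ × ℝ, planeChar z p * (gaussWeight δ z : ℂ) =
      (Complex.exp ((z.1 * p.1 : ℝ) * Complex.I) * (Real.exp (-δ * z.1 ^ 2) : ℂ)) *
      (Complex.exp ((z.2 * p.2 : ℝ) * Complex.I) * (Real.exp (-δ * z.2 ^ 2) : ℂ)) := by
    intro z
    rw [gaussWeight_eq, planeChar]
    push_cast
    rw [add_mul, Complex.exp_add]; ring
  simp_rw [e]
  rw [show (volume : Measure (ℝ × ℝ)) = (volume : Measure ℝ).prod volume from rfl,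
    integral_prod_mul (fun x : ℝ => Complex.exp ((x * p.1 : ℝ) * Complex.I) *
      (Real.exp (-δ * x ^ 2) : ℂ)) (fun x : ℝ => Complex.exp ((x * p.2 : ℝ) * Complex.I) *
      (Real.exp (-δ * x ^ 2) : ℂ)), integral_exp_mul_gaussian hδ, integral_exp_mul_gaussian hδ,
    ← Complex.ofReal_mul]
  congr 1
  have h1 : Real.sqrt (Real.pi / δ) * Real.sqrt (Real.pi / δ) = Real.pi / δ :=
    Real.mul_self_sqrt (by positivity)
  rw [gaussKernel, neg_add, add_div, Real.exp_add]
  linear_combination (Real.exp (-p.1 ^ 2 / (4 * δ)) * Real.exp (-p.2 ^ 2 / (4 * δ))) * h1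

/-- The Gaussian kernel has total mass `(2π)²`, whatever the width. -/
lemma lintegral_gaussKernel {δ : ℝ} (hδ : 0 < δ) :
    ∫⁻ p : ℝ × ℝ, ENNReal.ofReal (gaussKernel δ p) = ENNReal.ofReal ((2 * Real.pi) ^ 2) := by
  have hc : 0 < 1 / (4 * δ) := by positivity
  have e : ∀ p : ℝ × ℝ, gaussKernel δ p = Real.pi / δ * gaussWeight (1 / (4 * δ)) p := by
    intro p; rw [gaussKernel, gaussWeight]; congr 2; ring
  have hi : Integrable (gaussKernel δ) := by
    have := (integrable_gaussWeight hc).const_mul (Real.pi / δ)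
    exact this.congr (ae_of_all _ fun p => (e p).symm)
  rw [← ofReal_integral_eq_lintegral_ofReal hi (ae_of_all _ (gaussKernel_nonneg hδ))]
  congr 1
  have h0 := integral_planeChar_mul_gaussWeight hc 0
  have h1 : ∀ z, planeChar z 0 = 1 := by intro z; simp [planeChar]
  simp_rw [h1, one_mul] at h0
  rw [integral_complex_ofReal] at h0
  have h2 := Complex.ofReal_injective h0
  simp_rw [e]
  rw [integral_const_mul, h2, gaussKernel]
  simp
  field_simp
  norm_num

section Pairing

variable {Ω Ω' : Type*} [MeasurableSpace Ω] [MeasurableSpace Ω'] {m : Measure Ω}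
  {m' : Measure Ω'} {Φ : Ω → ℝ × ℝ} {Φ' : Ω' → ℝ × ℝ} {b : Ω → ℂ} {b' : Ω' → ℂ}

lemma integrable_planeChar_mul (hΦ : Measurable Φ) (hb : Integrable b m) (z : ℝ × ℝ) :
    Integrable (fun s => planeChar z (Φ s) * b s) m := by
  refine hb.bdd_mul (c := 1) ?_ (ae_of_all _ fun s => (norm_planeChar _ _).le)
  exact (measurable_planeChar_comp measurable_const hΦ).aestronglyMeasurable

lemma norm_oscInt_le (z : ℝ × ℝ) : ‖oscInt m Φ b z‖ ≤ ∫ s, ‖b s‖ ∂m := by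
  refine (norm_integral_le_integral_norm _).trans (le_of_eq ?_)
  simp [norm_planeChar]

lemma enorm_oscInt_le (z : ℝ × ℝ) : ‖oscInt m Φ b z‖ₑ ≤ ∫⁻ s, ‖b s‖ₑ ∂m := by
  refine (enorm_integral_le_lintegral_enorm _).trans (le_of_eq ?_)
  simp [enorm_planeChar]

lemma continuous_oscInt (hΦ : Measurable Φ) (hb : Integrable b m) :
    Continuous (oscInt m Φ b) := by
  refine continuous_of_dominated (bound := fun s => ‖b s‖) (fun z => ?_) (fun z => ?_)
    hb.norm (ae_of_all _ fun s => ?_)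
  · exact (integrable_planeChar_mul hΦ hb z).aestronglyMeasurable
  · exact ae_of_all _ fun s => by simp [norm_planeChar]
  · exact (continuous_planeChar.comp (continuous_id.prodMk continuous_const)).mul
      continuous_const

/-- The Gaussian-regularized `L²` pairing of two oscillatory integrals is a double integral
against the positive kernel `gaussKernel`. -/
lemma integral_oscInt_mul_conj [SFinite m] [SFinite m'] (hΦ : Measurable Φ)
    (hΦ' : Measurable Φ') (hb : Integrable b m) (hb' : Integrable b' m') {δ : ℝ} (hδ : 0 < δ) :
    ∫ z, oscInt m Φ b z * (starRingEnd ℂ) (oscInt m' Φ' b' z) * (gaussWeight δ z : ℂ) =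
      ∫ q : Ω × Ω', b q.1 * (starRingEnd ℂ) (b' q.2) * (gaussKernel δ (Φ q.1 - Φ' q.2) : ℂ)
        ∂(m.prod m') := by
  have h1 : ∀ z, oscInt m Φ b z * (starRingEnd ℂ) (oscInt m' Φ' b' z) * (gaussWeight δ z : ℂ) =
      ∫ q : Ω × Ω', (b q.1 * (starRingEnd ℂ) (b' q.2)) *
        (planeChar z (Φ q.1 - Φ' q.2) * (gaussWeight δ z : ℂ)) ∂(m.prod m') := by
    intro z
    rw [oscInt, oscInt, ← integral_conj, ← integral_prod_mul (L := ℂ), ← integral_mul_const]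
    refine integral_congr_ae (ae_of_all _ fun q => ?_)
    simp only [map_mul, ← planeChar_mul_conj]
    ring
  simp_rw [h1]
  rw [integral_integral_swap]
  · refine integral_congr_ae (ae_of_all _ fun q => ?_)
    simp only
    rw [integral_const_mul, integral_planeChar_mul_gaussWeight hδ]
  · have hbb : Integrable (fun q : Ω × Ω' => b q.1 * (starRingEnd ℂ) (b' q.2)) (m.prod m') :=
      hb.mul_prod ((Complex.conjCLE.toContinuousLinearMap.integrable_comp hb'))
    have hg : Integrable fun z => (gaussWeight δ z : ℂ) := (integrable_gaussWeight hδ).ofReal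
    have hG := hg.mul_prod hbb
    have hm : Measurable fun q : (ℝ × ℝ) × (Ω × Ω') => planeChar q.1 (Φ q.2.1 - Φ' q.2.2) :=
      measurable_planeChar_comp measurable_fst
        ((hΦ.comp (measurable_fst.comp measurable_snd)).sub
          (hΦ'.comp (measurable_snd.comp measurable_snd)))
    have := hG.bdd_mul (c := 1) hm.aestronglyMeasurable
      (ae_of_all _ fun q => (norm_planeChar _ _).le)
    refine this.congr (ae_of_all _ fun q => ?_)
    simp only [Function.uncurry]
    ring

lemma lintegral_enorm_sq_eq_ofReal_integral {δ : ℝ} (hδ : 0 < δ) [SFinite m]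
    (hΦ : Measurable Φ) (hb : Integrable b m) :
    ∫⁻ z, ‖oscInt m Φ b z‖ₑ ^ 2 * ENNReal.ofReal (gaussWeight δ z) =
      ‖∫ z, oscInt m Φ b z * (starRingEnd ℂ) (oscInt m Φ b z) * (gaussWeight δ z : ℂ)‖ₑ := by
  have e : ∀ z, oscInt m Φ b z * (starRingEnd ℂ) (oscInt m Φ b z) * (gaussWeight δ z : ℂ) =
      ((‖oscInt m Φ b z‖ ^ 2 * gaussWeight δ z : ℝ) : ℂ) := by
    intro z
    rw [Complex.mul_conj, Complex.normSq_eq_norm_sq]; push_cast; rfl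
  have hn : ∀ z, 0 ≤ ‖oscInt m Φ b z‖ ^ 2 * gaussWeight δ z := fun z =>
    mul_nonneg (by positivity) (gaussWeight_pos δ z).le
  have hint : Integrable fun z => ‖oscInt m Φ b z‖ ^ 2 * gaussWeight δ z := by
    refine (integrable_gaussWeight hδ).bdd_mul (c := (∫ s, ‖b s‖ ∂m) ^ 2) ?_ ?_
    · exact ((continuous_oscInt hΦ hb).norm.pow 2).aestronglyMeasurable
    · refine ae_of_all _ fun z => ?_
      rw [norm_pow, norm_norm]
      gcongr
      exact norm_oscInt_le z
  simp_rw [e]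
  rw [integral_complex_ofReal, ← ofReal_norm, Complex.norm_real, Real.norm_of_nonneg
    (integral_nonneg hn), ofReal_integral_eq_lintegral_ofReal hint (ae_of_all _ hn)]
  refine lintegral_congr fun z => ?_
  rw [ENNReal.ofReal_mul (by positivity), ENNReal.ofReal_pow (norm_nonneg _), ofReal_norm]

lemma lintegral_enorm_sq_gaussWeight_le [SFinite m] (hΦ : Measurable Φ) (hb : Integrable b m)
    {δ : ℝ} (hδ : 0 < δ) :
    ∫⁻ z, ‖oscInt m Φ b z‖ₑ ^ 2 * ENNReal.ofReal (gaussWeight δ z) ≤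
      ∫⁻ q : Ω × Ω, ‖b q.1‖ₑ * ‖b q.2‖ₑ * ENNReal.ofReal (gaussKernel δ (Φ q.1 - Φ q.2))
        ∂(m.prod m) := by
  rw [lintegral_enorm_sq_eq_ofReal_integral hδ hΦ hb, integral_oscInt_mul_conj hΦ hΦ hb hb hδ]
  refine (enorm_integral_le_lintegral_enorm _).trans (le_of_eq ?_)
  refine lintegral_congr fun q => ?_
  rw [enorm_mul, enorm_mul]
  congr 1
  · simp [← ofReal_norm]
  · rw [← ofReal_norm, Complex.norm_real, Real.norm_of_nonneg (gaussKernel_nonneg hδ _)]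

/-- Majorant principle: replacing the amplitude by its absolute value can only increase the
Gaussian-regularized `L²` norm of an oscillatory integral. -/
lemma lintegral_enorm_sq_gaussWeight_le_norm [SFinite m] (hΦ : Measurable Φ)
    (hb : Integrable b m) {δ : ℝ} (hδ : 0 < δ) :
    ∫⁻ z, ‖oscInt m Φ b z‖ₑ ^ 2 * ENNReal.ofReal (gaussWeight δ z) ≤
      ∫⁻ z, ‖oscInt m Φ (fun s => (‖b s‖ : ℂ)) z‖ₑ ^ 2 * ENNReal.ofReal (gaussWeight δ z) := by
  refine (lintegral_enorm_sq_gaussWeight_le hΦ hb hδ).trans (le_of_eq ?_)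
  have hb' : Integrable (fun s => (‖b s‖ : ℂ)) m := hb.norm.ofReal
  rw [lintegral_enorm_sq_eq_ofReal_integral hδ hΦ hb', integral_oscInt_mul_conj hΦ hΦ hb' hb' hδ]
  have e : ∀ q : Ω × Ω, (‖b q.1‖ : ℂ) * (starRingEnd ℂ) (‖b q.2‖ : ℂ) *
      (gaussKernel δ (Φ q.1 - Φ q.2) : ℂ) =
      ((‖b q.1‖ * ‖b q.2‖ * gaussKernel δ (Φ q.1 - Φ q.2) : ℝ) : ℂ) := by
    intro q; rw [Complex.conj_ofReal]; push_cast; rfl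
  have hn : ∀ q : Ω × Ω, 0 ≤ ‖b q.1‖ * ‖b q.2‖ * gaussKernel δ (Φ q.1 - Φ q.2) := fun q =>
    mul_nonneg (by positivity) (gaussKernel_nonneg hδ _)
  have hint : Integrable (fun q : Ω × Ω => ‖b q.1‖ * ‖b q.2‖ * gaussKernel δ (Φ q.1 - Φ q.2))
      (m.prod m) := by
    refine (hb.norm.mul_prod hb.norm).mul_bdd (c := Real.pi / δ) ?_ ?_
    · exact ((continuous_gaussKernel δ).measurable.comp
        ((hΦ.comp measurable_fst).sub (hΦ.comp measurable_snd))).aestronglyMeasurable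
    · refine ae_of_all _ fun q => ?_
      rw [Real.norm_of_nonneg (gaussKernel_nonneg hδ _), gaussKernel]
      refine mul_le_of_le_one_right (by positivity) (Real.exp_le_one_iff.2 ?_)
      rw [neg_div]
      exact neg_nonpos.2 (by positivity)
  simp_rw [e]
  rw [integral_complex_ofReal, ← ofReal_norm, Complex.norm_real, Real.norm_of_nonneg
    (integral_nonneg hn), ofReal_integral_eq_lintegral_ofReal hint (ae_of_all _ hn)]
  refine lintegral_congr fun q => ?_
  rw [ENNReal.ofReal_mul (by positivity), ENNReal.ofReal_mul (by positivity), ofReal_norm,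
    ofReal_norm]

/-- Schur's test for the kernel `gaussKernel δ (Φ s - Φ s')`. -/
lemma schur_gaussKernel [SFinite m] (hΦ : Measurable Φ) (hb : Integrable b m) {δ : ℝ}
    (hδ : 0 < δ) {C : ℝ≥0∞}
    (hC : ∀ p : ℝ × ℝ, ∫⁻ s, ENNReal.ofReal (gaussKernel δ (p - Φ s)) ∂m ≤ C) :
    ∫⁻ z, ‖oscInt m Φ b z‖ₑ ^ 2 * ENNReal.ofReal (gaussWeight δ z) ≤
      C * ∫⁻ s, ‖b s‖ₑ ^ 2 ∂m := by
  refine (lintegral_enorm_sq_gaussWeight_le hΦ hb hδ).trans ?_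
  set k : Ω → Ω → ℝ≥0∞ := fun s s' => ENNReal.ofReal (gaussKernel δ (Φ s - Φ s')) with hk
  have hkm : Measurable fun q : Ω × Ω => k q.1 q.2 :=
    ENNReal.measurable_ofReal.comp ((continuous_gaussKernel δ).measurable.comp
        ((hΦ.comp measurable_fst).sub (hΦ.comp measurable_snd)))
  have hsymm : ∀ s s', k s s' = k s' s := by
    intro s s'
    simp only [hk, gaussKernel, Prod.fst_sub, Prod.snd_sub]
    congr 4; ring
  have hbm : AEMeasurable (fun s => ‖b s‖ₑ ^ 2) m := hb.aestronglyMeasurable.enorm.pow_const 2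
  have hf1 : AEMeasurable (fun q : Ω × Ω => ‖b q.1‖ₑ ^ 2 * k q.1 q.2) (m.prod m) :=
    (hbm.comp_quasiMeasurePreserving Measure.quasiMeasurePreserving_fst).mul hkm.aemeasurable
  have hf2 : AEMeasurable (fun q : Ω × Ω => ‖b q.2‖ₑ ^ 2 * k q.1 q.2) (m.prod m) :=
    (hbm.comp_quasiMeasurePreserving Measure.quasiMeasurePreserving_snd).mul hkm.aemeasurable
  have h1 : ∫⁻ q : Ω × Ω, ‖b q.1‖ₑ ^ 2 * k q.1 q.2 ∂(m.prod m) ≤ C * ∫⁻ s, ‖b s‖ₑ ^ 2 ∂m := by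
    rw [lintegral_prod _ hf1, mul_comm, ← lintegral_mul_const'' _ hbm]
    refine lintegral_mono fun s => ?_
    simp only
    rw [lintegral_const_mul' _ _ (by simp)]
    exact mul_le_mul_right (hC (Φ s)) _
  have h2 : ∫⁻ q : Ω × Ω, ‖b q.2‖ₑ ^ 2 * k q.1 q.2 ∂(m.prod m) =
      ∫⁻ q : Ω × Ω, ‖b q.1‖ₑ ^ 2 * k q.1 q.2 ∂(m.prod m) := by
    rw [← lintegral_prod_swap]
    refine lintegral_congr fun q => ?_
    simp only [Prod.fst_swap, Prod.snd_swap]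
    rw [hsymm]
  calc ∫⁻ q : Ω × Ω, ‖b q.1‖ₑ * ‖b q.2‖ₑ * k q.1 q.2 ∂(m.prod m)
      ≤ ∫⁻ q : Ω × Ω, 2⁻¹ * (‖b q.1‖ₑ ^ 2 * k q.1 q.2 + ‖b q.2‖ₑ ^ 2 * k q.1 q.2)
          ∂(m.prod m) := by
        refine lintegral_mono fun q => ?_
        simp only
        rw [← add_mul, ← mul_assoc]
        refine mul_le_mul_left ?_ _
        rw [← ENNReal.div_eq_inv_mul, ENNReal.le_div_iff_mul_le (by simp) (by simp)]
        rcases eq_or_ne (‖b q.1‖ₑ) ⊤ with h | h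
        · simp at h
        have := two_mul_le_add_sq (‖b q.1‖) (‖b q.2‖)
        simp only [← ofReal_norm]
        rw [← ENNReal.ofReal_mul (norm_nonneg _), ← ENNReal.ofReal_pow (norm_nonneg _),
          ← ENNReal.ofReal_pow (norm_nonneg _), ← ENNReal.ofReal_add (by positivity)
          (by positivity), ← ENNReal.ofReal_ofNat, ← ENNReal.ofReal_mul (by positivity)]
        apply ENNReal.ofReal_le_ofReal
        linarith
    _ = ∫⁻ q : Ω × Ω, ‖b q.1‖ₑ ^ 2 * k q.1 q.2 ∂(m.prod m) := by
        rw [lintegral_const_mul' _ _ (by simp), lintegral_add_left' hf1, h2, ← two_mul,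
            ← mul_assoc, ENNReal.inv_mul_cancel (by simp) (by simp), one_mul]
    _ ≤ _ := h1

/-- Removal of the Gaussian regularization. -/
lemma lintegral_le_of_gaussWeight {F : ℝ × ℝ → ℝ≥0∞} (hF : Measurable F) {C : ℝ≥0∞}
    (h : ∀ δ : ℝ, 0 < δ → ∫⁻ z, F z * ENNReal.ofReal (gaussWeight δ z) ≤ C) :
    ∫⁻ z, F z ≤ C := by
  have hlim : ∀ z, Filter.Tendsto (fun n : ℕ => F z * ENNReal.ofReal (gaussWeight (1 / (n + 1)) z))
      Filter.atTop (nhds (F z)) := by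
    intro z
    have h1 : Filter.Tendsto (fun n : ℕ => gaussWeight (1 / ((n : ℝ) + 1)) z) Filter.atTop
        (nhds (gaussWeight 0 z)) := by
      have : Continuous fun δ : ℝ => gaussWeight δ z := by unfold gaussWeight; fun_prop
      exact (this.tendsto 0).comp tendsto_one_div_add_atTop_nhds_zero_nat
    have h2 := ENNReal.tendsto_ofReal h1
    have h3 : gaussWeight 0 z = 1 := by simp [gaussWeight]
    rw [h3, ENNReal.ofReal_one] at h2
    simpa using ENNReal.Tendsto.const_mul h2 (Or.inl one_ne_zero)
  calc ∫⁻ z, F z = ∫⁻ z, Filter.liminf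
        (fun n : ℕ => F z * ENNReal.ofReal (gaussWeight (1 / (n + 1)) z)) Filter.atTop := by
        refine lintegral_congr fun z => ?_
        rw [(hlim z).liminf_eq]
    _ ≤ Filter.liminf (fun n : ℕ => ∫⁻ z, F z * ENNReal.ofReal (gaussWeight (1 / (n + 1)) z))
          Filter.atTop := lintegral_liminf_le fun n => hF.mul
            (continuous_gaussWeight _).measurable.ennreal_ofReal
    _ ≤ C := by
        refine Filter.liminf_le_of_frequently_le' (Filter.Frequently.of_forall fun n => ?_)
        exact h _ (by positivity)

/-- Plancherel-type bound: if the push-forward of `m` under `Φ` has density at most `h₀`, then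
`‖oscInt b‖₂² ≤ (2π)² h₀ ‖b‖₂²`. -/
lemma lintegral_enorm_sq_oscInt_le [SFinite m] (hΦ : Measurable Φ) (hb : Integrable b m)
    {h₀ : ℝ≥0∞} (hm : m.map Φ ≤ h₀ • (volume : Measure (ℝ × ℝ))) :
    ∫⁻ z, ‖oscInt m Φ b z‖ₑ ^ 2 ≤
      ENNReal.ofReal ((2 * Real.pi) ^ 2) * h₀ * ∫⁻ s, ‖b s‖ₑ ^ 2 ∂m := by
  refine lintegral_le_of_gaussWeight ((continuous_oscInt hΦ hb).measurable.enorm.pow_const 2)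
    fun δ hδ => schur_gaussKernel hΦ hb hδ fun p => ?_
  have hk : Measurable fun q : ℝ × ℝ => ENNReal.ofReal (gaussKernel δ (p - q)) :=
    ((continuous_gaussKernel δ).measurable.comp (measurable_const.sub measurable_id)).ennreal_ofReal
  calc ∫⁻ s, ENNReal.ofReal (gaussKernel δ (p - Φ s)) ∂m
      = ∫⁻ q, ENNReal.ofReal (gaussKernel δ (p - q)) ∂(m.map Φ) := (lintegral_map hk hΦ).symm
    _ ≤ ∫⁻ q, ENNReal.ofReal (gaussKernel δ (p - q)) ∂(h₀ • (volume : Measure (ℝ × ℝ))) :=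
        lintegral_mono' hm le_rfl
    _ = ENNReal.ofReal ((2 * Real.pi) ^ 2) * h₀ := by
        rw [lintegral_smul_measure, lintegral_sub_left_eq_self
          (fun q => ENNReal.ofReal (gaussKernel δ q)) p, lintegral_gaussKernel hδ, smul_eq_mul,
          mul_comm]

end Pairing

/-! ### The Hausdorff–Young inequality at the exponents `3/2` and `3` -/

section HausdorffYoung

variable {Ω : Type*} [MeasurableSpace Ω] {m : Measure Ω} {Φ : Ω → ℝ × ℝ} {b : Ω → ℂ}

lemma oscInt_congr_ae {b' : Ω → ℂ} (h : b =ᵐ[m] b') : oscInt m Φ b = oscInt m Φ b' := by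
  funext z
  refine integral_congr_ae ?_
  filter_upwards [h] with s hs
  rw [hs]

lemma oscInt_add {b' : Ω → ℂ} (hΦ : Measurable Φ) (hb : Integrable b m) (hb' : Integrable b' m)
    (z : ℝ × ℝ) : oscInt m Φ (fun s => b s + b' s) z = oscInt m Φ b z + oscInt m Φ b' z := by
  unfold oscInt
  rw [← integral_add (integrable_planeChar_mul hΦ hb z) (integrable_planeChar_mul hΦ hb' z)]
  refine integral_congr_ae (ae_of_all _ fun s => ?_)
  simp only
  ring

/-- The weak-type input: at height `t` the amplitude is split at the level `(2N/t)²`, where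
`N = ∫|b|^{3/2}`; the large part contributes at most `t/2` pointwise. -/
lemma meas_lt_oscInt_mul_le [SFinite m] (hΦ : Measurable Φ) (hbm : Measurable b)
    (hb : Integrable b m) {h₀ : ℝ≥0∞} (hm : m.map Φ ≤ h₀ • (volume : Measure (ℝ × ℝ))) {N : ℝ}
    (hN0 : 0 < N) (hN : ∫⁻ s, ‖b s‖ₑ ^ (3 / 2 : ℝ) ∂m ≤ ENNReal.ofReal N) {t : ℝ} (ht : 0 < t) :
    volume {z | t < ‖oscInt m Φ b z‖} * ENNReal.ofReal (t ^ 2) ≤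
      4 * (ENNReal.ofReal ((2 * Real.pi) ^ 2) * h₀ *
        ∫⁻ s, {s | ‖b s‖ * t ^ 2 ≤ (2 * N) ^ 2}.indicator (fun s => ‖b s‖ₑ ^ 2) s ∂m) := by
  set S : Set Ω := {s | ‖b s‖ * t ^ 2 ≤ (2 * N) ^ 2} with hS
  have hSm : MeasurableSet S := measurableSet_le (by fun_prop) (by fun_prop)
  have hb2 : Integrable (S.indicator b) m := hb.indicator hSm
  have hb1 : Integrable (Sᶜ.indicator b) m := hb.indicator hSm.compl
  have hsplit : ∀ z, oscInt m Φ b z =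
      oscInt m Φ (Sᶜ.indicator b) z + oscInt m Φ (S.indicator b) z := by
    intro z
    rw [← oscInt_add hΦ hb1 hb2]
    congr 1; funext s
    exact (congrFun (Set.indicator_compl_add_self S b) s).symm
  have hlarge : ∀ z, ‖oscInt m Φ (Sᶜ.indicator b) z‖ₑ ≤ ENNReal.ofReal (t / 2) := by
    intro z
    calc ‖oscInt m Φ (Sᶜ.indicator b) z‖ₑ ≤ ∫⁻ s, ‖Sᶜ.indicator b s‖ₑ ∂m := enorm_oscInt_le z
      _ ≤ ∫⁻ s, ENNReal.ofReal (t / (2 * N)) * ‖b s‖ₑ ^ (3 / 2 : ℝ) ∂m := by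
          refine lintegral_mono fun s => ?_
          by_cases hs : s ∈ S
          · simp [hs]
          · have hs' : (2 * N) ^ 2 < ‖b s‖ * t ^ 2 := not_le.1 hs
            rw [Set.indicator_of_mem (by exact hs), ← ofReal_norm,
              ENNReal.ofReal_rpow_of_nonneg (norm_nonneg _) (by norm_num),
              ← ENNReal.ofReal_mul (by positivity)]
            refine ENNReal.ofReal_le_ofReal ?_
            have h1 : ‖b s‖ ^ (3 / 2 : ℝ) = ‖b s‖ * Real.sqrt ‖b s‖ := by
              rw [Real.sqrt_eq_rpow, ← Real.rpow_one_add' (norm_nonneg _) (by norm_num)]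
              norm_num
            have h2 : 2 * N < Real.sqrt ‖b s‖ * t := by
              refine lt_of_pow_lt_pow_left₀ 2 (by positivity) ?_
              rw [mul_pow _ t, Real.sq_sqrt (norm_nonneg _)]
              exact hs'
            rw [h1]
            have h3 : 1 ≤ t / (2 * N) * Real.sqrt ‖b s‖ := by
              rw [div_mul_eq_mul_div, le_div_iff₀ (by positivity)]
              linarith
            nlinarith [norm_nonneg (b s)]
      _ ≤ ENNReal.ofReal (t / (2 * N)) * ENNReal.ofReal N := by
          rw [lintegral_const_mul' _ _ (by simp)]
          gcongr
      _ = ENNReal.ofReal (t / 2) := by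
          rw [← ENNReal.ofReal_mul (by positivity)]
          congr 1; field_simp
  have hsub : {z | t < ‖oscInt m Φ b z‖} ⊆
      {z | ENNReal.ofReal ((t / 2) ^ 2) ≤ ‖oscInt m Φ (S.indicator b) z‖ₑ ^ 2} := by
    intro z hz
    have hz' : t < ‖oscInt m Φ b z‖ := hz
    have h1 : ‖oscInt m Φ (Sᶜ.indicator b) z‖ ≤ t / 2 := by
      have := hlarge z
      rw [← ofReal_norm] at this
      exact (ENNReal.ofReal_le_ofReal_iff (by positivity)).1 this
    have h2 := norm_add_le (oscInt m Φ (Sᶜ.indicator b) z) (oscInt m Φ (S.indicator b) z)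
    rw [← hsplit] at h2
    show ENNReal.ofReal ((t / 2) ^ 2) ≤ ‖oscInt m Φ (S.indicator b) z‖ₑ ^ 2
    rw [← ofReal_norm, ← ENNReal.ofReal_pow (norm_nonneg _)]
    refine ENNReal.ofReal_le_ofReal ?_
    gcongr
    linarith
  have hmark := meas_ge_le_lintegral_div (μ := volume)
    (f := fun z => ‖oscInt m Φ (S.indicator b) z‖ₑ ^ 2)
    ((continuous_oscInt hΦ hb2).measurable.enorm.pow_const 2).aemeasurable
    (ε := ENNReal.ofReal ((t / 2) ^ 2)) (by simp; positivity) (by simp)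
  have hL2 := lintegral_enorm_sq_oscInt_le hΦ hb2 hm
  have hind : ∫⁻ s, ‖S.indicator b s‖ₑ ^ 2 ∂m = ∫⁻ s, S.indicator (fun s => ‖b s‖ₑ ^ 2) s ∂m := by
    refine lintegral_congr fun s => ?_
    by_cases hs : s ∈ S <;> simp [hs]
  rw [hind] at hL2
  calc volume {z | t < ‖oscInt m Φ b z‖} * ENNReal.ofReal (t ^ 2)
      ≤ ((∫⁻ z, ‖oscInt m Φ (S.indicator b) z‖ₑ ^ 2) / ENNReal.ofReal ((t / 2) ^ 2)) *
          ENNReal.ofReal (t ^ 2) := by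
        gcongr
        exact (measure_mono hsub).trans hmark
    _ = 4 * ∫⁻ z, ‖oscInt m Φ (S.indicator b) z‖ₑ ^ 2 := by
        have : ENNReal.ofReal (t ^ 2) = 4 * ENNReal.ofReal ((t / 2) ^ 2) := by
          rw [show (4 : ℝ≥0∞) = ENNReal.ofReal 4 by simp, ← ENNReal.ofReal_mul (by norm_num)]
          congr 1; ring
        rw [this, mul_comm 4 (ENNReal.ofReal ((t / 2) ^ 2)), ← mul_assoc, ENNReal.div_mul_cancel (by simp; positivity) (by simp), mul_comm]
    _ ≤ _ := by gcongr

/-- Hausdorff–Young inequality `L^{3/2} → L³` for oscillatory integrals, by real interpolation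
between the trivial `L¹ → L^∞` bound and the Plancherel-type `L²` bound. -/
lemma lintegral_enorm_cube_oscInt_le [SFinite m] (hΦ : Measurable Φ) (hb : Integrable b m)
    {h₀ : ℝ≥0∞} (hm : m.map Φ ≤ h₀ • (volume : Measure (ℝ × ℝ)))
    (hfin : ∫⁻ s, ‖b s‖ₑ ^ (3 / 2 : ℝ) ∂m ≠ ⊤) :
    ∫⁻ z, ‖oscInt m Φ b z‖ₑ ^ 3 ≤
      24 * ENNReal.ofReal ((2 * Real.pi) ^ 2) * h₀ * (∫⁻ s, ‖b s‖ₑ ^ (3 / 2 : ℝ) ∂m) ^ 2 := by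
  wlog hbm : Measurable b generalizing b
  · have h1 := hb.aestronglyMeasurable.ae_eq_mk
    have h2 : ∫⁻ s, ‖b s‖ₑ ^ (3 / 2 : ℝ) ∂m =
        ∫⁻ s, ‖hb.aestronglyMeasurable.mk b s‖ₑ ^ (3 / 2 : ℝ) ∂m :=
      lintegral_congr_ae (h1.mono fun s hs => by simp only [hs])
    rw [oscInt_congr_ae h1, h2]
    exact this (hb.congr h1) (h2 ▸ hfin) hb.aestronglyMeasurable.stronglyMeasurable_mk.measurable
  set I := ∫⁻ s, ‖b s‖ₑ ^ (3 / 2 : ℝ) ∂m with hI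
  rcases eq_or_ne I 0 with h0 | h0
  · have hb0 : b =ᵐ[m] fun _ => 0 := by
      rw [hI, lintegral_eq_zero_iff (by fun_prop)] at h0
      filter_upwards [h0] with s hs
      simpa using hs
    rw [oscInt_congr_ae hb0]
    simp [oscInt]
  obtain ⟨N, hN0, hN⟩ : ∃ N : ℝ, 0 < N ∧ I = ENNReal.ofReal N :=
    ⟨I.toReal, ENNReal.toReal_pos h0 hfin, (ENNReal.ofReal_toReal hfin).symm⟩
  set K := ENNReal.ofReal ((2 * Real.pi) ^ 2) * h₀ with hK
  have hcont := continuous_oscInt hΦ hb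
  have hlayer := lintegral_rpow_eq_lintegral_meas_lt_mul (volume : Measure (ℝ × ℝ))
    (f := fun z => ‖oscInt m Φ b z‖) (ae_of_all _ fun z => norm_nonneg _)
    hcont.norm.measurable.aemeasurable (p := 3) (by norm_num)
  have hmeas : Measurable (fun q : ℝ × Ω => {s | ‖b s‖ * q.1 ^ 2 ≤ (2 * N) ^ 2}.indicator
      (fun s => ‖b s‖ₑ ^ 2) q.2) := by
    have : (fun q : ℝ × Ω => {s | ‖b s‖ * q.1 ^ 2 ≤ (2 * N) ^ 2}.indicator
      (fun s => ‖b s‖ₑ ^ 2) q.2) = {q : ℝ × Ω | ‖b q.2‖ * q.1 ^ 2 ≤ (2 * N) ^ 2}.indicator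
      (fun q => ‖b q.2‖ₑ ^ 2) := by
      funext q; simp [Set.indicator]
    rw [this]
    exact Measurable.indicator (by fun_prop) (measurableSet_le (by fun_prop) (by fun_prop))
  calc ∫⁻ z, ‖oscInt m Φ b z‖ₑ ^ 3
      = ∫⁻ z, ENNReal.ofReal (‖oscInt m Φ b z‖ ^ (3 : ℝ)) := by
        refine lintegral_congr fun z => ?_
        rw [show (3 : ℝ) = ((3 : ℕ) : ℝ) by norm_num, Real.rpow_natCast,
          ENNReal.ofReal_pow (norm_nonneg _), ofReal_norm]
    _ ≤ ENNReal.ofReal 3 * ∫⁻ t in Set.Ioi (0 : ℝ), 4 * (K *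
          ∫⁻ s, {s | ‖b s‖ * t ^ 2 ≤ (2 * N) ^ 2}.indicator (fun s => ‖b s‖ₑ ^ 2) s ∂m) := by
        rw [hlayer]
        refine mul_le_mul_right (setLIntegral_mono' measurableSet_Ioi fun t ht => ?_) _
        have := meas_lt_oscInt_mul_le hΦ hbm hb hm hN0 (hN ▸ le_refl I) ht
        rw [show (3 : ℝ) - 1 = ((2 : ℕ) : ℝ) by norm_num, Real.rpow_natCast]
        exact this
    _ = 12 * K * ∫⁻ s, (∫⁻ t in Set.Ioi (0 : ℝ), {s | ‖b s‖ * t ^ 2 ≤ (2 * N) ^ 2}.indicator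
          (fun s => ‖b s‖ₑ ^ 2) s) ∂m := by
        rw [lintegral_const_mul' _ _ (by simp), lintegral_const_mul _ hmeas.lintegral_prod_right',
          lintegral_lintegral_swap hmeas.aemeasurable, ← mul_assoc, ← mul_assoc]
        congr 2
        rw [show (12 : ℝ≥0∞) = ENNReal.ofReal 3 * 4 by
          rw [show (4 : ℝ≥0∞) = ENNReal.ofReal 4 by simp, ← ENNReal.ofReal_mul (by norm_num)]
          norm_num]
    _ ≤ 12 * K * ∫⁻ s, ENNReal.ofReal (2 * N) * ‖b s‖ₑ ^ (3 / 2 : ℝ) ∂m := by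
        refine mul_le_mul_right (lintegral_mono fun s => ?_) _
        rcases eq_or_ne (b s) 0 with hs | hs
        · simp [Set.indicator, hs]
        have hpos : 0 < ‖b s‖ := norm_pos_iff.2 hs
        have hsq : 0 < Real.sqrt ‖b s‖ := Real.sqrt_pos.2 hpos
        calc ∫⁻ t in Set.Ioi (0 : ℝ), {s | ‖b s‖ * t ^ 2 ≤ (2 * N) ^ 2}.indicator
              (fun s => ‖b s‖ₑ ^ 2) s
            ≤ ∫⁻ t in Set.Ioi (0 : ℝ), (Set.Ioc 0 (2 * N / Real.sqrt ‖b s‖)).indicator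
              (fun _ => ‖b s‖ₑ ^ 2) t := by
              refine setLIntegral_mono' measurableSet_Ioi fun t ht => ?_
              have ht' : (0 : ℝ) < t := ht
              by_cases h : ‖b s‖ * t ^ 2 ≤ (2 * N) ^ 2
              · rw [Set.indicator_of_mem (by exact h), Set.indicator_of_mem]
                refine ⟨ht, ?_⟩
                rw [le_div_iff₀ hsq]
                refine le_of_sq_le_sq ?_ (by positivity)
                rw [mul_pow, Real.sq_sqrt hpos.le]
                linarith
              · rw [Set.indicator_of_notMem (by exact h)]
                exact zero_le
          _ ≤ ∫⁻ t, (Set.Ioc 0 (2 * N / Real.sqrt ‖b s‖)).indicator (fun _ => ‖b s‖ₑ ^ 2) t :=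
              setLIntegral_le_lintegral _ _
          _ = ENNReal.ofReal (2 * N) * ‖b s‖ₑ ^ (3 / 2 : ℝ) := by
              rw [lintegral_indicator_const measurableSet_Ioc, Real.volume_Ioc, sub_zero,
                ← ofReal_norm, ENNReal.ofReal_rpow_of_pos hpos, ← ENNReal.ofReal_pow hpos.le,
                ← ENNReal.ofReal_mul (by positivity), ← ENNReal.ofReal_mul (by positivity)]
              congr 1
              have h1 : ‖b s‖ ^ (3 / 2 : ℝ) = ‖b s‖ * Real.sqrt ‖b s‖ := by
                rw [Real.sqrt_eq_rpow, ← Real.rpow_one_add' (norm_nonneg _) (by norm_num)]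
                norm_num
              have h2 := Real.mul_self_sqrt hpos.le
              rw [h1]
              field_simp
              nlinarith
    _ = 24 * ENNReal.ofReal ((2 * Real.pi) ^ 2) * h₀ * I ^ 2 := by
        rw [lintegral_const_mul' _ _ ENNReal.ofReal_ne_top, ← hI, hN, hK,
          ENNReal.ofReal_mul (by norm_num : (0 : ℝ) ≤ 2)]
        simp only [ENNReal.ofReal_ofNat]
        ring

end HausdorffYoung

/-! ### A refined Hardy–Littlewood–Sobolev inequality -/

lemma lintegral_comp_abs_le {F : ℝ → ℝ≥0∞} (hF : Measurable F) :
    ∫⁻ s : ℝ, F |s| ≤ 2 * ∫⁻ s in Set.Ici (0 : ℝ), F s := by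
  have h1 : ∫⁻ s in Set.Ici (0 : ℝ), F |s| = ∫⁻ s in Set.Ici (0 : ℝ), F s :=
    setLIntegral_congr_fun measurableSet_Ici fun s hs => by rw [abs_of_nonneg hs]
  have h2 : ∫⁻ s in (Set.Ici (0 : ℝ))ᶜ, F |s| ≤ ∫⁻ s in Set.Ici (0 : ℝ), F s := by
    have h3 : ∫⁻ s in Set.Iic (0 : ℝ), F |s| = ∫⁻ s in Set.Ici (0 : ℝ), F |s| := by
      have hmp := (Measure.measurePreserving_neg (volume : Measure ℝ)).setLIntegral_comp_preimage
        (s := Set.Ici 0) (f := fun s => F |s|) measurableSet_Ici (by fun_prop)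
      simpa [abs_neg] using hmp
    rw [← h1, ← h3]
    refine lintegral_mono_set fun s hs => ?_
    simp at hs ⊢
    exact hs.le
  rw [← lintegral_add_compl _ (measurableSet_Ici (a := (0 : ℝ))), two_mul, h1]
  gcongr

lemma lintegral_near_le {r : ℝ} (hr : 0 < r) (c : ℝ) :
    ∫⁻ x : ℝ, {x | |x - c| ≤ r}.indicator (fun x => ENNReal.ofReal (|x - c| ^ (-2 / 3 : ℝ))) x ≤
      ENNReal.ofReal (6 * r ^ (1 / 3 : ℝ)) := by
  set F : ℝ → ℝ≥0∞ := (Set.Iic r).indicator fun s => ENNReal.ofReal (s ^ (-2 / 3 : ℝ)) with hF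
  have hFm : Measurable F := Measurable.indicator (by fun_prop) measurableSet_Iic
  have e : ∀ x, {x | |x - c| ≤ r}.indicator (fun x => ENNReal.ofReal (|x - c| ^ (-2 / 3 : ℝ))) x =
      F |x - c| := by
    intro x; simp [hF, Set.indicator]
  simp_rw [e]
  rw [lintegral_sub_right_eq_self (fun x => F |x|) c]
  refine (lintegral_comp_abs_le hFm).trans ?_
  have h1 : ∫⁻ s in Set.Ici (0 : ℝ), F s = ENNReal.ofReal (3 * r ^ (1 / 3 : ℝ)) := by
    rw [hF, setLIntegral_indicator measurableSet_Iic, Set.inter_comm, Set.Ici_inter_Iic,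
      Measure.restrict_congr_set Ioc_ae_eq_Icc.symm]
    have hi : IntervalIntegrable (fun s : ℝ => s ^ (-2 / 3 : ℝ)) volume 0 r :=
      intervalIntegral.intervalIntegrable_rpow' (by norm_num)
    rw [← ofReal_integral_eq_lintegral_ofReal
      ((intervalIntegrable_iff_integrableOn_Ioc_of_le hr.le).1 hi)
      ((ae_restrict_iff' measurableSet_Ioc).2 (ae_of_all _ fun s hs => by
        have := hs.1; positivity)),
      ← intervalIntegral.integral_of_le hr.le, integral_rpow (Or.inl (by norm_num))]
    congr 1
    rw [Real.zero_rpow (by norm_num)]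
    norm_num
    ring
  rw [h1, show (2 : ℝ≥0∞) = ENNReal.ofReal 2 by simp, ← ENNReal.ofReal_mul (by norm_num)]
  refine ENNReal.ofReal_le_ofReal (le_of_eq (by ring))

lemma lintegral_far_le {r : ℝ} (hr : 0 < r) (c : ℝ) :
    ∫⁻ x : ℝ, {x | r < |x - c|}.indicator (fun x => ENNReal.ofReal (|x - c| ^ (-2 : ℝ))) x ≤
      ENNReal.ofReal (2 / r) := by
  set F : ℝ → ℝ≥0∞ := (Set.Ioi r).indicator fun s => ENNReal.ofReal (s ^ (-2 : ℝ)) with hF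
  have hFm : Measurable F := Measurable.indicator (by fun_prop) measurableSet_Ioi
  have e : ∀ x, {x | r < |x - c|}.indicator (fun x => ENNReal.ofReal (|x - c| ^ (-2 : ℝ))) x =
      F |x - c| := by
    intro x; simp [hF, Set.indicator]
  simp_rw [e]
  rw [lintegral_sub_right_eq_self (fun x => F |x|) c]
  refine (lintegral_comp_abs_le hFm).trans ?_
  have h1 : ∫⁻ s in Set.Ici (0 : ℝ), F s = ENNReal.ofReal (1 / r) := by
    have hs : Set.Ioi r ∩ Set.Ici 0 = Set.Ioi r :=
      Set.inter_eq_left.2 fun s hs => (hr.trans hs).le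
    rw [hF, setLIntegral_indicator measurableSet_Ioi, hs,
      ← ofReal_integral_eq_lintegral_ofReal (integrableOn_Ioi_rpow_of_lt (by norm_num) hr)
      ((ae_restrict_iff' measurableSet_Ioi).2 (ae_of_all _ fun s hs => by
        have : 0 < s := hr.trans hs
        positivity)), integral_Ioi_rpow_of_lt (by norm_num) hr]
    congr 1
    rw [show (-2 : ℝ) + 1 = -1 by norm_num, Real.rpow_neg_one]
    field_simp
  rw [h1, show (2 : ℝ≥0∞) = ENNReal.ofReal 2 by simp, ← ENNReal.ofReal_mul (by norm_num)]
  refine ENNReal.ofReal_le_ofReal (le_of_eq (by ring))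

/-- The bump profile used to measure concentration; any positive `L²` function with decay
`1/|s|` would do. -/
noncomputable def bumpProfile (s : ℝ) : ℝ := 1 / (1 + |s|)

lemma bumpProfile_pos (s : ℝ) : 0 < bumpProfile s := by unfold bumpProfile; positivity

lemma continuous_bumpProfile : Continuous bumpProfile := by
  unfold bumpProfile
  exact continuous_const.div (by fun_prop) fun s => by positivity

section

variable {g : ℝ → ℂ} {A : ℝ≥0∞}

/-- The near part, where `|x - c| ≤ h⁻²` and `|g| ≤ h`: a factor `|g|^{5/4}` is bounded by `h^{5/4}`,
and the bump is bounded below on this set, so Hölder's inequality applies to `|g|^{1/4}` and to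
`|x - c|^{-1/2}`, the `3/4` power of the locally integrable `|x - c|^{-2/3}`. -/
lemma lintegral_low_near_le (hg : Measurable g) {h : ℝ} (hh : 0 < h) (c : ℝ)
    (hA : ∫⁻ x, ‖g x‖ₑ * ENNReal.ofReal (bumpProfile ((x - c) / h ^ (-2 : ℝ))) ≤
      A * ENNReal.ofReal ((h ^ (-2 : ℝ)) ^ (1 / 2 : ℝ))) :
    ∫⁻ x, {x | ‖g x‖ ≤ h ∧ |x - c| ≤ h ^ (-2 : ℝ)}.indicator
      (fun x => ‖g x‖ₑ ^ (3 / 2 : ℝ) * ENNReal.ofReal (|x - c| ^ (-1 / 2 : ℝ))) x ≤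
      12 * A ^ (1 / 4 : ℝ) * ENNReal.ofReal (h ^ (1 / 2 : ℝ)) := by
  set r : ℝ := h ^ (-2 : ℝ) with hr
  have hr0 : 0 < r := by positivity
  set u : ℝ → ℝ≥0∞ := fun x => ‖g x‖ₑ * ENNReal.ofReal (bumpProfile ((x - c) / r)) with hu
  set v : ℝ → ℝ≥0∞ := {x | |x - c| ≤ r}.indicator
    (fun x => ENNReal.ofReal (|x - c| ^ (-2 / 3 : ℝ))) with hv
  have hum : Measurable u := by
    have := continuous_bumpProfile.measurable
    fun_prop
  have hvm : Measurable v := Measurable.indicator (by fun_prop)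
    (measurableSet_le (by fun_prop) (by fun_prop))
  have hpt : ∀ x, {x | ‖g x‖ ≤ h ∧ |x - c| ≤ r}.indicator
      (fun x => ‖g x‖ₑ ^ (3 / 2 : ℝ) * ENNReal.ofReal (|x - c| ^ (-1 / 2 : ℝ))) x ≤
      ENNReal.ofReal (2 * h ^ (5 / 4 : ℝ)) * (u x ^ (1 / 4 : ℝ) * v x ^ (3 / 4 : ℝ)) := by
    intro x
    by_cases hx : ‖g x‖ ≤ h ∧ |x - c| ≤ r
    swap
    · rw [Set.indicator_of_notMem (by exact hx)]; exact zero_le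
    rw [Set.indicator_of_mem (by exact hx), hv, Set.indicator_of_mem (by exact hx.2), hu]
    simp only
    have hk : 1 / 2 ≤ bumpProfile ((x - c) / r) := by
      unfold bumpProfile
      apply one_div_le_one_div_of_le (by positivity)
      rw [abs_div, abs_of_pos hr0]
      have : |x - c| / r ≤ 1 := (div_le_one hr0).2 hx.2
      linarith
    rw [← ofReal_norm, ENNReal.ofReal_rpow_of_nonneg (norm_nonneg _) (by norm_num),
      ← ENNReal.ofReal_mul (by positivity), ← ENNReal.ofReal_mul (by positivity),
      ENNReal.ofReal_rpow_of_nonneg (mul_nonneg (norm_nonneg _) (bumpProfile_pos _).le)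
        (by norm_num),
      ENNReal.ofReal_rpow_of_nonneg (by positivity) (by norm_num),
      ← ENNReal.ofReal_mul (by have := bumpProfile_pos ((x - c) / r); positivity),
      ← ENNReal.ofReal_mul (by positivity)]
    refine ENNReal.ofReal_le_ofReal ?_
    have e1 : ‖g x‖ ^ (3 / 2 : ℝ) = ‖g x‖ ^ (5 / 4 : ℝ) * ‖g x‖ ^ (1 / 4 : ℝ) := by
      rw [← Real.rpow_add_of_nonneg (norm_nonneg _) (by norm_num) (by norm_num)]; norm_num
    have e2 : (|x - c| ^ (-2 / 3 : ℝ)) ^ (3 / 4 : ℝ) = |x - c| ^ (-1 / 2 : ℝ) := by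
      rw [← Real.rpow_mul (abs_nonneg _)]; norm_num
    have e3 : ‖g x‖ ^ (1 / 4 : ℝ) ≤ 2 * (‖g x‖ * bumpProfile ((x - c) / r)) ^ (1 / 4 : ℝ) := by
      calc ‖g x‖ ^ (1 / 4 : ℝ) ≤ (2 * (‖g x‖ * bumpProfile ((x - c) / r))) ^ (1 / 4 : ℝ) := by
            gcongr
            nlinarith [norm_nonneg (g x)]
        _ = 2 ^ (1 / 4 : ℝ) * (‖g x‖ * bumpProfile ((x - c) / r)) ^ (1 / 4 : ℝ) :=
            Real.mul_rpow (by norm_num) (mul_nonneg (norm_nonneg _) (bumpProfile_pos _).le)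
        _ ≤ _ := by
            refine mul_le_mul_of_nonneg_right ?_
              (Real.rpow_nonneg (mul_nonneg (norm_nonneg _) (bumpProfile_pos _).le) _)
            calc (2 : ℝ) ^ (1 / 4 : ℝ) ≤ 2 ^ (1 : ℝ) :=
                  Real.rpow_le_rpow_of_exponent_le (by norm_num) (by norm_num)
              _ = 2 := Real.rpow_one 2
    have e4 : ‖g x‖ ^ (5 / 4 : ℝ) ≤ h ^ (5 / 4 : ℝ) := by gcongr; exact hx.1
    rw [e1, e2]
    calc ‖g x‖ ^ (5 / 4 : ℝ) * ‖g x‖ ^ (1 / 4 : ℝ) * |x - c| ^ (-1 / 2 : ℝ)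
        ≤ h ^ (5 / 4 : ℝ) * (2 * (‖g x‖ * bumpProfile ((x - c) / r)) ^ (1 / 4 : ℝ)) *
            |x - c| ^ (-1 / 2 : ℝ) := by gcongr
      _ = _ := by ring
  calc _ ≤ ∫⁻ x, ENNReal.ofReal (2 * h ^ (5 / 4 : ℝ)) * (u x ^ (1 / 4 : ℝ) * v x ^ (3 / 4 : ℝ)) :=
        lintegral_mono hpt
    _ = ENNReal.ofReal (2 * h ^ (5 / 4 : ℝ)) * ∫⁻ x, u x ^ (1 / 4 : ℝ) * v x ^ (3 / 4 : ℝ) :=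
        lintegral_const_mul' _ _ ENNReal.ofReal_ne_top
    _ ≤ ENNReal.ofReal (2 * h ^ (5 / 4 : ℝ)) *
          ((∫⁻ x, u x) ^ (1 / 4 : ℝ) * (∫⁻ x, v x) ^ (3 / 4 : ℝ)) := by
        gcongr
        have := ENNReal.lintegral_mul_norm_pow_le (μ := volume) hum.aemeasurable hvm.aemeasurable
          (p := 1 / 4) (q := 3 / 4) (by norm_num) (by norm_num) (by norm_num)
        exact this
    _ ≤ ENNReal.ofReal (2 * h ^ (5 / 4 : ℝ)) *
          ((A * ENNReal.ofReal (r ^ (1 / 2 : ℝ))) ^ (1 / 4 : ℝ) *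
            (ENNReal.ofReal (6 * r ^ (1 / 3 : ℝ))) ^ (3 / 4 : ℝ)) := by
        gcongr
        exact lintegral_near_le hr0 c
    _ = A ^ (1 / 4 : ℝ) * ENNReal.ofReal (2 * h ^ (5 / 4 : ℝ) * ((r ^ (1 / 2 : ℝ)) ^ (1 / 4 : ℝ) *
          (6 * r ^ (1 / 3 : ℝ)) ^ (3 / 4 : ℝ))) := by
        rw [ENNReal.mul_rpow_of_nonneg _ _ (by norm_num),
          ENNReal.ofReal_rpow_of_nonneg (by positivity) (by norm_num),
          ENNReal.ofReal_rpow_of_nonneg (by positivity) (by norm_num),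
          ENNReal.ofReal_mul (by positivity : (0:ℝ) ≤ 2 * h ^ (5 / 4 : ℝ)),
          ENNReal.ofReal_mul (by positivity : (0:ℝ) ≤ (r ^ (1 / 2 : ℝ)) ^ (1 / 4 : ℝ))]
        ring
    _ ≤ A ^ (1 / 4 : ℝ) * ENNReal.ofReal (12 * h ^ (1 / 2 : ℝ)) := by
        refine mul_le_mul_right (ENNReal.ofReal_le_ofReal ?_) _
        rw [Real.mul_rpow (by norm_num) (by positivity), ← Real.rpow_mul hr0.le,
          ← Real.rpow_mul hr0.le, hr, ← Real.rpow_mul hh.le, ← Real.rpow_mul hh.le]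
        have h6 : (6 : ℝ) ^ (3 / 4 : ℝ) ≤ 6 := by
          calc (6 : ℝ) ^ (3 / 4 : ℝ) ≤ 6 ^ (1 : ℝ) :=
                Real.rpow_le_rpow_of_exponent_le (by norm_num) (by norm_num)
            _ = 6 := Real.rpow_one 6
        have e : h ^ (1 / 2 : ℝ) = h ^ (5 / 4 : ℝ) * (h ^ (-2 * (1 / 2 * (1 / 4)) : ℝ) *
            h ^ (-2 * (1 / 3 * (3 / 4)) : ℝ)) := by
          rw [← Real.rpow_add hh, ← Real.rpow_add hh]; norm_num
        rw [e]
        calc 2 * h ^ (5 / 4 : ℝ) * (h ^ (-2 * (1 / 2 * (1 / 4)) : ℝ) *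
              (6 ^ (3 / 4 : ℝ) * h ^ (-2 * (1 / 3 * (3 / 4)) : ℝ)))
            ≤ 2 * h ^ (5 / 4 : ℝ) * (h ^ (-2 * (1 / 2 * (1 / 4)) : ℝ) *
              (6 * h ^ (-2 * (1 / 3 * (3 / 4)) : ℝ))) := by gcongr
          _ = _ := by ring
    _ = _ := by
        rw [ENNReal.ofReal_mul (by norm_num)]
        simp only [ENNReal.ofReal_ofNat]
        ring

/-- The far part, where `|x - c| > h⁻²`: part of the kernel is used to create the bump, and Hölder's
inequality with weights `1/4`, `5/8`, `1/8` is applied to the bump average, to `|g|²`, and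
to `|x - c|^{-2}`. -/
lemma lintegral_far_amplitude_le (hg : Measurable g) (hg2 : ∫⁻ x, ‖g x‖ₑ ^ 2 ≤ 1) {h : ℝ}
    (hh : 0 < h) (c : ℝ)
    (hA : ∫⁻ x, ‖g x‖ₑ * ENNReal.ofReal (bumpProfile ((x - c) / h ^ (-2 : ℝ))) ≤
      A * ENNReal.ofReal ((h ^ (-2 : ℝ)) ^ (1 / 2 : ℝ))) :
    ∫⁻ x, {x | h ^ (-2 : ℝ) < |x - c|}.indicator
      (fun x => ‖g x‖ₑ ^ (3 / 2 : ℝ) * ENNReal.ofReal (|x - c| ^ (-1 / 2 : ℝ))) x ≤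
      4 * A ^ (1 / 4 : ℝ) * ENNReal.ofReal (h ^ (1 / 2 : ℝ)) := by
  set r : ℝ := h ^ (-2 : ℝ) with hr
  have hr0 : 0 < r := by positivity
  set u : ℝ → ℝ≥0∞ := fun x => ‖g x‖ₑ * ENNReal.ofReal (bumpProfile ((x - c) / r)) with hu
  set v : ℝ → ℝ≥0∞ := {x | r < |x - c|}.indicator
    (fun x => ENNReal.ofReal (|x - c| ^ (-2 : ℝ))) with hv
  have hum : Measurable u := by
    have := continuous_bumpProfile.measurable
    fun_prop
  have hvm : Measurable v := Measurable.indicator (by fun_prop)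
    (measurableSet_lt (by fun_prop) (by fun_prop))
  set f : Fin 3 → ℝ → ℝ≥0∞ := ![u, fun x => ‖g x‖ₑ ^ 2, v] with hf
  have hpt : ∀ x, {x | r < |x - c|}.indicator
      (fun x => ‖g x‖ₑ ^ (3 / 2 : ℝ) * ENNReal.ofReal (|x - c| ^ (-1 / 2 : ℝ))) x ≤
      ENNReal.ofReal (2 * r ^ (-1 / 4 : ℝ)) *
        ∏ i, f i x ^ ((![1 / 4, 5 / 8, 1 / 8] : Fin 3 → ℝ) i) := by
    intro x
    by_cases hx : r < |x - c|
    swap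
    · rw [Set.indicator_of_notMem (by exact hx)]; exact zero_le
    have hs : 0 < |x - c| := hr0.trans hx
    rw [Set.indicator_of_mem (by exact hx), Fin.prod_univ_three]
    simp only [hf, Matrix.cons_val_zero, Matrix.cons_val_one, Matrix.cons_val]
    rw [hv, Set.indicator_of_mem (by exact hx), hu]
    simp only
    have hb0 := bumpProfile_pos ((x - c) / r)
    have hk : r / |x - c| ≤ 2 * bumpProfile ((x - c) / r) := by
      unfold bumpProfile
      rw [abs_div, abs_of_pos hr0, mul_one_div, div_le_div_iff₀ hs (by positivity)]
      have : r * (|x - c| / r) = |x - c| := by field_simp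
      nlinarith
    rw [← ofReal_norm, ENNReal.ofReal_rpow_of_nonneg (norm_nonneg _) (by norm_num),
      ← ENNReal.ofReal_mul (by positivity), ← ENNReal.ofReal_mul (by positivity),
      ← ENNReal.ofReal_pow (by positivity),
      ENNReal.ofReal_rpow_of_nonneg (by positivity) (by norm_num),
      ENNReal.ofReal_rpow_of_nonneg (by positivity) (by norm_num),
      ENNReal.ofReal_rpow_of_nonneg (by positivity) (by norm_num),
      ← ENNReal.ofReal_mul (by positivity), ← ENNReal.ofReal_mul (by positivity),
      ← ENNReal.ofReal_mul (by positivity)]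
    refine ENNReal.ofReal_le_ofReal ?_
    have e1 : ‖g x‖ ^ (3 / 2 : ℝ) = ‖g x‖ ^ (1 / 4 : ℝ) * (‖g x‖ ^ 2) ^ (5 / 8 : ℝ) := by
      rw [← Real.rpow_natCast, ← Real.rpow_mul (norm_nonneg _),
        ← Real.rpow_add_of_nonneg (norm_nonneg _) (by norm_num) (by norm_num)]; norm_num
    have e2 : |x - c| ^ (-1 / 2 : ℝ) =
        |x - c| ^ (-1 / 4 : ℝ) * (|x - c| ^ (-2 : ℝ)) ^ (1 / 8 : ℝ) := by
      rw [← Real.rpow_mul hs.le, ← Real.rpow_add hs]; norm_num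
    have e3 : |x - c| ^ (-1 / 4 : ℝ) ≤
        2 * r ^ (-1 / 4 : ℝ) * bumpProfile ((x - c) / r) ^ (1 / 4 : ℝ) := by
      have h1 : |x - c| ^ (-1 / 4 : ℝ) = r ^ (-1 / 4 : ℝ) * (r / |x - c|) ^ (1 / 4 : ℝ) := by
        rw [Real.div_rpow hr0.le hs.le, show (-1 / 4 : ℝ) = -(1 / 4) by norm_num,
          Real.rpow_neg hs.le, Real.rpow_neg hr0.le]
        field_simp
      rw [h1]
      have h2 : (2 : ℝ) ^ (1 / 4 : ℝ) ≤ 2 := by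
        calc (2 : ℝ) ^ (1 / 4 : ℝ) ≤ 2 ^ (1 : ℝ) :=
              Real.rpow_le_rpow_of_exponent_le (by norm_num) (by norm_num)
          _ = 2 := Real.rpow_one 2
      calc r ^ (-1 / 4 : ℝ) * (r / |x - c|) ^ (1 / 4 : ℝ)
          ≤ r ^ (-1 / 4 : ℝ) * (2 * bumpProfile ((x - c) / r)) ^ (1 / 4 : ℝ) := by gcongr
        _ = r ^ (-1 / 4 : ℝ) * (2 ^ (1 / 4 : ℝ) * bumpProfile ((x - c) / r) ^ (1 / 4 : ℝ)) := by
            rw [Real.mul_rpow (by norm_num) hb0.le]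
        _ ≤ r ^ (-1 / 4 : ℝ) * (2 * bumpProfile ((x - c) / r) ^ (1 / 4 : ℝ)) := by gcongr
        _ = _ := by ring
    rw [e1, e2, Real.mul_rpow (norm_nonneg _) hb0.le]
    calc ‖g x‖ ^ (1 / 4 : ℝ) * (‖g x‖ ^ 2) ^ (5 / 8 : ℝ) *
          (|x - c| ^ (-1 / 4 : ℝ) * (|x - c| ^ (-2 : ℝ)) ^ (1 / 8 : ℝ))
        ≤ ‖g x‖ ^ (1 / 4 : ℝ) * (‖g x‖ ^ 2) ^ (5 / 8 : ℝ) *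
          (2 * r ^ (-1 / 4 : ℝ) * bumpProfile ((x - c) / r) ^ (1 / 4 : ℝ) *
            (|x - c| ^ (-2 : ℝ)) ^ (1 / 8 : ℝ)) := by gcongr
      _ = _ := by ring
  calc _ ≤ ∫⁻ x, ENNReal.ofReal (2 * r ^ (-1 / 4 : ℝ)) *
            ∏ i, f i x ^ ((![1 / 4, 5 / 8, 1 / 8] : Fin 3 → ℝ) i) := lintegral_mono hpt
    _ = ENNReal.ofReal (2 * r ^ (-1 / 4 : ℝ)) *
          ∫⁻ x, ∏ i, f i x ^ ((![1 / 4, 5 / 8, 1 / 8] : Fin 3 → ℝ) i) :=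
        lintegral_const_mul' _ _ ENNReal.ofReal_ne_top
    _ ≤ ENNReal.ofReal (2 * r ^ (-1 / 4 : ℝ)) *
          ∏ i, (∫⁻ x, f i x) ^ ((![1 / 4, 5 / 8, 1 / 8] : Fin 3 → ℝ) i) := by
        gcongr
        refine ENNReal.lintegral_prod_norm_pow_le Finset.univ (fun i _ => ?_) ?_ (fun i _ => ?_)
        · fin_cases i
          · exact hum.aemeasurable
          · exact (hg.enorm.pow_const 2).aemeasurable
          · exact hvm.aemeasurable
        · rw [Fin.sum_univ_three]; simp; norm_num
        · fin_cases i <;> norm_num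
    _ ≤ ENNReal.ofReal (2 * r ^ (-1 / 4 : ℝ)) *
          ((A * ENNReal.ofReal (r ^ (1 / 2 : ℝ))) ^ (1 / 4 : ℝ) * 1 ^ (5 / 8 : ℝ) *
            (ENNReal.ofReal (2 / r)) ^ (1 / 8 : ℝ)) := by
        rw [Fin.prod_univ_three]
        simp only [hf, Matrix.cons_val_zero, Matrix.cons_val_one, Matrix.cons_val]
        gcongr
        exact lintegral_far_le hr0 c
    _ = A ^ (1 / 4 : ℝ) * ENNReal.ofReal (2 * r ^ (-1 / 4 : ℝ) *
          ((r ^ (1 / 2 : ℝ)) ^ (1 / 4 : ℝ) * (2 / r) ^ (1 / 8 : ℝ))) := by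
        rw [ENNReal.mul_rpow_of_nonneg _ _ (by norm_num),
          ENNReal.ofReal_rpow_of_nonneg (by positivity) (by norm_num),
          ENNReal.ofReal_rpow_of_nonneg (by positivity) (by norm_num),
          ENNReal.ofReal_mul (by positivity : (0:ℝ) ≤ 2 * r ^ (-1 / 4 : ℝ)),
          ENNReal.ofReal_mul (by positivity : (0:ℝ) ≤ (r ^ (1 / 2 : ℝ)) ^ (1 / 4 : ℝ)),
          ENNReal.one_rpow, mul_one]
        ring
    _ ≤ A ^ (1 / 4 : ℝ) * ENNReal.ofReal (4 * h ^ (1 / 2 : ℝ)) := by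
        refine mul_le_mul_right (ENNReal.ofReal_le_ofReal ?_) _
        have h2 : (2 : ℝ) ^ (1 / 8 : ℝ) ≤ 2 := by
          calc (2 : ℝ) ^ (1 / 8 : ℝ) ≤ 2 ^ (1 : ℝ) :=
                Real.rpow_le_rpow_of_exponent_le (by norm_num) (by norm_num)
            _ = 2 := Real.rpow_one 2
        rw [div_eq_mul_inv 2 r, Real.mul_rpow (by norm_num) (by positivity), ← Real.rpow_neg_one r,
          ← Real.rpow_mul hr0.le, ← Real.rpow_mul hr0.le]
        have e : h ^ (1 / 2 : ℝ) = r ^ (-1 / 4 : ℝ) * (r ^ (1 / 2 * (1 / 4) : ℝ) *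
            r ^ (-1 * (1 / 8) : ℝ)) := by
          rw [← Real.rpow_add hr0, ← Real.rpow_add hr0, hr, ← Real.rpow_mul hh.le]; norm_num
        rw [e]
        calc 2 * r ^ (-1 / 4 : ℝ) * (r ^ (1 / 2 * (1 / 4) : ℝ) * (2 ^ (1 / 8 : ℝ) *
              r ^ (-1 * (1 / 8) : ℝ)))
            ≤ 2 * r ^ (-1 / 4 : ℝ) * (r ^ (1 / 2 * (1 / 4) : ℝ) * (2 * r ^ (-1 * (1 / 8) : ℝ))) := by
              gcongr
          _ = _ := by ring
    _ = _ := by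
        rw [ENNReal.ofReal_mul (by norm_num)]
        simp only [ENNReal.ofReal_ofNat]
        ring

/-- Refined Hardy–Littlewood–Sobolev inequality: if `‖g‖₂ ≤ 1` and all normalized averages of `|g|`
against rescaled bumps are at most `A`, then the fractional energy of `|g|^{3/2}` gains the
factor `A^{1/4}`. The energy is split according to which of `|g(x)|`, `|g(y)|` is larger; if
`|g(y)| ≤ |g(x)| = h`, the scale `h⁻²` separates near and far interactions. -/
theorem refined_hls (hg : Measurable g) (hg2 : ∫⁻ x, ‖g x‖ₑ ^ 2 ≤ 1)
    (hA : ∀ c r : ℝ, 0 < r → ∫⁻ x, ‖g x‖ₑ * ENNReal.ofReal (bumpProfile ((x - c) / r)) ≤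
      A * ENNReal.ofReal (r ^ (1 / 2 : ℝ))) :
    ∫⁻ x, ∫⁻ y, ‖g x‖ₑ ^ (3 / 2 : ℝ) * ‖g y‖ₑ ^ (3 / 2 : ℝ) *
      ENNReal.ofReal (|y - x| ^ (-1 / 2 : ℝ)) ≤ 32 * A ^ (1 / 4 : ℝ) := by
  -- `L x y` is the part of the energy where the amplitude at `x` dominates
  set F : ℝ → ℝ → ℝ≥0∞ := fun x y => ‖g x‖ₑ ^ (3 / 2 : ℝ) * ‖g y‖ₑ ^ (3 / 2 : ℝ) *
      ENNReal.ofReal (|y - x| ^ (-1 / 2 : ℝ)) with hF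
  set L : ℝ → ℝ → ℝ≥0∞ := fun x y => {y | ‖g y‖ ≤ ‖g x‖}.indicator (F x) y with hL
  have hFs : ∀ x y, F x y = F y x := by
    intro x y; simp only [hF]; rw [abs_sub_comm y x]; ring
  have hLm : Measurable (fun q : ℝ × ℝ => L q.1 q.2) := by
    have : (fun q : ℝ × ℝ => L q.1 q.2) = {q : ℝ × ℝ | ‖g q.2‖ ≤ ‖g q.1‖}.indicator
        (fun q => F q.1 q.2) := by
      funext q; simp [hL, Set.indicator]
    rw [this]
    exact Measurable.indicator (by fun_prop) (measurableSet_le (by fun_prop) (by fun_prop))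
  have hpt : ∀ x y, F x y ≤ L x y + L y x := by
    intro x y
    rcases le_total ‖g y‖ ‖g x‖ with h | h
    · simp only [hL]
      rw [Set.indicator_of_mem (by exact h)]
      exact le_self_add
    · simp only [hL]
      rw [Set.indicator_of_mem (s := {z | ‖g z‖ ≤ ‖g y‖}) (by exact h), hFs x y]
      exact le_add_self
  have hinner : ∀ x, ∫⁻ y, L x y ≤ 16 * A ^ (1 / 4 : ℝ) * ‖g x‖ₑ ^ 2 := by
    intro x
    rcases eq_or_ne (g x) 0 with hx | hx
    · simp [hL, hF, hx, Set.indicator]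
    have hh : 0 < ‖g x‖ := norm_pos_iff.2 hx
    set h := ‖g x‖ with hhdef
    have hr : (0 : ℝ) < h ^ (-2 : ℝ) := by positivity
    have h1 := lintegral_low_near_le hg hh x (hA x _ hr)
    have h2 := lintegral_far_amplitude_le hg hg2 hh x (hA x _ hr)
    have hm2 : Measurable ({y | h ^ (-2 : ℝ) < |y - x|}.indicator
        (fun y => ‖g y‖ₑ ^ (3 / 2 : ℝ) * ENNReal.ofReal (|y - x| ^ (-1 / 2 : ℝ)))) :=
      Measurable.indicator (by fun_prop) (measurableSet_lt (by fun_prop) (by fun_prop))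
    calc ∫⁻ y, L x y ≤ ∫⁻ y, ‖g x‖ₑ ^ (3 / 2 : ℝ) *
          ({y | ‖g y‖ ≤ h ∧ |y - x| ≤ h ^ (-2 : ℝ)}.indicator
            (fun y => ‖g y‖ₑ ^ (3 / 2 : ℝ) * ENNReal.ofReal (|y - x| ^ (-1 / 2 : ℝ))) y +
          {y | h ^ (-2 : ℝ) < |y - x|}.indicator
            (fun y => ‖g y‖ₑ ^ (3 / 2 : ℝ) * ENNReal.ofReal (|y - x| ^ (-1 / 2 : ℝ))) y) := by
          refine lintegral_mono fun y => ?_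
          simp only [hL]
          by_cases hy : ‖g y‖ ≤ h
          · rw [Set.indicator_of_mem (by exact hy)]
            simp only [hF]
            rw [mul_assoc]
            gcongr
            rcases le_or_gt |y - x| (h ^ (-2 : ℝ)) with hd | hd
            · rw [Set.indicator_of_mem (by exact ⟨hy, hd⟩)]; exact le_self_add
            · rw [Set.indicator_of_mem (s := {y | h ^ (-2 : ℝ) < |y - x|}) (by exact hd)]
              exact le_add_self
          · rw [Set.indicator_of_notMem (by exact hy)]; exact zero_le
      _ ≤ ‖g x‖ₑ ^ (3 / 2 : ℝ) * (12 * A ^ (1 / 4 : ℝ) * ENNReal.ofReal (h ^ (1 / 2 : ℝ)) +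
            4 * A ^ (1 / 4 : ℝ) * ENNReal.ofReal (h ^ (1 / 2 : ℝ))) := by
          rw [lintegral_const_mul' _ _ (by
            rw [← ofReal_norm, ENNReal.ofReal_rpow_of_nonneg (norm_nonneg _) (by norm_num)]
            exact ENNReal.ofReal_ne_top), lintegral_add_right _ hm2]
          gcongr
      _ = 16 * A ^ (1 / 4 : ℝ) * (‖g x‖ₑ ^ (3 / 2 : ℝ) * ENNReal.ofReal (h ^ (1 / 2 : ℝ))) := by
          ring
      _ = 16 * A ^ (1 / 4 : ℝ) * ‖g x‖ₑ ^ 2 := by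
          congr 1
          rw [← ofReal_norm, ENNReal.ofReal_rpow_of_nonneg (norm_nonneg _) (by norm_num),
            ← ENNReal.ofReal_mul (by positivity), ← ENNReal.ofReal_pow (norm_nonneg _),
            ← Real.rpow_add hh, ← Real.rpow_natCast]
          norm_num
          rw [hhdef, ENNReal.ofReal_pow (norm_nonneg _), ofReal_norm]
  calc ∫⁻ x, ∫⁻ y, F x y ≤ ∫⁻ x, ∫⁻ y, (L x y + L y x) :=
        lintegral_mono fun x => lintegral_mono fun y => hpt x y
    _ = ∫⁻ x, ((∫⁻ y, L x y) + ∫⁻ y, L y x) := by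
        refine lintegral_congr fun x => ?_
        rw [lintegral_add_left]
        exact hLm.comp measurable_prodMk_left
    _ = (∫⁻ x, ∫⁻ y, L x y) + ∫⁻ x, ∫⁻ y, L y x := by
        rw [lintegral_add_left]
        exact hLm.lintegral_prod_right'
    _ = 2 * ∫⁻ x, ∫⁻ y, L x y := by
        rw [lintegral_lintegral_swap (f := fun x y => L y x)
          (hLm.comp measurable_swap).aemeasurable, two_mul]
    _ ≤ 2 * ∫⁻ x, 16 * A ^ (1 / 4 : ℝ) * ‖g x‖ₑ ^ 2 := by
        gcongr with x
        exact hinner x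
    _ = 32 * A ^ (1 / 4 : ℝ) * ∫⁻ x, ‖g x‖ₑ ^ 2 := by
        rw [lintegral_const_mul _ (hg.enorm.pow_const 2), ← mul_assoc, ← mul_assoc]
        norm_num
    _ ≤ 32 * A ^ (1 / 4 : ℝ) * 1 := by gcongr
    _ = _ := mul_one _

end

/-! ### The family of extension operators and the refined Strichartz estimate -/

/-- The phase `6α²η² + 4αβη³ + β²η⁴`. For `(α, β) = (0, 1)` it is `η⁴`, for `(1, 0)` it is the
Schrödinger phase `6η²`; in general it is `β⁻²(α + βη)⁴` up to an affine function of `η`. -/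
def phasePoly (α β η : ℝ) : ℝ := 6 * α ^ 2 * η ^ 2 + 4 * α * β * η ^ 3 + β ^ 2 * η ^ 4

/-- The weight `|α + βη|^{1/3}`, a multiple of the sixth root of the second derivative of
`phasePoly α β`. -/
noncomputable def phaseWeight (α β η : ℝ) : ℝ := |α + β * η| ^ (1 / 3 : ℝ)

/-- The curve `η ↦ (η, P(η))` with `P = phasePoly α β`. -/
def phaseCurve (α β η : ℝ) : ℝ × ℝ := (η, phasePoly α β η)

/-- The weighted extension operator
`g ↦ ∫ e^{i(xη + tP(η))} |α + βη|^{1/3} g(η) dη` attached to the curve `phaseCurve α β`. It is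
meaningful when `phaseWeight α β * g` is integrable. -/
noncomputable def ext (α β : ℝ) (g : ℝ → ℂ) : ℝ × ℝ → ℂ :=
  oscInt volume (phaseCurve α β) fun η => (phaseWeight α β η : ℂ) * g η

lemma continuous_phaseCurve (α β : ℝ) : Continuous (phaseCurve α β) := by
  unfold phaseCurve phasePoly; fun_prop

lemma measurable_phaseCurve (α β : ℝ) : Measurable (phaseCurve α β) :=
  (continuous_phaseCurve α β).measurable

lemma continuous_phaseWeight (α β : ℝ) : Continuous (phaseWeight α β) := by
  unfold phaseWeight
  exact Continuous.rpow_const (by fun_prop) fun _ => Or.inr (by norm_num)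

lemma phaseWeight_nonneg (α β η : ℝ) : 0 ≤ phaseWeight α β η := by
  unfold phaseWeight; positivity

section Products

variable {Ω Ω' : Type*} [MeasurableSpace Ω] [MeasurableSpace Ω'] {m : Measure Ω}
  {m' : Measure Ω'} {Φ : Ω → ℝ × ℝ} {Φ' : Ω' → ℝ × ℝ} {b : Ω → ℂ} {b' : Ω' → ℂ}

lemma oscInt_mul [SFinite m] [SFinite m'] (z : ℝ × ℝ) :
    oscInt m Φ b z * oscInt m' Φ' b' z =
      oscInt (m.prod m') (fun q => Φ q.1 + Φ' q.2) (fun q => b q.1 * b' q.2) z := by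
  unfold oscInt
  rw [← integral_prod_mul (L := ℂ)]
  refine integral_congr_ae (ae_of_all _ fun q => ?_)
  simp only [planeChar_add]
  ring

/-- Change of the reference measure by a density. -/
lemma oscInt_eq_withDensity {J : Ω → ℝ} (hJ : Measurable J) (hJ0 : ∀ s, 0 ≤ J s)
    (hbJ : ∀ᵐ s ∂m, J s = 0 → b s = 0) (z : ℝ × ℝ) :
    oscInt m Φ b z = oscInt (m.withDensity fun s => ENNReal.ofReal (J s)) Φ
      (fun s => b s / J s) z := by
  unfold oscInt
  rw [integral_withDensity_eq_integral_toReal_smul (by fun_prop) (by simp)]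
  refine integral_congr_ae ?_
  filter_upwards [hbJ] with s hs
  rw [ENNReal.toReal_ofReal (hJ0 s), Complex.real_smul]
  by_cases h : J s = 0
  · simp [hs h]
  · have : (J s : ℂ) ≠ 0 := by exact_mod_cast h
    field_simp

lemma integrable_withDensity_div {J : Ω → ℝ} (hJ : Measurable J) (hJ0 : ∀ s, 0 ≤ J s)
    (hb : Integrable b m) :
    Integrable (fun s => b s / J s) (m.withDensity fun s => ENNReal.ofReal (J s)) := by
  rw [integrable_withDensity_iff_integrable_smul' (by fun_prop) (by simp)]
  refine hb.mono ?_ (ae_of_all _ fun s => ?_)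
  · exact (hJ.ennreal_ofReal.ennreal_toReal.aestronglyMeasurable).smul
      ((hb.aemeasurable.div (Complex.measurable_ofReal.comp hJ).aemeasurable).aestronglyMeasurable)
  · rw [ENNReal.toReal_ofReal (hJ0 s), norm_smul, norm_div, Complex.norm_real]
    rcases (norm_nonneg (J s)).eq_or_lt with h | h
    · rw [← h]; simp
    · rw [mul_div_cancel₀ _ h.ne']

end Products

/-- The pair sum map `(ξ, η) ↦ (ξ + η, P(ξ) + P(η))`. -/
def pairSum (α β : ℝ) (q : ℝ × ℝ) : ℝ × ℝ := phaseCurve α β q.1 + phaseCurve α β q.2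

/-- The absolute Jacobian `|P'(ξ) - P'(η)|` of `pairSum`. -/
def pairJac (α β : ℝ) (q : ℝ × ℝ) : ℝ :=
  4 * |q.1 - q.2| * ((α + β * q.1) ^ 2 + (α + β * q.1) * (α + β * q.2) + (α + β * q.2) ^ 2)

lemma quad_form_nonneg (y y' : ℝ) : 0 ≤ y ^ 2 + y * y' + y' ^ 2 := by
  nlinarith [sq_nonneg (y + y'), sq_nonneg y, sq_nonneg y']

lemma pairJac_nonneg (α β : ℝ) (q : ℝ × ℝ) : 0 ≤ pairJac α β q :=
  mul_nonneg (by positivity) (quad_form_nonneg _ _)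

lemma measurable_pairJac (α β : ℝ) : Measurable (pairJac α β) := by
  unfold pairJac; fun_prop

lemma measurable_pairSum (α β : ℝ) : Measurable (pairSum α β) :=
  ((measurable_phaseCurve α β).comp measurable_fst).add
    ((measurable_phaseCurve α β).comp measurable_snd)

lemma hasDerivAt_phasePoly (α β η : ℝ) :
    HasDerivAt (phasePoly α β) (12 * α ^ 2 * η + 12 * α * β * η ^ 2 + 4 * β ^ 2 * η ^ 3) η := by
  unfold phasePoly
  have h2 := (hasDerivAt_pow 2 η).const_mul (6 * α ^ 2)
  have h3 := (hasDerivAt_pow 3 η).const_mul (4 * α * β)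
  have h4 := (hasDerivAt_pow 4 η).const_mul (β ^ 2)
  exact ((h2.add h3).add h4).congr_deriv (by push_cast; ring)

/-- The sum of two points of the curve determines the unordered pair: on each side of the diagonal
`pairSum` is injective. -/
lemma injOn_pairSum {α β : ℝ} (h : α ≠ 0 ∨ β ≠ 0) {s : Set (ℝ × ℝ)}
    (hs : ∀ q ∈ s, q.1 ≠ q.2)
    (hsign : ∀ q ∈ s, ∀ q' ∈ s, 0 < (q.1 - q.2) * (q'.1 - q'.2)) :
    Set.InjOn (pairSum α β) s := by
  rintro ⟨a, b⟩ hq ⟨c, d⟩ hq' heq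
  have hab : a - b ≠ 0 := sub_ne_zero.2 (hs _ hq)
  have hsg := hsign _ hq _ hq'
  simp only at hsg
  simp only [pairSum, phaseCurve, Prod.mk_add_mk, Prod.mk.injEq] at heq
  obtain ⟨h1, h2⟩ := heq
  have hb : b = c + d - a := by linarith
  -- in terms of the sum `σ` and the squared difference `e`, the second coordinate is
  -- `3e(α + βσ/2)² + β²e²/8` up to a function of `σ`
  have key : ((a - b) ^ 2 - (c - d) ^ 2) *
      (3 * (α + β * (a + b) / 2) ^ 2 + β ^ 2 * ((a - b) ^ 2 + (c - d) ^ 2) / 8) = 0 := by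
    unfold phasePoly at h2
    subst hb
    linear_combination h2
  have hpos : 0 < 3 * (α + β * (a + b) / 2) ^ 2 + β ^ 2 * ((a - b) ^ 2 + (c - d) ^ 2) / 8 := by
    rcases eq_or_ne β 0 with h0 | h0
    · have : α ≠ 0 := h.resolve_right (by simpa using h0)
      subst h0
      simp
      positivity
    · have : 0 < β ^ 2 * ((a - b) ^ 2 + (c - d) ^ 2) / 8 := by positivity
      positivity
  have h3 : (a - b) ^ 2 = (c - d) ^ 2 := by
    rcases mul_eq_zero.1 key with h' | h'
    · linarith
    · exact absurd h' hpos.ne'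
  rcases sq_eq_sq_iff_eq_or_eq_neg.1 h3 with h4 | h4
  · refine Prod.ext ?_ ?_ <;> simp only <;> linarith
  · rw [h4] at hsg
    nlinarith [sq_nonneg (c - d)]

lemma setLIntegral_pairJac_le {α β : ℝ} {s S : Set (ℝ × ℝ)} (hs : MeasurableSet s)
    (hS : MeasurableSet S) (hinj : Set.InjOn (pairSum α β) s) :
    ∫⁻ q in pairSum α β ⁻¹' S ∩ s, ENNReal.ofReal (pairJac α β q) ≤ volume S := by
  set T := pairSum α β ⁻¹' S ∩ s
  have hT : MeasurableSet T := (measurable_pairSum α β hS).inter hs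
  set P' : ℝ → ℝ := fun η => 12 * α ^ 2 * η + 12 * α * β * η ^ 2 + 4 * β ^ 2 * η ^ 3 with hP'
  set D : ℝ × ℝ → ℝ × ℝ →L[ℝ] ℝ × ℝ := fun q =>
    LinearMap.toContinuousLinearMap (Matrix.toLin (Module.Basis.finTwoProd ℝ)
      (Module.Basis.finTwoProd ℝ) !![1, 1; P' q.1, P' q.2]) with hD
  have hder : ∀ q ∈ T, HasFDerivWithinAt (pairSum α β) (D q) T q := by
    intro q _
    refine HasFDerivAt.hasFDerivWithinAt ?_
    have e : pairSum α β = fun q => (q.1 + q.2, phasePoly α β q.1 + phasePoly α β q.2) := by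
      funext q; simp [pairSum, phaseCurve]
    rw [e, hD]
    simp only
    rw [Matrix.toLin_finTwoProd_toContinuousLinearMap]
    have h1 : HasFDerivAt (fun q : ℝ × ℝ => phasePoly α β q.1)
        (P' q.1 • ContinuousLinearMap.fst ℝ ℝ ℝ) q :=
      (hasDerivAt_phasePoly α β q.1).comp_hasFDerivAt q hasFDerivAt_fst
    have h2 : HasFDerivAt (fun q : ℝ × ℝ => phasePoly α β q.2)
        (P' q.2 • ContinuousLinearMap.snd ℝ ℝ ℝ) q :=
      (hasDerivAt_phasePoly α β q.2).comp_hasFDerivAt q hasFDerivAt_snd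
    refine ((hasFDerivAt_fst.add hasFDerivAt_snd).prodMk (h1.add h2)).congr_fderiv ?_
    ext <;> simp
  have hdet : ∀ q, |(D q).det| = pairJac α β q := by
    intro q
    have : (D q).det = P' q.2 - P' q.1 := by
      simp [hD, ContinuousLinearMap.det, LinearMap.det_toLin, Matrix.det_fin_two]
    rw [this, pairJac]
    have e : P' q.2 - P' q.1 = 4 * (q.2 - q.1) *
        ((α + β * q.1) ^ 2 + (α + β * q.1) * (α + β * q.2) + (α + β * q.2) ^ 2) := by
      simp only [hP']; ring
    rw [e, abs_mul, abs_mul, abs_of_nonneg (quad_form_nonneg _ _), abs_sub_comm]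
    norm_num
  have := lintegral_image_eq_lintegral_abs_det_fderiv_mul volume hT hder
    (hinj.mono Set.inter_subset_right) (fun _ => 1)
  simp only [hdet, mul_one, lintegral_one, Measure.restrict_apply_univ] at this
  rw [← this]
  refine measure_mono ?_
  rintro _ ⟨q, hq, rfl⟩
  exact hq.1

lemma volume_diagonal_eq_zero : (volume : Measure (ℝ × ℝ)) {q | q.1 = q.2} = 0 := by
  have hm : MeasurableSet {q : ℝ × ℝ | q.1 = q.2} :=
    measurableSet_eq_fun measurable_fst measurable_snd
  rw [show (volume : Measure (ℝ × ℝ)) = (volume : Measure ℝ).prod volume from rfl,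
    Measure.measure_prod_null hm]
  refine ae_of_all _ fun x => ?_
  have : Prod.mk x ⁻¹' {q : ℝ × ℝ | q.1 = q.2} = {x} := by ext y; simp [eq_comm]
  show volume (Prod.mk x ⁻¹' {q : ℝ × ℝ | q.1 = q.2}) = 0
  rw [this]; simp

/-- The push-forward under `pairSum` of the measure with density `pairJac` is at most twice Lebesgue
measure, by the change of variables formula on each side of the diagonal. -/
lemma map_pairSum_le {α β : ℝ} (h : α ≠ 0 ∨ β ≠ 0) :
    ((volume : Measure (ℝ × ℝ)).withDensity fun q => ENNReal.ofReal (pairJac α β q)).map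
      (pairSum α β) ≤ (2 : ℝ≥0∞) • (volume : Measure (ℝ × ℝ)) := by
  refine Measure.le_iff.2 fun S hS => ?_
  have hpre := measurable_pairSum α β hS
  rw [Measure.map_apply (measurable_pairSum α β) hS, withDensity_apply _ hpre,
    Measure.smul_apply, smul_eq_mul, two_mul]
  set s₁ : Set (ℝ × ℝ) := {q | q.1 < q.2}
  set s₂ : Set (ℝ × ℝ) := {q | q.2 < q.1}
  have hs₁ : MeasurableSet s₁ := measurableSet_lt measurable_fst measurable_snd
  have hs₂ : MeasurableSet s₂ := measurableSet_lt measurable_snd measurable_fst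
  have hi₁ := setLIntegral_pairJac_le (α := α) (β := β) hs₁ hS (injOn_pairSum h
    (fun q hq => ne_of_lt hq) fun q hq q' hq' => by
      have h1 : q.1 < q.2 := hq
      have h2 : q'.1 < q'.2 := hq'
      nlinarith)
  have hi₂ := setLIntegral_pairJac_le (α := α) (β := β) hs₂ hS (injOn_pairSum h
    (fun q hq => ne_of_gt hq) fun q hq q' hq' => by
      have h1 : q.2 < q.1 := hq
      have h2 : q'.2 < q'.1 := hq'
      nlinarith)
  calc ∫⁻ q in pairSum α β ⁻¹' S, ENNReal.ofReal (pairJac α β q)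
      ≤ ∫⁻ q in (pairSum α β ⁻¹' S ∩ s₁ ∪ pairSum α β ⁻¹' S ∩ s₂) ∪ {q | q.1 = q.2},
          ENNReal.ofReal (pairJac α β q) := by
        refine lintegral_mono_set fun q hq => ?_
        rcases lt_trichotomy q.1 q.2 with h' | h' | h'
        · exact Or.inl (Or.inl ⟨hq, h'⟩)
        · exact Or.inr h'
        · exact Or.inl (Or.inr ⟨hq, h'⟩)
    _ ≤ (∫⁻ q in pairSum α β ⁻¹' S ∩ s₁, ENNReal.ofReal (pairJac α β q)) +
          (∫⁻ q in pairSum α β ⁻¹' S ∩ s₂, ENNReal.ofReal (pairJac α β q)) +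
          ∫⁻ q in {q : ℝ × ℝ | q.1 = q.2}, ENNReal.ofReal (pairJac α β q) :=
        (lintegral_union_le _ _ _).trans (add_le_add_left (lintegral_union_le _ _ _) _)
    _ ≤ volume S + volume S := by
        rw [setLIntegral_measure_zero _ _ volume_diagonal_eq_zero, add_zero]
        exact add_le_add hi₁ hi₂

/-- The square of the extension operator as a single oscillatory integral over pairs, with
respect to the measure whose push-forward under `pairSum` is controlled by Lebesgue measure. -/
lemma ext_sq_eq (α β : ℝ) (g : ℝ → ℂ) (z : ℝ × ℝ) :
    ext α β g z ^ 2 =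
      oscInt ((volume : Measure (ℝ × ℝ)).withDensity fun q => ENNReal.ofReal (pairJac α β q))
        (pairSum α β) (fun q => ((phaseWeight α β q.1 : ℂ) * g q.1) *
          ((phaseWeight α β q.2 : ℂ) * g q.2) / pairJac α β q) z := by
  rw [sq, ext, oscInt_mul]
  refine oscInt_eq_withDensity (measurable_pairJac α β) (pairJac_nonneg α β) ?_ z
  have hd : ∀ᵐ q : ℝ × ℝ, q.1 ≠ q.2 := by
    rw [ae_iff]; simpa using volume_diagonal_eq_zero
  filter_upwards [hd] with q hq hJ
  have h1 : |q.1 - q.2| ≠ 0 := abs_ne_zero.2 (sub_ne_zero.2 hq)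
  have h2 : (α + β * q.1) ^ 2 + (α + β * q.1) * (α + β * q.2) + (α + β * q.2) ^ 2 = 0 := by
    rcases mul_eq_zero.1 hJ with h' | h'
    · exact absurd h' (by positivity)
    · exact h'
  have h3 : α + β * q.1 = 0 := by
    nlinarith [sq_nonneg (α + β * q.1 + 2 * (α + β * q.2)), sq_nonneg (α + β * q.1)]
  simp [phaseWeight, h3]

/-- The weight `|α + βη|^{1/3}` is the one for which the Jacobian cancels in the pair energy, up to
the kernel `|q₂ - q₁|^{-1/2}`, uniformly in `α` and `β`. -/
lemma weight_pair_le (α β : ℝ) {q : ℝ × ℝ} (hq : pairJac α β q ≠ 0) :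
    (phaseWeight α β q.1 * phaseWeight α β q.2 / pairJac α β q) ^ (3 / 2 : ℝ) * pairJac α β q ≤
      |q.2 - q.1| ^ (-1 / 2 : ℝ) := by
  have hJ : 0 < pairJac α β q := lt_of_le_of_ne (pairJac_nonneg _ _ _) hq.symm
  have hd : 0 < |q.1 - q.2| := by
    rcases (abs_nonneg (q.1 - q.2)).eq_or_lt with h | h
    · exact absurd (by rw [pairJac, ← h]; ring) hq
    · exact h
  set y := α + β * q.1 with hy
  set y' := α + β * q.2 with hy'
  have hprod : |y * y'| ≤ y ^ 2 + y * y' + y' ^ 2 := by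
    rw [abs_le]; constructor <;> nlinarith [sq_nonneg (y + y'), sq_nonneg (y - y')]
  have e1 : (phaseWeight α β q.1 * phaseWeight α β q.2) ^ (3 / 2 : ℝ) = |y * y'| ^ (1 / 2 : ℝ) := by
    rw [phaseWeight, phaseWeight, ← hy, ← hy', ← Real.mul_rpow (abs_nonneg _) (abs_nonneg _), ← abs_mul,
      ← Real.rpow_mul (abs_nonneg _)]
    norm_num
  have e2 : (pairJac α β q) ^ (3 / 2 : ℝ) = pairJac α β q * pairJac α β q ^ (1 / 2 : ℝ) := by
    rw [← Real.rpow_one_add' hJ.le (by norm_num)]; norm_num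
  rw [Real.div_rpow (mul_nonneg (phaseWeight_nonneg _ _ _) (phaseWeight_nonneg _ _ _)) hJ.le, e1,
    e2]
  have hroot : 0 < pairJac α β q ^ (1 / 2 : ℝ) := by positivity
  have e3 : |y * y'| ^ (1 / 2 : ℝ) / (pairJac α β q * pairJac α β q ^ (1 / 2 : ℝ)) *
      pairJac α β q = |y * y'| ^ (1 / 2 : ℝ) / pairJac α β q ^ (1 / 2 : ℝ) := by
    field_simp
  rw [e3, abs_sub_comm, show (-1 / 2 : ℝ) = -(1 / 2) by norm_num, Real.rpow_neg hd.le,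
    div_le_iff₀ hroot, ← Real.inv_rpow hd.le, ← Real.mul_rpow (by positivity) hJ.le]
  refine Real.rpow_le_rpow (abs_nonneg _) ?_ (by norm_num)
  rw [pairJac, ← hy, ← hy']
  have : |q.1 - q.2|⁻¹ * (4 * |q.1 - q.2| * (y ^ 2 + y * y' + y' ^ 2)) =
      4 * (y ^ 2 + y * y' + y' ^ 2) := by field_simp
  rw [this]
  linarith [quad_form_nonneg y y']

/-- The constant in the refined Strichartz estimate. -/
noncomputable def refinedConst : ℝ≥0∞ := 48 * ENNReal.ofReal ((2 * Real.pi) ^ 2) * 32 ^ 2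

lemma refinedConst_ne_top : refinedConst ≠ ⊤ := by
  unfold refinedConst
  exact ENNReal.mul_ne_top (ENNReal.mul_ne_top (by simp) ENNReal.ofReal_ne_top) (by simp)

/-- Refined Strichartz estimate: the `L⁶` norm of the extension of a normalized `g` is controlled
by the largest normalized average of `|g|` against rescaled bumps. The square of the extension
is bounded in `L³` by Hausdorff–Young, and the resulting energy by the refined
Hardy–Littlewood–Sobolev inequality. -/
theorem refined_strichartz {α β : ℝ} (h : α ≠ 0 ∨ β ≠ 0) {g : ℝ → ℂ} {A : ℝ≥0∞}
    (hg : Measurable g) (hg2 : ∫⁻ x, ‖g x‖ₑ ^ 2 ≤ 1)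
    (hwg : Integrable fun η => (phaseWeight α β η : ℂ) * g η) (hAtop : A ≠ ⊤)
    (hA : ∀ c r : ℝ, 0 < r → ∫⁻ x, ‖g x‖ₑ * ENNReal.ofReal (bumpProfile ((x - c) / r)) ≤
      A * ENNReal.ofReal (r ^ (1 / 2 : ℝ))) :
    ∫⁻ z, ‖ext α β g z‖ₑ ^ 6 ≤ refinedConst * A ^ (1 / 2 : ℝ) := by
  set J := pairJac α β with hJdef
  set m := (volume : Measure (ℝ × ℝ)).withDensity fun q => ENNReal.ofReal (J q) with hm
  set b : ℝ × ℝ → ℂ := fun q => ((phaseWeight α β q.1 : ℂ) * g q.1) *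
          ((phaseWeight α β q.2 : ℂ) * g q.2) / J q with hb
  have hJm : Measurable J := measurable_pairJac α β
  have hJ0 : ∀ q, 0 ≤ J q := pairJac_nonneg α β
  have hbi : Integrable b m := integrable_withDensity_div hJm hJ0 (hwg.mul_prod hwg)
  have hwm : Measurable (phaseWeight α β) := (continuous_phaseWeight α β).measurable
  have henergy : ∫⁻ q, ‖b q‖ₑ ^ (3 / 2 : ℝ) ∂m ≤ 32 * A ^ (1 / 4 : ℝ) := by
    refine le_trans ?_ (refined_hls hg hg2 hA)
    rw [hm, lintegral_withDensity_eq_lintegral_mul_non_measurable _ (by fun_prop)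
      (ae_of_all _ fun q => ENNReal.ofReal_lt_top)]
    rw [← lintegral_prod (μ := volume) (ν := volume) (fun q : ℝ × ℝ => ‖g q.1‖ₑ ^ (3 / 2 : ℝ) *
      ‖g q.2‖ₑ ^ (3 / 2 : ℝ) * ENNReal.ofReal (|q.2 - q.1| ^ (-1 / 2 : ℝ)))
      (by fun_prop)]
    refine lintegral_mono fun q => ?_
    simp only [Pi.mul_apply]
    by_cases hq : J q = 0
    · simp [hq]
    have hw0 : 0 ≤ phaseWeight α β q.1 * phaseWeight α β q.2 / J q :=
      div_nonneg (mul_nonneg (phaseWeight_nonneg _ _ _) (phaseWeight_nonneg _ _ _)) (hJ0 q)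
    have e : ‖b q‖ = (phaseWeight α β q.1 * phaseWeight α β q.2 / J q) * (‖g q.1‖ * ‖g q.2‖) := by
      simp only [hb, norm_div, norm_mul, Complex.norm_real,
        Real.norm_of_nonneg (phaseWeight_nonneg _ _ _), Real.norm_of_nonneg (hJ0 q)]
      ring
    simp only [← ofReal_norm]
    rw [e, ENNReal.ofReal_rpow_of_nonneg (by positivity) (by norm_num),
      ENNReal.ofReal_rpow_of_nonneg (by positivity) (by norm_num),
      ENNReal.ofReal_rpow_of_nonneg (by positivity) (by norm_num),
      ← ENNReal.ofReal_mul (hJ0 q), ← ENNReal.ofReal_mul (by positivity),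
      ← ENNReal.ofReal_mul (by positivity)]
    refine ENNReal.ofReal_le_ofReal ?_
    have hk := weight_pair_le α β hq
    rw [Real.mul_rpow hw0 (by positivity), Real.mul_rpow (norm_nonneg _) (norm_nonneg _)]
    calc J q * ((phaseWeight α β q.1 * phaseWeight α β q.2 / J q) ^ (3 / 2 : ℝ) *
          (‖g q.1‖ ^ (3 / 2 : ℝ) * ‖g q.2‖ ^ (3 / 2 : ℝ)))
        = ‖g q.1‖ ^ (3 / 2 : ℝ) * ‖g q.2‖ ^ (3 / 2 : ℝ) *
          ((phaseWeight α β q.1 * phaseWeight α β q.2 / J q) ^ (3 / 2 : ℝ) * J q) := by ring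
      _ ≤ _ := by gcongr
  have hfin : ∫⁻ q, ‖b q‖ₑ ^ (3 / 2 : ℝ) ∂m ≠ ⊤ :=
    ne_top_of_le_ne_top (ENNReal.mul_ne_top (by simp)
      (ENNReal.rpow_ne_top_of_nonneg (by norm_num) hAtop)) henergy
  calc ∫⁻ z, ‖ext α β g z‖ₑ ^ 6 = ∫⁻ z, ‖oscInt m (pairSum α β) b z‖ₑ ^ 3 := by
        refine lintegral_congr fun z => ?_
        rw [← ext_sq_eq α β g z, enorm_pow, ← pow_mul]
    _ ≤ 24 * ENNReal.ofReal ((2 * Real.pi) ^ 2) * 2 * (∫⁻ q, ‖b q‖ₑ ^ (3 / 2 : ℝ) ∂m) ^ 2 :=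
        lintegral_enorm_cube_oscInt_le (measurable_pairSum α β) hbi (map_pairSum_le h) hfin
    _ ≤ 24 * ENNReal.ofReal ((2 * Real.pi) ^ 2) * 2 * (32 * A ^ (1 / 4 : ℝ)) ^ 2 := by gcongr
    _ = refinedConst * A ^ (1 / 2 : ℝ) := by
        rw [mul_pow 32, ← ENNReal.rpow_natCast (A ^ (1 / 4 : ℝ)), ← ENNReal.rpow_mul, refinedConst]
        norm_num
        ring

/-! ### The extension operator on `L²` -/

instance fact_one_le_six : Fact ((1 : ℝ≥0∞) ≤ 6) := ⟨by norm_num⟩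

/-- `L²` of the frequency line. -/
noncomputable abbrev FreqSpace := Lp ℂ 2 (volume : Measure ℝ)

/-- `L⁶` of the space-time plane. -/
noncomputable abbrev PlaneSpace := Lp ℂ 6 (volume : Measure (ℝ × ℝ))

lemma eLpNorm_two_sq {α : Type*} [MeasurableSpace α] {μ : Measure α} (f : α → ℂ) :
    eLpNorm f 2 μ ^ 2 = ∫⁻ x, ‖f x‖ₑ ^ 2 ∂μ := by
  have h := eLpNorm_nnreal_pow_eq_lintegral (p := 2) (f := f) (μ := μ) (by norm_num)
  simp only [NNReal.coe_ofNat] at h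
  rw [show (2 : ℝ) = ((2 : ℕ) : ℝ) by norm_num] at h
  simp_rw [ENNReal.rpow_natCast] at h
  exact_mod_cast h

lemma eLpNorm_six_pow {α : Type*} [MeasurableSpace α] {μ : Measure α} (f : α → ℂ) :
    eLpNorm f 6 μ ^ 6 = ∫⁻ x, ‖f x‖ₑ ^ 6 ∂μ := by
  have h := eLpNorm_nnreal_pow_eq_lintegral (p := 6) (f := f) (μ := μ) (by norm_num)
  simp only [NNReal.coe_ofNat] at h
  rw [show (6 : ℝ) = ((6 : ℕ) : ℝ) by norm_num] at h
  simp_rw [ENNReal.rpow_natCast] at h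
  exact_mod_cast h

lemma freq_enorm_sq (f : FreqSpace) : ‖f‖ₑ ^ 2 = ∫⁻ x, ‖f x‖ₑ ^ 2 := by
  rw [Lp.enorm_def, eLpNorm_two_sq]

lemma plane_enorm_pow (u : PlaneSpace) : ‖u‖ₑ ^ 6 = ∫⁻ z, ‖u z‖ₑ ^ 6 := by
  rw [Lp.enorm_def, eLpNorm_six_pow]

lemma lintegral_bumpProfile_sq_le {r : ℝ} (hr : 0 < r) (c : ℝ) :
    ∫⁻ x, ENNReal.ofReal (bumpProfile ((x - c) / r)) ^ 2 ≤ ENNReal.ofReal (4 * r) := by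
  have hpt : ∀ x, ENNReal.ofReal (bumpProfile ((x - c) / r)) ^ 2 ≤
      (Set.Icc (c - r) (c + r)).indicator (fun _ => 1) x + ENNReal.ofReal (r ^ 2) *
        {x | r < |x - c|}.indicator (fun x => ENNReal.ofReal (|x - c| ^ (-2 : ℝ))) x := by
    intro x
    rw [← ENNReal.ofReal_pow (bumpProfile_pos _).le]
    rcases le_or_gt |x - c| r with h | h
    · refine le_trans ?_ le_self_add
      rw [Set.indicator_of_mem]
      · rw [ENNReal.ofReal_le_one]
        refine pow_le_one₀ (bumpProfile_pos _).le ?_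
        unfold bumpProfile
        rw [div_le_one (by positivity)]
        linarith [abs_nonneg ((x - c) / r)]
      · rw [abs_le] at h; constructor <;> linarith
    · refine le_trans ?_ le_add_self
      have hs : 0 < |x - c| := hr.trans h
      rw [Set.indicator_of_mem (by exact h), ← ENNReal.ofReal_mul (by positivity)]
      refine ENNReal.ofReal_le_ofReal ?_
      have : bumpProfile ((x - c) / r) ≤ r / |x - c| := by
        unfold bumpProfile
        rw [abs_div, abs_of_pos hr, div_le_div_iff₀ (by positivity) hs]
        have : r * (|x - c| / r) = |x - c| := by field_simp
        nlinarith
      calc bumpProfile ((x - c) / r) ^ 2 ≤ (r / |x - c|) ^ 2 := by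
            gcongr
            exact (bumpProfile_pos _).le
        _ = r ^ 2 * |x - c| ^ (-2 : ℝ) := by
            rw [Real.rpow_neg hs.le, div_pow]
            norm_cast
  calc _ ≤ ∫⁻ x, ((Set.Icc (c - r) (c + r)).indicator (fun _ => 1) x + ENNReal.ofReal (r ^ 2) *
        {x | r < |x - c|}.indicator (fun x => ENNReal.ofReal (|x - c| ^ (-2 : ℝ))) x) :=
        lintegral_mono hpt
    _ ≤ ENNReal.ofReal (2 * r) + ENNReal.ofReal (r ^ 2) * ENNReal.ofReal (2 / r) := by
        rw [lintegral_add_left (measurable_const.indicator measurableSet_Icc),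
          lintegral_const_mul' _ _ ENNReal.ofReal_ne_top,
          lintegral_indicator_const measurableSet_Icc, Real.volume_Icc, one_mul]
        gcongr
        · exact le_of_eq (by ring)
        · exact lintegral_far_le hr c
    _ = ENNReal.ofReal (4 * r) := by
        rw [← ENNReal.ofReal_mul (by positivity), ← ENNReal.ofReal_add (by positivity)
          (by positivity)]
        congr 1; field_simp; ring

lemma lintegral_mul_bumpProfile_le {g : ℝ → ℂ} (hg : Measurable g)
    (hg2 : ∫⁻ x, ‖g x‖ₑ ^ 2 ≤ 1) {r : ℝ} (hr : 0 < r) (c : ℝ) :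
    ∫⁻ x, ‖g x‖ₑ * ENNReal.ofReal (bumpProfile ((x - c) / r)) ≤
      2 * ENNReal.ofReal (r ^ (1 / 2 : ℝ)) := by
  have hb : Measurable fun x => ENNReal.ofReal (bumpProfile ((x - c) / r)) := by
    have := continuous_bumpProfile.measurable
    fun_prop
  refine (ENNReal.lintegral_mul_le_Lp_mul_Lq volume Real.HolderConjugate.two_two
    hg.enorm.aemeasurable hb.aemeasurable).trans ?_
  have e : ∀ x : ℝ≥0∞, x ^ (2 : ℝ) = x ^ 2 := fun x => by
    rw [← ENNReal.rpow_natCast]; norm_num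
  simp_rw [e]
  calc _ ≤ (1 : ℝ≥0∞) ^ (1 / 2 : ℝ) * ENNReal.ofReal (4 * r) ^ (1 / 2 : ℝ) := by
        gcongr
        exact lintegral_bumpProfile_sq_le hr c
    _ = _ := by
        rw [ENNReal.one_rpow, one_mul, ENNReal.ofReal_rpow_of_pos (by positivity),
          Real.mul_rpow (by norm_num) hr.le, ENNReal.ofReal_mul (by positivity)]
        congr 1
        rw [show (4 : ℝ) = 2 ^ (2 : ℝ) by norm_num, ← Real.rpow_mul (by norm_num)]
        norm_num

/-- The constant in the (non-sharp) Strichartz inequality. -/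
noncomputable def strichartzBound : ℝ≥0∞ := refinedConst * 2 ^ (1 / 2 : ℝ)

lemma strichartzBound_ne_top : strichartzBound ≠ ⊤ :=
  ENNReal.mul_ne_top refinedConst_ne_top (ENNReal.rpow_ne_top_of_nonneg (by norm_num) (by simp))

lemma ext_congr_ae {α β : ℝ} {g g' : ℝ → ℂ} (h : g =ᵐ[volume] g') : ext α β g = ext α β g' :=
  oscInt_congr_ae (h.mono fun x hx => by simp only [hx])

lemma ext_const_mul (α β : ℝ) (c : ℂ) (g : ℝ → ℂ) (z : ℝ × ℝ) :
    ext α β (fun x => c * g x) z = c * ext α β g z := by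
  unfold ext oscInt
  rw [← integral_const_mul]
  refine integral_congr_ae (ae_of_all _ fun x => ?_)
  simp only
  ring

/-- The Strichartz inequality, for amplitudes with convergent extension integral. -/
theorem strichartz {α β : ℝ} (h : α ≠ 0 ∨ β ≠ 0) {g : ℝ → ℂ} (hg : Measurable g)
    (hg2 : ∫⁻ x, ‖g x‖ₑ ^ 2 ≠ ⊤)
    (hwg : Integrable fun η => (phaseWeight α β η : ℂ) * g η) :
    ∫⁻ z, ‖ext α β g z‖ₑ ^ 6 ≤ strichartzBound * (∫⁻ x, ‖g x‖ₑ ^ 2) ^ 3 := by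
  rcases eq_or_ne (∫⁻ x, ‖g x‖ₑ ^ 2) 0 with h0 | h0
  · have hg0 : g =ᵐ[volume] fun _ => 0 := by
      rw [lintegral_eq_zero_iff (by fun_prop)] at h0
      filter_upwards [h0] with x hx
      simpa using hx
    rw [ext_congr_ae hg0]
    simp [ext, oscInt]
  obtain ⟨N, hN0, hN⟩ : ∃ N : ℝ, 0 < N ∧ ∫⁻ x, ‖g x‖ₑ ^ 2 = ENNReal.ofReal (N ^ 2) := by
    refine ⟨Real.sqrt (∫⁻ x, ‖g x‖ₑ ^ 2).toReal, Real.sqrt_pos.2 (ENNReal.toReal_pos h0 hg2), ?_⟩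
    rw [Real.sq_sqrt ENNReal.toReal_nonneg, ENNReal.ofReal_toReal hg2]
  set g₁ : ℝ → ℂ := fun x => (N⁻¹ : ℂ) * g x with hg₁
  have hg₁m : Measurable g₁ := hg.const_mul _
  have hg₁n : ∀ x, ‖g₁ x‖ₑ = ENNReal.ofReal N⁻¹ * ‖g x‖ₑ := by
    intro x
    rw [hg₁, enorm_mul]
    congr 1
    rw [← ofReal_norm, norm_inv, Complex.norm_real, Real.norm_of_nonneg hN0.le]
  have hg₁2 : ∫⁻ x, ‖g₁ x‖ₑ ^ 2 ≤ 1 := by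
    simp_rw [hg₁n, mul_pow]
    rw [lintegral_const_mul' _ _ (by simp), hN, ← ENNReal.ofReal_pow (by positivity),
      ← ENNReal.ofReal_mul (by positivity), ← ENNReal.ofReal_one]
    refine ENNReal.ofReal_le_ofReal (le_of_eq ?_)
    field_simp
  have hwg₁ : Integrable fun η => (phaseWeight α β η : ℂ) * g₁ η := by
    refine (hwg.const_mul (N⁻¹ : ℂ)).congr (ae_of_all _ fun x => ?_)
    simp only [hg₁]; ring
  have key := refined_strichartz h hg₁m hg₁2 hwg₁ (A := 2) (by simp)
    fun c r hr => lintegral_mul_bumpProfile_le hg₁m hg₁2 hr c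
  have e : ∀ z, ‖ext α β g z‖ₑ ^ 6 = ENNReal.ofReal (N ^ 6) * ‖ext α β g₁ z‖ₑ ^ 6 := by
    intro z
    have : ext α β g z = N * ext α β g₁ z := by
      rw [hg₁, ext_const_mul, ← mul_assoc]
      have : (N : ℂ) ≠ 0 := by exact_mod_cast hN0.ne'
      field_simp
    rw [this, enorm_mul, mul_pow, ← ofReal_norm (N : ℂ), Complex.norm_real,
      Real.norm_of_nonneg hN0.le, ENNReal.ofReal_pow hN0.le]
  simp_rw [e]
  rw [lintegral_const_mul' _ _ (by simp), hN, ← ENNReal.ofReal_pow (by positivity), ← pow_mul,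
    mul_comm]
  gcongr
  exact key

/-- Truncation to frequencies `|η| ≤ n`. -/
noncomputable def cutoff (n : ℕ) (f : ℝ → ℂ) : ℝ → ℂ := (Set.Icc (-(n : ℝ)) n).indicator f

lemma measurable_cutoff {f : ℝ → ℂ} (hf : Measurable f) (n : ℕ) : Measurable (cutoff n f) :=
  hf.indicator measurableSet_Icc

lemma enorm_cutoff_le (n : ℕ) (f : ℝ → ℂ) (x : ℝ) : ‖cutoff n f x‖ₑ ≤ ‖f x‖ₑ :=
  enorm_indicator_le_enorm_self _ _

lemma memLp_cutoff {f : ℝ → ℂ} (hf : MemLp f 2) (n : ℕ) : MemLp (cutoff n f) 2 :=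
  hf.indicator measurableSet_Icc

lemma integrable_weight_mul_cutoff (α β : ℝ) {f : ℝ → ℂ} (hf : MemLp f 2) (n : ℕ) :
    Integrable fun η => (phaseWeight α β η : ℂ) * cutoff n f η := by
  have hc : Continuous fun η => (phaseWeight α β η : ℂ) :=
    Complex.continuous_ofReal.comp (continuous_phaseWeight α β)
  have h1 : MemLp ((Set.Icc (-(n : ℝ)) n).indicator fun η => (phaseWeight α β η : ℂ)) 2 :=
    (memLp_indicator_iff_restrict measurableSet_Icc).2
      (by
        obtain ⟨C, hC⟩ := (isCompact_Icc (a := -(n : ℝ)) (b := n)).exists_bound_of_continuousOn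
          hc.continuousOn
        exact MemLp.of_bound hc.aestronglyMeasurable C
          (ae_restrict_of_forall_mem measurableSet_Icc hC))
  refine (h1.integrable_mul hf).congr (ae_of_all _ fun x => ?_)
  simp only [Pi.mul_apply, cutoff, Set.indicator]
  split_ifs <;> simp

lemma tendsto_cutoff (f : ℝ → ℂ) (x : ℝ) :
    Filter.Tendsto (fun n => cutoff n f x) Filter.atTop (nhds (f x)) := by
  obtain ⟨N, hN⟩ := exists_nat_ge |x|
  refine tendsto_const_nhds.congr' ?_
  filter_upwards [Filter.eventually_ge_atTop N] with n hn
  rw [cutoff, Set.indicator_of_mem]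
  rw [Set.mem_Icc, ← abs_le]
  exact hN.trans (by exact_mod_cast hn)

lemma memLp_ext {α β : ℝ} (h : α ≠ 0 ∨ β ≠ 0) {g : ℝ → ℂ} (hg : MemLp g 2)
    (hwg : Integrable fun η => (phaseWeight α β η : ℂ) * g η) : MemLp (ext α β g) 6 := by
  wlog hgm : Measurable g generalizing g
  · have h1 := hg.aestronglyMeasurable.ae_eq_mk
    rw [ext_congr_ae h1]
    refine this (hg.ae_eq h1) (hwg.congr (h1.mono fun x hx => by simp only [hx])) ?_
    exact hg.aestronglyMeasurable.stronglyMeasurable_mk.measurable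
  refine ⟨(continuous_oscInt (measurable_phaseCurve α β) hwg).aestronglyMeasurable, ?_⟩
  have h2 : ∫⁻ x, ‖g x‖ₑ ^ 2 ≠ ⊤ := by
    rw [← eLpNorm_two_sq]
    exact ENNReal.pow_ne_top hg.eLpNorm_ne_top
  have h3 : eLpNorm (ext α β g) 6 volume ^ 6 < ⊤ := by
    rw [eLpNorm_six_pow]
    exact (strichartz h hgm h2 hwg).trans_lt
      (ENNReal.mul_lt_top strichartzBound_ne_top.lt_top (ENNReal.pow_lt_top h2.lt_top))
  by_contra hcon
  rw [not_lt, top_le_iff] at hcon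
  rw [hcon] at h3
  simp at h3

/-- The norm bound for the extension operator. -/
noncomputable def strichartzBoundRoot : ℝ := (strichartzBound ^ (1 / 6 : ℝ)).toReal

lemma strichartzBoundRoot_nonneg : 0 ≤ strichartzBoundRoot := ENNReal.toReal_nonneg

lemma ofReal_strichartzBoundRoot_pow : ENNReal.ofReal strichartzBoundRoot ^ 6 = strichartzBound := by
  rw [strichartzBoundRoot, ENNReal.ofReal_toReal
    (ENNReal.rpow_ne_top_of_nonneg (by norm_num) strichartzBound_ne_top), ← ENNReal.rpow_natCast,
    ← ENNReal.rpow_mul]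
  norm_num

lemma norm_le_of_enorm_pow_le {E F : Type*} [NormedAddCommGroup E] [NormedAddCommGroup F] {x : E}
    {y : F} {C : ℝ} (hC : 0 ≤ C) {n : ℕ} (hn : n ≠ 0)
    (h : ‖x‖ₑ ^ n ≤ ENNReal.ofReal C ^ n * ‖y‖ₑ ^ n) : ‖x‖ ≤ C * ‖y‖ := by
  rw [← mul_pow] at h
  have h' := (ENNReal.pow_le_pow_left_iff hn).1 h
  rw [← ofReal_norm, ← ofReal_norm, ← ENNReal.ofReal_mul hC] at h'
  exact (ENNReal.ofReal_le_ofReal_iff (by positivity)).1 h'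

lemma norm_toLp_ext_le {α β : ℝ} (h : α ≠ 0 ∨ β ≠ 0) {g : ℝ → ℂ} (hg : MemLp g 2)
    (hwg : Integrable fun η => (phaseWeight α β η : ℂ) * g η) :
    ‖(memLp_ext h hg hwg).toLp‖ ≤ strichartzBoundRoot * ‖hg.toLp‖ := by
  refine norm_le_of_enorm_pow_le strichartzBoundRoot_nonneg (n := 6) (by norm_num) ?_
  rw [Lp.enorm_toLp, Lp.enorm_toLp, ofReal_strichartzBoundRoot_pow, eLpNorm_six_pow,
    show 6 = 2 * 3 by norm_num, pow_mul (eLpNorm g 2 volume), eLpNorm_two_sq]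
  have h1 := hg.aestronglyMeasurable.ae_eq_mk
  have h2 : ∫⁻ x, ‖g x‖ₑ ^ 2 = ∫⁻ x, ‖hg.aestronglyMeasurable.mk g x‖ₑ ^ 2 :=
    lintegral_congr_ae (h1.mono fun x hx => by simp only [hx])
  have h3 : ∫⁻ x, ‖g x‖ₑ ^ 2 ≠ ⊤ := by
    rw [← eLpNorm_two_sq]
    exact ENNReal.pow_ne_top hg.eLpNorm_ne_top
  rw [ext_congr_ae h1, h2]
  exact strichartz h hg.aestronglyMeasurable.stronglyMeasurable_mk.measurable (h2 ▸ h3)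
    (hwg.congr (h1.mono fun x hx => by simp only [hx]))

/-- The extension operator on frequencies `|η| ≤ n`. -/
noncomputable def extTrunc (α β : ℝ) (h : α ≠ 0 ∨ β ≠ 0) (n : ℕ) : FreqSpace →L[ℂ] PlaneSpace :=
  LinearMap.mkContinuous
    { toFun := fun f => (memLp_ext h (memLp_cutoff (Lp.memLp f) n)
        (integrable_weight_mul_cutoff α β (Lp.memLp f) n)).toLp
      map_add' := by
        intro f g
        rw [← MemLp.toLp_add]
        refine MemLp.toLp_congr _ _ (ae_of_all _ fun z => ?_)
        rw [Pi.add_apply, ext, ext, ext, ← oscInt_add (measurable_phaseCurve α β)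
          (integrable_weight_mul_cutoff α β (Lp.memLp f) n)
          (integrable_weight_mul_cutoff α β (Lp.memLp g) n)]
        refine congrFun (oscInt_congr_ae ?_) z
        filter_upwards [Lp.coeFn_add f g] with x hx
        simp only [cutoff, Set.indicator, hx, Pi.add_apply]
        split_ifs <;> ring
      map_smul' := by
        intro c f
        rw [RingHom.id_apply, ← MemLp.toLp_const_smul]
        refine MemLp.toLp_congr _ _ (ae_of_all _ fun z => ?_)
        rw [Pi.smul_apply, smul_eq_mul, ← ext_const_mul]
        refine congrFun (ext_congr_ae ?_) z
        filter_upwards [Lp.coeFn_smul c f] with x hx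
        simp only [cutoff, Set.indicator, hx, Pi.smul_apply, smul_eq_mul]
        split_ifs <;> ring }
    strichartzBoundRoot (by
      intro f
      refine (norm_toLp_ext_le h (memLp_cutoff (Lp.memLp f) n)
        (integrable_weight_mul_cutoff α β (Lp.memLp f) n)).trans ?_
      refine mul_le_mul_of_nonneg_left ?_ strichartzBoundRoot_nonneg
      refine Lp.norm_le_norm_of_ae_le ?_
      filter_upwards [MemLp.coeFn_toLp (memLp_cutoff (Lp.memLp f) n)] with x hx
      rw [hx]
      exact norm_indicator_le_norm_self _ _)

lemma extTrunc_apply (α β : ℝ) (h : α ≠ 0 ∨ β ≠ 0) (n : ℕ) (f : FreqSpace) :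
    extTrunc α β h n f = (memLp_ext h (memLp_cutoff (Lp.memLp f) n)
        (integrable_weight_mul_cutoff α β (Lp.memLp f) n)).toLp := rfl

lemma coeFn_extTrunc (α β : ℝ) (h : α ≠ 0 ∨ β ≠ 0) (n : ℕ) (f : FreqSpace) :
    extTrunc α β h n f =ᵐ[volume] ext α β (cutoff n f) := by
  rw [extTrunc_apply]; exact MemLp.coeFn_toLp _

lemma norm_extTrunc_le (α β : ℝ) (h : α ≠ 0 ∨ β ≠ 0) (n : ℕ) (f : FreqSpace) :
    ‖extTrunc α β h n f‖ ≤ strichartzBoundRoot * ‖f‖ := by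
  refine (ContinuousLinearMap.le_opNorm _ f).trans ?_
  gcongr
  exact LinearMap.mkContinuous_norm_le _ strichartzBoundRoot_nonneg _

/-- Truncation as an element of `L²`. -/
noncomputable def truncFreq (n : ℕ) (f : FreqSpace) : FreqSpace :=
  (memLp_cutoff (Lp.memLp f) n).toLp

lemma coeFn_truncFreq (n : ℕ) (f : FreqSpace) : truncFreq n f =ᵐ[volume] cutoff n f :=
  MemLp.coeFn_toLp _

lemma tendsto_truncFreq (f : FreqSpace) :
    Filter.Tendsto (fun n => truncFreq n f) Filter.atTop (nhds f) := by
  rw [Lp.tendsto_Lp_iff_tendsto_eLpNorm']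
  have hpow : Filter.Tendsto (fun n => eLpNorm (⇑(truncFreq n f) - ⇑f) 2 volume ^ 2) Filter.atTop
      (nhds 0) := by
    have e : ∀ n, eLpNorm (⇑(truncFreq n f) - ⇑f) 2 volume ^ 2 =
        ∫⁻ x, ‖cutoff n f x - f x‖ₑ ^ 2 := by
      intro n
      rw [eLpNorm_two_sq]
      refine lintegral_congr_ae ?_
      filter_upwards [coeFn_truncFreq n f] with x hx
      rw [Pi.sub_apply, hx]
    simp_rw [e]
    have hfm : Measurable f := (Lp.stronglyMeasurable f).measurable
    have := tendsto_lintegral_of_dominated_convergence (μ := volume)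
      (F := fun n x => ‖cutoff n f x - f x‖ₑ ^ 2) (f := fun _ => 0) (fun x => ‖f x‖ₑ ^ 2)
      (fun n => ((measurable_cutoff hfm n).sub hfm).enorm.pow_const 2)
      (fun n => ae_of_all _ fun x => by
        simp only [cutoff, Set.indicator]
        split_ifs <;> simp)
      (by rw [← freq_enorm_sq]; exact ENNReal.pow_ne_top enorm_ne_top)
      (ae_of_all _ fun x => by
        have h1 := (tendsto_cutoff f x).sub_const (f x)
        rw [sub_self] at h1
        have h2 := ((ENNReal.continuous_pow 2).tendsto _).comp h1.enorm
        simpa [Function.comp_def] using h2)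
    simpa using this
  have h2 := (ENNReal.continuous_rpow_const (y := (1 / 2 : ℝ))).tendsto 0 |>.comp hpow
  rw [ENNReal.zero_rpow_of_pos (by norm_num)] at h2
  refine h2.congr fun n => ?_
  simp only [Function.comp]
  rw [← ENNReal.rpow_natCast, ← ENNReal.rpow_mul]
  norm_num

lemma extTrunc_truncFreq (α β : ℝ) (h : α ≠ 0 ∨ β ≠ 0) {n N : ℕ} (hn : N ≤ n) (f : FreqSpace) :
    extTrunc α β h n (truncFreq N f) = extTrunc α β h N f := by
  rw [extTrunc_apply, extTrunc_apply]
  refine MemLp.toLp_congr _ _ (ae_of_all _ fun z => congrFun (ext_congr_ae ?_) z)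
  filter_upwards [coeFn_truncFreq N f] with x hx
  have hNn : (N : ℝ) ≤ n := by exact_mod_cast hn
  simp only [cutoff, Set.indicator, Set.mem_Icc] at hx ⊢
  rw [hx]
  by_cases h1 : -(N : ℝ) ≤ x ∧ x ≤ N
  · rw [if_pos h1, if_pos ⟨by linarith [h1.1], by linarith [h1.2]⟩]
  · rw [if_neg h1, ite_self]

lemma cauchySeq_extTrunc (α β : ℝ) (h : α ≠ 0 ∨ β ≠ 0) (f : FreqSpace) :
    CauchySeq fun n => extTrunc α β h n f := by
  rw [Metric.cauchySeq_iff']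
  intro ε hε
  have hC : 0 < strichartzBoundRoot + 1 := by linarith [strichartzBoundRoot_nonneg]
  obtain ⟨N, hN⟩ := (Metric.tendsto_atTop.1 (tendsto_truncFreq f)) (ε / (strichartzBoundRoot + 1))
    (by positivity)
  refine ⟨N, fun n hn => ?_⟩
  rw [← extTrunc_truncFreq α β h hn f, dist_eq_norm, ← map_sub]
  refine (norm_extTrunc_le α β h n _).trans_lt ?_
  have h1 := hN N le_rfl
  rw [dist_comm, dist_eq_norm, lt_div_iff₀ hC] at h1
  nlinarith [norm_nonneg (f - truncFreq N f)]

/-- The limit of the truncated extension operators. -/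
noncomputable def extLimit (α β : ℝ) (h : α ≠ 0 ∨ β ≠ 0) (f : FreqSpace) : PlaneSpace :=
  Filter.atTop.limUnder fun n => extTrunc α β h n f

lemma tendsto_extTrunc_extLimit (α β : ℝ) (h : α ≠ 0 ∨ β ≠ 0) :
    Filter.Tendsto (fun n f => extTrunc α β h n f) Filter.atTop (nhds (extLimit α β h)) :=
  tendsto_pi_nhds.2 fun f => (cauchySeq_extTrunc α β h f).tendsto_limUnder

/-- The extension operator `L²(ℝ) → L⁶(ℝ²)`, the limit of its truncations. -/
noncomputable def extOp (α β : ℝ) (h : α ≠ 0 ∨ β ≠ 0) : FreqSpace →L[ℂ] PlaneSpace :=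
  continuousLinearMapOfTendsto (fun n => extTrunc α β h n) (tendsto_extTrunc_extLimit α β h)

lemma tendsto_extTrunc (α β : ℝ) (h : α ≠ 0 ∨ β ≠ 0) (f : FreqSpace) :
    Filter.Tendsto (fun n => extTrunc α β h n f) Filter.atTop (nhds (extOp α β h f)) :=
  (cauchySeq_extTrunc α β h f).tendsto_limUnder

lemma norm_extOp_le (α β : ℝ) (h : α ≠ 0 ∨ β ≠ 0) (f : FreqSpace) :
    ‖extOp α β h f‖ ≤ strichartzBoundRoot * ‖f‖ :=
  le_of_tendsto (tendsto_extTrunc α β h f).norm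
    (Filter.Eventually.of_forall fun n => norm_extTrunc_le α β h n f)

lemma tendsto_ext_cutoff {α β : ℝ} {g : ℝ → ℂ}
    (hwg : Integrable fun η => (phaseWeight α β η : ℂ) * g η) (z : ℝ × ℝ) :
    Filter.Tendsto (fun n => ext α β (cutoff n g) z) Filter.atTop (nhds (ext α β g z)) := by
  have e : ∀ n η, planeChar z (phaseCurve α β η) * ((phaseWeight α β η : ℂ) * cutoff n g η) =
      (Set.Icc (-(n : ℝ)) n).indicator
        (fun η => planeChar z (phaseCurve α β η) * ((phaseWeight α β η : ℂ) * g η)) η := by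
    intro n η
    simp only [cutoff, Set.indicator]
    split_ifs <;> simp
  have hi := integrable_planeChar_mul (measurable_phaseCurve α β) hwg z
  refine tendsto_integral_of_dominated_convergence
    (fun η => ‖planeChar z (phaseCurve α β η) * ((phaseWeight α β η : ℂ) * g η)‖)
    (fun n => ?_) hi.norm (fun n => ae_of_all _ fun η => ?_) (ae_of_all _ fun η => ?_)
  · simp_rw [e]; exact (hi.indicator measurableSet_Icc).aestronglyMeasurable
  · rw [e]; exact norm_indicator_le_norm_self _ _
  · exact ((tendsto_cutoff g η).const_mul _).const_mul _

/-- On amplitudes with convergent extension integral the extension operator is given by that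
integral. -/
lemma coeFn_extOp {α β : ℝ} (h : α ≠ 0 ∨ β ≠ 0) (f : FreqSpace)
    (hwf : Integrable fun η => (phaseWeight α β η : ℂ) * f η) :
    extOp α β h f =ᵐ[volume] ext α β f := by
  obtain ⟨ns, hns, hae⟩ := (tendstoInMeasure_of_tendsto_Lp
    (tendsto_extTrunc α β h f)).exists_seq_tendsto_ae
  have hall : ∀ᵐ z : ℝ × ℝ, ∀ n, extTrunc α β h n f z = ext α β (cutoff n f) z :=
    ae_all_iff.2 fun n => coeFn_extTrunc α β h n f
  filter_upwards [hae, hall] with z hz hall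
  refine tendsto_nhds_unique hz ?_
  simp_rw [hall]
  exact (tendsto_ext_cutoff hwf z).comp hns.tendsto_atTop

/-- The element `|f|` of `L²`. -/
noncomputable def absFreq (f : FreqSpace) : FreqSpace :=
  (MemLp.toLp (fun x => (‖f x‖ : ℂ)) ((Lp.memLp f).norm.ofReal))

lemma coeFn_absFreq (f : FreqSpace) : absFreq f =ᵐ[volume] fun x => (‖f x‖ : ℂ) :=
  MemLp.coeFn_toLp _

lemma norm_absFreq (f : FreqSpace) : ‖absFreq f‖ = ‖f‖ := by
  refine le_antisymm (Lp.norm_le_norm_of_ae_le ?_) (Lp.norm_le_norm_of_ae_le ?_) <;>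
  · filter_upwards [coeFn_absFreq f] with x hx
    rw [hx]; simp

lemma ext_cube_eq (α β : ℝ) (g : ℝ → ℂ) (z : ℝ × ℝ) :
    ext α β g z ^ 3 = oscInt (volume.prod (volume.prod volume))
      (fun q : ℝ × ℝ × ℝ => phaseCurve α β q.1 + (phaseCurve α β q.2.1 + phaseCurve α β q.2.2))
      (fun q => ((phaseWeight α β q.1 : ℂ) * g q.1) * (((phaseWeight α β q.2.1 : ℂ) * g q.2.1) *
        ((phaseWeight α β q.2.2 : ℂ) * g q.2.2))) z := by
  rw [pow_succ', sq, ext, oscInt_mul, oscInt_mul]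

lemma measurable_tripleSum (α β : ℝ) : Measurable (fun q : ℝ × ℝ × ℝ =>
    phaseCurve α β q.1 + (phaseCurve α β q.2.1 + phaseCurve α β q.2.2)) := by
  have := measurable_phaseCurve α β
  fun_prop

/-- Majorant principle for the `L⁶` norm of the extension operator, from the positivity of the
Gaussian-regularized sextic form. -/
lemma lintegral_ext_le_norm {α β : ℝ} {g : ℝ → ℂ}
    (hwg : Integrable fun η => (phaseWeight α β η : ℂ) * g η) :
    ∫⁻ z, ‖ext α β g z‖ₑ ^ 6 ≤ ∫⁻ z, ‖ext α β (fun x => (‖g x‖ : ℂ)) z‖ₑ ^ 6 := by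
  set b : ℝ × ℝ × ℝ → ℂ := fun q => ((phaseWeight α β q.1 : ℂ) * g q.1) *
    (((phaseWeight α β q.2.1 : ℂ) * g q.2.1) * ((phaseWeight α β q.2.2 : ℂ) * g q.2.2)) with hb
  have hbi : Integrable b (volume.prod (volume.prod volume)) :=
    hwg.mul_prod (hwg.mul_prod hwg)
  have e1 : ∀ z, ‖ext α β g z‖ₑ ^ 6 = ‖oscInt (volume.prod (volume.prod volume))
      (fun q : ℝ × ℝ × ℝ => phaseCurve α β q.1 + (phaseCurve α β q.2.1 + phaseCurve α β q.2.2))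
      b z‖ₑ ^ 2 := by
    intro z
    rw [hb, ← ext_cube_eq, enorm_pow, ← pow_mul]
  have hbn : (fun q => (‖b q‖ : ℂ)) = fun q : ℝ × ℝ × ℝ =>
      ((phaseWeight α β q.1 : ℂ) * (‖g q.1‖ : ℂ)) *
      (((phaseWeight α β q.2.1 : ℂ) * (‖g q.2.1‖ : ℂ)) *
        ((phaseWeight α β q.2.2 : ℂ) * (‖g q.2.2‖ : ℂ))) := by
    funext q
    simp only [hb, norm_mul, Complex.norm_real, Real.norm_of_nonneg (phaseWeight_nonneg _ _ _)]
    push_cast; ring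
  have e2 : ∀ z, ‖ext α β (fun x => (‖g x‖ : ℂ)) z‖ₑ ^ 6 =
      ‖oscInt (volume.prod (volume.prod volume))
      (fun q : ℝ × ℝ × ℝ => phaseCurve α β q.1 + (phaseCurve α β q.2.1 + phaseCurve α β q.2.2))
      (fun q => (‖b q‖ : ℂ)) z‖ₑ ^ 2 := by
    intro z
    rw [hbn, ← ext_cube_eq α β (fun x => (‖g x‖ : ℂ)) z, enorm_pow, ← pow_mul]
  simp_rw [e1, e2]
  refine lintegral_le_of_gaussWeight ((continuous_oscInt (measurable_tripleSum α β)
    hbi).measurable.enorm.pow_const 2) fun δ hδ => ?_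
  refine (lintegral_enorm_sq_gaussWeight_le_norm (measurable_tripleSum α β) hbi hδ).trans ?_
  refine lintegral_mono fun z => mul_le_of_le_one_right (zero_le) ?_
  rw [ENNReal.ofReal_le_one, gaussWeight]
  refine Real.exp_le_one_iff.2 ?_
  nlinarith [sq_nonneg z.1, sq_nonneg z.2, mul_nonneg hδ.le (add_nonneg (sq_nonneg z.1) (sq_nonneg z.2))]

lemma cutoff_norm (n : ℕ) (f : ℝ → ℂ) :
    cutoff n (fun x => (‖f x‖ : ℂ)) = fun x => (‖cutoff n f x‖ : ℂ) := by
  funext x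
  simp only [cutoff, Set.indicator]
  split_ifs <;> simp

lemma norm_extOp_le_absFreq (α β : ℝ) (h : α ≠ 0 ∨ β ≠ 0) (f : FreqSpace) :
    ‖extOp α β h f‖ ≤ ‖extOp α β h (absFreq f)‖ := by
  refine le_of_tendsto_of_tendsto' (tendsto_extTrunc α β h f).norm
    (tendsto_extTrunc α β h (absFreq f)).norm fun n => ?_
  have h1 : ext α β (cutoff n (absFreq f)) = ext α β (fun x => (‖cutoff n f x‖ : ℂ)) := by
    rw [← cutoff_norm]
    refine ext_congr_ae ?_
    filter_upwards [coeFn_absFreq f] with x hx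
    simp only [cutoff, Set.indicator, hx]
  have := norm_le_of_enorm_pow_le (x := extTrunc α β h n f) (y := extTrunc α β h n (absFreq f))
    zero_le_one (n := 6) (by norm_num) (by
      rw [ENNReal.ofReal_one, one_pow, one_mul, extTrunc_apply, extTrunc_apply, Lp.enorm_toLp,
        Lp.enorm_toLp, eLpNorm_six_pow, eLpNorm_six_pow, h1]
      exact lintegral_ext_le_norm (integrable_weight_mul_cutoff α β (Lp.memLp f) n))
  simpa using this

/-- The refined Strichartz estimate for the extension operator. -/
lemma enorm_extOp_pow_le {α β : ℝ} (h : α ≠ 0 ∨ β ≠ 0) {f : FreqSpace} (hf : ‖f‖ ≤ 1) {A : ℝ≥0∞}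
    (hAtop : A ≠ ⊤)
    (hA : ∀ c r : ℝ, 0 < r → ∫⁻ x, ‖f x‖ₑ * ENNReal.ofReal (bumpProfile ((x - c) / r)) ≤
      A * ENNReal.ofReal (r ^ (1 / 2 : ℝ))) :
    ‖extOp α β h f‖ₑ ^ 6 ≤ refinedConst * A ^ (1 / 2 : ℝ) := by
  have hlim : Filter.Tendsto (fun n => ‖extTrunc α β h n f‖ₑ ^ 6) Filter.atTop
      (nhds (‖extOp α β h f‖ₑ ^ 6)) :=
    ((ENNReal.continuous_pow 6).tendsto _).comp (tendsto_extTrunc α β h f).enorm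
  refine le_of_tendsto hlim (Filter.Eventually.of_forall fun n => ?_)
  rw [extTrunc_apply, Lp.enorm_toLp, eLpNorm_six_pow]
  have hfm : Measurable f := (Lp.stronglyMeasurable f).measurable
  refine refined_strichartz h (measurable_cutoff hfm n) ?_
    (integrable_weight_mul_cutoff α β (Lp.memLp f) n) hAtop fun c r hr => ?_
  · refine (lintegral_mono fun x => pow_le_pow_left' (enorm_cutoff_le n f x) 2).trans ?_
    rw [← freq_enorm_sq, ← ofReal_norm]
    exact pow_le_one' (ENNReal.ofReal_le_one.2 hf) 2
  · refine (lintegral_mono fun x => ?_).trans (hA c r hr)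
    gcongr
    exact enorm_cutoff_le n f x

/-! ### Local smoothing and convergence almost everywhere -/

lemma ENNReal.tendsto_zero_of_tendsto_pow {ι : Type*} {l : Filter ι} {a : ι → ℝ≥0∞} {k : ℕ}
    (hk : k ≠ 0) (h : Filter.Tendsto (fun i => a i ^ k) l (nhds 0)) :
    Filter.Tendsto a l (nhds 0) := by
  have hk' : (0 : ℝ) < (k : ℝ)⁻¹ := by positivity
  have h2 := (ENNReal.continuous_rpow_const (y := (k : ℝ)⁻¹)).tendsto 0 |>.comp h
  rw [ENNReal.zero_rpow_of_pos hk'] at h2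
  refine h2.congr fun n => ?_
  simp only [Function.comp]
  rw [← ENNReal.rpow_natCast, ← ENNReal.rpow_mul, mul_inv_cancel₀ (by exact_mod_cast hk),
    ENNReal.rpow_one]

/-- Dominated convergence in `Lᵖ`, for exponents `p` that are natural numbers. -/
lemma tendsto_Lp_of_dominated {X : Type*} [MeasurableSpace X] {μ : Measure X} {p : ℝ≥0∞}
    [Fact (1 ≤ p)] {k : ℕ} (hk : k ≠ 0)
    (hpow : ∀ f : X → ℂ, eLpNorm f p μ ^ k = ∫⁻ x, ‖f x‖ₑ ^ k ∂μ)
    {u : ℕ → Lp ℂ p μ} {v : Lp ℂ p μ} (bound : X → ℝ≥0∞) (hfin : ∫⁻ x, bound x ∂μ ≠ ⊤)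
    (hbound : ∀ n, ∀ᵐ x ∂μ, ‖u n x - v x‖ₑ ^ k ≤ bound x)
    (hlim : ∀ᵐ x ∂μ, Filter.Tendsto (fun n => u n x) Filter.atTop (nhds (v x))) :
    Filter.Tendsto u Filter.atTop (nhds v) := by
  rw [Lp.tendsto_Lp_iff_tendsto_eLpNorm']
  refine ENNReal.tendsto_zero_of_tendsto_pow hk ?_
  simp_rw [hpow]
  have := tendsto_lintegral_of_dominated_convergence' (μ := μ)
    (F := fun n x => ‖u n x - v x‖ₑ ^ k) (f := fun _ => 0) bound
    (fun n => ((Lp.aestronglyMeasurable (u n)).sub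
      (Lp.aestronglyMeasurable v)).enorm.pow_const k) hbound hfin
    (by
      filter_upwards [hlim] with x hx
      have h1 := hx.sub_const (v x)
      rw [sub_self] at h1
      have h2 := ((ENNReal.continuous_pow k).tendsto _).comp h1.enorm
      simpa [Function.comp_def, hk] using h2)
  simpa using this

lemma lintegral_le_of_tendsto_ae {X : Type*} [MeasurableSpace X] {μ : Measure X}
    {F : ℕ → X → ℝ≥0∞} {G : X → ℝ≥0∞} {C : ℝ≥0∞} (hF : ∀ n, AEMeasurable (F n) μ)
    (hlim : ∀ᵐ x ∂μ, Filter.Tendsto (fun n => F n x) Filter.atTop (nhds (G x)))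
    (hC : ∀ n, ∫⁻ x, F n x ∂μ ≤ C) : ∫⁻ x, G x ∂μ ≤ C := by
  calc ∫⁻ x, G x ∂μ = ∫⁻ x, Filter.liminf (fun n => F n x) Filter.atTop ∂μ :=
        lintegral_congr_ae (hlim.mono fun x hx => hx.liminf_eq.symm)
    _ ≤ Filter.liminf (fun n => ∫⁻ x, F n x ∂μ) Filter.atTop := lintegral_liminf_le' hF
    _ ≤ C := Filter.liminf_le_of_frequently_le' (Filter.Frequently.of_forall hC)

lemma ENNReal.add_sq_le_two_mul (x y : ℝ≥0∞) : (x + y) ^ 2 ≤ 2 * (x ^ 2 + y ^ 2) := by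
  have := ENNReal.rpow_add_le_mul_rpow_add_rpow x y (p := ((2 : ℕ) : ℝ)) (by norm_num)
  simp only [ENNReal.rpow_natCast] at this
  norm_num at this
  exact this

/-- The derivative of `phasePoly α β`. -/
def phaseDeriv (α β η : ℝ) : ℝ := 4 * η * (3 * α ^ 2 + 3 * α * β * η + β ^ 2 * η ^ 2)

lemma hasDerivAt_phaseDeriv (α β η : ℝ) : HasDerivAt (phasePoly α β) (phaseDeriv α β η) η := by
  convert hasDerivAt_phasePoly α β η using 1
  unfold phaseDeriv; ring

lemma measurable_phaseDeriv (α β : ℝ) : Measurable (phaseDeriv α β) := by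
  unfold phaseDeriv; fun_prop

lemma phaseDeriv_quad_pos {α β : ℝ} (h : α ≠ 0 ∨ β ≠ 0) {η : ℝ} (hη : η ≠ 0) :
    0 < 3 * α ^ 2 + 3 * α * β * η + β ^ 2 * η ^ 2 := by
  rcases eq_or_ne α 0 with ha | ha
  · have hb : β ≠ 0 := h.resolve_left (by simpa using ha)
    rw [ha]
    have := mul_pos (sq_pos_of_ne_zero hb) (sq_pos_of_ne_zero hη)
    nlinarith
  · nlinarith [sq_pos_of_ne_zero ha, sq_nonneg (3 * α + 2 * (β * η))]

lemma strictMonoOn_phasePoly {α β : ℝ} (h : α ≠ 0 ∨ β ≠ 0) :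
    StrictMonoOn (phasePoly α β) (Set.Ici 0) := by
  refine strictMonoOn_of_deriv_pos (convex_Ici 0)
    (fun x _ => (hasDerivAt_phaseDeriv α β x).continuousAt.continuousWithinAt) fun x hx => ?_
  rw [interior_Ici, Set.mem_Ioi] at hx
  rw [(hasDerivAt_phaseDeriv α β x).deriv]
  exact mul_pos (by linarith) (phaseDeriv_quad_pos h hx.ne')

lemma strictAntiOn_phasePoly {α β : ℝ} (h : α ≠ 0 ∨ β ≠ 0) :
    StrictAntiOn (phasePoly α β) (Set.Iic 0) := by
  refine strictAntiOn_of_deriv_neg (convex_Iic 0)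
    (fun x _ => (hasDerivAt_phaseDeriv α β x).continuousAt.continuousWithinAt) fun x hx => ?_
  rw [interior_Iic, Set.mem_Iio] at hx
  rw [(hasDerivAt_phaseDeriv α β x).deriv]
  exact mul_neg_of_neg_of_pos (by linarith) (phaseDeriv_quad_pos h hx.ne)

/-- A bound for the integral of the Gaussian kernel along the curve, with respect to `|dP|`. -/
noncomputable def smoothingConst : ℝ≥0∞ :=
  ENNReal.ofReal (2 * ∫ x : ℝ, Real.pi * Real.exp (-(1 / 4) * x ^ 2))

lemma lintegral_shifted_gaussian (q : ℝ) :
    2 * ∫⁻ x : ℝ, ENNReal.ofReal (Real.pi * Real.exp (-(1 / 4) * (q - x) ^ 2)) =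
      smoothingConst := by
  have hi : Integrable fun x : ℝ => Real.pi * Real.exp (-(1 / 4) * x ^ 2) :=
    (integrable_exp_neg_mul_sq (by norm_num)).const_mul _
  rw [smoothingConst, ENNReal.ofReal_mul (by norm_num), ofReal_integral_eq_lintegral_ofReal hi
    (ae_of_all _ fun x => by positivity),
    lintegral_sub_left_eq_self
      (fun x => ENNReal.ofReal (Real.pi * Real.exp (-(1 / 4) * x ^ 2))) q]
  norm_num

lemma setLIntegral_gaussian_phase_le {α β : ℝ} {s : Set ℝ} (hs : MeasurableSet s)
    (hinj : Set.InjOn (phasePoly α β) s) (q : ℝ) :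
    ∫⁻ η in s, ENNReal.ofReal |phaseDeriv α β η| *
      ENNReal.ofReal (Real.pi * Real.exp (-(1 / 4) * (q - phasePoly α β η) ^ 2)) ≤
      ∫⁻ x : ℝ, ENNReal.ofReal (Real.pi * Real.exp (-(1 / 4) * (q - x) ^ 2)) := by
  rw [← lintegral_image_eq_lintegral_abs_deriv_mul hs
    (fun x _ => (hasDerivAt_phaseDeriv α β x).hasDerivWithinAt) hinj
    (fun x => ENNReal.ofReal (Real.pi * Real.exp (-(1 / 4) * (q - x) ^ 2)))]
  exact setLIntegral_le_lintegral _ _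

/-- The phase is strictly monotone on each half-line, so `|P'| dη` may be replaced by the Lebesgue
measure in the second variable of `gaussKernel`. The bound is uniform in `α`, `β` and `p`. -/
lemma lintegral_gaussKernel_phaseCurve_le {α β : ℝ} (h : α ≠ 0 ∨ β ≠ 0) (p : ℝ × ℝ) :
    ∫⁻ η, ENNReal.ofReal (gaussKernel 1 (p - phaseCurve α β η))
      ∂(volume.withDensity fun η => ENNReal.ofReal |phaseDeriv α β η|) ≤ smoothingConst := by
  have hm : Measurable fun η => ENNReal.ofReal |phaseDeriv α β η| := by
    have := measurable_phaseDeriv α β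
    fun_prop
  refine (lintegral_withDensity_le_lintegral_mul _ hm _).trans ?_
  have hle : ∀ η, ENNReal.ofReal (gaussKernel 1 (p - phaseCurve α β η)) ≤
      ENNReal.ofReal (Real.pi * Real.exp (-(1 / 4) * (p.2 - phasePoly α β η) ^ 2)) := by
    intro η
    refine ENNReal.ofReal_le_ofReal ?_
    simp only [gaussKernel, phaseCurve, Prod.fst_sub, Prod.snd_sub, div_one, mul_one]
    refine mul_le_mul_of_nonneg_left (Real.exp_le_exp.2 ?_) Real.pi_pos.le
    nlinarith [sq_nonneg (p.1 - η)]
  calc _ ≤ ∫⁻ η in Set.Ici 0 ∪ Set.Iic 0, ENNReal.ofReal |phaseDeriv α β η| *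
      ENNReal.ofReal (Real.pi * Real.exp (-(1 / 4) * (p.2 - phasePoly α β η) ^ 2)) := by
        rw [Set.union_comm, Set.Iic_union_Ici, setLIntegral_univ]
        exact lintegral_mono fun η => mul_le_mul_right (hle η) _
    _ ≤ _ := lintegral_union_le _ _ _
    _ ≤ _ := add_le_add
        (setLIntegral_gaussian_phase_le measurableSet_Ici (strictMonoOn_phasePoly h).injOn p.2)
        (setLIntegral_gaussian_phase_le measurableSet_Iic (strictAntiOn_phasePoly h).injOn p.2)
    _ = smoothingConst := by rw [← two_mul, lintegral_shifted_gaussian]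

/-- Parameters for which `phaseWeight² / |P'|` is at most `1 / (2|η|)` for `|η| ≥ 1`. -/
def IsSmoothing (α β : ℝ) : Prop := ∀ η : ℝ, 1 ≤ |η| →
  phaseWeight α β η ^ 2 ≤ 2 * (3 * α ^ 2 + 3 * α * β * η + β ^ 2 * η ^ 2)

lemma phaseWeight_sq_le (α β η : ℝ) : phaseWeight α β η ^ 2 ≤ 1 + (α + β * η) ^ 2 := by
  have h0 : 0 ≤ |α + β * η| := abs_nonneg _
  rw [phaseWeight, ← Real.rpow_natCast, ← Real.rpow_mul h0, ← sq_abs (α + β * η)]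
  rcases le_total |α + β * η| 1 with h | h
  · have := Real.rpow_le_one h0 h (z := 1 / 3 * ((2 : ℕ) : ℝ)) (by norm_num)
    nlinarith
  · have := Real.rpow_le_rpow_of_exponent_le h (y := 1 / 3 * ((2 : ℕ) : ℝ)) (z := ((2 : ℕ) : ℝ))
      (by norm_num)
    rw [Real.rpow_natCast] at this
    linarith

lemma isSmoothing_one (β : ℝ) : IsSmoothing 1 β := by
  intro η _
  refine (phaseWeight_sq_le 1 β η).trans ?_
  nlinarith [sq_nonneg (2 + β * η)]

lemma isSmoothing_zero_one : IsSmoothing 0 1 := by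
  intro η hη
  refine (phaseWeight_sq_le 0 1 η).trans ?_
  have : 1 ≤ η ^ 2 := by rw [← sq_abs]; nlinarith
  nlinarith

/-- Local smoothing for amplitudes supported in `|η| ≥ R`. -/
lemma lintegral_ext_gaussWeight_le {α β : ℝ} (h : α ≠ 0 ∨ β ≠ 0) (hs : IsSmoothing α β)
    {g : ℝ → ℂ} (hwg : Integrable fun η => (phaseWeight α β η : ℂ) * g η) {R : ℝ} (hR : 1 ≤ R)
    (hgR : ∀ᵐ η, |η| ≤ R → g η = 0) :
    ∫⁻ z, ‖ext α β g z‖ₑ ^ 2 * ENNReal.ofReal (gaussWeight 1 z) ≤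
      smoothingConst * (ENNReal.ofReal (1 / R) * ∫⁻ η, ‖g η‖ₑ ^ 2) := by
  have hJm : Measurable fun η => |phaseDeriv α β η| := by
    have := measurable_phaseDeriv α β
    fun_prop
  have e : ∀ z, ext α β g z = oscInt (volume.withDensity fun η =>
      ENNReal.ofReal |phaseDeriv α β η|) (phaseCurve α β)
      (fun η => (phaseWeight α β η : ℂ) * g η / (|phaseDeriv α β η| : ℝ)) z := by
    intro z
    refine oscInt_eq_withDensity hJm (fun _ => abs_nonneg _) ?_ z
    filter_upwards [hgR] with η hη h0
    rcases eq_or_ne η 0 with h1 | h1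
    · rw [hη (by rw [h1, abs_zero]; linarith), mul_zero]
    · exfalso
      rw [abs_eq_zero, phaseDeriv] at h0
      have := phaseDeriv_quad_pos h h1
      have h2 : (4 : ℝ) * η ≠ 0 := by positivity
      exact (mul_ne_zero h2 this.ne') h0
  simp_rw [e]
  refine (schur_gaussKernel (measurable_phaseCurve α β)
    (integrable_withDensity_div hJm (fun _ => abs_nonneg _) hwg) one_pos
    (lintegral_gaussKernel_phaseCurve_le h)).trans ?_
  refine mul_le_mul_right ?_ _
  refine (lintegral_withDensity_le_lintegral_mul _ hJm.ennreal_ofReal _).trans ?_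
  rw [← lintegral_const_mul' _ _ ENNReal.ofReal_ne_top]
  refine lintegral_mono_ae ?_
  filter_upwards [hgR] with η hη
  rcases le_or_gt |η| R with h1 | h1
  · simp [hη h1]
  have hη0 : 0 < |η| := by linarith
  have hQ := phaseDeriv_quad_pos h (abs_pos.1 hη0)
  have hJ : |phaseDeriv α β η| = 4 * |η| * (3 * α ^ 2 + 3 * α * β * η + β ^ 2 * η ^ 2) := by
    rw [phaseDeriv, abs_mul, abs_mul, abs_of_pos hQ]; norm_num
  have hwb := hs η (hR.trans h1.le)
  simp only [Pi.mul_apply]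
  rw [← ofReal_norm, ← ofReal_norm, norm_div, norm_mul, Complex.norm_real, Complex.norm_real,
    Real.norm_of_nonneg (phaseWeight_nonneg _ _ _), Real.norm_of_nonneg (abs_nonneg _),
    ← ENNReal.ofReal_pow (by positivity [phaseWeight_nonneg α β η]), ← ENNReal.ofReal_pow (norm_nonneg _),
    ← ENNReal.ofReal_mul (abs_nonneg _), ← ENNReal.ofReal_mul (by positivity), hJ]
  refine ENNReal.ofReal_le_ofReal ?_
  set Q := 3 * α ^ 2 + 3 * α * β * η + β ^ 2 * η ^ 2
  have e2 : 4 * |η| * Q * (phaseWeight α β η * ‖g η‖ / (4 * |η| * Q)) ^ 2 =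
      phaseWeight α β η ^ 2 / (4 * |η| * Q) * ‖g η‖ ^ 2 := by
    field_simp
  rw [e2]
  refine mul_le_mul_of_nonneg_right ?_ (sq_nonneg _)
  rw [div_le_div_iff₀ (by positivity) (by linarith)]
  have h3 : Q * R ≤ Q * |η| := mul_le_mul_of_nonneg_left h1.le hQ.le
  have h4 : phaseWeight α β η ^ 2 * R ≤ 2 * Q * R := mul_le_mul_of_nonneg_right hwb (by linarith)
  have h5 : 0 ≤ Q * |η| := by positivity
  nlinarith

/-- Local smoothing for the extension operator. -/
lemma lintegral_extOp_gaussWeight_le {α β : ℝ} (h : α ≠ 0 ∨ β ≠ 0) (hs : IsSmoothing α β)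
    (f : FreqSpace) {R : ℝ} (hR : 1 ≤ R) (hfR : ∀ᵐ η, |η| ≤ R → f η = 0) :
    ∫⁻ z, ‖extOp α β h f z‖ₑ ^ 2 * ENNReal.ofReal (gaussWeight 1 z) ≤
      smoothingConst * (ENNReal.ofReal (1 / R) * ‖f‖ₑ ^ 2) := by
  obtain ⟨ns, hns, hae⟩ := (tendstoInMeasure_of_tendsto_Lp
    (tendsto_extTrunc α β h f)).exists_seq_tendsto_ae
  have hwt : Measurable fun z => ENNReal.ofReal (gaussWeight 1 z) :=
    (continuous_gaussWeight 1).measurable.ennreal_ofReal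
  refine lintegral_le_of_tendsto_ae
    (F := fun n z => ‖extTrunc α β h (ns n) f z‖ₑ ^ 2 * ENNReal.ofReal (gaussWeight 1 z))
    (fun n => ((Lp.aestronglyMeasurable _).enorm.pow_const 2).mul hwt.aemeasurable) ?_ fun n => ?_
  · filter_upwards [hae] with z hz
    refine ENNReal.Tendsto.mul_const ?_ (Or.inr ENNReal.ofReal_ne_top)
    exact ((ENNReal.continuous_pow 2).tendsto _).comp hz.enorm
  · rw [lintegral_congr_ae (g := fun z => ‖ext α β (cutoff (ns n) f) z‖ₑ ^ 2 *
      ENNReal.ofReal (gaussWeight 1 z))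
      ((coeFn_extTrunc α β h (ns n) f).mono fun z hz => by simp only [hz])]
    refine (lintegral_ext_gaussWeight_le h hs
      (integrable_weight_mul_cutoff α β (Lp.memLp f) (ns n)) hR ?_).trans ?_
    · filter_upwards [hfR] with η hη h1
      simp only [cutoff, Set.indicator, hη h1, ite_self]
    · rw [freq_enorm_sq]
      gcongr
      exact enorm_cutoff_le _ _ _

/-- Weak convergence to zero in `L²`. -/
def WeaklyNull (r : ℕ → FreqSpace) : Prop :=
  ∀ ψ : FreqSpace, Filter.Tendsto (fun n => inner ℂ ψ (r n)) Filter.atTop (nhds 0)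

lemma tendsto_inner_of_weaklyNull {r κ : ℕ → FreqSpace} {κ₀ : FreqSpace} (hr : WeaklyNull r)
    {B : ℝ} (hB : ∀ n, ‖r n‖ ≤ B) (hκ : Filter.Tendsto κ Filter.atTop (nhds κ₀)) :
    Filter.Tendsto (fun n => inner ℂ (κ n) (r n)) Filter.atTop (nhds 0) := by
  have h1 : Filter.Tendsto (fun n => inner ℂ (κ n - κ₀) (r n)) Filter.atTop (nhds 0) := by
    have h2 : Filter.Tendsto (fun n => ‖κ n - κ₀‖ * B) Filter.atTop (nhds 0) := by
      have := ((tendsto_iff_norm_sub_tendsto_zero.1 hκ).mul_const B)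
      rwa [zero_mul] at this
    refine squeeze_zero_norm (fun n => ?_) h2
    exact (norm_inner_le_norm _ _).trans (mul_le_mul_of_nonneg_left (hB n) (norm_nonneg _))
  have h3 := h1.add (hr κ₀)
  rw [add_zero] at h3
  refine h3.congr fun n => ?_
  rw [← inner_add_left, sub_add_cancel]

/-- The amplitude whose inner product with `g` is `ext α β (cutoff N g) z`. -/
noncomputable def extKernel (α β : ℝ) (N : ℕ) (z : ℝ × ℝ) (η : ℝ) : ℂ :=
  cutoff N (fun η => (starRingEnd ℂ) (planeChar z (phaseCurve α β η)) * (phaseWeight α β η : ℂ)) η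

lemma norm_extKernel_le {α β : ℝ} (hα : |α| ≤ 1) (hβ : |β| ≤ 1) (N : ℕ) (z : ℝ × ℝ) (η : ℝ) :
    ‖extKernel α β N z η‖ ≤ (cutoff N (fun _ => ((1 + N : ℝ) : ℂ)) η).re := by
  simp only [extKernel, cutoff, Set.indicator]
  split_ifs with hη
  · rw [norm_mul, RCLike.norm_conj, norm_planeChar, one_mul, Complex.norm_real,
      Real.norm_of_nonneg (phaseWeight_nonneg _ _ _), Complex.ofReal_re]
    have hη' : |η| ≤ N := abs_le.2 hη
    have h1 : |α + β * η| ≤ 1 + N := by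
      refine (abs_add_le _ _).trans (add_le_add hα ?_)
      rw [abs_mul]
      exact (mul_le_mul hβ hη' (abs_nonneg _) zero_le_one).trans (one_mul _).le
    refine (Real.rpow_le_rpow (abs_nonneg _) h1 (by norm_num)).trans ?_
    have h2 : (1 : ℝ) ≤ 1 + N := by linarith [Nat.cast_nonneg (α := ℝ) N]
    exact (Real.rpow_le_rpow_of_exponent_le h2 (by norm_num : (1 / 3 : ℝ) ≤ 1)).trans
      (Real.rpow_one _).le
  · simp

lemma measurable_extKernel (α β : ℝ) (N : ℕ) (z : ℝ × ℝ) : Measurable (extKernel α β N z) := by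
  refine measurable_cutoff ?_ N
  have h1 := continuous_planeChar.measurable.comp
    ((measurable_const (a := z)).prodMk (measurable_phaseCurve α β))
  have h2 := (continuous_phaseWeight α β).measurable
  exact (Complex.continuous_conj.measurable.comp h1).mul (Complex.measurable_ofReal.comp h2)

lemma integrable_cutoff_sq (N : ℕ) (C : ℝ) :
    ∫⁻ η, ENNReal.ofReal ((cutoff N (fun _ => (C : ℂ)) η).re) ^ 2 ≠ ⊤ := by
  have e : ∀ η, ENNReal.ofReal ((cutoff N (fun _ => (C : ℂ)) η).re) ^ 2 =
      (Set.Icc (-(N : ℝ)) N).indicator (fun _ => ENNReal.ofReal C ^ 2) η := by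
    intro η
    simp only [cutoff, Set.indicator]
    split_ifs <;> simp
  simp_rw [e]
  rw [lintegral_indicator_const measurableSet_Icc, Real.volume_Icc]
  exact ENNReal.mul_ne_top (by simp) (by simp)

lemma memLp_extKernel {α β : ℝ} (hα : |α| ≤ 1) (hβ : |β| ≤ 1) (N : ℕ) (z : ℝ × ℝ) :
    MemLp (extKernel α β N z) 2 := by
  refine ⟨(measurable_extKernel α β N z).aestronglyMeasurable, ?_⟩
  refine (ENNReal.pow_lt_top_iff (n := 2)).1 ?_ |>.resolve_right (by norm_num)
  rw [eLpNorm_two_sq]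
  refine lt_of_le_of_lt (lintegral_mono fun η => ?_) (integrable_cutoff_sq N (1 + N)).lt_top
  rw [← ofReal_norm]
  exact pow_le_pow_left' (ENNReal.ofReal_le_ofReal (norm_extKernel_le hα hβ N z η)) 2

lemma ext_cutoff_eq_inner {α β : ℝ} (hα : |α| ≤ 1) (hβ : |β| ≤ 1) (N : ℕ) (z : ℝ × ℝ)
    (f : FreqSpace) :
    ext α β (cutoff N f) z = inner ℂ (memLp_extKernel hα hβ N z).toLp f := by
  rw [L2.inner_def, ext, oscInt]
  refine integral_congr_ae ?_
  filter_upwards [(memLp_extKernel hα hβ N z).coeFn_toLp] with η hη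
  rw [hη]
  simp only [extKernel, cutoff, Set.indicator, RCLike.inner_apply]
  split_ifs
  · rw [map_mul, Complex.conj_conj, Complex.conj_ofReal]; ring
  · simp

lemma tendsto_ext_cutoff_of_weaklyNull {a b : ℕ → ℝ} {α β : ℝ} (ha : ∀ n, |a n| ≤ 1)
    (hb : ∀ n, |b n| ≤ 1) (haα : Filter.Tendsto a Filter.atTop (nhds α))
    (hbβ : Filter.Tendsto b Filter.atTop (nhds β)) {r : ℕ → FreqSpace} (hr : WeaklyNull r)
    {B : ℝ} (hB : ∀ n, ‖r n‖ ≤ B) (N : ℕ) (z : ℝ × ℝ) :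
    Filter.Tendsto (fun n => ext (a n) (b n) (cutoff N (r n)) z) Filter.atTop (nhds 0) := by
  have hα : |α| ≤ 1 := le_of_tendsto haα.abs (Filter.Eventually.of_forall ha)
  have hβ : |β| ≤ 1 := le_of_tendsto hbβ.abs (Filter.Eventually.of_forall hb)
  simp_rw [fun n => ext_cutoff_eq_inner (ha n) (hb n) N z (r n)]
  refine tendsto_inner_of_weaklyNull hr hB (κ₀ := (memLp_extKernel hα hβ N z).toLp) ?_
  refine tendsto_Lp_of_dominated (k := 2) (by norm_num) eLpNorm_two_sq
    (fun η => (2 * ENNReal.ofReal ((cutoff N (fun _ => ((1 + N : ℝ) : ℂ)) η).re)) ^ 2)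
    ?_ (fun n => ?_) ?_
  · simp_rw [mul_pow]
    rw [lintegral_const_mul' _ _ (by simp)]
    exact ENNReal.mul_ne_top (by simp) (integrable_cutoff_sq N (1 + N))
  · filter_upwards [(memLp_extKernel hα hβ N z).coeFn_toLp,
      (memLp_extKernel (ha n) (hb n) N z).coeFn_toLp] with η h1 h2
    rw [h1, h2]
    refine pow_le_pow_left' (enorm_sub_le.trans ?_) 2
    rw [two_mul, ← ofReal_norm, ← ofReal_norm]
    exact add_le_add (ENNReal.ofReal_le_ofReal (norm_extKernel_le (ha n) (hb n) N z η))
      (ENNReal.ofReal_le_ofReal (norm_extKernel_le hα hβ N z η))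
  · have hall : ∀ᵐ η, ∀ n, (memLp_extKernel (ha n) (hb n) N z).toLp _ η =
        extKernel (a n) (b n) N z η :=
      ae_all_iff.2 fun n => (memLp_extKernel (ha n) (hb n) N z).coeFn_toLp
    filter_upwards [(memLp_extKernel hα hβ N z).coeFn_toLp, hall] with η h1 h2
    rw [h1]
    simp_rw [h2]
    have hc : Continuous fun p : ℝ × ℝ => (starRingEnd ℂ) (planeChar z (phaseCurve p.1 p.2 η)) *
        (phaseWeight p.1 p.2 η : ℂ) := by
      have h3 : Continuous fun p : ℝ × ℝ => phaseCurve p.1 p.2 η := by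
        unfold phaseCurve phasePoly; fun_prop
      have h4 : Continuous fun p : ℝ × ℝ => phaseWeight p.1 p.2 η := by
        unfold phaseWeight
        exact Continuous.rpow_const (by fun_prop) fun _ => Or.inr (by norm_num)
      exact (Complex.continuous_conj.comp (continuous_planeChar.comp
        (continuous_const.prodMk h3))).mul (Complex.continuous_ofReal.comp h4)
    have h5 := (hc.tendsto (α, β)).comp (haα.prodMk_nhds hbβ)
    simp only [extKernel, cutoff, Set.indicator]
    split_ifs
    · exact h5
    · exact tendsto_const_nhds

/-- A weakly null sequence is mapped to a sequence tending to zero in `L²` with Gaussian weight,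
uniformly for convergent parameters: high frequencies are controlled by local smoothing and low
frequencies by weak convergence. -/
lemma tendsto_lintegral_extOp_of_weaklyNull {a b : ℕ → ℝ} {α β : ℝ} (ha : ∀ n, |a n| ≤ 1)
    (hb : ∀ n, |b n| ≤ 1) (haα : Filter.Tendsto a Filter.atTop (nhds α))
    (hbβ : Filter.Tendsto b Filter.atTop (nhds β)) (h : ∀ n, a n ≠ 0 ∨ b n ≠ 0)
    (hs : ∀ n, IsSmoothing (a n) (b n)) {r : ℕ → FreqSpace} (hr : WeaklyNull r)
    {B : ℝ} (hB : ∀ n, ‖r n‖ ≤ B) :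
    Filter.Tendsto (fun n => ∫⁻ z, ‖extOp (a n) (b n) (h n) (r n) z‖ₑ ^ 2 *
      ENNReal.ofReal (gaussWeight 1 z)) Filter.atTop (nhds 0) := by
  have hwt : Measurable fun z => ENNReal.ofReal (gaussWeight 1 z) :=
    (continuous_gaussWeight 1).measurable.ennreal_ofReal
  have hgfin : ∫⁻ z, ENNReal.ofReal (gaussWeight 1 z) ≠ ⊤ := by
    have := (integrable_gaussWeight one_pos).lintegral_lt_top
    exact this.ne
  have hlow : ∀ N : ℕ, Filter.Tendsto (fun n => ∫⁻ z, ‖ext (a n) (b n) (cutoff N (r n)) z‖ₑ ^ 2 *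
      ENNReal.ofReal (gaussWeight 1 z)) Filter.atTop (nhds 0) := by
    intro N
    obtain ⟨C, hC, hCb⟩ : ∃ C : ℝ≥0∞, C ≠ ⊤ ∧
        ∀ n z, ‖ext (a n) (b n) (cutoff N (r n)) z‖ₑ ≤ C := by
      refine ⟨ENNReal.ofReal (((∫⁻ η, ENNReal.ofReal ((cutoff N (fun _ => ((1 + N : ℝ) : ℂ)) η).re)
        ^ 2) ^ (1 / 2 : ℝ)).toReal * B), ENNReal.ofReal_ne_top, fun n z => ?_⟩
      rw [ext_cutoff_eq_inner (ha n) (hb n) N z (r n), ← ofReal_norm]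
      refine ENNReal.ofReal_le_ofReal ((norm_inner_le_norm _ _).trans ?_)
      refine mul_le_mul ?_ (hB n) (norm_nonneg _) ENNReal.toReal_nonneg
      rw [← toReal_enorm]
      refine ENNReal.toReal_mono (ENNReal.rpow_ne_top_of_nonneg (by norm_num)
        (integrable_cutoff_sq N (1 + N))) ?_
      rw [one_div, ENNReal.le_rpow_inv_iff (by norm_num), Lp.enorm_toLp,
        show (2 : ℝ) = ((2 : ℕ) : ℝ) by norm_num, ENNReal.rpow_natCast, eLpNorm_two_sq]
      refine lintegral_mono fun η => ?_
      rw [← ofReal_norm]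
      exact pow_le_pow_left' (ENNReal.ofReal_le_ofReal
        (norm_extKernel_le (ha n) (hb n) N z η)) 2
    have hlim := tendsto_lintegral_of_dominated_convergence (μ := volume)
      (F := fun n z => ‖ext (a n) (b n) (cutoff N (r n)) z‖ₑ ^ 2 *
        ENNReal.ofReal (gaussWeight 1 z)) (f := fun _ => 0)
      (fun z => C ^ 2 * ENNReal.ofReal (gaussWeight 1 z))
      (fun n => (((continuous_oscInt (measurable_phaseCurve (a n) (b n))
        (integrable_weight_mul_cutoff (a n) (b n) (Lp.memLp (r n)) N)).measurable.enorm.pow_const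
          2).mul hwt))
      (fun n => ae_of_all _ fun z => mul_le_mul_left (pow_le_pow_left' (hCb n z) 2) _)
      (by
        rw [lintegral_const_mul' _ _ (ENNReal.pow_ne_top hC)]
        exact ENNReal.mul_ne_top (ENNReal.pow_ne_top hC) hgfin)
      (ae_of_all _ fun z => by
        have h1 := (tendsto_ext_cutoff_of_weaklyNull ha hb haα hbβ hr hB N z)
        have h2 := ((ENNReal.continuous_pow 2).tendsto _).comp h1.enorm
        have h3 := ENNReal.Tendsto.mul_const (b := ENNReal.ofReal (gaussWeight 1 z)) h2
          (Or.inr ENNReal.ofReal_ne_top)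
        simpa [Function.comp_def] using h3)
    simpa using hlim
  have hsplit : ∀ N : ℕ, 1 ≤ N → ∀ n, ∫⁻ z, ‖extOp (a n) (b n) (h n) (r n) z‖ₑ ^ 2 *
      ENNReal.ofReal (gaussWeight 1 z) ≤
      2 * (∫⁻ z, ‖ext (a n) (b n) (cutoff N (r n)) z‖ₑ ^ 2 * ENNReal.ofReal (gaussWeight 1 z)) +
      2 * (smoothingConst * (ENNReal.ofReal (1 / N) * ENNReal.ofReal (2 * B) ^ 2)) := by
    intro N hN n
    have h1 : extOp (a n) (b n) (h n) (r n) =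
        extOp (a n) (b n) (h n) (truncFreq N (r n)) +
        extOp (a n) (b n) (h n) (r n - truncFreq N (r n)) := by
      rw [← map_add, add_sub_cancel]
    have hwc : Integrable fun η => (phaseWeight (a n) (b n) η : ℂ) * truncFreq N (r n) η :=
      (integrable_weight_mul_cutoff (a n) (b n) (Lp.memLp (r n)) N).congr
        ((coeFn_truncFreq N (r n)).mono fun η hη => by simp only [hη])
    have h2 : extOp (a n) (b n) (h n) (truncFreq N (r n)) =ᵐ[volume]
        ext (a n) (b n) (cutoff N (r n)) := by
      rw [← ext_congr_ae (coeFn_truncFreq N (r n))]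
      exact coeFn_extOp (h n) _ hwc
    have h3 : ∫⁻ z, ‖extOp (a n) (b n) (h n) (r n - truncFreq N (r n)) z‖ₑ ^ 2 *
        ENNReal.ofReal (gaussWeight 1 z) ≤
        smoothingConst * (ENNReal.ofReal (1 / N) * ENNReal.ofReal (2 * B) ^ 2) := by
      refine (lintegral_extOp_gaussWeight_le (h n) (hs n) _ (R := N) (by exact_mod_cast hN)
        ?_).trans ?_
      · filter_upwards [Lp.coeFn_sub (r n) (truncFreq N (r n)), coeFn_truncFreq N (r n)]
          with η h4 h5 h6
        rw [h4, Pi.sub_apply, h5, cutoff, Set.indicator_of_mem (by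
          rw [Set.mem_Icc, ← abs_le]; exact h6), sub_self]
      · gcongr
        rw [← ofReal_norm]
        refine ENNReal.ofReal_le_ofReal ((norm_sub_le _ _).trans ?_)
        have h4 : ‖truncFreq N (r n)‖ ≤ ‖r n‖ := by
          refine Lp.norm_le_norm_of_ae_le ?_
          filter_upwards [coeFn_truncFreq N (r n)] with x hx
          rw [hx]
          exact norm_indicator_le_norm_self _ _
        linarith [hB n]
    calc _ ≤ ∫⁻ z, (2 * (‖ext (a n) (b n) (cutoff N (r n)) z‖ₑ ^ 2 *
          ENNReal.ofReal (gaussWeight 1 z)) +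
          2 * (‖extOp (a n) (b n) (h n) (r n - truncFreq N (r n)) z‖ₑ ^ 2 *
          ENNReal.ofReal (gaussWeight 1 z))) := by
          refine lintegral_mono_ae ?_
          rw [h1]
          filter_upwards [Lp.coeFn_add (extOp (a n) (b n) (h n) (truncFreq N (r n)))
            (extOp (a n) (b n) (h n) (r n - truncFreq N (r n))), h2] with z hz hz2
          rw [hz, Pi.add_apply, hz2, ← mul_assoc, ← mul_assoc, ← add_mul, ← mul_add]
          refine mul_le_mul_left ?_ _
          refine (pow_le_pow_left' (enorm_add_le _ _) 2).trans ?_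
          exact ENNReal.add_sq_le_two_mul _ _
      _ = 2 * (∫⁻ z, ‖ext (a n) (b n) (cutoff N (r n)) z‖ₑ ^ 2 *
          ENNReal.ofReal (gaussWeight 1 z)) +
          2 * ∫⁻ z, ‖extOp (a n) (b n) (h n) (r n - truncFreq N (r n)) z‖ₑ ^ 2 *
          ENNReal.ofReal (gaussWeight 1 z) := by
          rw [lintegral_add_left, lintegral_const_mul' _ _ (by simp),
            lintegral_const_mul' _ _ (by simp)]
          exact ((((continuous_oscInt (measurable_phaseCurve (a n) (b n))
            (integrable_weight_mul_cutoff (a n) (b n)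
              (Lp.memLp (r n)) N)).measurable.enorm.pow_const 2).mul hwt).const_mul 2)
      _ ≤ _ := by gcongr
  rw [ENNReal.tendsto_nhds_zero]
  intro ε hε
  have hsm : smoothingConst ≠ ⊤ := ENNReal.ofReal_ne_top
  have htail : Filter.Tendsto (fun N : ℕ => 2 * (smoothingConst *
      (ENNReal.ofReal (1 / N) * ENNReal.ofReal (2 * B) ^ 2))) Filter.atTop (nhds 0) := by
    have h1 : Filter.Tendsto (fun N : ℕ => ENNReal.ofReal (1 / N)) Filter.atTop (nhds 0) := by
      have := ENNReal.tendsto_ofReal (tendsto_const_div_atTop_nhds_zero_nat (1 : ℝ))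
      simpa using this
    have h2 := ENNReal.Tendsto.const_mul (a := 2) (ENNReal.Tendsto.const_mul (a := smoothingConst)
      (ENNReal.Tendsto.mul_const (b := ENNReal.ofReal (2 * B) ^ 2) h1
        (Or.inr (by finiteness))) (Or.inr hsm)) (Or.inr (by simp))
    simpa using h2
  have hε2 : 0 < ε / 2 := ENNReal.half_pos hε.ne'
  obtain ⟨N, hN, hN1⟩ := (((ENNReal.tendsto_nhds_zero.1 htail) (ε / 2) hε2).and
    (Filter.eventually_ge_atTop 1)).exists
  have hlow2 := ENNReal.Tendsto.const_mul (a := 2) (hlow N) (Or.inr (by simp))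
  rw [mul_zero] at hlow2
  filter_upwards [(ENNReal.tendsto_nhds_zero.1 hlow2) (ε / 2) hε2] with n hn
  refine (hsplit N hN1 n).trans ((add_le_add hn hN).trans ?_)
  rw [ENNReal.add_halves]

/-- A subsequence of the image of a weakly null sequence tends to zero almost everywhere. -/
lemma exists_subseq_extOp_tendsto_ae {a b : ℕ → ℝ} {α β : ℝ} (ha : ∀ n, |a n| ≤ 1)
    (hb : ∀ n, |b n| ≤ 1) (haα : Filter.Tendsto a Filter.atTop (nhds α))
    (hbβ : Filter.Tendsto b Filter.atTop (nhds β)) (h : ∀ n, a n ≠ 0 ∨ b n ≠ 0)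
    (hs : ∀ n, IsSmoothing (a n) (b n)) {r : ℕ → FreqSpace} (hr : WeaklyNull r)
    {B : ℝ} (hB : ∀ n, ‖r n‖ ≤ B) :
    ∃ ns : ℕ → ℕ, StrictMono ns ∧ ∀ᵐ z : ℝ × ℝ, Filter.Tendsto
      (fun k => extOp (a (ns k)) (b (ns k)) (h (ns k)) (r (ns k)) z) Filter.atTop (nhds 0) := by
  set ν : Measure (ℝ × ℝ) := volume.withDensity fun z => ENNReal.ofReal (gaussWeight 1 z) with hν
  have hwt : Measurable fun z => ENNReal.ofReal (gaussWeight 1 z) :=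
    (continuous_gaussWeight 1).measurable.ennreal_ofReal
  have hac : (volume : Measure (ℝ × ℝ)) ≪ ν :=
    withDensity_absolutelyContinuous' hwt.aemeasurable
      (ae_of_all _ fun z => (ENNReal.ofReal_pos.2 (gaussWeight_pos 1 z)).ne')
  have hac' : ν ≪ (volume : Measure (ℝ × ℝ)) := withDensity_absolutelyContinuous _ _
  have hlim : Filter.Tendsto (fun n => eLpNorm (fun z => extOp (a n) (b n) (h n) (r n) z - 0) 2 ν)
      Filter.atTop (nhds 0) := by
    refine ENNReal.tendsto_zero_of_tendsto_pow (k := 2) (by norm_num) ?_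
    refine (tendsto_lintegral_extOp_of_weaklyNull ha hb haα hbβ h hs hr hB).congr fun n => ?_
    rw [eLpNorm_two_sq, hν, lintegral_withDensity_eq_lintegral_mul₀ hwt.aemeasurable
      (by simpa using (Lp.aestronglyMeasurable _).enorm.pow_const 2)]
    refine lintegral_congr fun z => ?_
    simp only [Pi.mul_apply, sub_zero]
    rw [mul_comm]
  have hm := tendstoInMeasure_of_tendsto_eLpNorm (μ := ν) (p := 2) (by norm_num)
    (f := fun n z => extOp (a n) (b n) (h n) (r n) z) (g := fun _ => 0)
    (fun n => (Lp.aestronglyMeasurable _).mono_ac hac') aestronglyMeasurable_const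
    (by simpa [Pi.sub_def] using hlim)
  obtain ⟨ns, hns, hae⟩ := hm.exists_seq_tendsto_ae
  exact ⟨ns, hns, hac.ae_le hae⟩

/-! ### Stationary phase bounds and convergence to the Schrödinger operator -/

section StationaryPhase

variable {φ φ' φ'' : ℝ → ℝ} {h : ℝ → ℂ}

/-- Integration by parts against the multiplier `φ' / (φ'² + s)`, a regularization of `1 / φ'`. -/
lemma norm_integral_exp_mul_le (hφ : ∀ x, HasDerivAt φ (φ' x) x)
    (hφ' : ∀ x, HasDerivAt φ' (φ'' x) x) (hcont : Continuous φ'') (hh : ContDiff ℝ ∞ h)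
    (hc : HasCompactSupport h) {s : ℝ} (hs : 0 < s) :
    ‖∫ x, Complex.exp ((φ x : ℝ) * Complex.I) * h x‖ ≤
      ∫ x, (‖deriv h x‖ * (|φ' x| / (φ' x ^ 2 + s)) +
        ‖h x‖ * ((|φ'' x| + s) / (φ' x ^ 2 + s))) := by
  have hD : ∀ x, 0 < φ' x ^ 2 + s := fun x => by positivity
  have cφ : Continuous φ := continuous_iff_continuousAt.2 fun x => (hφ x).continuousAt
  have cφ' : Continuous φ' := continuous_iff_continuousAt.2 fun x => (hφ' x).continuousAt
  have ch : Continuous h := hh.continuous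
  have cdh : Continuous (deriv h) := hh.continuous_deriv (by simp)
  have hcd : HasCompactSupport (deriv h) := hc.deriv
  set E : ℝ → ℂ := fun x => Complex.exp ((φ x : ℝ) * Complex.I) with hE
  have cE : Continuous E := by
    simp only [hE]; fun_prop
  set m : ℝ → ℝ := fun x => φ' x / (φ' x ^ 2 + s) with hm
  set m' : ℝ → ℝ := fun x => φ'' x * (s - φ' x ^ 2) / (φ' x ^ 2 + s) ^ 2 with hm'
  have hmd : ∀ x, HasDerivAt m (m' x) x := by
    intro x
    have h1 := (hφ' x).div (((hφ' x).pow 2).add_const s) (hD x).ne'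
    refine h1.congr_deriv ?_
    simp only [hm', Pi.pow_apply]
    push_cast
    congr 1
    ring
  have cm : Continuous m := continuous_iff_continuousAt.2 fun x => (hmd x).continuousAt
  have cm' : Continuous m' := by
    simp only [hm']
    exact (hcont.mul (continuous_const.sub (cφ'.pow 2))).div₀ (((cφ'.pow 2).add continuous_const).pow 2)
      fun x => (pow_pos (hD x) 2).ne'
  have hEd : ∀ x, HasDerivAt E (E x * ((φ' x : ℂ) * Complex.I)) x := by
    intro x
    exact ((hφ x).ofReal_comp.mul_const Complex.I).cexp
  set F : ℝ → ℂ := fun x => E x * ((m x : ℂ) * h x) with hF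
  set F' : ℝ → ℂ := fun x => E x * ((φ' x : ℂ) * Complex.I) * ((m x : ℂ) * h x) +
    E x * ((m' x : ℂ) * h x + (m x : ℂ) * deriv h x) with hF'
  have hFd : ∀ x, HasDerivAt F (F' x) x := fun x =>
    (hEd x).mul ((hmd x).ofReal_comp.mul (hh.differentiable (by simp) x).hasDerivAt)
  have iF : Integrable F := by
    refine Continuous.integrable_of_hasCompactSupport (by fun_prop) ?_
    exact (hc.mul_left).mul_left
  have iF' : Integrable F' := by
    refine Continuous.integrable_of_hasCompactSupport (by fun_prop) ?_
    exact ((hc.mul_left).mul_left).add ((hc.mul_left.add hcd.mul_left).mul_left)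
  have iEh : Integrable fun x => Complex.I * (E x * h x) :=
    Continuous.integrable_of_hasCompactSupport (by fun_prop) (hc.mul_left.mul_left)
  have h0 : ∫ x, F' x = 0 := integral_eq_zero_of_hasDerivAt_of_integrable hFd iF' iF
  have e1 : ‖∫ x, E x * h x‖ = ‖∫ x, (Complex.I * (E x * h x) - F' x)‖ := by
    rw [integral_sub iEh iF', h0, sub_zero, integral_const_mul, norm_mul, Complex.norm_I, one_mul]
  rw [e1]
  have cR : Continuous fun x => ‖deriv h x‖ * (|φ' x| / (φ' x ^ 2 + s)) +
        ‖h x‖ * ((|φ'' x| + s) / (φ' x ^ 2 + s)) := by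
    have c1 : Continuous fun x => φ' x ^ 2 + s := by fun_prop
    exact (cdh.norm.mul (cφ'.abs.div₀ c1 fun x => (hD x).ne')).add
      (ch.norm.mul ((hcont.abs.add continuous_const).div₀ c1 fun x => (hD x).ne'))
  refine norm_integral_le_of_norm_le (cR.integrable_of_hasCompactSupport
    ((hcd.norm.mul_right).add (hc.norm.mul_right))) (ae_of_all _ fun x => ?_)
  have hnE : ‖E x‖ = 1 := Complex.norm_exp_ofReal_mul_I _
  have e2 : Complex.I * (E x * h x) - F' x =
      E x * ((Complex.I * ((s / (φ' x ^ 2 + s) : ℝ) : ℂ) - (m' x : ℂ)) * h x -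
        (m x : ℂ) * deriv h x) := by
    have h3 : ((φ' x * m x : ℝ) : ℂ) = 1 - ((s / (φ' x ^ 2 + s) : ℝ) : ℂ) := by
      rw [← Complex.ofReal_one, ← Complex.ofReal_sub]
      congr 1
      have := (hD x).ne'
      simp only [hm]
      field_simp
      ring
    rw [Complex.ofReal_mul] at h3
    simp only [hF']
    linear_combination (-(E x * Complex.I * h x)) * h3
  rw [e2, norm_mul, hnE, one_mul]
  have hm1 : |m' x| ≤ |φ'' x| / (φ' x ^ 2 + s) := by
    simp only [hm']
    rw [abs_div, abs_mul, abs_of_pos (pow_pos (hD x) 2), div_le_div_iff₀ (pow_pos (hD x) 2) (hD x)]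
    have : |s - φ' x ^ 2| ≤ φ' x ^ 2 + s := abs_le.2 ⟨by linarith [sq_nonneg (φ' x)], by
      linarith [sq_nonneg (φ' x)]⟩
    calc |φ'' x| * |s - φ' x ^ 2| * (φ' x ^ 2 + s) ≤
        |φ'' x| * (φ' x ^ 2 + s) * (φ' x ^ 2 + s) := by gcongr
      _ = _ := by ring
  calc _ ≤ ‖(Complex.I * ((s / (φ' x ^ 2 + s) : ℝ) : ℂ) - (m' x : ℂ)) * h x‖ +
        ‖(m x : ℂ) * deriv h x‖ := norm_sub_le _ _
    _ ≤ (s / (φ' x ^ 2 + s) + |φ'' x| / (φ' x ^ 2 + s)) * ‖h x‖ +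
        |φ' x| / (φ' x ^ 2 + s) * ‖deriv h x‖ := by
        rw [norm_mul, norm_mul]
        refine add_le_add (mul_le_mul_of_nonneg_right ?_ (norm_nonneg _))
          (mul_le_mul_of_nonneg_right ?_ (norm_nonneg _))
        · refine (norm_sub_le _ _).trans (add_le_add ?_ ?_)
          · rw [norm_mul, Complex.norm_I, one_mul, Complex.norm_real,
              Real.norm_of_nonneg (div_pos hs (hD x)).le]
          · rw [Complex.norm_real, Real.norm_eq_abs]; exact hm1
        · simp only [hm]
          rw [Complex.norm_real, Real.norm_eq_abs, abs_div, abs_of_pos (hD x)]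
    _ = _ := by ring

/-- Van der Corput's second derivative bound. -/
lemma norm_integral_exp_mul_le_of_deriv2 (hφ : ∀ x, HasDerivAt φ (φ' x) x)
    (hφ' : ∀ x, HasDerivAt φ' (φ'' x) x) (hcont : Continuous φ'') (hh : ContDiff ℝ ∞ h)
    (hc : HasCompactSupport h) {R H : ℝ} (hR : 0 ≤ R) (hsupp : ∀ x, R < |x| → h x = 0)
    (hH : ∀ x, ‖h x‖ ≤ H) {s σ : ℝ} (hs : 0 < s) (hσ : |σ| = 1)
    (hlow : ∀ x, |x| ≤ R → s ≤ σ * φ'' x) :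
    ‖∫ x, Complex.exp ((φ x : ℝ) * Complex.I) * h x‖ ≤
      ((∫ x, ‖deriv h x‖) + 2 * Real.pi * H) / Real.sqrt s := by
  have hD : ∀ x, 0 < φ' x ^ 2 + s := fun x => by positivity
  have cφ' : Continuous φ' := continuous_iff_continuousAt.2 fun x => (hφ' x).continuousAt
  have hsq : 0 < Real.sqrt s := Real.sqrt_pos.2 hs
  have hss : Real.sqrt s * Real.sqrt s = s := Real.mul_self_sqrt hs.le
  have cdh : Continuous (deriv h) := hh.continuous_deriv (by simp)
  have c1 : Continuous fun x => φ' x ^ 2 + s := by fun_prop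
  have cq : Continuous fun x => φ'' x / (φ' x ^ 2 + s) := hcont.div₀ c1 fun x => (hD x).ne'
  have hH0 : 0 ≤ H := (norm_nonneg _).trans (hH 0)
  have hG : ∀ x, HasDerivAt (fun x => Real.arctan (φ' x / Real.sqrt s) / Real.sqrt s)
      (φ'' x / (φ' x ^ 2 + s)) x := by
    intro x
    refine ((((hφ' x).div_const (Real.sqrt s)).arctan).div_const (Real.sqrt s)).congr_deriv ?_
    have h1 : (1 : ℝ) + (φ' x / Real.sqrt s) ^ 2 = (φ' x ^ 2 + s) / s := by
      rw [div_pow, Real.sq_sqrt hs.le]; field_simp; ring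
    rw [h1]
    have := (hD x).ne'
    field_simp
    rw [Real.sq_sqrt hs.le, mul_comm]
  have hFTC := intervalIntegral.integral_eq_sub_of_hasDerivAt (a := -R) (b := R)
    (fun x _ => hG x) (cq.intervalIntegrable _ _)
  have hbd : σ * ∫ x in (-R)..R, φ'' x / (φ' x ^ 2 + s) ≤ Real.pi / Real.sqrt s := by
    refine (le_abs_self _).trans ?_
    rw [abs_mul, hσ, one_mul, hFTC, ← sub_div, abs_div, abs_of_pos hsq]
    gcongr
    rw [abs_le]
    have a1 := Real.arctan_lt_pi_div_two (φ' R / Real.sqrt s)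
    have a2 := Real.neg_pi_div_two_lt_arctan (φ' R / Real.sqrt s)
    have a3 := Real.arctan_lt_pi_div_two (φ' (-R) / Real.sqrt s)
    have a4 := Real.neg_pi_div_two_lt_arctan (φ' (-R) / Real.sqrt s)
    constructor <;> linarith
  refine (norm_integral_exp_mul_le hφ hφ' hcont hh hc hs).trans ?_
  have i1 : Integrable fun x => ‖deriv h x‖ := (cdh.integrable_of_hasCompactSupport hc.deriv).norm
  have i2 : Integrable ((Set.Ioc (-R) R).indicator
      fun x => 2 * H * σ * (φ'' x / (φ' x ^ 2 + s))) :=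
    (((cq.const_mul _).integrableOn_Ioc)).integrable_indicator measurableSet_Ioc
  calc _ ≤ ∫ x, (‖deriv h x‖ * (1 / Real.sqrt s) + (Set.Ioc (-R) R).indicator
      (fun x => 2 * H * σ * (φ'' x / (φ' x ^ 2 + s))) x) := by
        refine integral_mono_of_nonneg (ae_of_all _ fun x => ?_) ((i1.mul_const _).add i2) ?_
        · have := hD x
          have := hs.le
          simp only [Pi.zero_apply]
          positivity
        have hne : ∀ᵐ x : ℝ, x ≠ -R := by simp [ae_iff]
        filter_upwards [hne] with x hx
        refine add_le_add ?_ ?_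
        · refine mul_le_mul_of_nonneg_left ?_ (norm_nonneg _)
          rw [div_le_div_iff₀ (hD x) hsq]
          nlinarith [sq_nonneg (|φ' x| - Real.sqrt s), sq_abs (φ' x), Real.sq_sqrt hs.le,
            mul_nonneg (abs_nonneg (φ' x)) hsq.le]
        · rcases le_or_gt |x| R with hxR | hxR
          · have hmem : x ∈ Set.Ioc (-R) R :=
              ⟨lt_of_le_of_ne (abs_le.1 hxR).1 (Ne.symm hx), (abs_le.1 hxR).2⟩
            rw [Set.indicator_of_mem hmem]
            have h2 := hlow x hxR
            have h3 : |φ'' x| = σ * φ'' x := by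
              rw [← abs_of_pos (lt_of_lt_of_le hs h2), abs_mul, hσ, one_mul]
            calc ‖h x‖ * ((|φ'' x| + s) / (φ' x ^ 2 + s)) ≤
                H * ((σ * φ'' x + σ * φ'' x) / (φ' x ^ 2 + s)) := by
                  rw [h3]
                  have h4 := hD x
                  refine mul_le_mul (hH x) ?_ (div_nonneg (by linarith) h4.le) hH0
                  gcongr
              _ = _ := by ring
          · rw [hsupp x hxR, norm_zero, zero_mul, Set.indicator_of_notMem]
            intro hmem
            exact absurd (abs_le.2 ⟨hmem.1.le, hmem.2⟩) (not_le.2 hxR)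
    _ = (∫ x, ‖deriv h x‖) * (1 / Real.sqrt s) +
        2 * H * (σ * ∫ x in (-R)..R, φ'' x / (φ' x ^ 2 + s)) := by
        rw [integral_add (i1.mul_const _) i2, integral_mul_const, integral_indicator
          measurableSet_Ioc, integral_const_mul, intervalIntegral.integral_of_le (by linarith)]
        ring
    _ ≤ (∫ x, ‖deriv h x‖) * (1 / Real.sqrt s) + 2 * H * (Real.pi / Real.sqrt s) := by
        gcongr
    _ = _ := by ring

/-- Non-stationary phase bound. -/
lemma norm_integral_exp_mul_le_of_deriv (hφ : ∀ x, HasDerivAt φ (φ' x) x)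
    (hφ' : ∀ x, HasDerivAt φ' (φ'' x) x) (hcont : Continuous φ'') (hh : ContDiff ℝ ∞ h)
    (hc : HasCompactSupport h) {R : ℝ} (hsupp : ∀ x, R < |x| → h x = 0) {s : ℝ} (hs : 0 < s)
    (hlow : ∀ x, |x| ≤ R → s ≤ |φ' x|) (hup : ∀ x, |x| ≤ R → |φ'' x| ≤ 2 * s) :
    ‖∫ x, Complex.exp ((φ x : ℝ) * Complex.I) * h x‖ ≤
      ((∫ x, ‖deriv h x‖) + 3 * ∫ x, ‖h x‖) / s := by
  have hD : ∀ x, 0 < φ' x ^ 2 + s := fun x => by positivity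
  have cdh : Continuous (deriv h) := hh.continuous_deriv (by simp)
  have i1 : Integrable fun x => ‖deriv h x‖ := (cdh.integrable_of_hasCompactSupport hc.deriv).norm
  have i2 : Integrable fun x => ‖h x‖ := (hh.continuous.integrable_of_hasCompactSupport hc).norm
  have hdsupp : ∀ x, R < |x| → deriv h x = 0 := by
    intro x hx
    have : h =ᶠ[nhds x] fun _ => 0 := by
      filter_upwards [(isOpen_lt continuous_const continuous_abs).mem_nhds hx] with y hy
      exact hsupp y hy
    rw [this.deriv_eq, deriv_const]
  refine (norm_integral_exp_mul_le hφ hφ' hcont hh hc hs).trans ?_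
  calc _ ≤ ∫ x, (‖deriv h x‖ * (1 / s) + ‖h x‖ * (3 / s)) := by
        refine integral_mono_of_nonneg (ae_of_all _ fun x => ?_)
          ((i1.mul_const _).add (i2.mul_const _)) (ae_of_all _ fun x => ?_)
        · have := hD x
          have := hs.le
          simp only [Pi.zero_apply]
          positivity
        rcases le_or_gt |x| R with hx | hx
        · have h1 := hlow x hx
          have h2 := hup x hx
          have h3 : s ^ 2 ≤ φ' x ^ 2 := by rw [← sq_abs (φ' x)]; gcongr
          refine add_le_add (mul_le_mul_of_nonneg_left ?_ (norm_nonneg _))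
            (mul_le_mul_of_nonneg_left ?_ (norm_nonneg _))
          · rw [div_le_div_iff₀ (hD x) hs]
            nlinarith [sq_abs (φ' x)]
          · rw [div_le_div_iff₀ (hD x) hs]
            nlinarith
        · simp [hsupp x hx, hdsupp x hx]
    _ = _ := by
        rw [integral_add (i1.mul_const _) (i2.mul_const _), integral_mul_const, integral_mul_const]
        ring

end StationaryPhase

/-- The pointwise bound that dominates the extension integrals of a fixed test amplitude, uniformly
in the parameter. -/
lemma norm_oscInt_phaseCurve_le {h : ℝ → ℂ} (hh : ContDiff ℝ ∞ h) (hc : HasCompactSupport h)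
    {R H : ℝ} (hR : 1 ≤ R) (hsupp : ∀ x, R < |x| → h x = 0) (hH : ∀ x, ‖h x‖ ≤ H) {ε : ℝ}
    (hε : |ε| * R ≤ 1 / 4) (z : ℝ × ℝ) :
    (1 + |z.2|) * (1 + |z.1|) * ‖oscInt volume (phaseCurve 1 ε) h z‖ ^ 4 ≤
      100 * R * ((∫ x, ‖deriv h x‖) + 3 * (∫ x, ‖h x‖) + 7 * H) ^ 4 := by
  obtain ⟨x, t⟩ := z
  set D := (∫ x, ‖deriv h x‖) + 3 * (∫ x, ‖h x‖) + 7 * H with hDdef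
  have hH0 : 0 ≤ H := (norm_nonneg _).trans (hH 0)
  have hI1 : 0 ≤ ∫ x, ‖deriv h x‖ := integral_nonneg fun _ => norm_nonneg _
  have hI2 : 0 ≤ ∫ x, ‖h x‖ := integral_nonneg fun _ => norm_nonneg _
  have hD0 : 0 ≤ D := by positivity
  have e : oscInt volume (phaseCurve 1 ε) h (x, t) =
      ∫ η, Complex.exp (((x * η + t * phasePoly 1 ε η : ℝ) : ℂ) * Complex.I) * h η := rfl
  have d1 : ∀ η, HasDerivAt (fun η => x * η + t * phasePoly 1 ε η) (x + t * phaseDeriv 1 ε η) η := by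
    intro η
    have := ((hasDerivAt_id η).const_mul x).add ((hasDerivAt_phaseDeriv 1 ε η).const_mul t)
    exact this.congr_deriv (by rw [mul_one])
  have d2 : ∀ η, HasDerivAt (fun η => x + t * phaseDeriv 1 ε η) (t * (12 * (1 + ε * η) ^ 2)) η := by
    intro η
    have h0 : HasDerivAt (phaseDeriv 1 ε) (12 * (1 + ε * η) ^ 2) η := by
      have h1 : phaseDeriv 1 ε = fun η => 12 * η + 12 * ε * η ^ 2 + 4 * ε ^ 2 * η ^ 3 := by
        funext y; unfold phaseDeriv; ring
      rw [h1]
      have := (((hasDerivAt_id η).const_mul 12).add ((hasDerivAt_pow 2 η).const_mul (12 * ε))).add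
        ((hasDerivAt_pow 3 η).const_mul (4 * ε ^ 2))
      refine this.congr_deriv ?_
      push_cast; ring
    exact (h0.const_mul t).const_add x
  have hcont : Continuous fun η : ℝ => t * (12 * (1 + ε * η) ^ 2) := by fun_prop
  have hεη : ∀ η, |η| ≤ R → |ε * η| ≤ 1 / 4 := fun η hη => by
    rw [abs_mul]
    exact (mul_le_mul_of_nonneg_left hη (abs_nonneg _)).trans hε
  have hP2 : ∀ η, |η| ≤ R → 6 ≤ 12 * (1 + ε * η) ^ 2 ∧ 12 * (1 + ε * η) ^ 2 ≤ 19 := by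
    intro η hη
    have := abs_le.1 (hεη η hη)
    constructor <;> nlinarith
  have hP1 : ∀ η, |η| ≤ R → |phaseDeriv 1 ε η| ≤ 16 * R := by
    intro η hη
    have := abs_le.1 (hεη η hη)
    rw [phaseDeriv, abs_mul, abs_mul]
    have h1 : |3 * (1 : ℝ) ^ 2 + 3 * 1 * ε * η + ε ^ 2 * η ^ 2| ≤ 4 := by
      rw [abs_le]; constructor <;> nlinarith
    calc |(4 : ℝ)| * |η| * _ ≤ |(4 : ℝ)| * R * 4 := by gcongr
      _ = 16 * R := by rw [abs_of_pos (by norm_num : (0 : ℝ) < 4)]; ring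
  have hA : ‖oscInt volume (phaseCurve 1 ε) h (x, t)‖ ≤ D := by
    refine (norm_oscInt_le _).trans ?_
    rw [hDdef]; nlinarith
  have ht0 := abs_nonneg t
  have hx0 := abs_nonneg x
  simp only
  set U := ‖oscInt volume (phaseCurve 1 ε) h (x, t)‖ with hU
  have hU0 : 0 ≤ U := norm_nonneg _
  rcases le_or_gt |x| (32 * R * |t|) with hxt | hxt
  · rcases le_or_gt |t| 1 with ht | ht
    · calc (1 + |t|) * (1 + |x|) * U ^ 4 ≤ (1 + 1) * (1 + 32 * R) * D ^ 4 := by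
            gcongr
            nlinarith
        _ ≤ 100 * R * D ^ 4 := by
            refine mul_le_mul_of_nonneg_right ?_ (by positivity)
            linarith
    · have hs : 0 < |t| := by linarith
      have hU2 : U ≤ D / Real.sqrt |t| := by
        obtain ⟨σ, hσ, hσt⟩ : ∃ σ : ℝ, |σ| = 1 ∧ σ * t = |t| := by
          rcases le_total 0 t with h0 | h0
          · exact ⟨1, abs_one, by rw [one_mul, abs_of_nonneg h0]⟩
          · exact ⟨-1, by simp, by rw [abs_of_nonpos h0]; ring⟩
        rw [hU, e]
        refine (norm_integral_exp_mul_le_of_deriv2 d1 d2 hcont hh hc (by linarith) hsupp hH hs hσ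
          fun η hη => ?_).trans ?_
        · rw [← mul_assoc, hσt]
          nlinarith [(hP2 η hη).1]
        · gcongr
          rw [hDdef]
          nlinarith [Real.pi_lt_d2]
      have hU4 : U ^ 4 ≤ D ^ 4 / |t| ^ 2 := by
        calc U ^ 4 ≤ (D / Real.sqrt |t|) ^ 4 := by gcongr
          _ = D ^ 4 / (Real.sqrt |t| ^ 2) ^ 2 := by ring
          _ = _ := by rw [Real.sq_sqrt hs.le]
      calc (1 + |t|) * (1 + |x|) * U ^ 4 ≤ (2 * |t|) * (33 * R * |t|) * (D ^ 4 / |t| ^ 2) := by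
            gcongr
            · linarith
            · nlinarith
        _ = 66 * R * D ^ 4 := by field_simp; ring
        _ ≤ 100 * R * D ^ 4 := by gcongr; norm_num
  · rcases le_or_gt |x| 1 with hx | hx
    · have ht : |t| ≤ 1 := by nlinarith
      calc (1 + |t|) * (1 + |x|) * U ^ 4 ≤ (1 + 1) * (1 + 1) * D ^ 4 := by gcongr
        _ ≤ 100 * R * D ^ 4 := by
            refine mul_le_mul_of_nonneg_right ?_ (by positivity)
            linarith
    · have hs : 0 < |x| / 2 := by linarith
      have hU2 : U ≤ D / (|x| / 2) := by
        rw [hU, e]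
        refine (norm_integral_exp_mul_le_of_deriv d1 d2 hcont hh hc hsupp hs
          (fun η hη => ?_) fun η hη => ?_).trans ?_
        · have h1 := abs_sub_abs_le_abs_sub x (-(t * phaseDeriv 1 ε η))
          rw [abs_neg, sub_neg_eq_add, abs_mul] at h1
          have h2 := mul_le_mul_of_nonneg_left (hP1 η hη) ht0
          linarith
        · rw [abs_mul, abs_of_nonneg (by positivity : (0 : ℝ) ≤ 12 * (1 + ε * η) ^ 2)]
          have h2 := mul_le_mul_of_nonneg_left (hP2 η hη).2 ht0
          nlinarith
        · gcongr
          rw [hDdef]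
          linarith
      have ht : |t| ≤ |x| := by nlinarith
      calc (1 + |t|) * (1 + |x|) * U ^ 4 ≤ (2 * |x|) * (2 * |x|) * (D / (|x| / 2)) ^ 4 := by
            gcongr <;> linarith
        _ = 64 * D ^ 4 / |x| ^ 2 := by field_simp; ring
        _ ≤ 64 * D ^ 4 / 1 := by gcongr; nlinarith
        _ ≤ 100 * R * D ^ 4 := by rw [div_one]; gcongr; linarith

lemma phaseWeight_one_bounds {R ε η : ℝ} (hε : |ε| * R ≤ 1 / 4) (hη : |η| ≤ R) :
    1 / 2 ≤ phaseWeight 1 ε η := by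
  have h1 : |ε * η| ≤ 1 / 4 := by
    rw [abs_mul]
    exact (mul_le_mul_of_nonneg_left hη (abs_nonneg _)).trans hε
  have h2 := abs_le.1 h1
  have h3 : 3 / 4 ≤ |1 + ε * η| := (by linarith [h2.1] : (3 : ℝ) / 4 ≤ 1 + ε * η).trans (le_abs_self _)
  calc (1 : ℝ) / 2 ≤ (3 / 4 : ℝ) ^ (1 : ℝ) := by norm_num
    _ ≤ (3 / 4 : ℝ) ^ (1 / 3 : ℝ) :=
      Real.rpow_le_rpow_of_exponent_ge (by norm_num) (by norm_num) (by norm_num)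
    _ ≤ _ := Real.rpow_le_rpow (by norm_num) h3 (by norm_num)

lemma norm_div_phaseWeight_le {h : ℝ → ℂ} {R ε : ℝ} (hsupp : ∀ x, R < |x| → h x = 0)
    (hε : |ε| * R ≤ 1 / 4) (η : ℝ) : ‖h η / (phaseWeight 1 ε η : ℂ)‖ ≤ 2 * ‖h η‖ := by
  rcases le_or_gt |η| R with hη | hη
  · have h1 := phaseWeight_one_bounds hε hη
    rw [norm_div, Complex.norm_real, Real.norm_of_nonneg (phaseWeight_nonneg _ _ _),
      div_le_iff₀ (by linarith)]
    nlinarith [norm_nonneg (h η)]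
  · simp [hsupp η hη]

lemma memLp_div_phaseWeight {h : ℝ → ℂ} (hh : Continuous h) (hc : HasCompactSupport h) {R ε : ℝ}
    (hsupp : ∀ x, R < |x| → h x = 0) (hε : |ε| * R ≤ 1 / 4) :
    MemLp (fun η => h η / (phaseWeight 1 ε η : ℂ)) 2 := by
  have h2 : MemLp h 2 := hh.memLp_of_hasCompactSupport hc
  refine h2.of_le_mul (c := 2) ?_ (ae_of_all _ fun η => norm_div_phaseWeight_le hsupp hε η)
  have := (continuous_phaseWeight 1 ε).measurable
  exact (hh.measurable.div (Complex.measurable_ofReal.comp this)).aestronglyMeasurable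

lemma phaseWeight_mul_div {h : ℝ → ℂ} {R ε : ℝ} (hsupp : ∀ x, R < |x| → h x = 0)
    (hε : |ε| * R ≤ 1 / 4) (η : ℝ) :
    (phaseWeight 1 ε η : ℂ) * (h η / (phaseWeight 1 ε η : ℂ)) = h η := by
  rcases le_or_gt |η| R with hη | hη
  · have h1 := phaseWeight_one_bounds hε hη
    have h2 : (phaseWeight 1 ε η : ℂ) ≠ 0 := by
      have : phaseWeight 1 ε η ≠ 0 := by linarith
      exact_mod_cast this
    field_simp
  · simp [hsupp η hη]

lemma coeFn_extOp_div_phaseWeight {h : ℝ → ℂ} (hh : Continuous h) (hc : HasCompactSupport h)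
    {R ε : ℝ} (hsupp : ∀ x, R < |x| → h x = 0) (hε : |ε| * R ≤ 1 / 4) :
    extOp 1 ε (Or.inl one_ne_zero) (memLp_div_phaseWeight hh hc hsupp hε).toLp =ᵐ[volume]
      oscInt volume (phaseCurve 1 ε) h := by
  have e1 := (memLp_div_phaseWeight hh hc hsupp hε).coeFn_toLp
  have e2 : (fun η => (phaseWeight 1 ε η : ℂ) * (memLp_div_phaseWeight hh hc hsupp hε).toLp _ η)
      =ᵐ[volume] h := by
    filter_upwards [e1] with η hη
    rw [hη, phaseWeight_mul_div hsupp hε]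
  refine (coeFn_extOp _ _ ((hh.integrable_of_hasCompactSupport hc).congr e2.symm)).trans ?_
  rw [ext, oscInt_congr_ae e2]

lemma lintegral_dominating_ne_top (C : ℝ≥0∞) (hC : C ≠ ⊤) :
    ∫⁻ z : ℝ × ℝ, C * (ENNReal.ofReal ((1 + ‖z.1‖) ^ (-(3 / 2) : ℝ)) *
      ENNReal.ofReal ((1 + ‖z.2‖) ^ (-(3 / 2) : ℝ))) ≠ ⊤ := by
  have hi : Integrable fun x : ℝ => (1 + ‖x‖) ^ (-(3 / 2) : ℝ) :=
    integrable_one_add_norm (by norm_num)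
  have h1 := (hi.mul_prod hi).lintegral_lt_top
  rw [lintegral_const_mul' _ _ hC]
  refine ENNReal.mul_ne_top hC ?_
  refine ne_of_eq_of_ne (lintegral_congr fun z => ?_) h1.ne
  rw [ENNReal.ofReal_mul (by positivity)]

/-- The extension integrals of a fixed test amplitude converge in `L⁶` as the parameter tends to
zero. -/
lemma tendsto_extOp_div_phaseWeight {h : ℝ → ℂ} (hh : ContDiff ℝ ∞ h) (hc : HasCompactSupport h)
    {R : ℝ} (hR : 1 ≤ R) (hsupp : ∀ x, R < |x| → h x = 0) {ε : ℕ → ℝ}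
    (hεR : ∀ n, |ε n| * R ≤ 1 / 4) (h0R : |(0 : ℝ)| * R ≤ 1 / 4)
    (hε : Filter.Tendsto ε Filter.atTop (nhds 0)) :
    Filter.Tendsto (fun n => extOp 1 (ε n) (Or.inl one_ne_zero)
      (memLp_div_phaseWeight hh.continuous hc hsupp (hεR n)).toLp) Filter.atTop
      (nhds (extOp 1 0 (Or.inl one_ne_zero)
        (memLp_div_phaseWeight hh.continuous hc hsupp h0R).toLp)) := by
  obtain ⟨H, hH⟩ : ∃ H, ∀ x, ‖h x‖ ≤ H := hc.exists_bound_of_continuous hh.continuous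
  set K : ℝ := 100 * R * ((∫ x, ‖deriv h x‖) + 3 * (∫ x, ‖h x‖) + 7 * H) ^ 4 with hK
  have hK0 : 0 ≤ K := by positivity
  clear_value K
  have hptw : ∀ e, |e| * R ≤ 1 / 4 → ∀ z : ℝ × ℝ, ‖oscInt volume (phaseCurve 1 e) h z‖ₑ ^ 6 ≤
      ENNReal.ofReal (K ^ (3 / 2 : ℝ)) * (ENNReal.ofReal ((1 + ‖z.1‖) ^ (-(3 / 2) : ℝ)) *
      ENNReal.ofReal ((1 + ‖z.2‖) ^ (-(3 / 2) : ℝ))) := by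
    intro e he z
    have h1 := norm_oscInt_phaseCurve_le hh hc hR hsupp hH he z
    rw [← hK] at h1
    set U := ‖oscInt volume (phaseCurve 1 e) h z‖ with hU
    have hU0 : 0 ≤ U := norm_nonneg _
    have p1 : 0 < 1 + ‖z.1‖ := by positivity
    have p2 : 0 < 1 + ‖z.2‖ := by positivity
    have h2 : U ^ 4 ≤ K * ((1 + ‖z.1‖)⁻¹ * (1 + ‖z.2‖)⁻¹) := by
      rw [← mul_inv, ← div_eq_mul_inv, le_div_iff₀ (by positivity)]
      rw [Real.norm_eq_abs, Real.norm_eq_abs]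
      linarith
    rw [← ofReal_norm, ← hU, ← ENNReal.ofReal_pow hU0, ← ENNReal.ofReal_mul (by positivity),
      ← ENNReal.ofReal_mul (by positivity)]
    refine ENNReal.ofReal_le_ofReal ?_
    have h3 := Real.rpow_le_rpow (by positivity) h2 (by norm_num : (0 : ℝ) ≤ 3 / 2)
    rw [← Real.rpow_natCast, ← Real.rpow_mul hU0, Real.mul_rpow hK0 (by positivity),
      Real.mul_rpow (by positivity) (by positivity), Real.inv_rpow p1.le, Real.inv_rpow p2.le,
      ← Real.rpow_neg p1.le, ← Real.rpow_neg p2.le] at h3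
    norm_num at h3 ⊢
    exact_mod_cast h3
  refine tendsto_Lp_of_dominated (k := 6) (by norm_num) eLpNorm_six_pow
    (fun z => (2 ^ 6 * ENNReal.ofReal (K ^ (3 / 2 : ℝ))) *
      (ENNReal.ofReal ((1 + ‖z.1‖) ^ (-(3 / 2) : ℝ)) *
      ENNReal.ofReal ((1 + ‖z.2‖) ^ (-(3 / 2) : ℝ))))
    (lintegral_dominating_ne_top _ (by finiteness)) (fun n => ?_) ?_
  · filter_upwards [coeFn_extOp_div_phaseWeight hh.continuous hc hsupp (hεR n),
      coeFn_extOp_div_phaseWeight hh.continuous hc hsupp h0R] with z h1 h2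
    rw [h1, h2, mul_assoc]
    set B := ENNReal.ofReal (K ^ (3 / 2 : ℝ)) * (ENNReal.ofReal ((1 + ‖z.1‖) ^ (-(3 / 2) : ℝ)) *
      ENNReal.ofReal ((1 + ‖z.2‖) ^ (-(3 / 2) : ℝ))) with hB
    have h3 := hptw _ (hεR n) z
    have h4 := hptw _ h0R z
    have h5 : ‖oscInt volume (phaseCurve 1 (ε n)) h z - oscInt volume (phaseCurve 1 0) h z‖ₑ ≤
        2 * max ‖oscInt volume (phaseCurve 1 (ε n)) h z‖ₑ ‖oscInt volume (phaseCurve 1 0) h z‖ₑ := by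
      refine enorm_sub_le.trans ?_
      rw [two_mul]
      exact add_le_add (le_max_left _ _) (le_max_right _ _)
    refine (pow_le_pow_left' h5 6).trans ?_
    rw [mul_pow]
    gcongr
    rcases max_cases ‖oscInt volume (phaseCurve 1 (ε n)) h z‖ₑ ‖oscInt volume (phaseCurve 1 0) h z‖ₑ
      with h6 | h6
    · rw [h6.1]; exact h3
    · rw [h6.1]; exact h4
  · have hall : ∀ᵐ z : ℝ × ℝ, ∀ n, extOp 1 (ε n) (Or.inl one_ne_zero)
        (memLp_div_phaseWeight hh.continuous hc hsupp (hεR n)).toLp z =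
        oscInt volume (phaseCurve 1 (ε n)) h z :=
      ae_all_iff.2 fun n => coeFn_extOp_div_phaseWeight hh.continuous hc hsupp (hεR n)
    filter_upwards [hall, coeFn_extOp_div_phaseWeight hh.continuous hc hsupp h0R] with z h1 h2
    rw [h2]
    simp_rw [h1]
    have hi : Integrable h := hh.continuous.integrable_of_hasCompactSupport hc
    refine tendsto_integral_of_dominated_convergence (fun η => ‖h η‖)
      (fun n => (integrable_planeChar_mul (measurable_phaseCurve 1 (ε n)) hi z).aestronglyMeasurable)
      hi.norm (fun n => ae_of_all _ fun η => ?_) (ae_of_all _ fun η => ?_)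
    · rw [norm_mul, norm_planeChar, one_mul]
    · have h3 : Continuous fun e : ℝ => planeChar z (phaseCurve 1 e η) * h η := by
        have h4 : Continuous fun e : ℝ => phaseCurve 1 e η := by
          unfold phaseCurve phasePoly; fun_prop
        exact (continuous_planeChar.comp (continuous_const.prodMk h4)).mul continuous_const
      exact (h3.tendsto 0).comp hε

lemma tendsto_div_phaseWeight {h : ℝ → ℂ} (hh : ContDiff ℝ ∞ h) (hc : HasCompactSupport h)
    {R : ℝ} (hsupp : ∀ x, R < |x| → h x = 0) {ε : ℕ → ℝ}
    (hεR : ∀ n, |ε n| * R ≤ 1 / 4) (h0R : |(0 : ℝ)| * R ≤ 1 / 4)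
    (hε : Filter.Tendsto ε Filter.atTop (nhds 0)) :
    Filter.Tendsto (fun n => (memLp_div_phaseWeight hh.continuous hc hsupp (hεR n)).toLp _)
      Filter.atTop (nhds ((memLp_div_phaseWeight hh.continuous hc hsupp h0R).toLp _)) := by
  refine tendsto_Lp_of_dominated (k := 2) (by norm_num) eLpNorm_two_sq
    (fun η => 4 ^ 2 * ‖h η‖ₑ ^ 2) ?_ (fun n => ?_) ?_
  · rw [lintegral_const_mul' _ _ (by simp), ← eLpNorm_two_sq]
    have h2 : MemLp h 2 := hh.continuous.memLp_of_hasCompactSupport hc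
    have := h2.eLpNorm_ne_top
    finiteness
  · filter_upwards [(memLp_div_phaseWeight hh.continuous hc hsupp (hεR n)).coeFn_toLp,
      (memLp_div_phaseWeight hh.continuous hc hsupp h0R).coeFn_toLp] with η h1 h2
    rw [h1, h2, ← mul_pow]
    refine pow_le_pow_left' ?_ 2
    rw [← ofReal_norm, ← ofReal_norm, show (4 : ℝ≥0∞) = ENNReal.ofReal 4 by norm_num,
      ← ENNReal.ofReal_mul (by norm_num)]
    refine ENNReal.ofReal_le_ofReal ((norm_sub_le _ _).trans ?_)
    linarith [norm_div_phaseWeight_le hsupp (hεR n) η, norm_div_phaseWeight_le hsupp h0R η]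
  · have hall : ∀ᵐ η, ∀ n, (memLp_div_phaseWeight hh.continuous hc hsupp (hεR n)).toLp _ η =
        h η / (phaseWeight 1 (ε n) η : ℂ) :=
      ae_all_iff.2 fun n => (memLp_div_phaseWeight hh.continuous hc hsupp (hεR n)).coeFn_toLp
    filter_upwards [hall, (memLp_div_phaseWeight hh.continuous hc hsupp h0R).coeFn_toLp]
      with η h1 h2
    rw [h2]
    simp_rw [h1]
    have h4 : Continuous fun e : ℝ => phaseWeight 1 e η := by
      unfold phaseWeight
      exact Continuous.rpow_const (by fun_prop) fun _ => Or.inr (by norm_num)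
    have h5 := (Complex.continuous_ofReal.comp h4).tendsto 0 |>.comp hε
    refine Filter.Tendsto.div tendsto_const_nhds h5 ?_
    simp [phaseWeight]

/-- Strong convergence of the extension operators `extOp 1 ε` to the Schrödinger extension
operator `extOp 1 0` as `ε → 0`. -/
lemma tendsto_extOp_one {ε : ℕ → ℝ} (hε : Filter.Tendsto ε Filter.atTop (nhds 0))
    (ψ : FreqSpace) :
    Filter.Tendsto (fun n => extOp 1 (ε n) (Or.inl one_ne_zero) ψ) Filter.atTop
      (nhds (extOp 1 0 (Or.inl one_ne_zero) ψ)) := by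
  have hsmooth : ∀ {f : FreqSpace} {h : ℝ → ℂ}, f =ᵐ[volume] h → HasCompactSupport h →
      ContDiff ℝ ∞ h → Filter.Tendsto (fun n => extOp 1 (ε n) (Or.inl one_ne_zero) f)
      Filter.atTop (nhds (extOp 1 0 (Or.inl one_ne_zero) f)) := by
    intro f h hf hc hh
    obtain ⟨R, hR, hsupp⟩ : ∃ R : ℝ, 1 ≤ R ∧ ∀ x, R < |x| → h x = 0 := by
      obtain ⟨r, hr⟩ := hc.isCompact.isBounded.subset_closedBall 0
      refine ⟨max r 1, le_max_right _ _, fun x hx => ?_⟩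
      by_contra h0
      have := hr (subset_tsupport h (Function.mem_support.2 h0))
      rw [mem_closedBall_zero_iff, Real.norm_eq_abs] at this
      exact absurd (this.trans (le_max_left _ _)) (not_le.2 hx)
    have h0R : |(0 : ℝ)| * R ≤ 1 / 4 := by norm_num
    obtain ⟨N, hN⟩ : ∃ N, ∀ n, N ≤ n → |ε n| * R ≤ 1 / 4 := by
      have := (hε.abs.mul_const R).eventually_le_const (u := (1 / 4 : ℝ)) (by norm_num)
      exact Filter.eventually_atTop.1 this
    rw [← Filter.tendsto_add_atTop_iff_nat N]
    have hεN : ∀ n, |ε (n + N)| * R ≤ 1 / 4 := fun n => hN _ (by omega)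
    have hε' := (Filter.tendsto_add_atTop_iff_nat N).2 hε
    have t1 := tendsto_extOp_div_phaseWeight hh hc hR hsupp hεN h0R hε'
    have t2 := tendsto_div_phaseWeight hh hc hsupp hεN h0R hε'
    have e0 : (memLp_div_phaseWeight hh.continuous hc hsupp h0R).toLp _ = f := by
      refine Lp.ext ?_
      filter_upwards [hf, (memLp_div_phaseWeight hh.continuous hc hsupp h0R).coeFn_toLp]
        with η h1 h2
      rw [h1, h2]
      simp [phaseWeight]
    rw [e0] at t1 t2
    have t3 : Filter.Tendsto (fun n => extOp 1 (ε (n + N)) (Or.inl one_ne_zero)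
        (f - (memLp_div_phaseWeight hh.continuous hc hsupp (hεN n)).toLp _)) Filter.atTop
        (nhds 0) := by
      have t4 := (tendsto_const_nhds (x := f)).sub t2 |>.norm
      rw [sub_self, norm_zero] at t4
      have t5 := t4.const_mul strichartzBoundRoot
      rw [mul_zero] at t5
      exact squeeze_zero_norm (fun n => norm_extOp_le _ _ _ _) t5
    have t6 := t3.add t1
    rw [zero_add] at t6
    refine t6.congr fun n => ?_
    rw [← map_add, sub_add_cancel]
  rw [Metric.tendsto_atTop]
  intro δ hδ
  have hC : 0 < strichartzBoundRoot + 1 := by linarith [strichartzBoundRoot_nonneg]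
  obtain ⟨f, hf, ⟨h, hfh, hc, hh⟩⟩ := Metric.dense_iff.1
    (Lp.dense_hasCompactSupport_contDiff (F := ℂ) (μ := (volume : Measure ℝ)) (p := 2) (by norm_num))
    ψ (δ / (3 * (strichartzBoundRoot + 1))) (by positivity)
  obtain ⟨N, hN⟩ := Metric.tendsto_atTop.1 (hsmooth hfh hc hh) (δ / 3) (by positivity)
  refine ⟨N, fun n hn => ?_⟩
  have hd : (strichartzBoundRoot + 1) * ‖ψ - f‖ < δ / 3 := by
    rw [Metric.mem_ball, dist_comm, dist_eq_norm, lt_div_iff₀ (by positivity)] at hf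
    linarith
  have hb : ∀ e : ℝ, dist (extOp 1 e (Or.inl one_ne_zero) ψ) (extOp 1 e (Or.inl one_ne_zero) f)
      < δ / 3 := by
    intro e
    rw [dist_eq_norm, ← map_sub]
    refine lt_of_le_of_lt (norm_extOp_le _ _ _ _) (lt_of_le_of_lt ?_ hd)
    nlinarith [norm_nonneg (ψ - f)]
  have h1 := hb (ε n)
  have h2 := hb 0
  rw [dist_comm] at h2
  have h3 := hN n hn
  calc _ ≤ _ := dist_triangle4 _ (extOp 1 (ε n) (Or.inl one_ne_zero) f)
        (extOp 1 0 (Or.inl one_ne_zero) f) _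
    _ < δ / 3 + δ / 3 + δ / 3 := by gcongr
    _ = δ := by ring

/-! ### Weak limits of concentrating sequences -/

/-- Sequential weak compactness of bounded sets in `L²`. -/
lemma exists_subseq_weak_limit {f : ℕ → FreqSpace} {B : ℝ} (hB : ∀ n, ‖f n‖ ≤ B) :
    ∃ (φ : FreqSpace) (ns : ℕ → ℕ), StrictMono ns ∧
      ∀ ψ : FreqSpace, Filter.Tendsto (fun k => inner ℂ ψ (f (ns k))) Filter.atTop
        (nhds (inner ℂ ψ φ)) := by
  set D : ℕ → WeakDual ℂ FreqSpace := fun n =>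
    StrongDual.toWeakDual (InnerProductSpace.toDual ℂ FreqSpace (f n)) with hD
  have hmem : ∀ n, D n ∈ WeakDual.toStrongDual ⁻¹'
      Metric.closedBall (0 : StrongDual ℂ FreqSpace) B := by
    intro n
    change InnerProductSpace.toDual ℂ FreqSpace (f n) ∈ Metric.closedBall 0 B
    rw [mem_closedBall_zero_iff, LinearIsometryEquiv.norm_map]
    exact hB n
  have : Fact ((2 : ℝ≥0∞) ≠ ⊤) := ⟨by simp⟩
  obtain ⟨L, -, ns, hns, hlim⟩ := WeakDual.isSeqCompact_closedBall ℂ FreqSpace 0 B hmem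
  refine ⟨(InnerProductSpace.toDual ℂ FreqSpace).symm (WeakDual.toStrongDual L), ns, hns,
    fun ψ => ?_⟩
  have h1 := (WeakDual.eval_continuous (𝕜 := ℂ) (E := FreqSpace) ψ).tendsto L |>.comp hlim
  have h2 := (Complex.continuous_conj.tendsto _).comp h1
  have e1 : (starRingEnd ℂ) (L ψ) =
      inner ℂ ψ ((InnerProductSpace.toDual ℂ FreqSpace).symm (WeakDual.toStrongDual L)) := by
    rw [← inner_conj_symm, InnerProductSpace.toDual_symm_apply]
    rfl
  rw [e1] at h2
  refine h2.congr fun k => ?_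
  simp only [Function.comp, hD]
  rw [← inner_conj_symm]
  rfl

/-- Brezis–Lieb inequality in `L⁶`: the sixth power of the norm decouples asymptotically along a
sequence tending to zero almost everywhere. -/
lemma enorm_pow_le_of_tendsto_ae_zero {F : PlaneSpace} {v : ℕ → PlaneSpace}
    (hv : ∀ᵐ z : ℝ × ℝ, Filter.Tendsto (fun n => v n z) Filter.atTop (nhds 0)) {M L : ℝ≥0∞}
    (hL : L ≠ ⊤) {l : ℕ → ℝ≥0∞} (hl : ∀ n, ‖v n‖ₑ ^ 6 ≤ l n)
    (hlL : Filter.Tendsto l Filter.atTop (nhds L))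
    (hM : Filter.Tendsto (fun n => ‖F + v n‖ₑ ^ 6) Filter.atTop (nhds M)) :
    M ≤ ‖F‖ₑ ^ 6 + L := by
  have key : ∀ d : ℝ, 0 < d → M ≤ ENNReal.ofReal (1 + d) ^ 6 * L + ‖F‖ₑ ^ 6 := by
    intro d hd
    set c : ℝ≥0∞ := ENNReal.ofReal (1 + d) ^ 6 with hc
    have hctop : c ≠ ⊤ := by simp [hc]
    set W : ℕ → ℝ × ℝ → ℝ≥0∞ := fun n z => ‖F z + v n z‖ₑ ^ 6 - (c * ‖v n z‖ₑ ^ 6 + ‖F z‖ₑ ^ 6)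
      with hW
    have hWm : ∀ n, AEMeasurable (W n) := fun n =>
      (((Lp.aestronglyMeasurable F).add (Lp.aestronglyMeasurable (v n))).enorm.pow_const 6).sub
        (((Lp.aestronglyMeasurable (v n)).enorm.pow_const 6 |>.const_mul c).add
          ((Lp.aestronglyMeasurable F).enorm.pow_const 6))
    have hWlim : Filter.Tendsto (fun n => ∫⁻ z, W n z) Filter.atTop (nhds 0) := by
      have := tendsto_lintegral_of_dominated_convergence' (μ := volume) (F := W) (f := fun _ => 0)
        (fun z => ENNReal.ofReal (1 + 1 / d) ^ 6 * ‖F z‖ₑ ^ 6) hWm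
        (fun n => ae_of_all _ fun z => by
          simp only [hW]
          have h1 : ‖F z + v n z‖ₑ ≤ ‖F z‖ₑ + ‖v n z‖ₑ := enorm_add_le _ _
          rcases le_total ‖F z‖ (d * ‖v n z‖) with h2 | h2
          · have h3 : ‖F z + v n z‖ₑ ≤ ENNReal.ofReal (1 + d) * ‖v n z‖ₑ := by
              rw [← ofReal_norm, ← ofReal_norm, ← ENNReal.ofReal_mul (by positivity)]
              refine ENNReal.ofReal_le_ofReal ((norm_add_le _ _).trans ?_)
              linarith
            have h4 : ‖F z + v n z‖ₑ ^ 6 ≤ c * ‖v n z‖ₑ ^ 6 + ‖F z‖ₑ ^ 6 := by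
              refine le_add_right ?_
              rw [hc, ← mul_pow]
              exact pow_le_pow_left' h3 6
            rw [tsub_eq_zero_of_le h4]
            exact zero_le
          · refine tsub_le_self.trans ?_
            rw [← mul_pow]
            refine pow_le_pow_left' ?_ 6
            rw [← ofReal_norm, ← ofReal_norm, ← ENNReal.ofReal_mul (by positivity)]
            refine ENNReal.ofReal_le_ofReal ((norm_add_le _ _).trans ?_)
            have h5 : ‖v n z‖ ≤ 1 / d * ‖F z‖ := by
              rw [one_div, ← div_eq_inv_mul, le_div_iff₀ hd]; linarith
            linarith)
        (by
          rw [lintegral_const_mul' _ _ (by simp), ← plane_enorm_pow]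
          finiteness)
        (by
          filter_upwards [hv] with z hz
          have p6 := ENNReal.continuous_pow 6
          have h1 : Filter.Tendsto (fun n => ‖F z + v n z‖ₑ ^ 6) Filter.atTop
              (nhds (‖F z‖ₑ ^ 6)) := by
            have := (p6.tendsto _).comp (hz.const_add (F z)).enorm
            simpa [Function.comp_def] using this
          have h2 : Filter.Tendsto (fun n => c * ‖v n z‖ₑ ^ 6 + ‖F z‖ₑ ^ 6) Filter.atTop
              (nhds (c * 0 + ‖F z‖ₑ ^ 6)) := by
            have := (p6.tendsto _).comp hz.enorm
            have h3 : Filter.Tendsto (fun n => ‖v n z‖ₑ ^ 6) Filter.atTop (nhds 0) := by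
              simpa [Function.comp_def] using this
            exact (ENNReal.Tendsto.const_mul h3 (Or.inr hctop)).add_const _
          have h4 := ENNReal.Tendsto.sub h1 h2 (Or.inl (by finiteness))
          simpa using h4)
      simpa using this
    have hle : ∀ n, ‖F + v n‖ₑ ^ 6 ≤ c * l n + ‖F‖ₑ ^ 6 + ∫⁻ z, W n z := by
      intro n
      calc ‖F + v n‖ₑ ^ 6 = ∫⁻ z, ‖F z + v n z‖ₑ ^ 6 := by
            rw [plane_enorm_pow]
            refine lintegral_congr_ae ?_
            filter_upwards [Lp.coeFn_add F (v n)] with z hz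
            rw [hz, Pi.add_apply]
        _ ≤ ∫⁻ z, (c * ‖v n z‖ₑ ^ 6 + ‖F z‖ₑ ^ 6) + W n z :=
            lintegral_mono fun z => le_add_tsub
        _ = c * ‖v n‖ₑ ^ 6 + ‖F‖ₑ ^ 6 + ∫⁻ z, W n z := by
            rw [lintegral_add_right' _ (hWm n), lintegral_add_right'
              _ ((Lp.aestronglyMeasurable F).enorm.pow_const 6),
              lintegral_const_mul' _ _ hctop, ← plane_enorm_pow, ← plane_enorm_pow]
        _ ≤ _ := by gcongr; exact hl n
    have hlim := ((ENNReal.Tendsto.const_mul hlL (Or.inr hctop)).add_const (‖F‖ₑ ^ 6)).add hWlim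
    rw [add_zero] at hlim
    exact le_of_tendsto_of_tendsto' hM hlim hle
  have hd : Filter.Tendsto (fun n : ℕ => ENNReal.ofReal (1 + 1 / ((n : ℝ) + 1)) ^ 6 * L + ‖F‖ₑ ^ 6)
      Filter.atTop (nhds (1 * L + ‖F‖ₑ ^ 6)) := by
    refine (ENNReal.Tendsto.mul_const ?_ (Or.inr hL)).add_const _
    have h1 := (tendsto_one_div_add_atTop_nhds_zero_nat (𝕜 := ℝ)).const_add 1
    have h2 := ((ENNReal.continuous_pow 6).tendsto _).comp (ENNReal.tendsto_ofReal h1)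
    simpa [Function.comp_def] using h2
  have := ge_of_tendsto' hd fun n => key _ (by positivity)
  rwa [one_mul, add_comm] at this

/-- If unit-size amplitudes `φₙ` nearly saturate a common bound `K` for convergent extension
operators and have a nonzero weak limit, then the weak limit saturates `K` for the limiting
operator. -/
lemma exists_saturating_of_concentrating {a b : ℕ → ℝ} {α β : ℝ} (ha : ∀ n, |a n| ≤ 1)
    (hb : ∀ n, |b n| ≤ 1) (haα : Filter.Tendsto a Filter.atTop (nhds α))
    (hbβ : Filter.Tendsto b Filter.atTop (nhds β)) (h : ∀ n, a n ≠ 0 ∨ b n ≠ 0)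
    (h₀ : α ≠ 0 ∨ β ≠ 0) (hs : ∀ n, IsSmoothing (a n) (b n))
    (hstrong : ∀ ψ, Filter.Tendsto (fun n => extOp (a n) (b n) (h n) ψ) Filter.atTop
      (nhds (extOp α β h₀ ψ))) {K : ℝ} (hK0 : 0 ≤ K)
    (hK : ∀ n ψ, ‖extOp (a n) (b n) (h n) ψ‖ ≤ K * ‖ψ‖) {f : ℕ → FreqSpace}
    (hf : ∀ n, ‖f n‖ ≤ 1) {κ : FreqSpace} {A : ℝ} (hA : 0 < A)
    (hfκ : ∀ n, A ≤ ‖(inner ℂ κ (f n) : ℂ)‖)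
    (hmax : Filter.Tendsto (fun n => ‖extOp (a n) (b n) (h n) (f n)‖) Filter.atTop (nhds K)) :
    ∃ φ : FreqSpace, φ ≠ 0 ∧ K * ‖φ‖ ≤ ‖extOp α β h₀ φ‖ := by
  obtain ⟨φ, ns, hns, hweak⟩ := exists_subseq_weak_limit hf
  -- the inner product with the fixed `κ` passes to the weak limit
  have hφ0 : φ ≠ 0 := by
    rintro rfl
    have h1 := ge_of_tendsto' (hweak κ).norm fun k => hfκ (ns k)
    rw [inner_zero_right, norm_zero] at h1
    linarith
  set r : ℕ → FreqSpace := fun k => f (ns k) - φ with hr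
  have hrnull : WeaklyNull r := by
    intro ψ
    have h1 := (hweak ψ).sub_const (inner ℂ ψ φ)
    rw [sub_self] at h1
    refine h1.congr fun k => ?_
    rw [hr, inner_sub_right]
  have hrB : ∀ k, ‖r k‖ ≤ 1 + ‖φ‖ := fun k => (norm_sub_le _ _).trans (by linarith [hf (ns k)])
  obtain ⟨ms, hms, hae⟩ := exists_subseq_extOp_tendsto_ae (fun k => ha (ns k)) (fun k => hb (ns k))
    (haα.comp hns.tendsto_atTop) (hbβ.comp hns.tendsto_atTop) (fun k => h (ns k))
    (fun k => hs (ns k)) hrnull hrB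
  set p : ℕ → ℕ := fun j => ns (ms j) with hp
  have hpt : Filter.Tendsto p Filter.atTop Filter.atTop := hns.tendsto_atTop.comp hms.tendsto_atTop
  set F := extOp α β h₀ φ with hF
  set v : ℕ → PlaneSpace := fun j => extOp (a (p j)) (b (p j)) (h (p j)) (r (ms j)) with hv
  -- `q j` dominates `‖f - φ‖²` and, unlike it, converges: `‖f‖` itself need not
  set q : ℕ → ℝ := fun j => 1 - 2 * (inner ℂ φ (f (p j)) : ℂ).re + ‖φ‖ ^ 2 with hq
  have hrq : ∀ j, ‖r (ms j)‖ ^ 2 ≤ q j := by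
    intro j
    have h1 := norm_sub_sq (𝕜 := ℂ) (f (p j)) φ
    have h2 : RCLike.re (inner ℂ (f (p j)) φ) = (inner ℂ φ (f (p j)) : ℂ).re := by
      exact inner_re_symm (𝕜 := ℂ) _ _
    rw [h2] at h1
    have h3 : ‖f (p j)‖ ^ 2 ≤ 1 := pow_le_one₀ (norm_nonneg _) (hf _)
    simp only [hr, hq]
    linarith
  have hqlim : Filter.Tendsto q Filter.atTop (nhds (1 - ‖φ‖ ^ 2)) := by
    have h1 := (Complex.continuous_re.tendsto _).comp ((hweak φ).comp hms.tendsto_atTop)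
    have h2 := ((h1.const_mul 2).const_sub 1).add_const (‖φ‖ ^ 2)
    have e : (inner ℂ φ φ : ℂ).re = ‖φ‖ ^ 2 := by
      rw [inner_self_eq_norm_sq_to_K]; norm_cast
    rw [e] at h2
    rw [show 1 - ‖φ‖ ^ 2 = 1 - 2 * ‖φ‖ ^ 2 + ‖φ‖ ^ 2 by ring]
    exact h2
  have ha1 : ‖φ‖ ^ 2 ≤ 1 := by
    have := ge_of_tendsto' hqlim fun j => (sq_nonneg _).trans (hrq j)
    linarith
  have hvq : ∀ j, ‖v j‖ₑ ^ 6 ≤ ENNReal.ofReal (K ^ 6 * q j ^ 3) := by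
    intro j
    rw [← ofReal_norm, ← ENNReal.ofReal_pow (norm_nonneg _)]
    refine ENNReal.ofReal_le_ofReal ?_
    calc ‖v j‖ ^ 6 ≤ (K * ‖r (ms j)‖) ^ 6 := by gcongr; exact hK _ _
      _ = K ^ 6 * (‖r (ms j)‖ ^ 2) ^ 3 := by ring
      _ ≤ _ := by gcongr; exact hrq j
  -- by strong convergence, `F + v j` differs from the image of `f (p j)` by a null sequence
  have hM : Filter.Tendsto (fun j => ‖F + v j‖ₑ ^ 6) Filter.atTop
      (nhds (ENNReal.ofReal (K ^ 6))) := by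
    have h1 : Filter.Tendsto (fun j => ‖F + v j‖) Filter.atTop (nhds K) := by
      have h2 : Filter.Tendsto (fun j => F - extOp (a (p j)) (b (p j)) (h (p j)) φ) Filter.atTop
          (nhds 0) := by
        have := ((hstrong φ).comp hpt).const_sub F
        rwa [sub_self] at this
      have h3 := hmax.comp hpt
      have h4 : Filter.Tendsto (fun j => ‖F + v j‖ - ‖extOp (a (p j)) (b (p j)) (h (p j)) (f (p j))‖)
          Filter.atTop (nhds 0) := by
        refine squeeze_zero_norm (fun j => ?_) (tendsto_zero_iff_norm_tendsto_zero.1 h2)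
        refine (abs_norm_sub_norm_le _ _).trans (le_of_eq ?_)
        congr 1
        simp only [hv, hr, map_sub]
        abel
      have h5 := h4.add h3
      rw [zero_add] at h5
      refine h5.congr fun j => ?_
      simp
    have h2 := ENNReal.tendsto_ofReal (h1.pow 6)
    refine h2.congr fun j => ?_
    rw [ENNReal.ofReal_pow (norm_nonneg _), ofReal_norm]
  have hBL := enorm_pow_le_of_tendsto_ae_zero hae ENNReal.ofReal_ne_top hvq
    (ENNReal.tendsto_ofReal ((hqlim.pow 3).const_mul (K ^ 6))) hM
  rw [← ofReal_norm, ← ENNReal.ofReal_pow (norm_nonneg _), ← ENNReal.ofReal_add (by positivity)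
    (mul_nonneg (by positivity) (pow_nonneg (by linarith) 3)),
    ENNReal.ofReal_le_ofReal_iff (add_nonneg (by positivity)
      (mul_nonneg (by positivity) (pow_nonneg (by linarith) 3)))] at hBL
  refine ⟨φ, hφ0, ?_⟩
  refine le_of_pow_le_pow_left₀ (n := 6) (by norm_num) (norm_nonneg _) ?_
  -- superadditivity of the cube: none of the norm is lost to the remainder
  have h6 : (1 - ‖φ‖ ^ 2) ^ 3 ≤ 1 - (‖φ‖ ^ 2) ^ 3 := by
    have : 0 ≤ ‖φ‖ ^ 2 := by positivity
    nlinarith [mul_nonneg this (sub_nonneg.2 ha1)]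
  have h7 := mul_le_mul_of_nonneg_left h6 (pow_nonneg hK0 6)
  calc (K * ‖φ‖) ^ 6 = K ^ 6 * (‖φ‖ ^ 2) ^ 3 := by ring
    _ ≤ ‖F‖ ^ 6 := by linarith

/-! ### Symmetries and the dichotomy for maximizing sequences -/

lemma map_affine_volume {r : ℝ} (hr : r ≠ 0) (c : ℝ) :
    (volume : Measure ℝ).map (fun η => c + r * η) = ENNReal.ofReal |r⁻¹| • volume := by
  have : (fun η : ℝ => c + r * η) = (fun x => c + x) ∘ (fun η => r * η) := rfl
  rw [this, ← Measure.map_map (measurable_const_add c) (measurable_const_mul r),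
    Real.map_volume_mul_left hr, Measure.map_smul, map_add_left_eq_self]

lemma measurable_affine (c r : ℝ) : Measurable fun η : ℝ => c + r * η := by fun_prop

lemma lintegral_comp_affine {r : ℝ} (hr : 0 < r) (c : ℝ) {F : ℝ → ℝ≥0∞} (hF : Measurable F) :
    ∫⁻ η, F (c + r * η) = ENNReal.ofReal r⁻¹ * ∫⁻ x, F x := by
  rw [← lintegral_map hF (measurable_affine c r), map_affine_volume hr.ne', lintegral_smul_measure,
    abs_of_pos (inv_pos.2 hr), smul_eq_mul]

lemma quasiMeasurePreserving_affine {r : ℝ} (hr : r ≠ 0) (c : ℝ) :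
    Measure.QuasiMeasurePreserving (fun η : ℝ => c + r * η) volume volume := by
  refine ⟨measurable_affine c r, ?_⟩
  rw [map_affine_volume hr]
  exact Measure.smul_absolutelyContinuous

lemma lintegral_comp_shear {r k : ℝ} (hr : 0 < r) (hk : 0 < k) (s : ℝ) {F : ℝ × ℝ → ℝ≥0∞}
    (hF : Measurable F) :
    ∫⁻ z : ℝ × ℝ, F (s * z.2 + r * z.1, k * z.2) = ENNReal.ofReal (r * k)⁻¹ * ∫⁻ z, F z := by
  rw [Measure.volume_eq_prod, lintegral_prod_symm _ (by fun_prop), lintegral_prod_symm _ (by fun_prop)]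
  have h1 : ∀ t, ∫⁻ x, F (s * t + r * x, k * t) = ENNReal.ofReal r⁻¹ * ∫⁻ x, F (x, k * t) :=
    fun t => lintegral_comp_affine hr (s * t) (F := fun x => F (x, k * t)) (by fun_prop)
  simp_rw [h1]
  rw [lintegral_const_mul' _ _ ENNReal.ofReal_ne_top]
  have h2 := lintegral_comp_affine hk 0 (F := fun y => ∫⁻ x, F (x, y)) hF.lintegral_prod_left'
  simp only [zero_add] at h2
  rw [h2, ← mul_assoc, ← ENNReal.ofReal_mul (by positivity), mul_inv]

lemma memLp_rescale (c : ℝ) {r : ℝ} (hr : 0 < r) (g : FreqSpace) :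
    MemLp (fun η => ((r ^ (1 / 2 : ℝ) : ℝ) : ℂ) * g (c + r * η)) 2 := by
  have h1 : MemLp (fun η => g (c + r * η)) 2 := by
    have h2 : MemLp g 2 ((volume : Measure ℝ).map fun η => c + r * η) := by
      rw [map_affine_volume hr.ne']
      exact (Lp.memLp g).smul_measure ENNReal.ofReal_ne_top
    exact h2.comp_of_map (measurable_affine c r).aemeasurable
  exact h1.const_mul _

/-- The unitary rescaling `g ↦ r^{1/2} g(c + r ·)` of `L²`. -/
noncomputable def rescale (c : ℝ) {r : ℝ} (hr : 0 < r) (g : FreqSpace) : FreqSpace :=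
  (memLp_rescale c hr g).toLp

lemma coeFn_rescale (c : ℝ) {r : ℝ} (hr : 0 < r) (g : FreqSpace) :
    rescale c hr g =ᵐ[volume] fun η => ((r ^ (1 / 2 : ℝ) : ℝ) : ℂ) * g (c + r * η) :=
  MemLp.coeFn_toLp _

lemma enorm_rpow_half {r : ℝ} (hr : 0 < r) :
    ‖((r ^ (1 / 2 : ℝ) : ℝ) : ℂ)‖ₑ = ENNReal.ofReal (r ^ (1 / 2 : ℝ)) := by
  rw [← ofReal_norm, Complex.norm_real, Real.norm_of_nonneg (by positivity)]

lemma rpow_half_sq {r : ℝ} (hr : 0 < r) : (r ^ (1 / 2 : ℝ)) ^ 2 = r := by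
  rw [← Real.rpow_natCast, ← Real.rpow_mul hr.le]; norm_num

lemma norm_rescale (c : ℝ) {r : ℝ} (hr : 0 < r) (g : FreqSpace) : ‖rescale c hr g‖ = ‖g‖ := by
  have hgm : Measurable g := (Lp.stronglyMeasurable g).measurable
  have h1 : ‖rescale c hr g‖ₑ ^ 2 = ‖g‖ₑ ^ 2 := by
    rw [freq_enorm_sq, freq_enorm_sq]
    calc _ = ∫⁻ η, ENNReal.ofReal r * ‖g (c + r * η)‖ₑ ^ 2 := by
          refine lintegral_congr_ae ?_
          filter_upwards [coeFn_rescale c hr g] with η hη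
          rw [hη, enorm_mul, mul_pow, enorm_rpow_half hr, ← ENNReal.ofReal_pow (by positivity),
            rpow_half_sq hr]
      _ = _ := by
          rw [lintegral_const_mul' _ _ ENNReal.ofReal_ne_top,
            lintegral_comp_affine hr c (F := fun x => ‖g x‖ₑ ^ 2) (by fun_prop), ← mul_assoc,
            ← ENNReal.ofReal_mul hr.le, mul_inv_cancel₀ hr.ne', ENNReal.ofReal_one, one_mul]
  rw [← ofReal_norm, ← ofReal_norm, ← ENNReal.ofReal_pow (norm_nonneg _),
    ← ENNReal.ofReal_pow (norm_nonneg _)] at h1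
  have h2 := (ENNReal.ofReal_eq_ofReal_iff (by positivity) (by positivity)).1 h1
  exact (pow_left_inj₀ (norm_nonneg _) (norm_nonneg _) (by norm_num)).1 h2

lemma rescale_sub (c : ℝ) {r : ℝ} (hr : 0 < r) (f g : FreqSpace) :
    rescale c hr (f - g) = rescale c hr f - rescale c hr g := by
  refine Lp.ext ?_
  have h1 := (quasiMeasurePreserving_affine hr.ne' c).ae (Lp.coeFn_sub f g)
  filter_upwards [coeFn_rescale c hr (f - g), coeFn_rescale c hr f, coeFn_rescale c hr g,
    Lp.coeFn_sub (rescale c hr f) (rescale c hr g), h1] with η e1 e2 e3 e4 e5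
  rw [e4, Pi.sub_apply, e1, e2, e3, e5, Pi.sub_apply]
  ring

lemma rescale_rescale_neg (c : ℝ) (f : FreqSpace) :
    rescale c one_pos (rescale (-c) one_pos f) = f := by
  refine Lp.ext ?_
  have h1 := (quasiMeasurePreserving_affine one_ne_zero c).ae (coeFn_rescale (-c) one_pos f)
  filter_upwards [coeFn_rescale c one_pos (rescale (-c) one_pos f), h1] with η e1 e2
  rw [e1, e2]
  simp

lemma tendsto_rescale (c : ℝ) {r : ℝ} (hr : 0 < r) {u : ℕ → FreqSpace} {g : FreqSpace}
    (hu : Filter.Tendsto u Filter.atTop (nhds g)) :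
    Filter.Tendsto (fun n => rescale c hr (u n)) Filter.atTop (nhds (rescale c hr g)) := by
  rw [tendsto_iff_norm_sub_tendsto_zero] at hu ⊢
  refine hu.congr fun n => ?_
  rw [← rescale_sub, norm_rescale]

lemma ext_rescale (c : ℝ) {r l : ℝ} (hr : 0 < r) (hl : l ≠ 0) (g : ℝ → ℂ) (z : ℝ × ℝ) :
    ext 0 1 g z = planeChar z (c, c ^ 4) * (((r ^ (1 / 2 : ℝ) * (|l| ^ (1 / 3 : ℝ))⁻¹ : ℝ) : ℂ) *
      ext (l * c) (l * r) (fun η => ((r ^ (1 / 2 : ℝ) : ℝ) : ℂ) * g (c + r * η))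
        (4 * c ^ 3 * r * z.2 + r * z.1, r ^ 2 / l ^ 2 * z.2)) := by
  have hch : ∀ F : ℝ → ℂ, ∫ x, F x = (r : ℂ) * ∫ η, F (c + r * η) := by
    intro F
    have h1 := Measure.integral_comp_mul_left (fun x => F (c + x)) r
    rw [integral_add_left_eq_self F c, abs_of_pos (inv_pos.2 hr)] at h1
    rw [h1, Complex.real_smul, ← mul_assoc, ← Complex.ofReal_mul, mul_inv_cancel₀ hr.ne',
      Complex.ofReal_one, one_mul]
  have hl3 : 0 < |l| ^ (1 / 3 : ℝ) := Real.rpow_pos_of_pos (abs_pos.2 hl) _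
  have hrr : ((r : ℝ) : ℂ) = ((r ^ (1 / 2 : ℝ) : ℝ) : ℂ) * ((r ^ (1 / 2 : ℝ) : ℝ) : ℂ) := by
    rw [← Complex.ofReal_mul, ← sq, rpow_half_sq hr]
  rw [ext, oscInt, hch, hrr, mul_assoc, ext, oscInt, ← integral_const_mul, ← integral_const_mul,
    ← integral_const_mul, ← integral_const_mul]
  refine integral_congr_ae (ae_of_all _ fun η => ?_)
  have hw : phaseWeight (l * c) (l * r) η = |l| ^ (1 / 3 : ℝ) * phaseWeight 0 1 (c + r * η) := by
    unfold phaseWeight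
    rw [← Real.mul_rpow (abs_nonneg _) (abs_nonneg _), ← abs_mul]
    congr 2
    ring
  have hp : planeChar z (phaseCurve 0 1 (c + r * η)) = planeChar z (c, c ^ 4) *
      planeChar (4 * c ^ 3 * r * z.2 + r * z.1, r ^ 2 / l ^ 2 * z.2)
        (phaseCurve (l * c) (l * r) η) := by
    simp only [planeChar, phaseCurve, phasePoly]
    rw [← Complex.exp_add, ← add_mul, ← Complex.ofReal_add]
    congr 3
    field_simp
    ring
  have hl3' : ((|l| ^ (1 / 3 : ℝ) : ℝ) : ℂ) ≠ 0 := by exact_mod_cast hl3.ne'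
  simp only [hw, hp]
  push_cast
  generalize ((|l| ^ (1 / 3 : ℝ) : ℝ) : ℂ) = L at hl3'
  field_simp

lemma lintegral_ext_rescale (c : ℝ) {r l : ℝ} (hr : 0 < r) (hl : l ≠ 0) {g : ℝ → ℂ}
    (hwg : Integrable fun η => (phaseWeight (l * c) (l * r) η : ℂ) *
      (((r ^ (1 / 2 : ℝ) : ℝ) : ℂ) * g (c + r * η))) :
    ∫⁻ z, ‖ext 0 1 g z‖ₑ ^ 6 = ∫⁻ z, ‖ext (l * c) (l * r)
      (fun η => ((r ^ (1 / 2 : ℝ) : ℝ) : ℂ) * g (c + r * η)) z‖ₑ ^ 6 := by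
  have hl2 : 0 < l ^ 2 := by positivity
  have hk : 0 < r ^ 2 / l ^ 2 := by positivity
  simp_rw [ext_rescale c hr hl g, enorm_mul, enorm_planeChar, one_mul, mul_pow]
  rw [lintegral_const_mul' _ _ (by finiteness)]
  rw [lintegral_comp_shear hr hk (4 * c ^ 3 * r) (F := fun z => ‖ext (l * c) (l * r)
      (fun η => ((r ^ (1 / 2 : ℝ) : ℝ) : ℂ) * g (c + r * η)) z‖ₑ ^ 6)
      ((continuous_oscInt (measurable_phaseCurve _ _) hwg).measurable.enorm.pow_const 6),
    ← mul_assoc]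
  have hl3 : 0 < |l| ^ (1 / 3 : ℝ) := Real.rpow_pos_of_pos (abs_pos.2 hl) _
  have e1 : (|l| ^ (1 / 3 : ℝ)) ^ 6 = l ^ 2 := by
    rw [← Real.rpow_natCast, ← Real.rpow_mul (abs_nonneg l), ← sq_abs l, ← Real.rpow_natCast]
    norm_num
  have e2 : (r ^ (1 / 2 : ℝ)) ^ 6 = r ^ 3 := by
    rw [show (6 : ℕ) = 2 * 3 by norm_num, pow_mul, rpow_half_sq hr]
  rw [← ofReal_norm, Complex.norm_real, Real.norm_of_nonneg (by positivity),
    ← ENNReal.ofReal_pow (by positivity), ← ENNReal.ofReal_mul (by positivity), mul_pow, inv_pow,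
    e1, e2]
  have : r ^ 3 * (l ^ 2)⁻¹ * (r * (r ^ 2 / l ^ 2))⁻¹ = 1 := by field_simp
  rw [this, ENNReal.ofReal_one, one_mul]

lemma enorm_extOp_pow {α β : ℝ} (h : α ≠ 0 ∨ β ≠ 0) (f : FreqSpace)
    (hwf : Integrable fun η => (phaseWeight α β η : ℂ) * f η) :
    ‖extOp α β h f‖ₑ ^ 6 = ∫⁻ z, ‖ext α β f z‖ₑ ^ 6 := by
  rw [plane_enorm_pow]
  exact lintegral_congr_ae ((coeFn_extOp h f hwf).mono fun z hz => by simp only [hz])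

/-- The frequency translations and dilations carry the quartic extension operator to the operators
of the two-parameter family. -/
lemma norm_extOp_rescale (c : ℝ) {r l : ℝ} (hr : 0 < r) (hl : l ≠ 0)
    (h : l * c ≠ 0 ∨ l * r ≠ 0) (g : FreqSpace) :
    ‖extOp (l * c) (l * r) h (rescale c hr g)‖ = ‖extOp 0 1 (Or.inr one_ne_zero) g‖ := by
  have hcase : ∀ f : FreqSpace, (Integrable fun η => (phaseWeight 0 1 η : ℂ) * f η) →
      ‖extOp (l * c) (l * r) h (rescale c hr f)‖ = ‖extOp 0 1 (Or.inr one_ne_zero) f‖ := by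
    intro f hf
    have hi : Integrable fun η => (phaseWeight (l * c) (l * r) η : ℂ) *
        (((r ^ (1 / 2 : ℝ) : ℝ) : ℂ) * f (c + r * η)) := by
      have h1 : Integrable fun η => (phaseWeight 0 1 (c + r * η) : ℂ) * f (c + r * η) :=
        (hf.comp_add_left c).comp_mul_left' hr.ne'
      have h2 := h1.const_mul (((|l| ^ (1 / 3 : ℝ) : ℝ) : ℂ) * ((r ^ (1 / 2 : ℝ) : ℝ) : ℂ))
      refine h2.congr (ae_of_all _ fun η => ?_)
      have hw : phaseWeight (l * c) (l * r) η = |l| ^ (1 / 3 : ℝ) * phaseWeight 0 1 (c + r * η) := by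
        unfold phaseWeight
        rw [← Real.mul_rpow (abs_nonneg _) (abs_nonneg _), ← abs_mul]
        congr 2
        ring
      simp only [hw]
      push_cast
      ring
    have e : ‖extOp (l * c) (l * r) h (rescale c hr f)‖ₑ ^ 6 =
        ‖extOp 0 1 (Or.inr one_ne_zero) f‖ₑ ^ 6 := by
      rw [enorm_extOp_pow _ _ hf, enorm_extOp_pow, ext_congr_ae (coeFn_rescale c hr f),
        lintegral_ext_rescale c hr hl hi]
      refine hi.congr ?_
      filter_upwards [coeFn_rescale c hr f] with η hη
      rw [hη]
    rw [← ofReal_norm, ← ofReal_norm, ← ENNReal.ofReal_pow (norm_nonneg _),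
      ← ENNReal.ofReal_pow (norm_nonneg _),
      ENNReal.ofReal_eq_ofReal_iff (by positivity) (by positivity)] at e
    exact (pow_left_inj₀ (norm_nonneg _) (norm_nonneg _) (by norm_num)).1 e
  have t1 := ((extOp (l * c) (l * r) h).continuous.tendsto _).comp
    (tendsto_rescale c hr (tendsto_truncFreq g)) |>.norm
  have t2 := ((extOp 0 1 (Or.inr one_ne_zero)).continuous.tendsto _).comp
    (tendsto_truncFreq g) |>.norm
  refine tendsto_nhds_unique t1 (t2.congr fun n => ?_)
  refine (hcase _ ?_).symm
  exact (integrable_weight_mul_cutoff 0 1 (Lp.memLp g) n).congr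
    ((coeFn_truncFreq n g).mono fun η hη => by simp only [hη])

/-- The optimal constant of the quartic extension operator. -/
noncomputable def quarticNorm : ℝ := ‖extOp 0 1 (Or.inr one_ne_zero)‖

/-- Every `extOp 1 e` with `e ≠ 0` is conjugate to the quartic operator by isometries. -/
lemma norm_extOp_one_le {e : ℝ} (he : e ≠ 0) (ψ : FreqSpace) :
    ‖extOp 1 e (Or.inl one_ne_zero) ψ‖ ≤ quarticNorm * ‖ψ‖ := by
  have h1 := norm_extOp_rescale (1 / e) one_pos he (Or.inr (by simpa using he))
    (rescale (-(1 / e)) one_pos ψ)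
  have h2 : e * (1 / e) = 1 := by field_simp
  rw [rescale_rescale_neg] at h1
  simp only [h2, mul_one] at h1
  rw [h1]
  refine ((extOp 0 1 (Or.inr one_ne_zero)).le_opNorm _).trans ?_
  rw [norm_rescale]
  rfl

/-- `bumpProfile` as an element of `L²`. -/
lemma memLp_bumpProfile : MemLp (fun x => (bumpProfile x : ℂ)) 2 := by
  refine ⟨(Complex.continuous_ofReal.comp continuous_bumpProfile).aestronglyMeasurable, ?_⟩
  refine (ENNReal.pow_lt_top_iff (n := 2)).1 ?_ |>.resolve_right (by norm_num)
  rw [eLpNorm_two_sq]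
  refine lt_of_le_of_lt ?_ (ENNReal.ofReal_lt_top (r := 4 * 1))
  refine le_trans (le_of_eq ?_) (lintegral_bumpProfile_sq_le one_pos 0)
  refine lintegral_congr fun x => ?_
  rw [← ofReal_norm, Complex.norm_real, Real.norm_of_nonneg (bumpProfile_pos x).le, sub_zero,
    div_one]

lemma ofReal_norm_inner_bumpProfile {f : FreqSpace} (hf : ∀ᵐ x, f x = (‖f x‖ : ℂ)) :
    ENNReal.ofReal ‖(inner ℂ (memLp_bumpProfile.toLp _) f : ℂ)‖ =
      ∫⁻ x, ‖f x‖ₑ * ENNReal.ofReal (bumpProfile x) := by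
  have h1 : (inner ℂ (memLp_bumpProfile.toLp _) f : ℂ) = ((∫ x, ‖f x‖ * bumpProfile x : ℝ) : ℂ) := by
    rw [L2.inner_def, ← integral_complex_ofReal]
    refine integral_congr_ae ?_
    filter_upwards [memLp_bumpProfile.coeFn_toLp, hf] with x e1 e2
    rw [e1, RCLike.inner_apply, Complex.conj_ofReal]
    rw [e2]
    simp
  have hi : Integrable fun x => ‖f x‖ * bumpProfile x := by
    have h2 := (Lp.memLp f).norm.integrable_mul memLp_bumpProfile.norm
    refine h2.congr (ae_of_all _ fun x => ?_)
    simp [Complex.norm_real, abs_of_pos (bumpProfile_pos x)]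
  rw [h1, Complex.norm_real, Real.norm_of_nonneg (integral_nonneg fun x =>
    mul_nonneg (norm_nonneg _) (bumpProfile_pos x).le),
    ofReal_integral_eq_lintegral_ofReal hi (ae_of_all _ fun x =>
      mul_nonneg (norm_nonneg _) (bumpProfile_pos x).le)]
  refine lintegral_congr fun x => ?_
  rw [ENNReal.ofReal_mul (norm_nonneg _), ofReal_norm]

lemma lintegral_rescale_bumpProfile {c r : ℝ} (hr : 0 < r) (g : FreqSpace) (d : ℝ) :
    ∫⁻ x, ‖rescale c hr g x‖ₑ * ENNReal.ofReal (bumpProfile (x - d)) =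
      ENNReal.ofReal (r ^ (1 / 2 : ℝ))⁻¹ *
        ∫⁻ x, ‖g x‖ₑ * ENNReal.ofReal (bumpProfile ((x - (c + r * d)) / r)) := by
  have hgm : Measurable g := (Lp.stronglyMeasurable g).measurable
  have hbm := continuous_bumpProfile.measurable
  calc _ = ∫⁻ η, ENNReal.ofReal (r ^ (1 / 2 : ℝ)) * (‖g (c + r * η)‖ₑ *
        ENNReal.ofReal (bumpProfile ((c + r * η - (c + r * d)) / r))) := by
        refine lintegral_congr_ae ?_
        filter_upwards [coeFn_rescale c hr g] with η hη
        rw [hη, enorm_mul, enorm_rpow_half hr, mul_assoc]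
        congr 4
        field_simp
        ring
    _ = _ := by
        rw [lintegral_const_mul' _ _ ENNReal.ofReal_ne_top,
          lintegral_comp_affine hr c (F := fun x => ‖g x‖ₑ *
            ENNReal.ofReal (bumpProfile ((x - (c + r * d)) / r))) (by fun_prop), ← mul_assoc,
          ← ENNReal.ofReal_mul (by positivity)]
        congr 2
        have h1 := rpow_half_sq hr
        have h2 : 0 < r ^ (1 / 2 : ℝ) := by positivity
        rw [← div_eq_mul_inv, div_eq_iff hr.ne', inv_mul_eq_div, eq_div_iff h2.ne', ← sq, h1]

/-- Moving the centre of the bump by a bounded amount costs a bounded factor, so that a bounded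
frequency location can be moved to the origin. -/
lemma bumpProfile_sub_le (x d : ℝ) : bumpProfile (x - d) ≤ (1 + |d|) * bumpProfile x := by
  unfold bumpProfile
  rw [mul_one_div, div_le_div_iff₀ (by positivity) (by positivity)]
  have h1 : |x| ≤ |x - d| + |d| := by
    have := abs_add_le (x - d) d
    rwa [sub_add_cancel] at this
  nlinarith [mul_nonneg (abs_nonneg d) (abs_nonneg (x - d))]

lemma rescale_absFreq_eq_norm {c r : ℝ} (hr : 0 < r) (g : FreqSpace) :
    ∀ᵐ x, rescale c hr (absFreq g) x = (‖rescale c hr (absFreq g) x‖ : ℂ) := by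
  have h1 := (quasiMeasurePreserving_affine hr.ne' c).ae (coeFn_absFreq g)
  filter_upwards [coeFn_rescale c hr (absFreq g), h1] with x e1 e2
  rw [e1, e2, norm_mul, Complex.norm_real, Complex.norm_real, norm_norm,
    Real.norm_of_nonneg (by positivity : (0 : ℝ) ≤ r ^ (1 / 2 : ℝ))]
  push_cast
  rfl

/-- A maximizing sequence that is nonnegative, together with locations and scales at which it does
not vanish; this is where the refined Strichartz estimate enters. -/
lemma exists_maximizing_sequence (hK : 0 < quarticNorm) :
    ∃ (g : ℕ → FreqSpace) (c r : ℕ → ℝ) (_ : ∀ n, 0 < r n) (A : ℝ), 0 < A ∧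
      (∀ n, ‖absFreq (g n)‖ ≤ 1) ∧
      Filter.Tendsto (fun n => ‖extOp 0 1 (Or.inr one_ne_zero) (absFreq (g n))‖) Filter.atTop
        (nhds quarticNorm) ∧
      ∀ n, ENNReal.ofReal (A * r n ^ (1 / 2 : ℝ)) ≤
        ∫⁻ x, ‖absFreq (g n) x‖ₑ * ENNReal.ofReal (bumpProfile ((x - c n) / r n)) := by
  have hex : ∀ n : ℕ, ∃ g : FreqSpace, ‖g‖ < 1 ∧
      quarticNorm * (1 - 1 / ((n : ℝ) + 2)) < ‖extOp 0 1 (Or.inr one_ne_zero) g‖ := by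
    intro n
    refine (extOp 0 1 (Or.inr one_ne_zero)).exists_lt_apply_of_lt_opNorm ?_
    have h1 : 0 < 1 / ((n : ℝ) + 2) := by positivity
    change _ < quarticNorm
    nlinarith
  choose g hg1 hgK using hex
  have hgK' : ∀ n : ℕ, quarticNorm * (1 - 1 / ((n : ℝ) + 2)) ≤
      ‖extOp 0 1 (Or.inr one_ne_zero) (absFreq (g n))‖ := fun n =>
    (hgK n).le.trans (norm_extOp_le_absFreq 0 1 _ _)
  have habs : ∀ n, ‖absFreq (g n)‖ ≤ 1 := fun n => by rw [norm_absFreq]; exact (hg1 n).le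
  obtain ⟨A, hA0, hA⟩ : ∃ A : ℝ, 0 < A ∧ refinedConst * ENNReal.ofReal A ^ (1 / 2 : ℝ) <
      ENNReal.ofReal (quarticNorm / 2) ^ 6 := by
    have h1 : Filter.Tendsto (fun a : ℝ => refinedConst * ENNReal.ofReal a ^ (1 / 2 : ℝ))
        (nhdsWithin 0 (Set.Ioi 0)) (nhds 0) := by
      have h2 := (ENNReal.continuous_rpow_const (y := (1 / 2 : ℝ))).tendsto (ENNReal.ofReal 0)
        |>.comp (ENNReal.continuous_ofReal.tendsto 0)
      have h3 := ENNReal.Tendsto.const_mul (a := refinedConst) h2 (Or.inr refinedConst_ne_top)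
      rw [ENNReal.ofReal_zero, ENNReal.zero_rpow_of_pos (by norm_num), mul_zero] at h3
      exact h3.mono_left nhdsWithin_le_nhds
    have h4 := h1.eventually_lt_const (u := ENNReal.ofReal (quarticNorm / 2) ^ 6)
      (ENNReal.pow_pos (ENNReal.ofReal_pos.2 (by linarith)) 6)
    obtain ⟨A, hA⟩ := (h4.and self_mem_nhdsWithin).exists
    exact ⟨A, hA.2, hA.1⟩
  have hcr : ∀ n, ∃ c r : ℝ, 0 < r ∧ ENNReal.ofReal (A * r ^ (1 / 2 : ℝ)) ≤
      ∫⁻ x, ‖absFreq (g n) x‖ₑ * ENNReal.ofReal (bumpProfile ((x - c) / r)) := by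
    intro n
    by_contra! hcon
    have h1 := enorm_extOp_pow_le (α := 0) (β := 1) (Or.inr one_ne_zero) (habs n)
      (A := ENNReal.ofReal A) ENNReal.ofReal_ne_top (fun c r hr => by
        rw [← ENNReal.ofReal_mul hA0.le]; exact (hcon c r hr).le)
    have h2 := h1.trans_lt hA
    have h3 : quarticNorm / 2 ≤ ‖extOp 0 1 (Or.inr one_ne_zero) (absFreq (g n))‖ := by
      refine le_trans ?_ (hgK' n)
      have h4 : 1 / ((n : ℝ) + 2) ≤ 1 / 2 := by
        refine one_div_le_one_div_of_le (by norm_num) ?_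
        linarith [Nat.cast_nonneg (α := ℝ) n]
      nlinarith
    rw [← ofReal_norm] at h2
    exact absurd h2 (not_lt.2 (pow_le_pow_left' (ENNReal.ofReal_le_ofReal h3) 6))
  choose c r hr hcr using hcr
  refine ⟨g, c, r, hr, A, hA0, habs, ?_, hcr⟩
  have hlow : Filter.Tendsto (fun n : ℕ => quarticNorm * (1 - 1 / ((n : ℝ) + 2))) Filter.atTop
      (nhds quarticNorm) := by
    have h1 := (Filter.tendsto_add_atTop_iff_nat 2).2 (tendsto_const_div_atTop_nhds_zero_nat (1 : ℝ))
    have h2 := (h1.const_sub 1).const_mul quarticNorm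
    simp only [sub_zero, mul_one] at h2
    refine h2.congr fun n => ?_
    push_cast
    rfl
  refine tendsto_of_tendsto_of_tendsto_of_le_of_le hlow tendsto_const_nhds hgK' fun n => ?_
  refine ((extOp 0 1 (Or.inr one_ne_zero)).le_opNorm _).trans ?_
  change quarticNorm * _ ≤ _
  nlinarith [habs n]

/-- If the Schrödinger extension operator has strictly smaller norm than the quartic one, then the
quartic extension operator attains its norm: a maximizing sequence, renormalized to unit scale,
concentrates at bounded frequency, since otherwise its profile would saturate the quartic norm for
the Schrödinger operator. -/
theorem exists_extremizer_extOp
    (hlt : ‖extOp 1 0 (Or.inl one_ne_zero)‖ < quarticNorm) :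
    ∃ φ : FreqSpace, φ ≠ 0 ∧ ‖extOp 0 1 (Or.inr one_ne_zero) φ‖ = quarticNorm * ‖φ‖ := by
  have hK : 0 < quarticNorm := (norm_nonneg _).trans_lt hlt
  obtain ⟨g, c, r, hr, A, hA, hg1, hmax, hbump⟩ := exists_maximizing_sequence hK
  -- `d` is the distance, in units of the scale, between the centre `c'` of the rescaling and `c n`
  have hinner : ∀ (n : ℕ) (d : ℝ) (c' : ℝ), c' + r n * d = c n →
      A ≤ (1 + |d|) * ‖(inner ℂ (memLp_bumpProfile.toLp _) (rescale c' (hr n) (absFreq (g n))) : ℂ)‖ := by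
    intro n d c' hd
    have h1 := lintegral_rescale_bumpProfile (c := c') (hr n) (absFreq (g n)) d
    rw [hd] at h1
    have hrp : 0 < r n ^ (1 / 2 : ℝ) := Real.rpow_pos_of_pos (hr n) _
    have h2 : ENNReal.ofReal A ≤
        ∫⁻ x, ‖rescale c' (hr n) (absFreq (g n)) x‖ₑ * ENNReal.ofReal (bumpProfile (x - d)) := by
      rw [h1]
      refine le_trans (le_of_eq ?_) (mul_le_mul_right (hbump n) _)
      rw [← ENNReal.ofReal_mul (by positivity)]
      congr 1
      field_simp
    have h3 : ∫⁻ x, ‖rescale c' (hr n) (absFreq (g n)) x‖ₑ * ENNReal.ofReal (bumpProfile (x - d)) ≤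
        ENNReal.ofReal (1 + |d|) * ∫⁻ x, ‖rescale c' (hr n) (absFreq (g n)) x‖ₑ *
          ENNReal.ofReal (bumpProfile x) := by
      rw [← lintegral_const_mul' _ _ ENNReal.ofReal_ne_top]
      refine lintegral_mono fun x => ?_
      rw [mul_left_comm, ← ENNReal.ofReal_mul (by positivity)]
      gcongr
      exact bumpProfile_sub_le x d
    have h4 := h2.trans h3
    rw [← ofReal_norm_inner_bumpProfile (rescale_absFreq_eq_norm (hr n) (g n)),
      ← ENNReal.ofReal_mul (by positivity)] at h4
    exact (ENNReal.ofReal_le_ofReal_iff (by positivity)).1 h4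
  by_cases hdiv : Filter.Tendsto (fun n => |c n / r n|) Filter.atTop Filter.atTop
  · -- The frequency runs off to infinity relative to the scale.
    exfalso
    obtain ⟨N, hN⟩ := Filter.eventually_atTop.1 (hdiv.eventually_ge_atTop 1)
    have hc0 : ∀ n, c (n + N) ≠ 0 := by
      intro n h0
      have := hN (n + N) (by omega)
      rw [h0] at this
      norm_num at this
    set b : ℕ → ℝ := fun n => r (n + N) / c (n + N) with hb
    have hb0 : ∀ n, b n ≠ 0 := fun n => div_ne_zero (hr _).ne' (hc0 n)
    have hbinv : ∀ n, |b n| = |c (n + N) / r (n + N)|⁻¹ := fun n => by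
      rw [← abs_inv, inv_div]
    have hb1 : ∀ n, |b n| ≤ 1 := fun n => by
      rw [hbinv]; exact inv_le_one_of_one_le₀ (hN _ (by omega))
    have hblim : Filter.Tendsto b Filter.atTop (nhds 0) := by
      rw [tendsto_zero_iff_abs_tendsto_zero]
      have := ((Filter.tendsto_add_atTop_iff_nat N).2 hdiv).inv_tendsto_atTop
      exact this.congr fun n => (hbinv n).symm
    have hnorm : ∀ n, ‖extOp 1 (b n) (Or.inl one_ne_zero)
        (rescale (c (n + N)) (hr (n + N)) (absFreq (g (n + N))))‖ =
        ‖extOp 0 1 (Or.inr one_ne_zero) (absFreq (g (n + N)))‖ := by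
      intro n
      have h1 : (c (n + N))⁻¹ * c (n + N) = 1 := inv_mul_cancel₀ (hc0 n)
      have h2 : (c (n + N))⁻¹ * r (n + N) = b n := by simp only [hb, div_eq_inv_mul]
      have h3 := norm_extOp_rescale (c (n + N)) (hr (n + N)) (inv_ne_zero (hc0 n))
        (Or.inl (by rw [h1]; exact one_ne_zero)) (absFreq (g (n + N)))
      simp only [h1, h2] at h3
      exact h3
    obtain ⟨φ, hφ0, hφ⟩ := exists_saturating_of_concentrating (a := fun _ => 1) (b := b)
      (α := 1) (β := 0) (fun _ => by norm_num) hb1 tendsto_const_nhds hblim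
      (fun _ => Or.inl one_ne_zero) (Or.inl one_ne_zero) (fun n => isSmoothing_one (b n))
      (tendsto_extOp_one hblim) hK.le (fun n ψ => norm_extOp_one_le (hb0 n) ψ)
      (f := fun n => rescale (c (n + N)) (hr (n + N)) (absFreq (g (n + N))))
      (fun n => by rw [norm_rescale]; exact hg1 _) (κ := memLp_bumpProfile.toLp _) hA
      (fun n => by simpa using hinner (n + N) 0 (c (n + N)) (by ring))
      (((Filter.tendsto_add_atTop_iff_nat N).2 hmax).congr fun n => (hnorm n).symm)
    have h1 := (extOp 1 0 (Or.inl one_ne_zero)).le_opNorm φ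
    have h2 : 0 < ‖φ‖ := norm_pos_iff.2 hφ0
    nlinarith
  · -- Along a subsequence the location is bounded by the scale: a dilation alone suffices.
    obtain ⟨C, hC⟩ : ∃ C, ∃ᶠ n in Filter.atTop, |c n / r n| < C := by
      rw [Filter.tendsto_atTop] at hdiv
      push Not at hdiv
      obtain ⟨C, hC⟩ := hdiv
      exact ⟨C, hC.mono fun n hn => by simpa using hn⟩
    obtain ⟨ns, hns, hnsC⟩ := Filter.extraction_of_frequently_atTop hC
    have hC0 : 0 < 1 + C := by
      have := (abs_nonneg _).trans_lt (hnsC 0)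
      linarith
    have hnorm : ∀ n, ‖extOp 0 1 (Or.inr one_ne_zero)
        (rescale 0 (hr n) (absFreq (g n)))‖ =
        ‖extOp 0 1 (Or.inr one_ne_zero) (absFreq (g n))‖ := by
      intro n
      have h2 : (r n)⁻¹ * r n = 1 := inv_mul_cancel₀ (hr n).ne'
      have h3 := norm_extOp_rescale 0 (hr n) (inv_ne_zero (hr n).ne')
        (Or.inr (by rw [h2]; exact one_ne_zero)) (absFreq (g n))
      simp only [h2, mul_zero] at h3
      exact h3
    obtain ⟨φ, hφ0, hφ⟩ := exists_saturating_of_concentrating (a := fun _ => 0) (b := fun _ => 1)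
      (α := 0) (β := 1) (fun _ => by norm_num) (fun _ => by norm_num) tendsto_const_nhds
      tendsto_const_nhds (fun _ => Or.inr one_ne_zero) (Or.inr one_ne_zero)
      (fun _ => isSmoothing_zero_one) (fun _ => tendsto_const_nhds) hK.le
      (fun _ ψ => (extOp 0 1 (Or.inr one_ne_zero)).le_opNorm ψ)
      (f := fun k => rescale 0 (hr (ns k)) (absFreq (g (ns k))))
      (fun k => by rw [norm_rescale]; exact hg1 _) (κ := memLp_bumpProfile.toLp _)
      (A := A / (1 + C)) (by positivity)
      (fun k => by
        have hrk := (hr (ns k)).ne'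
        have h1 := hinner (ns k) (c (ns k) / r (ns k)) 0 (by field_simp; ring)
        rw [div_le_iff₀ hC0, mul_comm]
        refine h1.trans (mul_le_mul_of_nonneg_right ?_ (norm_nonneg _))
        linarith [hnsC k])
      ((hmax.comp hns.tendsto_atTop).congr fun k => (hnorm (ns k)).symm)
    exact ⟨φ, hφ0, le_antisymm ((extOp 0 1 (Or.inr one_ne_zero)).le_opNorm φ) hφ⟩

/-! ### The norm of the Schrödinger extension operator -/

lemma lintegral_radial_le {H : ℝ → ℝ≥0∞} (hH : Measurable H) :
    ∫⁻ z : ℝ × ℝ, H (z.1 ^ 2 + z.2 ^ 2) ≤ ENNReal.ofReal Real.pi * ∫⁻ y, H y := by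
  rw [← lintegral_comp_polarCoord_symm]
  have hinj : Set.InjOn (fun r : ℝ => r ^ 2) (Set.Ioi 0) := fun x hx y hy h =>
    (pow_left_inj₀ (le_of_lt hx) (le_of_lt hy) two_ne_zero).1 h
  have hsub : ∫⁻ r in Set.Ioi (0 : ℝ), ENNReal.ofReal |2 * r| * H (r ^ 2) ≤ ∫⁻ y, H y := by
    rw [← lintegral_image_eq_lintegral_abs_deriv_mul measurableSet_Ioi
      (fun r _ => ((hasDerivAt_pow 2 r).hasDerivWithinAt.congr_deriv (by ring))) hinj H]
    exact setLIntegral_le_lintegral _ _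
  have hpt : ∀ p ∈ polarCoord.target, ENNReal.ofReal p.1 •
      H ((polarCoord.symm p).1 ^ 2 + (polarCoord.symm p).2 ^ 2) =
      (1 / 2 : ℝ≥0∞) * (ENNReal.ofReal |2 * p.1| * H (p.1 ^ 2)) := by
    intro p hp
    have hp1 : 0 < p.1 := by
      rw [polarCoord_target] at hp; exact hp.1
    have e : (polarCoord.symm p).1 ^ 2 + (polarCoord.symm p).2 ^ 2 = p.1 ^ 2 := by
      simp only [polarCoord_symm_apply]
      have := Real.cos_sq_add_sin_sq p.2
      linear_combination p.1 ^ 2 * this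
    rw [e, abs_of_pos (by positivity), ENNReal.ofReal_mul (by norm_num), smul_eq_mul, ← mul_assoc,
      ← mul_assoc]
    congr 1
    rw [one_div, ENNReal.ofReal_ofNat, ENNReal.inv_mul_cancel (by simp) (by simp), one_mul]
  rw [setLIntegral_congr_fun (by
    rw [polarCoord_target]; exact measurableSet_Ioi.prod measurableSet_Ioo) hpt,
    lintegral_const_mul' _ _ (by simp), polarCoord_target, Measure.volume_eq_prod,
    ← Measure.prod_restrict, lintegral_prod _ (by fun_prop)]
  simp only [lintegral_const, Measure.restrict_apply MeasurableSet.univ, Set.univ_inter,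
    Real.volume_Ioo]
  rw [lintegral_mul_const _ (by fun_prop), sub_neg_eq_add, ← two_mul,
    ENNReal.ofReal_mul (by norm_num), ENNReal.ofReal_ofNat]
  calc _ = (1 / 2 * 2) * (ENNReal.ofReal Real.pi *
        ∫⁻ r in Set.Ioi (0 : ℝ), ENNReal.ofReal |2 * r| * H (r ^ 2)) := by ring
    _ ≤ _ := by
        rw [one_div, ENNReal.inv_mul_cancel (by simp) (by simp), one_mul]
        gcongr

/-- The sum of three points of the curve. -/
def tripleSum (α β : ℝ) (q : ℝ × ℝ × ℝ) : ℝ × ℝ :=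
  phaseCurve α β q.1 + (phaseCurve α β q.2.1 + phaseCurve α β q.2.2)

/-- The density `π / (6√3)` of the threefold convolution of the parabola measure. -/
noncomputable def parabolaDensity : ℝ := Real.pi / (6 * Real.sqrt 3)

lemma parabolaDensity_pos : 0 < parabolaDensity := by
  unfold parabolaDensity
  have := Real.pi_pos
  positivity

/-- The threefold convolution of the parabola measure is bounded by `parabolaDensity`. For a fixed sum
`σ`, the second coordinate is `2σ²` plus a positive definite quadratic form in the remaining two
variables, whose push-forward is a multiple of Lebesgue measure on a half-line. -/
lemma lintegral_tripleSum_parabola_le {F : ℝ × ℝ → ℝ≥0∞} (hF : Measurable F) :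
    ∫⁻ q, F (tripleSum 1 0 q) ≤ ENNReal.ofReal parabolaDensity * ∫⁻ p, F p := by
  have e0 : ∀ q : ℝ × ℝ × ℝ, tripleSum 1 0 q =
      (q.1 + (q.2.1 + q.2.2), 6 * (q.1 ^ 2 + q.2.1 ^ 2 + q.2.2 ^ 2)) := by
    intro q
    simp only [tripleSum, phaseCurve, phasePoly, Prod.mk_add_mk]
    congr 1
    ring
  simp_rw [e0]
  have h3 : 0 < Real.sqrt 3 := Real.sqrt_pos.2 (by norm_num)
  have h33 : Real.sqrt 3 ^ 2 = 3 := Real.sq_sqrt (by norm_num)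
  have hslice : ∀ s : ℝ, ∫⁻ v : ℝ × ℝ,
      F (s, 6 * ((s - (v.1 + v.2)) ^ 2 + v.1 ^ 2 + v.2 ^ 2)) ≤
      ENNReal.ofReal parabolaDensity * ∫⁻ y, F (s, y) := by
    intro s
    have hH : Measurable fun y => F (s, 2 * s ^ 2 + 12 * y) := by fun_prop
    calc _ = ∫⁻ v : ℝ × ℝ, F (s, 2 * s ^ 2 + 12 * ((1 / 2 * v.2 + 1 * v.1) ^ 2 +
          (Real.sqrt 3 / 2 * v.2) ^ 2)) := by
          rw [← lintegral_add_right_eq_self _ ((s / 3, s / 3) : ℝ × ℝ)]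
          refine lintegral_congr fun v => ?_
          congr 2
          simp only [Prod.fst_add, Prod.snd_add]
          linear_combination (-(3 * v.2 ^ 2)) * h33
      _ = ENNReal.ofReal (1 * (Real.sqrt 3 / 2))⁻¹ *
          ∫⁻ z : ℝ × ℝ, F (s, 2 * s ^ 2 + 12 * (z.1 ^ 2 + z.2 ^ 2)) :=
          lintegral_comp_shear one_pos (by positivity) (1 / 2)
            (F := fun z => F (s, 2 * s ^ 2 + 12 * (z.1 ^ 2 + z.2 ^ 2))) (by fun_prop)
      _ ≤ ENNReal.ofReal (1 * (Real.sqrt 3 / 2))⁻¹ * (ENNReal.ofReal Real.pi *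
          ∫⁻ y, F (s, 2 * s ^ 2 + 12 * y)) := by
          gcongr
          exact lintegral_radial_le hH
      _ = _ := by
          rw [lintegral_comp_affine (by norm_num : (0 : ℝ) < 12) (2 * s ^ 2)
            (F := fun y => F (s, y)) (by fun_prop), ← mul_assoc, ← mul_assoc,
            ← ENNReal.ofReal_mul (by positivity),
            ← ENNReal.ofReal_mul (mul_nonneg (by positivity) Real.pi_pos.le)]
          congr 2
          unfold parabolaDensity
          field_simp
          norm_num
  calc ∫⁻ q : ℝ × ℝ × ℝ, F (q.1 + (q.2.1 + q.2.2), 6 * (q.1 ^ 2 + q.2.1 ^ 2 + q.2.2 ^ 2))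
      = ∫⁻ v : ℝ × ℝ, ∫⁻ x : ℝ, F (x + (v.1 + v.2), 6 * (x ^ 2 + v.1 ^ 2 + v.2 ^ 2)) := by
        rw [Measure.volume_eq_prod, lintegral_prod_symm _ (by fun_prop)]
    _ = ∫⁻ v : ℝ × ℝ, ∫⁻ s : ℝ, F (s, 6 * ((s - (v.1 + v.2)) ^ 2 + v.1 ^ 2 + v.2 ^ 2)) := by
        refine lintegral_congr fun v => ?_
        rw [← lintegral_sub_right_eq_self _ (v.1 + v.2)]
        refine lintegral_congr fun s => ?_
        rw [sub_add_cancel]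
    _ = ∫⁻ s : ℝ, ∫⁻ v : ℝ × ℝ, F (s, 6 * ((s - (v.1 + v.2)) ^ 2 + v.1 ^ 2 + v.2 ^ 2)) :=
        lintegral_lintegral_swap (by fun_prop)
    _ ≤ ∫⁻ s : ℝ, ENNReal.ofReal parabolaDensity * ∫⁻ y, F (s, y) := lintegral_mono hslice
    _ = _ := by
        rw [lintegral_const_mul' _ _ ENNReal.ofReal_ne_top, Measure.volume_eq_prod,
          lintegral_prod _ hF.aemeasurable]

lemma map_tripleSum_parabola_le :
    (volume : Measure (ℝ × ℝ × ℝ)).map (tripleSum 1 0) ≤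
      ENNReal.ofReal parabolaDensity • (volume : Measure (ℝ × ℝ)) := by
  have hm : Measurable (tripleSum 1 0) := measurable_tripleSum 1 0
  refine Measure.le_iff.2 fun S hS => ?_
  have h1 := lintegral_tripleSum_parabola_le (F := S.indicator fun _ => 1)
    (measurable_const.indicator hS)
  rw [Measure.map_apply hm hS, Measure.smul_apply, smul_eq_mul]
  rw [lintegral_indicator_const hS, one_mul] at h1
  refine le_trans (le_of_eq ?_) h1
  rw [← one_mul (volume _), ← lintegral_indicator_const (hm hS)]
  rfl

lemma lintegral_enorm_sq_triple (g : ℝ → ℂ) (hg : Measurable g) (α β : ℝ) :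
    ∫⁻ q : ℝ × ℝ × ℝ, ‖((phaseWeight α β q.1 : ℂ) * g q.1) * (((phaseWeight α β q.2.1 : ℂ) *
      g q.2.1) * ((phaseWeight α β q.2.2 : ℂ) * g q.2.2))‖ₑ ^ 2 =
      (∫⁻ x, ‖(phaseWeight α β x : ℂ) * g x‖ₑ ^ 2) ^ 3 := by
  have hw : Measurable fun x => ‖(phaseWeight α β x : ℂ) * g x‖ₑ ^ 2 :=
    ((Complex.measurable_ofReal.comp (continuous_phaseWeight α β).measurable).mul
      hg).enorm.pow_const 2
  simp_rw [enorm_mul ((phaseWeight α β _ : ℂ) * g _), mul_pow]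
  set u : ℝ → ℝ≥0∞ := fun x => ‖(phaseWeight α β x : ℂ) * g x‖ₑ ^ 2 with hu
  have h1 : ∫⁻ p : ℝ × ℝ, u p.1 * u p.2 = (∫⁻ x, u x) * ∫⁻ x, u x :=
    lintegral_prod_mul hw.aemeasurable hw.aemeasurable
  have h2 : ∫⁻ q : ℝ × ℝ × ℝ, u q.1 * (u q.2.1 * u q.2.2) =
      (∫⁻ x, u x) * ∫⁻ p : ℝ × ℝ, u p.1 * u p.2 :=
    lintegral_prod_mul (f := u) (g := fun p : ℝ × ℝ => u p.1 * u p.2) hw.aemeasurable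
      ((hw.comp measurable_fst).mul (hw.comp measurable_snd)).aemeasurable
  rw [h2, h1]
  ring

/-- Upper bound for the Schrödinger extension operator. -/
theorem norm_extOp_schrodinger_pow_le :
    ‖extOp 1 0 (Or.inl one_ne_zero)‖ ^ 6 ≤ (2 * Real.pi) ^ 2 * parabolaDensity := by
  set C : ℝ := (2 * Real.pi) ^ 2 * parabolaDensity with hC
  have hC0 : 0 ≤ C := mul_nonneg (sq_nonneg _) parabolaDensity_pos.le
  have hcase : ∀ (g : ℝ → ℂ), Measurable g → Integrable (fun η => (phaseWeight 1 0 η : ℂ) * g η) →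
      ∫⁻ z, ‖ext 1 0 g z‖ₑ ^ 6 ≤ ENNReal.ofReal C * (∫⁻ x, ‖g x‖ₑ ^ 2) ^ 3 := by
    intro g hg hwg
    have h1 := lintegral_enorm_sq_oscInt_le (m := volume.prod (volume.prod volume))
      (measurable_tripleSum 1 0) (hwg.mul_prod (hwg.mul_prod hwg)) map_tripleSum_parabola_le
    simp_rw [← ext_cube_eq 1 0 g, enorm_pow, ← pow_mul] at h1
    have h2 := lintegral_enorm_sq_triple g hg 1 0
    simp only [Measure.volume_eq_prod] at h2
    rw [h2, ← ENNReal.ofReal_mul (sq_nonneg _)] at h1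
    simpa [phaseWeight, Measure.volume_eq_prod] using h1
  have hle : ∀ f : FreqSpace, ‖extOp 1 0 (Or.inl one_ne_zero) f‖ ^ 6 ≤ C * ‖f‖ ^ 6 := by
    intro f
    have hlim := (tendsto_extTrunc 1 0 (Or.inl one_ne_zero) f).norm.pow 6
    refine le_of_tendsto hlim (Filter.Eventually.of_forall fun n => ?_)
    have hfm : Measurable f := (Lp.stronglyMeasurable f).measurable
    have h1 := hcase _ (measurable_cutoff hfm n) (integrable_weight_mul_cutoff 1 0 (Lp.memLp f) n)
    have h2 : ‖extTrunc 1 0 (Or.inl one_ne_zero) n f‖ₑ ^ 6 ≤ ENNReal.ofReal C * (‖f‖ₑ ^ 2) ^ 3 := by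
      rw [extTrunc_apply, Lp.enorm_toLp, eLpNorm_six_pow, freq_enorm_sq]
      refine h1.trans ?_
      gcongr
      exact enorm_cutoff_le n f _
    rw [← pow_mul, ← ofReal_norm, ← ofReal_norm, ← ENNReal.ofReal_pow (norm_nonneg _),
      ← ENNReal.ofReal_pow (norm_nonneg _), ← ENNReal.ofReal_mul hC0] at h2
    exact (ENNReal.ofReal_le_ofReal_iff (by positivity)).1 h2
  have hroot : (C ^ (1 / 6 : ℝ)) ^ 6 = C := by
    rw [← Real.rpow_natCast, ← Real.rpow_mul hC0]; norm_num
  have hop : ‖extOp 1 0 (Or.inl one_ne_zero)‖ ≤ C ^ (1 / 6 : ℝ) := by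
    refine ContinuousLinearMap.opNorm_le_bound _ (by positivity) fun f => ?_
    refine le_of_pow_le_pow_left₀ (n := 6) (by norm_num) (by positivity) ?_
    rw [mul_pow, hroot]
    exact hle f
  calc _ ≤ (C ^ (1 / 6 : ℝ)) ^ 6 := by gcongr
    _ = C := hroot

/-! ### A dual lower bound for oscillatory integrals with positive amplitude -/

lemma gaussKernel_scale {δ : ℝ} (hδ : 0 < δ) (y : ℝ × ℝ) :
    gaussKernel δ (Real.sqrt δ * y.1, Real.sqrt δ * y.2) = δ⁻¹ * gaussKernel 1 y := by
  have h := Real.sq_sqrt hδ.le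
  simp only [gaussKernel, mul_pow, h]
  rw [show -(δ * y.1 ^ 2 + δ * y.2 ^ 2) / (4 * δ) = -(y.1 ^ 2 + y.2 ^ 2) / (4 * 1) by
    field_simp]
  field_simp

lemma lintegral_mul_gaussKernel_eq {G : ℝ × ℝ → ℝ≥0∞} (hG : Measurable G) {δ : ℝ} (hδ : 0 < δ)
    (w : ℝ × ℝ) :
    ∫⁻ p, G p * ENNReal.ofReal (gaussKernel δ (w - p)) =
      ∫⁻ y, G (w - (Real.sqrt δ * y.1, Real.sqrt δ * y.2)) * ENNReal.ofReal (gaussKernel 1 y) := by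
  have hsq : 0 < Real.sqrt δ := Real.sqrt_pos.2 hδ
  have hk := (continuous_gaussKernel δ).measurable
  have h1 := lintegral_sub_left_eq_self (μ := (volume : Measure (ℝ × ℝ)))
    (fun p => G p * ENNReal.ofReal (gaussKernel δ (w - p))) w
  have h2 := lintegral_comp_shear hsq hsq 0
    (F := fun y => G (w - y) * ENNReal.ofReal (gaussKernel δ y)) (by fun_prop)
  simp only [sub_sub_cancel] at h1
  simp only [zero_mul, zero_add, gaussKernel_scale hδ] at h2
  rw [← h1]
  have h3 : ∀ X : ℝ≥0∞, ENNReal.ofReal δ * (ENNReal.ofReal (Real.sqrt δ * Real.sqrt δ)⁻¹ * X) = X := by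
    intro X
    rw [← mul_assoc, ← ENNReal.ofReal_mul hδ.le, Real.mul_self_sqrt hδ.le, mul_inv_cancel₀ hδ.ne',
      ENNReal.ofReal_one, one_mul]
  rw [← h3 (∫⁻ x, _), ← h2, ← lintegral_const_mul' _ _ ENNReal.ofReal_ne_top]
  refine lintegral_congr fun y => ?_
  rw [mul_left_comm, ← ENNReal.ofReal_mul hδ.le, ← mul_assoc, mul_inv_cancel₀ hδ.ne', one_mul]

/-- Fatou's lemma for the approximate identity `gaussKernel δ`. -/
lemma le_liminf_gaussKernel {G : ℝ × ℝ → ℝ≥0∞} (hG : Measurable G) {w : ℝ × ℝ}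
    (hw : ContinuousAt G w) :
    ENNReal.ofReal ((2 * Real.pi) ^ 2) * G w ≤ Filter.liminf (fun n : ℕ =>
      ∫⁻ p, G p * ENNReal.ofReal (gaussKernel (1 / ((n : ℝ) + 1)) (w - p))) Filter.atTop := by
  have hk := (continuous_gaussKernel 1).measurable
  simp_rw [fun n : ℕ => lintegral_mul_gaussKernel_eq hG
    (by positivity : 0 < 1 / ((n : ℝ) + 1)) w]
  have hδ : Filter.Tendsto (fun n : ℕ => Real.sqrt (1 / ((n : ℝ) + 1))) Filter.atTop (nhds 0) := by
    have := (Real.continuous_sqrt.tendsto 0).comp (tendsto_one_div_add_atTop_nhds_zero_nat (𝕜 := ℝ))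
    simpa [Function.comp_def] using this
  rw [mul_comm, ← lintegral_gaussKernel one_pos, ← lintegral_const_mul _ hk.ennreal_ofReal]
  refine le_trans (lintegral_mono fun y => ?_) (lintegral_liminf_le fun n => by fun_prop)
  refine (Filter.Tendsto.liminf_eq ?_).ge
  refine ENNReal.Tendsto.mul_const ?_ (Or.inr ENNReal.ofReal_ne_top)
  refine hw.tendsto.comp ?_
  have h1 := (hδ.mul_const y.1).prodMk_nhds (hδ.mul_const y.2)
  have h2 := h1.const_sub w
  simpa [← Prod.zero_eq_mk] using h2

section Duality

variable {Ω : Type*} [MeasurableSpace Ω] {m : Measure Ω} {Φ : Ω → ℝ × ℝ}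

/-- Cauchy–Schwarz for the form with kernel `gaussKernel δ`, between the push-forward of `b dm` and the
measure `G dp`. -/
lemma lintegral_pairing_gaussKernel_le [SFinite m] (hΦ : Measurable Φ) {b : Ω → ℝ}
    (hb0 : ∀ s, 0 ≤ b s) (hb : Integrable b m) {G : ℝ × ℝ → ℝ} (hG0 : ∀ p, 0 ≤ G p)
    (hG : Integrable G) {δ : ℝ} (hδ : 0 < δ) :
    (∫⁻ q : Ω × (ℝ × ℝ), ENNReal.ofReal (b q.1) * (ENNReal.ofReal (G q.2) *
      ENNReal.ofReal (gaussKernel δ (Φ q.1 - q.2))) ∂(m.prod volume)) ^ 2 ≤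
      (∫⁻ z, ‖oscInt m Φ (fun s => (b s : ℂ)) z‖ₑ ^ 2) *
        (ENNReal.ofReal ((2 * Real.pi) ^ 2) * ∫⁻ p, ENNReal.ofReal (G p) ^ 2) := by
  have hbc : Integrable (fun s => (b s : ℂ)) m := hb.ofReal
  have hGc : Integrable (fun p => (G p : ℂ)) := hG.ofReal
  set u := oscInt m Φ (fun s => (b s : ℂ)) with hu
  set v := oscInt volume (fun p : ℝ × ℝ => p) (fun p => (G p : ℂ)) with hv
  have hum : Measurable u := (continuous_oscInt hΦ hbc).measurable
  have hvm : Measurable v := (continuous_oscInt measurable_id hGc).measurable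
  have hpair := integral_oscInt_mul_conj hΦ measurable_id hbc hGc hδ
  have hk := continuous_gaussKernel δ
  have hi : Integrable (fun q : Ω × (ℝ × ℝ) => b q.1 * G q.2 * gaussKernel δ (Φ q.1 - q.2))
      (m.prod volume) := by
    refine (hb.mul_prod hG).mul_bdd (c := Real.pi / δ) ?_ (ae_of_all _ fun q => ?_)
    · exact (hk.measurable.comp ((hΦ.comp measurable_fst).sub measurable_snd)).aestronglyMeasurable
    · rw [Real.norm_of_nonneg (gaussKernel_nonneg hδ _), gaussKernel]
      refine mul_le_of_le_one_right (div_pos Real.pi_pos hδ).le (Real.exp_le_one_iff.2 ?_)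
      exact div_nonpos_of_nonpos_of_nonneg (by
        nlinarith [sq_nonneg ((Φ q.1 - q.2).1), sq_nonneg ((Φ q.1 - q.2).2)]) (by positivity)
  have hnn : ∀ q : Ω × (ℝ × ℝ), 0 ≤ b q.1 * G q.2 * gaussKernel δ (Φ q.1 - q.2) := fun q =>
    mul_nonneg (mul_nonneg (hb0 _) (hG0 _)) (gaussKernel_nonneg hδ _)
  have e1 : ∫⁻ q : Ω × (ℝ × ℝ), ENNReal.ofReal (b q.1) * (ENNReal.ofReal (G q.2) *
      ENNReal.ofReal (gaussKernel δ (Φ q.1 - q.2))) ∂(m.prod volume) =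
      ‖∫ z, u z * (starRingEnd ℂ) (v z) * (gaussWeight δ z : ℂ)‖ₑ := by
    have e2 : ∫ z, u z * (starRingEnd ℂ) (v z) * (gaussWeight δ z : ℂ) =
        ((∫ q : Ω × (ℝ × ℝ), b q.1 * G q.2 * gaussKernel δ (Φ q.1 - q.2) ∂(m.prod volume) : ℝ) : ℂ) := by
      refine Eq.trans hpair ?_
      rw [← integral_complex_ofReal]
      refine integral_congr_ae (ae_of_all _ fun q => ?_)
      simp only [Complex.conj_ofReal, id]
      push_cast
      rfl
    rw [e2, ← ofReal_norm, Complex.norm_real, Real.norm_of_nonneg (integral_nonneg hnn),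
      ofReal_integral_eq_lintegral_ofReal hi (ae_of_all _ hnn)]
    refine lintegral_congr fun q => ?_
    rw [ENNReal.ofReal_mul (mul_nonneg (hb0 _) (hG0 _)), ENNReal.ofReal_mul (hb0 _), mul_assoc]
  have hvL : ∫⁻ z, ‖v z‖ₑ ^ 2 ≤ ENNReal.ofReal ((2 * Real.pi) ^ 2) *
      ∫⁻ p, ENNReal.ofReal (G p) ^ 2 := by
    have h1 := lintegral_enorm_sq_oscInt_le (m := (volume : Measure (ℝ × ℝ))) (h₀ := 1)
      (Φ := fun p => p) measurable_id hGc (by rw [one_smul]; exact (Measure.map_id).le)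
    rw [mul_one] at h1
    refine h1.trans (le_of_eq ?_)
    congr 1
    refine lintegral_congr fun p => ?_
    rw [← ofReal_norm, Complex.norm_real, Real.norm_of_nonneg (hG0 p)]
  rw [e1]
  have hCS : ‖∫ z, u z * (starRingEnd ℂ) (v z) * (gaussWeight δ z : ℂ)‖ₑ ≤
      (∫⁻ z, ‖u z‖ₑ ^ (2 : ℝ)) ^ (1 / 2 : ℝ) * (∫⁻ z, ‖v z‖ₑ ^ (2 : ℝ)) ^ (1 / 2 : ℝ) := by
    refine (enorm_integral_le_lintegral_enorm _).trans ?_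
    refine le_trans (lintegral_mono fun z => ?_) (ENNReal.lintegral_mul_le_Lp_mul_Lq volume
      Real.HolderConjugate.two_two hum.enorm.aemeasurable hvm.enorm.aemeasurable)
    simp only [Pi.mul_apply]
    rw [enorm_mul, enorm_mul, RCLike.enorm_conj]
    refine mul_le_of_le_one_right zero_le ?_
    rw [← ofReal_norm, Complex.norm_real, Real.norm_of_nonneg (gaussWeight_pos δ z).le,
      ENNReal.ofReal_le_one, gaussWeight]
    refine Real.exp_le_one_iff.2 ?_
    nlinarith [sq_nonneg z.1, sq_nonneg z.2, mul_nonneg hδ.le (add_nonneg (sq_nonneg z.1)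
      (sq_nonneg z.2))]
  have er : ∀ x : ℝ≥0∞, (x ^ (1 / 2 : ℝ)) ^ 2 = x := fun x => by
    rw [← ENNReal.rpow_natCast, ← ENNReal.rpow_mul]; norm_num
  have er2 : ∀ x : ℝ≥0∞, x ^ (2 : ℝ) = x ^ 2 := fun x => by
    rw [← ENNReal.rpow_natCast]; norm_num
  calc _ ≤ ((∫⁻ z, ‖u z‖ₑ ^ (2 : ℝ)) ^ (1 / 2 : ℝ) * (∫⁻ z, ‖v z‖ₑ ^ (2 : ℝ)) ^ (1 / 2 : ℝ)) ^ 2 :=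
        pow_le_pow_left' hCS 2
    _ = (∫⁻ z, ‖u z‖ₑ ^ 2) * ∫⁻ z, ‖v z‖ₑ ^ 2 := by
        rw [mul_pow, er, er]
        simp_rw [er2]
    _ ≤ _ := by gcongr

/-- Pairing with a test density: if the amplitude is nonnegative, the `L²` norm of the oscillatory
integral is bounded below by testing the push-forward of `b dm` against any nonnegative
square-integrable `G`. -/
theorem sq_lintegral_le_lintegral_oscInt [SFinite m] (hΦ : Measurable Φ) {b : Ω → ℝ}
    (hb0 : ∀ s, 0 ≤ b s) (hbm : Measurable b) (hb : Integrable b m) {G : ℝ × ℝ → ℝ}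
    (hG0 : ∀ p, 0 ≤ G p) (hGm : Measurable G) (hG : Integrable G)
    (hcont : ∀ᵐ s ∂m, ContinuousAt G (Φ s)) :
    ENNReal.ofReal ((2 * Real.pi) ^ 2) *
      (∫⁻ s, ENNReal.ofReal (b s) * ENNReal.ofReal (G (Φ s)) ∂m) ^ 2 ≤
      (∫⁻ z, ‖oscInt m Φ (fun s => (b s : ℂ)) z‖ₑ ^ 2) * ∫⁻ p, ENNReal.ofReal (G p) ^ 2 := by
  set P : ℝ≥0∞ := ENNReal.ofReal ((2 * Real.pi) ^ 2) with hP
  have hP0 : P ≠ 0 := by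
    rw [hP]; exact (ENNReal.ofReal_pos.2 (by positivity)).ne'
  have hPt : P ≠ ⊤ := ENNReal.ofReal_ne_top
  set X : ℝ≥0∞ := (∫⁻ z, ‖oscInt m Φ (fun s => (b s : ℂ)) z‖ₑ ^ 2) *
    (P * ∫⁻ p, ENNReal.ofReal (G p) ^ 2) with hX
  set I : ℕ → Ω → ℝ≥0∞ := fun n s => ENNReal.ofReal (b s) * ∫⁻ p, ENNReal.ofReal (G p) *
    ENNReal.ofReal (gaussKernel (1 / ((n : ℝ) + 1)) (Φ s - p)) with hI
  have hkm : ∀ n : ℕ, Measurable fun q : Ω × (ℝ × ℝ) =>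
      ENNReal.ofReal (G q.2) * ENNReal.ofReal (gaussKernel (1 / ((n : ℝ) + 1)) (Φ q.1 - q.2)) :=
    fun n => ((hGm.comp measurable_snd).ennreal_ofReal).mul
      (((continuous_gaussKernel _).measurable.comp
        ((hΦ.comp measurable_fst).sub measurable_snd)).ennreal_ofReal)
  have hIm : ∀ n, Measurable (I n) := fun n =>
    hbm.ennreal_ofReal.mul (hkm n).lintegral_prod_right'
  have hIX : ∀ n, ∫⁻ s, I n s ∂m ≤ X ^ (1 / 2 : ℝ) := by
    intro n
    have h1 := lintegral_pairing_gaussKernel_le hΦ hb0 hb hG0 hG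
      (by positivity : 0 < 1 / ((n : ℝ) + 1))
    rw [lintegral_prod _ (by
      exact ((hbm.comp measurable_fst).ennreal_ofReal.mul (hkm n)).aemeasurable)] at h1
    have h2 : ∀ s, ∫⁻ p, ENNReal.ofReal (b s) * (ENNReal.ofReal (G p) *
        ENNReal.ofReal (gaussKernel (1 / ((n : ℝ) + 1)) (Φ s - p))) = I n s := fun s => by
      rw [lintegral_const_mul' _ _ ENNReal.ofReal_ne_top]
    simp_rw [h2] at h1
    rw [one_div, ENNReal.le_rpow_inv_iff (by norm_num), show (2 : ℝ) = ((2 : ℕ) : ℝ) by norm_num,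
      ENNReal.rpow_natCast]
    exact h1
  have hlow : ∫⁻ s, ENNReal.ofReal (b s) * (P * ENNReal.ofReal (G (Φ s))) ∂m ≤ X ^ (1 / 2 : ℝ) := by
    calc _ ≤ ∫⁻ s, Filter.liminf (fun n => I n s) Filter.atTop ∂m := by
          refine lintegral_mono_ae ?_
          filter_upwards [hcont] with s hs
          have h1 := le_liminf_gaussKernel (G := fun p => ENNReal.ofReal (G p)) hGm.ennreal_ofReal
            (w := Φ s) (ENNReal.continuous_ofReal.continuousAt.comp hs)
          refine le_trans (mul_le_mul_right h1 _) ?_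
          simp only [hI]
          rw [ENNReal.liminf_const_mul_of_ne_top ENNReal.ofReal_ne_top]
      _ ≤ Filter.liminf (fun n => ∫⁻ s, I n s ∂m) Filter.atTop := lintegral_liminf_le hIm
      _ ≤ _ := Filter.liminf_le_of_frequently_le' (Filter.Frequently.of_forall hIX)
  have e1 : ∫⁻ s, ENNReal.ofReal (b s) * (P * ENNReal.ofReal (G (Φ s))) ∂m =
      P * ∫⁻ s, ENNReal.ofReal (b s) * ENNReal.ofReal (G (Φ s)) ∂m := by
    rw [← lintegral_const_mul' _ _ hPt]
    refine lintegral_congr fun s => ?_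
    rw [mul_left_comm]
  rw [e1, one_div, ENNReal.le_rpow_inv_iff (by norm_num), show (2 : ℝ) = ((2 : ℕ) : ℝ) by norm_num,
    ENNReal.rpow_natCast, mul_pow, sq P, mul_assoc, hX] at hlow
  rw [mul_left_comm (∫⁻ z, ‖oscInt m Φ (fun s => (b s : ℂ)) z‖ₑ ^ 2) P] at hlow
  exact (ENNReal.mul_le_mul_iff_right hP0 hPt).1 hlow

end Duality

/-! ### Numerical bounds for the Gamma function -/

lemma Gamma_add_natCast_eq_prod {x : ℝ} (hx : 0 < x) (n : ℕ) :
    Real.Gamma (n + x) = (∏ m ∈ Finset.range n, (x + m)) * Real.Gamma x := by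
  induction n with
  | zero => simp
  | succ n ih =>
    have hne : (n : ℝ) + x ≠ 0 := by positivity
    rw [Finset.prod_range_succ, show ((n + 1 : ℕ) : ℝ) + x = n + x + 1 by push_cast; ring,
      Real.Gamma_add_one hne, ih]
    ring

/-- Log-convexity of `Γ` between `n + x`, `n + 1` and `n + 1 + x`. -/
lemma factorial_mul_rpow_le_Gamma {x : ℝ} (hx : 0 < x) (hx1 : x < 1) (n : ℕ) :
    (n.factorial : ℝ) * (n + x) ^ x ≤
      (∏ m ∈ Finset.range (n + 1), (x + m)) * Real.Gamma x := by
  have hpos : 0 < (n : ℝ) + x := by positivity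
  have hΓ := Real.Gamma_pos_of_pos hpos
  have h := Real.Gamma_mul_add_mul_le_rpow_Gamma_mul_rpow_Gamma (s := n + x + 1) (t := n + x)
    (a := 1 - x) (b := x) (by positivity) hpos (by linarith) hx (by ring)
  rw [show (1 - x) * (n + x + 1) + x * (n + x) = (n : ℝ) + 1 by ring,
    Real.Gamma_nat_eq_factorial, Real.Gamma_add_one hpos.ne',
    Real.mul_rpow hpos.le hΓ.le, mul_assoc, ← Real.rpow_add hΓ, sub_add_cancel, Real.rpow_one] at h
  rw [← Gamma_add_natCast_eq_prod hx, show ((n + 1 : ℕ) : ℝ) + x = n + x + 1 by push_cast; ring,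
    Real.Gamma_add_one hpos.ne']
  calc _ ≤ ((n : ℝ) + x) ^ (1 - x) * Real.Gamma (n + x) * (n + x) ^ x := by gcongr
    _ = ((n : ℝ) + x) ^ (1 - x + x) * Real.Gamma (n + x) := by rw [Real.rpow_add hpos]; ring
    _ = _ := by rw [sub_add_cancel, Real.rpow_one]

/-- Log-convexity of `Γ` between `n + 1`, `n + 1 + x` and `n + 2`. -/
lemma Gamma_le_factorial_mul_rpow {x : ℝ} (hx : 0 < x) (hx1 : x < 1) (n : ℕ) :
    (∏ m ∈ Finset.range (n + 1), (x + m)) * Real.Gamma x ≤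
      (n.factorial : ℝ) * (n + 1) ^ x := by
  have hpos : 0 < (n : ℝ) + 1 := by positivity
  have hΓ := Real.Gamma_pos_of_pos hpos
  have h := Real.Gamma_mul_add_mul_le_rpow_Gamma_mul_rpow_Gamma (s := (n : ℝ) + 1)
    (t := (n : ℝ) + 1 + 1) (a := 1 - x) (b := x) hpos (by positivity) (by linarith) hx (by ring)
  rw [Real.Gamma_add_one hpos.ne', Real.mul_rpow hpos.le hΓ.le, mul_left_comm,
    ← Real.rpow_add hΓ, sub_add_cancel, Real.rpow_one, Real.Gamma_nat_eq_factorial] at h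
  rw [← Gamma_add_natCast_eq_prod hx]
  refine le_trans (le_of_eq ?_) (h.trans_eq (mul_comm _ _))
  congr 1
  push_cast
  ring

lemma le_Gamma_five_div_twelve : (2.123 : ℝ) ≤ Real.Gamma (5 / 12) := by
  have h := factorial_mul_rpow_le_Gamma (x := 5 / 12) (by norm_num) (by norm_num) 63
  have h1 : (5.635 : ℝ) ≤ ((63 : ℕ) + 5 / 12 : ℝ) ^ (5 / 12 : ℝ) := by
    refine le_of_pow_le_pow_left₀ (n := 12) (by norm_num) (by positivity) ?_
    rw [← Real.rpow_natCast (_ ^ (5 / 12 : ℝ)), ← Real.rpow_mul (by positivity),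
      show (5 / 12 : ℝ) * (12 : ℕ) = (5 : ℕ) by norm_num, Real.rpow_natCast]
    norm_num
  have h2 : (0 : ℝ) < ∏ m ∈ Finset.range (63 + 1), ((5 / 12 : ℝ) + m) :=
    Finset.prod_pos fun m _ => by positivity
  refine le_of_mul_le_mul_left (le_trans ?_ h) h2
  refine le_trans ?_ (mul_le_mul_of_nonneg_left h1 (by positivity))
  norm_num [Finset.prod_range_succ, Nat.factorial]

lemma Gamma_eleven_div_twelve_le : Real.Gamma (11 / 12) ≤ (1.0563 : ℝ) := by
  have h := Gamma_le_factorial_mul_rpow (x := 11 / 12) (by norm_num) (by norm_num) 63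
  have h1 : (((63 : ℕ) : ℝ) + 1) ^ (11 / 12 : ℝ) ≤ 45.256 := by
    refine le_of_pow_le_pow_left₀ (n := 12) (by norm_num) (by norm_num) ?_
    rw [← Real.rpow_natCast (_ ^ (11 / 12 : ℝ)), ← Real.rpow_mul (by positivity),
      show (11 / 12 : ℝ) * (12 : ℕ) = (11 : ℕ) by norm_num, Real.rpow_natCast]
    norm_num
  have h2 : (0 : ℝ) < ∏ m ∈ Finset.range (63 + 1), ((11 / 12 : ℝ) + m) :=
    Finset.prod_pos fun m _ => by positivity
  refine le_of_mul_le_mul_left (h.trans ?_) h2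
  refine le_trans (mul_le_mul_of_nonneg_left h1 (by positivity)) ?_
  norm_num [Finset.prod_range_succ, Nat.factorial]

lemma Gamma_five_div_four_le : Real.Gamma (5 / 4) ≤ (0.9079 : ℝ) := by
  have h := Gamma_le_factorial_mul_rpow (x := 1 / 4) (by norm_num) (by norm_num) 63
  have h0 := Real.Gamma_add_one (s := 1 / 4) (by norm_num)
  rw [show (1 / 4 : ℝ) + 1 = 5 / 4 by norm_num] at h0
  have h1 : (((63 : ℕ) : ℝ) + 1) ^ (1 / 4 : ℝ) ≤ 2.8285 := by
    refine le_of_pow_le_pow_left₀ (n := 4) (by norm_num) (by norm_num) ?_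
    rw [← Real.rpow_natCast (_ ^ (1 / 4 : ℝ)), ← Real.rpow_mul (by positivity),
      show (1 / 4 : ℝ) * (4 : ℕ) = (1 : ℕ) by norm_num, Real.rpow_natCast]
    norm_num
  have h2 : (0 : ℝ) < ∏ m ∈ Finset.range (63 + 1), ((1 / 4 : ℝ) + m) :=
    Finset.prod_pos fun m _ => by positivity
  have h3 : Real.Gamma (1 / 4) ≤ 0.9079 * 4 := by
    refine le_of_mul_le_mul_left (h.trans ?_) h2
    refine le_trans (mul_le_mul_of_nonneg_left h1 (by positivity)) ?_
    norm_num [Finset.prod_range_succ, Nat.factorial]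
  rw [h0]
  linarith

/-! ### Moments of the trial density -/

/-- The density `|ξ|^{2/3} e^{-λξ⁴}`. -/
noncomputable def quarticWeight (l x : ℝ) : ℝ := |x| ^ (2 / 3 : ℝ) * Real.exp (-l * x ^ 4)

lemma quarticWeight_nonneg (l x : ℝ) : 0 ≤ quarticWeight l x := by
  unfold quarticWeight; positivity

lemma quarticWeight_neg (l x : ℝ) : quarticWeight l (-x) = quarticWeight l x := by
  simp [quarticWeight, abs_neg, show (-x) ^ 4 = x ^ 4 by ring]

lemma continuous_quarticWeight (l : ℝ) : Continuous (quarticWeight l) := by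
  unfold quarticWeight
  exact (continuous_abs.rpow_const fun _ => Or.inr (by norm_num)).mul (by fun_prop)

/-- The moments `∫ ξ^k |ξ|^{2/3} e^{-λξ⁴} dξ`. -/
noncomputable def quarticMoment (l : ℝ) (k : ℕ) : ℝ := ∫ x, quarticWeight l x * x ^ k

lemma integrableOn_quarticWeight_mul_pow {l : ℝ} (hl : 0 < l) (k : ℕ) :
    IntegrableOn (fun x => quarticWeight l x * x ^ k) (Set.Ioi 0) := by
  refine (integrableOn_rpow_mul_exp_neg_mul_rpow (p := 4) (s := 2 / 3 + k) (b := l)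
    (by have : (0 : ℝ) ≤ k := Nat.cast_nonneg k
        linarith) (by norm_num) hl).congr_fun (fun x hx => ?_) measurableSet_Ioi
  have hx0 : 0 < x := hx
  simp only [quarticWeight, abs_of_pos hx0]
  rw [Real.rpow_add hx0, Real.rpow_natCast, show (4 : ℝ) = ((4 : ℕ) : ℝ) by norm_num,
    Real.rpow_natCast]
  ring

lemma integrable_quarticWeight_mul_pow {l : ℝ} (hl : 0 < l) (k : ℕ) :
    Integrable (fun x => quarticWeight l x * x ^ k) := by
  have h := integrableOn_quarticWeight_mul_pow hl k
  have h2 : IntegrableOn (fun x => quarticWeight l x * x ^ k) (Set.Iic 0) := by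
    rw [integrableOn_Iic_iff_integrableOn_Iio]
    have h3 : IntegrableOn (fun x => quarticWeight l (-x) * (-x) ^ k) (Set.Iio 0) :=
      IntegrableOn.comp_neg_Iio (f := fun x => quarticWeight l x * x ^ k) (c := 0)
        (by rw [neg_zero]; exact h)
    rcases k.even_or_odd with hk | hk
    · simpa only [quarticWeight_neg, hk.neg_pow] using h3
    · refine h3.neg.congr (ae_of_all _ fun x => ?_)
      simp only [Pi.neg_apply, quarticWeight_neg, hk.neg_pow, mul_neg, neg_neg]
  rw [← integrableOn_univ, ← Set.Iic_union_Ioi (a := (0 : ℝ))]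
  exact h2.union h

lemma quarticMoment_odd (l : ℝ) {k : ℕ} (hk : Odd k) : quarticMoment l k = 0 := by
  have h : quarticMoment l k = -quarticMoment l k := by
    conv_lhs => rw [quarticMoment, ← integral_neg_eq_self]
    rw [quarticMoment, ← integral_neg]
    refine integral_congr_ae (ae_of_all _ fun x => ?_)
    simp only [quarticWeight_neg, hk.neg_pow, mul_neg]
  linarith

lemma quarticMoment_even {l : ℝ} (hl : 0 < l) {k : ℕ} (hk : Even k) :
    quarticMoment l k = l ^ (-((5 / 3 + k) / 4 : ℝ)) * (1 / 2) * Real.Gamma ((5 / 3 + k) / 4) := by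
  have hk0 : (0 : ℝ) ≤ k := Nat.cast_nonneg k
  have h1 : quarticMoment l k = ∫ x, (fun y => quarticWeight l y * y ^ k) |x| := by
    refine integral_congr_ae (ae_of_all _ fun x => ?_)
    simp only [hk.pow_abs]
    rcases abs_choice x with h | h <;> rw [h]
    rw [quarticWeight_neg]
  rw [h1, integral_comp_abs (f := fun y => quarticWeight l y * y ^ k)]
  have h2 := integral_rpow_mul_exp_neg_mul_rpow (p := 4) (q := 2 / 3 + k) (b := l)
    (by norm_num) (by linarith) hl
  have h3 : ∫ x in Set.Ioi (0 : ℝ), quarticWeight l x * x ^ k =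
      ∫ x in Set.Ioi (0 : ℝ), x ^ (2 / 3 + (k : ℝ)) * Real.exp (-l * x ^ (4 : ℝ)) := by
    refine setIntegral_congr_fun measurableSet_Ioi fun x hx => ?_
    have hx0 : 0 < x := hx
    simp only [quarticWeight, abs_of_pos hx0]
    rw [Real.rpow_add hx0, Real.rpow_natCast, show (4 : ℝ) = ((4 : ℕ) : ℝ) by norm_num,
      Real.rpow_natCast]
    ring
  rw [h3, h2, show -(2 / 3 + (k : ℝ) + 1) / 4 = -((5 / 3 + k) / 4) by ring,
    show (2 / 3 + (k : ℝ) + 1) / 4 = (5 / 3 + k) / 4 by ring]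
  ring

/-- Binomial expansion of the moments of a sum of independent variables. -/
lemma integrable_prod_mul_add_pow {Ω : Type*} [MeasurableSpace Ω] {m : Measure Ω} [SFinite m]
    {f : ℝ → ℝ} (hf : ∀ j : ℕ, Integrable fun x => f x * x ^ j) {F S : Ω → ℝ}
    (hF : ∀ j : ℕ, Integrable (fun s => F s * S s ^ j) m) (k : ℕ) :
    Integrable (fun q : ℝ × Ω => f q.1 * F q.2 * (q.1 + S q.2) ^ k) (volume.prod m) ∧
    ∫ q : ℝ × Ω, f q.1 * F q.2 * (q.1 + S q.2) ^ k ∂(volume.prod m) =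
      ∑ j ∈ Finset.range (k + 1), (k.choose j : ℝ) * ((∫ x, f x * x ^ j) *
        ∫ s, F s * S s ^ (k - j) ∂m) := by
  have hj : ∀ j ∈ Finset.range (k + 1), Integrable (fun q : ℝ × Ω =>
      (k.choose j : ℝ) * ((f q.1 * q.1 ^ j) * (F q.2 * S q.2 ^ (k - j)))) (volume.prod m) :=
    fun j _ => ((hf j).mul_prod (hF (k - j))).const_mul _
  have e : ∀ q : ℝ × Ω, f q.1 * F q.2 * (q.1 + S q.2) ^ k = ∑ j ∈ Finset.range (k + 1),
      (k.choose j : ℝ) * ((f q.1 * q.1 ^ j) * (F q.2 * S q.2 ^ (k - j))) := fun q => by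
    rw [add_pow, Finset.mul_sum]
    exact Finset.sum_congr rfl fun j _ => by ring
  simp_rw [e]
  refine ⟨integrable_finsetSum _ hj, ?_⟩
  rw [integral_finsetSum _ hj]
  refine Finset.sum_congr rfl fun j _ => ?_
  rw [integral_const_mul]
  congr 1
  exact integral_prod_mul (μ := (volume : Measure ℝ)) (ν := m) (fun x => f x * x ^ j)
    fun s => F s * S s ^ (k - j)

/-- The threefold product density `∏ |qᵢ|^{2/3} e^{-λqᵢ⁴}`. -/
noncomputable def tripleWeight (l : ℝ) (q : ℝ × ℝ × ℝ) : ℝ :=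
  quarticWeight l q.1 * (quarticWeight l q.2.1 * quarticWeight l q.2.2)

lemma tripleWeight_nonneg (l : ℝ) (q : ℝ × ℝ × ℝ) : 0 ≤ tripleWeight l q :=
  mul_nonneg (quarticWeight_nonneg _ _) (mul_nonneg (quarticWeight_nonneg _ _)
    (quarticWeight_nonneg _ _))

lemma tripleWeight_moment {l : ℝ} (hl : 0 < l) (k : ℕ) :
    Integrable (fun q : ℝ × ℝ × ℝ => tripleWeight l q * (q.1 + (q.2.1 + q.2.2)) ^ k) ∧
    ∫ q : ℝ × ℝ × ℝ, tripleWeight l q * (q.1 + (q.2.1 + q.2.2)) ^ k =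
      ∑ j ∈ Finset.range (k + 1), (k.choose j : ℝ) * (quarticMoment l j *
        ∑ i ∈ Finset.range (k - j + 1), ((k - j).choose i : ℝ) *
          (quarticMoment l i * quarticMoment l (k - j - i))) := by
  have hf := integrable_quarticWeight_mul_pow hl
  have h2 := fun j => integrable_prod_mul_add_pow (m := (volume : Measure ℝ)) hf (S := id) hf j
  have h3 := integrable_prod_mul_add_pow (m := (volume : Measure ℝ).prod (volume : Measure ℝ)) hf
    (F := fun p => quarticWeight l p.1 * quarticWeight l p.2) (S := fun p => p.1 + p.2)
    (fun j => (h2 j).1) k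
  refine ⟨h3.1, h3.2.trans ?_⟩
  refine Finset.sum_congr rfl fun j _ => ?_
  congr 2
  exact (h2 (k - j)).2

/-- `½Γ(5/12)`, the mass of `|ξ|^{2/3} e^{-ξ⁴}`. -/
noncomputable def gammaMass : ℝ := 1 / 2 * Real.Gamma (5 / 12)

/-- `½Γ(11/12)`, the second moment of `|ξ|^{2/3} e^{-ξ⁴}`. -/
noncomputable def gammaSecond : ℝ := 1 / 2 * Real.Gamma (11 / 12)

lemma quarticMoment_zero {l : ℝ} (hl : 0 < l) :
    quarticMoment l 0 = l ^ (-(5 / 12) : ℝ) * gammaMass := by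
  rw [quarticMoment_even hl (by decide), gammaMass]
  norm_num [mul_assoc]

lemma quarticMoment_two {l : ℝ} (hl : 0 < l) :
    quarticMoment l 2 = l ^ (-(11 / 12) : ℝ) * gammaSecond := by
  rw [quarticMoment_even hl (by decide), gammaSecond]
  norm_num [mul_assoc]

lemma quarticMoment_add_four {l : ℝ} (hl : 0 < l) {k : ℕ} (hk : Even k) :
    quarticMoment l (k + 4) = (5 / 3 + k) / 4 * l⁻¹ * quarticMoment l k := by
  have hk0 : (0 : ℝ) ≤ k := Nat.cast_nonneg k
  rw [quarticMoment_even hl hk, quarticMoment_even hl (hk.add (by decide)),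
    show ((5 / 3 + ((k + 4 : ℕ) : ℝ)) / 4) = (5 / 3 + k) / 4 + 1 by push_cast; ring,
    Real.Gamma_add_one (by positivity), neg_add, Real.rpow_add hl, Real.rpow_neg_one]
  ring

lemma tripleWeight_moment_zero {l : ℝ} (hl : 0 < l) :
    ∫ q : ℝ × ℝ × ℝ, tripleWeight l q = l ^ (-(5 / 4) : ℝ) * gammaMass ^ 3 := by
  have h := (tripleWeight_moment hl 0).2
  simp only [pow_zero, mul_one] at h
  rw [h]
  simp only [zero_add, Finset.sum_range_one, Nat.choose_self, Nat.cast_one, one_mul, Nat.sub_self,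
    quarticMoment_zero hl]
  rw [show (-(5 / 4) : ℝ) = -(5 / 12) + -(5 / 12) + -(5 / 12) by norm_num, Real.rpow_add hl,
    Real.rpow_add hl]
  ring

lemma tripleWeight_moment_four {l : ℝ} (hl : 0 < l) :
    ∫ q : ℝ × ℝ × ℝ, tripleWeight l q * (q.1 + (q.2.1 + q.2.2)) ^ 4 =
      l ^ (-(9 / 4) : ℝ) * (5 / 4 * gammaMass ^ 3 + 18 * gammaMass * gammaSecond ^ 2) := by
  have h1 := quarticMoment_odd l (k := 1) (by decide)
  have h3 := quarticMoment_odd l (k := 3) (by decide)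
  have h4 := quarticMoment_add_four hl (k := 0) (by decide)
  rw [(tripleWeight_moment hl 4).2]
  norm_num [Finset.sum_range_succ, Nat.choose, h1, h3] at h4 ⊢
  rw [h4, quarticMoment_zero hl, quarticMoment_two hl]
  have e1 : l ^ (-(9 / 4) : ℝ) = l⁻¹ * (l ^ (-(5 / 12) : ℝ)) ^ 3 := by
    rw [← Real.rpow_neg_one, ← Real.rpow_natCast, ← Real.rpow_mul hl.le, ← Real.rpow_add hl]
    norm_num
  have e2 : l ^ (-(9 / 4) : ℝ) = l ^ (-(5 / 12) : ℝ) * (l ^ (-(11 / 12) : ℝ)) ^ 2 := by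
    rw [← Real.rpow_natCast, ← Real.rpow_mul hl.le, ← Real.rpow_add hl]
    norm_num
  linear_combination (-(5 / 4) * gammaMass ^ 3) * e1 - (18 * gammaMass * gammaSecond ^ 2) * e2

lemma tripleWeight_moment_eight {l : ℝ} (hl : 0 < l) :
    ∫ q : ℝ × ℝ × ℝ, tripleWeight l q * (q.1 + (q.2.1 + q.2.2)) ^ 8 =
      l ^ (-(13 / 4) : ℝ) * (5505 / 144 * gammaMass ^ 3 + 679 * gammaMass * gammaSecond ^ 2) := by
  have h1 := quarticMoment_odd l (k := 1) (by decide)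
  have h3 := quarticMoment_odd l (k := 3) (by decide)
  have h5 := quarticMoment_odd l (k := 5) (by decide)
  have h7 := quarticMoment_odd l (k := 7) (by decide)
  have h4 := quarticMoment_add_four hl (k := 0) (by decide)
  have h6 := quarticMoment_add_four hl (k := 2) (by decide)
  have h8 := quarticMoment_add_four hl (k := 4) (by decide)
  rw [(tripleWeight_moment hl 8).2]
  norm_num [Finset.sum_range_succ, Nat.choose, h1, h3, h5, h7] at h4 h6 h8 ⊢
  rw [h8, h6, h4, quarticMoment_zero hl, quarticMoment_two hl]
  have e1 : l ^ (-(13 / 4) : ℝ) = l⁻¹ ^ 2 * (l ^ (-(5 / 12) : ℝ)) ^ 3 := by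
    rw [← Real.rpow_neg_one, ← Real.rpow_natCast, ← Real.rpow_natCast, ← Real.rpow_mul hl.le,
      ← Real.rpow_mul hl.le, ← Real.rpow_add hl]
    norm_num
  have e2 : l ^ (-(13 / 4) : ℝ) = l⁻¹ * (l ^ (-(5 / 12) : ℝ) * (l ^ (-(11 / 12) : ℝ)) ^ 2) := by
    rw [← Real.rpow_neg_one, ← Real.rpow_natCast, ← Real.rpow_mul hl.le, ← Real.rpow_add hl,
      ← Real.rpow_add hl]
    norm_num
  linear_combination (-(5505 / 144) * gammaMass ^ 3) * e1 -
    (679 * gammaMass * gammaSecond ^ 2) * e2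

/-! ### Pairing with the dual test function -/

/-- The second coordinate `q₁⁴ + q₂⁴ + q₃⁴` of `tripleSum 0 1 q`. -/
def quarticSum (q : ℝ × ℝ × ℝ) : ℝ := q.1 ^ 4 + (q.2.1 ^ 4 + q.2.2 ^ 4)

lemma tripleSum_quartic (q : ℝ × ℝ × ℝ) :
    tripleSum 0 1 q = (q.1 + (q.2.1 + q.2.2), quarticSum q) := by
  simp only [tripleSum, phaseCurve, phasePoly, quarticSum, Prod.mk_add_mk]
  congr 1
  ring

lemma quarticSum_nonneg (q : ℝ × ℝ × ℝ) : 0 ≤ quarticSum q := by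
  unfold quarticSum; positivity

lemma pow_four_sum_le (q : ℝ × ℝ × ℝ) : (q.1 + (q.2.1 + q.2.2)) ^ 4 ≤ 27 * quarticSum q := by
  obtain ⟨x, y, z⟩ := q
  simp only [quarticSum]
  have h1 : (x + (y + z)) ^ 2 ≤ 3 * (x ^ 2 + y ^ 2 + z ^ 2) := by
    nlinarith [sq_nonneg (x - y), sq_nonneg (y - z), sq_nonneg (x - z)]
  have h2 : (x ^ 2 + y ^ 2 + z ^ 2) ^ 2 ≤ 3 * (x ^ 4 + (y ^ 4 + z ^ 4)) := by
    nlinarith [sq_nonneg (x ^ 2 - y ^ 2), sq_nonneg (y ^ 2 - z ^ 2), sq_nonneg (x ^ 2 - z ^ 2)]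
  calc (x + (y + z)) ^ 4 = ((x + (y + z)) ^ 2) ^ 2 := by ring
    _ ≤ (3 * (x ^ 2 + y ^ 2 + z ^ 2)) ^ 2 := by gcongr
    _ ≤ _ := by linarith

/-- Equality in the power mean inequality forces equal entries, so almost all triple sums lie in the
open set on which `dualTest` is continuous. -/
lemma pow_four_sum_lt {q : ℝ × ℝ × ℝ} (hq : q.1 ≠ q.2.1) :
    (q.1 + (q.2.1 + q.2.2)) ^ 4 < 27 * quarticSum q := by
  obtain ⟨x, y, z⟩ := q
  simp only [quarticSum] at hq ⊢
  have hd : 0 < (x - y) ^ 2 := sq_pos_of_ne_zero (sub_ne_zero.2 hq)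
  have h1 : (x + (y + z)) ^ 2 < 3 * (x ^ 2 + y ^ 2 + z ^ 2) := by
    nlinarith [sq_nonneg (y - z), sq_nonneg (x - z)]
  have h2 : (x ^ 2 + y ^ 2 + z ^ 2) ^ 2 ≤ 3 * (x ^ 4 + (y ^ 4 + z ^ 4)) := by
    nlinarith [sq_nonneg (x ^ 2 - y ^ 2), sq_nonneg (y ^ 2 - z ^ 2), sq_nonneg (x ^ 2 - z ^ 2)]
  calc (x + (y + z)) ^ 4 = ((x + (y + z)) ^ 2) ^ 2 := by ring
    _ < (3 * (x ^ 2 + y ^ 2 + z ^ 2)) ^ 2 := by gcongr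
    _ ≤ _ := by linarith

lemma ae_fst_ne : ∀ᵐ q : ℝ × ℝ × ℝ, q.1 ≠ q.2.1 := by
  have h2 : (volume : Measure (ℝ × ℝ)).IsAddHaarMeasure :=
    Measure.prod.instIsAddHaarMeasure volume volume
  have h3 : (volume : Measure (ℝ × ℝ × ℝ)).IsAddHaarMeasure :=
    Measure.prod.instIsAddHaarMeasure volume volume
  have h := Measure.addHaar_submodule (volume : Measure (ℝ × ℝ × ℝ))
    (LinearMap.ker (LinearMap.fst ℝ ℝ (ℝ × ℝ) -
      (LinearMap.fst ℝ ℝ ℝ).comp (LinearMap.snd ℝ ℝ (ℝ × ℝ)))) (by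
      rw [Ne, LinearMap.ker_eq_top]
      intro h
      have := LinearMap.congr_fun h (1, 0, 0)
      simp at this)
  rw [ae_iff]
  refine measure_mono_null (fun q hq => ?_) h
  simp only [ne_eq, not_not, Set.mem_ofPred_eq] at hq
  simp [hq]

lemma quarticSum_pos {q : ℝ × ℝ × ℝ} (hq : q.1 ≠ q.2.1) : 0 < quarticSum q := by
  have h := pow_four_sum_lt hq
  have : 0 ≤ (q.1 + (q.2.1 + q.2.2)) ^ 4 := by positivity
  linarith

lemma tripleWeight_add (l u : ℝ) (q : ℝ × ℝ × ℝ) :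
    tripleWeight (l + u) q = tripleWeight l q * Real.exp (-(quarticSum q * u)) := by
  have h : Real.exp (-(quarticSum q * u)) = Real.exp (-u * q.1 ^ 4) * (Real.exp (-u * q.2.1 ^ 4) *
      Real.exp (-u * q.2.2 ^ 4)) := by
    rw [← Real.exp_add, ← Real.exp_add, quarticSum]; ring_nf
  have h2 : ∀ x : ℝ, Real.exp (-(l + u) * x ^ 4) =
      Real.exp (-l * x ^ 4) * Real.exp (-u * x ^ 4) := fun x => by
    rw [← Real.exp_add]; ring_nf
  simp only [tripleWeight, quarticWeight, h, h2]
  ring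

lemma continuous_tripleWeight (l : ℝ) : Continuous (tripleWeight l) := by
  have := continuous_quarticWeight l
  unfold tripleWeight
  fun_prop

lemma continuous_quarticSum : Continuous quarticSum := by
  unfold quarticSum; fun_prop

/-- The scale-invariant ratio `(q₁+q₂+q₃)⁴ / (q₁⁴+q₂⁴+q₃⁴)`. -/
noncomputable def sumRatio (q : ℝ × ℝ × ℝ) : ℝ := (q.1 + (q.2.1 + q.2.2)) ^ 4 / quarticSum q

lemma measurable_sumRatio : Measurable sumRatio := by
  have := continuous_quarticSum.measurable
  unfold sumRatio
  fun_prop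

lemma sumRatio_nonneg (q : ℝ × ℝ × ℝ) : 0 ≤ sumRatio q :=
  div_nonneg (by positivity) (quarticSum_nonneg q)

lemma sumRatio_le (q : ℝ × ℝ × ℝ) : sumRatio q ≤ 27 :=
  div_le_of_le_mul₀ (quarticSum_nonneg q) (by norm_num) (pow_four_sum_le q)

lemma integrable_tripleWeight {l : ℝ} (hl : 0 < l) : Integrable (tripleWeight l) := by
  simpa using (tripleWeight_moment hl 0).1

lemma integrable_tripleWeight_mul_sumRatio_pow {l : ℝ} (hl : 0 < l) (n : ℕ) :
    Integrable fun q => tripleWeight l q * sumRatio q ^ n := by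
  refine (integrable_tripleWeight hl).mul_bdd (c := 27 ^ n)
    (measurable_sumRatio.pow_const n).aestronglyMeasurable (ae_of_all _ fun q => ?_)
  rw [norm_pow, Real.norm_of_nonneg (sumRatio_nonneg q)]
  exact pow_le_pow_left₀ (sumRatio_nonneg q) (sumRatio_le q) n

/-- The powers of `sumRatio` are averages over `u > 0` of the moments of `tripleWeight (l + u)`,
by `τ⁻ⁿ = Γ(n)⁻¹ ∫ uⁿ⁻¹ e^{-uτ} du`. -/
lemma lintegral_tripleWeight_mul_sumRatio_pow {l : ℝ} (hl : 0 < l) {n : ℕ} (hn : 0 < n) :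
    ∫⁻ q, ENNReal.ofReal (tripleWeight l q * sumRatio q ^ n) =
      ∫⁻ u in Set.Ioi (0 : ℝ), ENNReal.ofReal (u ^ ((n : ℝ) - 1) / Real.Gamma n *
        ∫ q : ℝ × ℝ × ℝ, tripleWeight (l + u) q * (q.1 + (q.2.1 + q.2.2)) ^ (4 * n)) := by
  have hn' : (0 : ℝ) < n := by exact_mod_cast hn
  have hΓ := Real.Gamma_pos_of_pos hn'
  have hw := (continuous_tripleWeight l).measurable
  have hs := continuous_quarticSum.measurable
  have hpt : ∀ᵐ q : ℝ × ℝ × ℝ, ENNReal.ofReal (tripleWeight l q * sumRatio q ^ n) =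
      ∫⁻ u in Set.Ioi (0 : ℝ), ENNReal.ofReal (u ^ ((n : ℝ) - 1) / Real.Gamma n *
        (tripleWeight l q * Real.exp (-(quarticSum q * u)) *
          (q.1 + (q.2.1 + q.2.2)) ^ (4 * n))) := by
    filter_upwards [ae_fst_ne] with q hq
    have hτ := quarticSum_pos hq
    have hI := Real.integral_rpow_mul_exp_neg_mul_Ioi hn' hτ
    have hint : IntegrableOn (fun t => t ^ ((n : ℝ) - 1) * Real.exp (-(quarticSum q * t)))
        (Set.Ioi 0) := by
      by_contra h
      rw [integral_undef h] at hI
      have : 0 < (1 / quarticSum q) ^ (n : ℝ) * Real.Gamma n := by positivity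
      linarith
    set c : ℝ := tripleWeight l q * (q.1 + (q.2.1 + q.2.2)) ^ (4 * n) / Real.Gamma n with hc
    have hc0 : 0 ≤ c := div_nonneg (mul_nonneg (tripleWeight_nonneg _ _)
      (by rw [pow_mul]; positivity)) hΓ.le
    have e : ∀ u, u ^ ((n : ℝ) - 1) / Real.Gamma n * (tripleWeight l q *
        Real.exp (-(quarticSum q * u)) * (q.1 + (q.2.1 + q.2.2)) ^ (4 * n)) =
        c * (u ^ ((n : ℝ) - 1) * Real.exp (-(quarticSum q * u))) := fun u => by
      rw [hc]; ring
    simp_rw [e]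
    rw [← ofReal_integral_eq_lintegral_ofReal (hint.const_mul c)
      ((ae_restrict_mem measurableSet_Ioi).mono fun u hu => mul_nonneg hc0
        (mul_nonneg (Real.rpow_nonneg (le_of_lt hu) _) (Real.exp_pos _).le)),
      integral_const_mul, hI, Real.rpow_natCast]
    congr 1
    rw [hc, sumRatio, div_pow, ← pow_mul, one_div, inv_pow]
    field_simp
  rw [lintegral_congr_ae hpt, lintegral_lintegral_swap]
  · refine setLIntegral_congr_fun measurableSet_Ioi fun u hu => ?_
    have hu0 : 0 < u := hu
    have hm := (tripleWeight_moment (add_pos hl hu0) (4 * n)).1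
    rw [← integral_const_mul, ofReal_integral_eq_lintegral_ofReal (hm.const_mul _)
      (ae_of_all _ fun q => mul_nonneg (div_nonneg (Real.rpow_nonneg hu0.le _) hΓ.le)
        (mul_nonneg (tripleWeight_nonneg _ _) (by rw [pow_mul]; positivity)))]
    simp_rw [tripleWeight_add]
  · refine Measurable.aemeasurable ?_
    unfold Function.uncurry
    fun_prop

lemma integral_Ioi_const_add_rpow {c a : ℝ} (hc : 0 < c) (ha : a < -1) :
    IntegrableOn (fun u => (c + u) ^ a) (Set.Ioi 0) ∧
    ∫ u in Set.Ioi (0 : ℝ), (c + u) ^ a = -c ^ (a + 1) / (a + 1) := by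
  refine ⟨by simpa only [add_comm] using (integrableOn_add_rpow_Ioi_of_lt (c := 0) (m := c) ha
    (show -c < 0 by linarith)), ?_⟩
  have h := (measurePreserving_add_left volume c).setIntegral_preimage_emb
    (measurableEmbedding_addLeft c) (fun u : ℝ => u ^ a) (Set.Ioi c)
  rw [Set.preimage_const_add_Ioi, sub_self, integral_Ioi_rpow_of_lt ha hc] at h
  exact h

lemma integral_tripleWeight_mul_sumRatio :
    ∫ q, tripleWeight 2 q * sumRatio q = 4 / 5 * 2 ^ (-(5 / 4) : ℝ) *
      (5 / 4 * gammaMass ^ 3 + 18 * gammaMass * gammaSecond ^ 2) := by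
  have hα : 0 < gammaMass := mul_pos (by norm_num) (Real.Gamma_pos_of_pos (by norm_num))
  have h := lintegral_tripleWeight_mul_sumRatio_pow two_pos one_pos
  obtain ⟨hi, hv⟩ := integral_Ioi_const_add_rpow (c := 2) (a := -(9 / 4)) two_pos (by norm_num)
  set K := 5 / 4 * gammaMass ^ 3 + 18 * gammaMass * gammaSecond ^ 2 with hK
  have hK0 : 0 ≤ K := by positivity
  have e : ∫⁻ u in Set.Ioi (0 : ℝ), ENNReal.ofReal (u ^ (((1 : ℕ) : ℝ) - 1) / Real.Gamma (1 : ℕ) *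
        ∫ q : ℝ × ℝ × ℝ, tripleWeight (2 + u) q * (q.1 + (q.2.1 + q.2.2)) ^ (4 * 1)) =
      ENNReal.ofReal (∫ u in Set.Ioi (0 : ℝ), (2 + u) ^ (-(9 / 4) : ℝ) * K) := by
    rw [ofReal_integral_eq_lintegral_ofReal (hi.mul_const K)
      ((ae_restrict_mem measurableSet_Ioi).mono fun u hu => mul_nonneg (Real.rpow_nonneg
        (by have : (0 : ℝ) < u := hu
            linarith) _) hK0)]
    refine setLIntegral_congr_fun measurableSet_Ioi fun u hu => ?_
    have hu0 : 0 < u := hu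
    simp only [mul_one]
    rw [tripleWeight_moment_four (by linarith : 0 < 2 + u)]
    simp [hK]
  rw [e, integral_mul_const, hv] at h
  simp only [pow_one] at h
  rw [integral_eq_lintegral_of_nonneg_ae (ae_of_all _ fun q => mul_nonneg (tripleWeight_nonneg _ _)
    (sumRatio_nonneg q)) (by simpa using
      (integrable_tripleWeight_mul_sumRatio_pow two_pos 1).aestronglyMeasurable), h,
    show (-(9 / 4) + 1 : ℝ) = -(5 / 4) by norm_num, ENNReal.toReal_ofReal]
  · ring
  · have : (0 : ℝ) ≤ 2 ^ (-(5 / 4) : ℝ) := by positivity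
    refine mul_nonneg (div_nonneg_of_nonpos (by linarith) (by norm_num)) hK0

lemma integral_tripleWeight_mul_sumRatio_sq :
    ∫ q, tripleWeight 2 q * sumRatio q ^ 2 = 16 / 45 * 2 ^ (-(5 / 4) : ℝ) *
      (5505 / 144 * gammaMass ^ 3 + 679 * gammaMass * gammaSecond ^ 2) := by
  have hα : 0 < gammaMass := mul_pos (by norm_num) (Real.Gamma_pos_of_pos (by norm_num))
  have h := lintegral_tripleWeight_mul_sumRatio_pow two_pos two_pos
  obtain ⟨hi, hv⟩ := integral_Ioi_const_add_rpow (c := 2) (a := -(9 / 4)) two_pos (by norm_num)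
  obtain ⟨hi', hv'⟩ := integral_Ioi_const_add_rpow (c := 2) (a := -(13 / 4)) two_pos (by norm_num)
  set K := 5505 / 144 * gammaMass ^ 3 + 679 * gammaMass * gammaSecond ^ 2 with hK
  have hK0 : 0 ≤ K := by positivity
  -- the factor `u` is split as `(2 + u) - 2`
  have e0 : ∀ u ∈ Set.Ioi (0 : ℝ), ((2 + u) ^ (-(9 / 4) : ℝ) - 2 * (2 + u) ^ (-(13 / 4) : ℝ)) =
      u * (2 + u) ^ (-(13 / 4) : ℝ) := fun u hu => by
    have hu0 : 0 < u := hu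
    rw [show (-(9 / 4) : ℝ) = -(13 / 4) + 1 by norm_num, Real.rpow_add (by linarith), Real.rpow_one]
    ring
  have e : ∫⁻ u in Set.Ioi (0 : ℝ), ENNReal.ofReal (u ^ (((2 : ℕ) : ℝ) - 1) / Real.Gamma (2 : ℕ) *
        ∫ q : ℝ × ℝ × ℝ, tripleWeight (2 + u) q * (q.1 + (q.2.1 + q.2.2)) ^ (4 * 2)) =
      ENNReal.ofReal (∫ u in Set.Ioi (0 : ℝ),
        ((2 + u) ^ (-(9 / 4) : ℝ) - 2 * (2 + u) ^ (-(13 / 4) : ℝ)) * K) := by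
    have hi2 : IntegrableOn (fun u : ℝ => ((2 + u) ^ (-(9 / 4) : ℝ) -
        2 * (2 + u) ^ (-(13 / 4) : ℝ)) * K) (Set.Ioi 0) :=
      (Integrable.sub hi (hi'.const_mul 2)).mul_const K
    rw [ofReal_integral_eq_lintegral_ofReal hi2
      ((ae_restrict_mem measurableSet_Ioi).mono fun u hu => by
        have hu0 : (0 : ℝ) < u := hu
        simp only [Pi.zero_apply]
        rw [e0 u hu]
        positivity)]
    refine setLIntegral_congr_fun measurableSet_Ioi fun u hu => ?_
    have hu0 : 0 < u := hu
    simp only [e0 u hu]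
    rw [tripleWeight_moment_eight (by linarith : 0 < 2 + u)]
    norm_num [hK]
    ring_nf
  rw [e, integral_mul_const, integral_sub hi (hi'.const_mul 2), integral_const_mul, hv, hv'] at h
  have e9 : (2 : ℝ) ^ (-(9 / 4) : ℝ) = 1 / 2 * 2 ^ (-(5 / 4) : ℝ) := by
    rw [show (-(9 / 4) : ℝ) = -1 + -(5 / 4) by norm_num, Real.rpow_add two_pos, Real.rpow_neg_one]
    norm_num
  rw [integral_eq_lintegral_of_nonneg_ae (ae_of_all _ fun q => mul_nonneg (tripleWeight_nonneg _ _)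
    (pow_nonneg (sumRatio_nonneg q) 2))
      (integrable_tripleWeight_mul_sumRatio_pow two_pos 2).aestronglyMeasurable, h,
    show (-(9 / 4) + 1 : ℝ) = -(5 / 4) by norm_num, show (-(13 / 4) + 1 : ℝ) = -(9 / 4) by norm_num,
    e9, ENNReal.toReal_ofReal]
  · ring
  · have h5 : (0 : ℝ) ≤ 2 ^ (-(5 / 4) : ℝ) := by positivity
    refine mul_nonneg ?_ hK0
    linarith

/-! ### The norm of the dual test function -/

/-- The substitution `ξ = τ^{1/4} s` separates the variables. -/
lemma lintegral_slab {H K : ℝ → ℝ≥0∞} (hH : Measurable H) (hK : Measurable K) :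
    ∫⁻ p : ℝ × ℝ, {p : ℝ × ℝ | p.1 ^ 4 < 27 * p.2}.indicator
      (fun p => H p.2 * K (p.1 ^ 4 / p.2)) p =
      (∫⁻ t in Set.Ioi (0 : ℝ), H t * ENNReal.ofReal (t ^ (1 / 4 : ℝ))) *
        ∫⁻ s : ℝ, {s : ℝ | s ^ 4 < 27}.indicator (fun s => K (s ^ 4)) s := by
  have hm1 : MeasurableSet {p : ℝ × ℝ | p.1 ^ 4 < 27 * p.2} :=
    measurableSet_lt (by fun_prop) (by fun_prop)
  have hm2 : MeasurableSet {s : ℝ | s ^ 4 < 27} := measurableSet_lt (by fun_prop) (by fun_prop)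
  have hm3 : Measurable fun p : ℝ × ℝ => H p.2 * K (p.1 ^ 4 / p.2) := by fun_prop
  rw [Measure.volume_eq_prod, lintegral_prod_symm _ (hm3.indicator hm1).aemeasurable,
    ← lintegral_mul_const _ (by fun_prop), ← lintegral_indicator measurableSet_Ioi]
  refine lintegral_congr fun t => ?_
  rcases le_or_gt t 0 with ht | ht
  · rw [Set.indicator_of_notMem (by simpa using ht)]
    refine (lintegral_congr fun x => ?_).trans lintegral_zero
    refine Set.indicator_of_notMem (fun h => ?_) _
    have h' : x ^ 4 < 27 * t := h
    have : 0 ≤ x ^ 4 := by positivity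
    linarith
  · rw [Set.indicator_of_mem (by exact ht)]
    have hr : 0 < t ^ (1 / 4 : ℝ) := Real.rpow_pos_of_pos ht _
    have hr4 : (t ^ (1 / 4 : ℝ)) ^ 4 = t := by
      rw [← Real.rpow_natCast, ← Real.rpow_mul ht.le]; norm_num
    have h := lintegral_comp_affine hr 0 (F := fun x => {p : ℝ × ℝ | p.1 ^ 4 < 27 * p.2}.indicator
      (fun p => H p.2 * K (p.1 ^ 4 / p.2)) (x, t))
      ((hm3.indicator hm1).comp (measurable_id.prodMk measurable_const))
    have h2 : ∀ X : ℝ≥0∞, X = ENNReal.ofReal (t ^ (1 / 4 : ℝ)) *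
        (ENNReal.ofReal (t ^ (1 / 4 : ℝ))⁻¹ * X) := fun X => by
      rw [← mul_assoc, ← ENNReal.ofReal_mul hr.le, mul_inv_cancel₀ hr.ne', ENNReal.ofReal_one,
        one_mul]
    rw [h2 (∫⁻ x : ℝ, _), ← h, mul_assoc, mul_left_comm]
    congr 1
    rw [← lintegral_const_mul _ ((by fun_prop : Measurable fun s : ℝ => K (s ^ 4)).indicator hm2)]
    refine lintegral_congr fun s => ?_
    have e : (0 + t ^ (1 / 4 : ℝ) * s) ^ 4 = t * s ^ 4 := by rw [zero_add, mul_pow, hr4]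
    by_cases hs : s ^ 4 < 27
    · rw [Set.indicator_of_mem (by
        simp only [Set.mem_ofPred_eq, e]; nlinarith), Set.indicator_of_mem (by exact hs)]
      simp only [e]
      rw [mul_div_cancel_left₀ _ ht.ne']
    · rw [Set.indicator_of_notMem (by
        simp only [Set.mem_ofPred_eq, e]; nlinarith), Set.indicator_of_notMem (by exact hs),
        mul_zero]

/-- The profile of the dual test function. Its coefficients are close to the optimal ones among
quadratic polynomials. -/
noncomputable def dualProfile (s : ℝ) : ℝ := 1 - s / 12 + s ^ 2 / 300

lemma dualProfile_pos (s : ℝ) : 0 < dualProfile s := by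
  unfold dualProfile
  nlinarith [sq_nonneg (s / 12 - 1)]

lemma continuous_dualProfile : Continuous dualProfile := by
  unfold dualProfile; fun_prop

/-- The test density `e^{-τ} (1 - s/12 + s²/300)`, `s = ξ⁴/τ`, supported on the region
`ξ⁴ < 27τ` that contains almost all sums of three points of the quartic curve. -/
noncomputable def dualTest : ℝ × ℝ → ℝ :=
  {p : ℝ × ℝ | p.1 ^ 4 < 27 * p.2}.indicator
    fun p => Real.exp (-p.2) * dualProfile (p.1 ^ 4 / p.2)

lemma dualTest_nonneg (p : ℝ × ℝ) : 0 ≤ dualTest p :=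
  Set.indicator_nonneg (fun _ _ => mul_nonneg (Real.exp_pos _).le (dualProfile_pos _).le) _

lemma measurable_dualTest : Measurable dualTest := by
  have := continuous_dualProfile.measurable
  refine Measurable.indicator (by fun_prop) (measurableSet_lt (by fun_prop) (by fun_prop))

lemma continuousAt_dualTest {p : ℝ × ℝ} (hp : p.1 ^ 4 < 27 * p.2) : ContinuousAt dualTest p := by
  have hopen : IsOpen {p : ℝ × ℝ | p.1 ^ 4 < 27 * p.2} :=
    isOpen_lt (by fun_prop) (by fun_prop)
  have hp2 : p.2 ≠ 0 := by
    rintro h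
    rw [h] at hp
    have : 0 ≤ p.1 ^ 4 := by positivity
    linarith
  have hc : ContinuousAt (fun p : ℝ × ℝ => Real.exp (-p.2) * dualProfile (p.1 ^ 4 / p.2)) p :=
    ContinuousAt.mul (by fun_prop) (continuous_dualProfile.continuousAt.comp
      (ContinuousAt.div (by fun_prop) (by fun_prop) hp2))
  refine hc.congr ?_
  filter_upwards [hopen.mem_nhds hp] with x hx
  exact (Set.indicator_of_mem (s := {p : ℝ × ℝ | p.1 ^ 4 < 27 * p.2}) hx
    (fun p => Real.exp (-p.2) * dualProfile (p.1 ^ 4 / p.2))).symm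

lemma lintegral_dualTest_pow (n : ℕ) (hn : 0 < n) :
    ∫⁻ p, ENNReal.ofReal (dualTest p) ^ n =
      ENNReal.ofReal ((1 / n : ℝ) ^ (5 / 4 : ℝ) * Real.Gamma (5 / 4)) *
        ENNReal.ofReal (∫ s in -((27 : ℝ) ^ (1 / 4 : ℝ))..(27 : ℝ) ^ (1 / 4 : ℝ),
          dualProfile (s ^ 4) ^ n) := by
  have hn' : (0 : ℝ) < n := by exact_mod_cast hn
  have hcont := continuous_dualProfile
  have h := lintegral_slab (H := fun t => ENNReal.ofReal (Real.exp (-(n * t))))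
    (K := fun s => ENNReal.ofReal (dualProfile s ^ n)) (by fun_prop)
    (hcont.measurable.pow_const n).ennreal_ofReal
  have e1 : ∀ p : ℝ × ℝ, {p : ℝ × ℝ | p.1 ^ 4 < 27 * p.2}.indicator
      (fun p => ENNReal.ofReal (Real.exp (-(n * p.2))) *
        ENNReal.ofReal (dualProfile (p.1 ^ 4 / p.2) ^ n)) p = ENNReal.ofReal (dualTest p) ^ n := by
    intro p
    by_cases hp : p ∈ {p : ℝ × ℝ | p.1 ^ 4 < 27 * p.2}
    · rw [dualTest, Set.indicator_of_mem hp, Set.indicator_of_mem hp,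
        ← ENNReal.ofReal_pow (mul_nonneg (Real.exp_pos _).le (dualProfile_pos _).le), mul_pow,
        ← Real.exp_nat_mul, ENNReal.ofReal_mul (Real.exp_pos _).le, mul_neg]
    · rw [dualTest, Set.indicator_of_notMem hp, Set.indicator_of_notMem hp, ENNReal.ofReal_zero,
        zero_pow hn.ne']
  simp_rw [e1] at h
  rw [h]
  congr 1
  · have hI := Real.integral_rpow_mul_exp_neg_mul_Ioi (a := 5 / 4) (by norm_num) hn'
    have hint : IntegrableOn (fun t => t ^ ((5 / 4 : ℝ) - 1) * Real.exp (-(n * t))) (Set.Ioi 0) := by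
      by_contra h
      rw [integral_undef h] at hI
      have h5 := Real.Gamma_pos_of_pos (by norm_num : (0 : ℝ) < 5 / 4)
      have : 0 < (1 / n : ℝ) ^ (5 / 4 : ℝ) * Real.Gamma (5 / 4) := by positivity
      linarith
    rw [← hI, ofReal_integral_eq_lintegral_ofReal hint
      ((ae_restrict_mem measurableSet_Ioi).mono fun u hu => mul_nonneg
        (Real.rpow_nonneg (le_of_lt hu) _) (Real.exp_pos _).le)]
    refine setLIntegral_congr_fun measurableSet_Ioi fun t ht => ?_
    rw [← ENNReal.ofReal_mul (Real.exp_pos _).le, mul_comm]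
    norm_num
  · set r : ℝ := (27 : ℝ) ^ (1 / 4 : ℝ) with hr
    have hr0 : 0 < r := by positivity
    have hr4 : r ^ 4 = 27 := by
      rw [hr, ← Real.rpow_natCast, ← Real.rpow_mul (by norm_num)]; norm_num
    have hset : {s : ℝ | s ^ 4 < 27} = Set.Ioo (-r) r := by
      ext s
      rw [Set.mem_ofPred_eq, ← hr4, Set.mem_Ioo, ← abs_lt, ← (show Even 4 by decide).pow_abs,
        pow_lt_pow_iff_left₀ (abs_nonneg s) hr0.le (by norm_num)]
    have hc : Continuous fun s : ℝ => dualProfile (s ^ 4) ^ n := by fun_prop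
    rw [hset, lintegral_indicator measurableSet_Ioo, intervalIntegral.integral_of_le (by linarith),
      ofReal_integral_eq_lintegral_ofReal (hc.integrableOn_Ioc)
        (ae_of_all _ fun s => pow_nonneg (dualProfile_pos _).le n),
      restrict_Ioo_eq_restrict_Ioc]

lemma integrable_dualTest : Integrable dualTest := by
  refine ⟨measurable_dualTest.aestronglyMeasurable, ?_⟩
  rw [hasFiniteIntegral_iff_ofReal (ae_of_all _ dualTest_nonneg)]
  have h := lintegral_dualTest_pow 1 one_pos
  simp only [pow_one] at h
  rw [h]
  exact ENNReal.mul_lt_top ENNReal.ofReal_lt_top ENNReal.ofReal_lt_top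

lemma integral_dualProfile_sq {r : ℝ} (hr : r ^ 4 = 27) :
    ∫ s in -r..r, dualProfile (s ^ 4) ^ 2 =
      2 * r * (1 - 27 / 30 + (1 / 144 + 1 / 150) * 81 - 19683 / 23400 + 531441 / 1530000) := by
  have e : ∀ s : ℝ, dualProfile (s ^ 4) ^ 2 = 1 - 1 / 6 * s ^ 4 + (1 / 144 + 1 / 150) * s ^ 8 -
      1 / 1800 * s ^ 12 + 1 / 90000 * s ^ 16 := fun s => by
    unfold dualProfile; ring
  have h8 : r ^ 8 = 729 := by rw [show r ^ 8 = (r ^ 4) ^ 2 by ring, hr]; norm_num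
  have h12 : r ^ 12 = 19683 := by rw [show r ^ 12 = (r ^ 4) ^ 3 by ring, hr]; norm_num
  have h16 : r ^ 16 = 531441 := by rw [show r ^ 16 = (r ^ 4) ^ 4 by ring, hr]; norm_num
  have hF : ∀ x ∈ Set.uIcc (-r) r, HasDerivAt (fun s : ℝ => s - 1 / 30 * s ^ 5 +
      (1 / 144 + 1 / 150) / 9 * s ^ 9 - 1 / 23400 * s ^ 13 + 1 / 1530000 * s ^ 17)
      (dualProfile (x ^ 4) ^ 2) x := by
    intro x _
    refine (((((hasDerivAt_id x).sub ((hasDerivAt_pow 5 x).const_mul _)).add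
      ((hasDerivAt_pow 9 x).const_mul _)).sub ((hasDerivAt_pow 13 x).const_mul _)).add
      ((hasDerivAt_pow 17 x).const_mul _)).congr_deriv ?_
    rw [e]
    norm_num
    ring
  rw [intervalIntegral.integral_eq_sub_of_hasDerivAt hF
    ((by have := continuous_dualProfile
         fun_prop : Continuous fun s : ℝ => dualProfile (s ^ 4) ^ 2).intervalIntegrable _ _)]
  linear_combination (-(2 * r) / 30) * hr + 2 * r * (1 / 144 + 1 / 150) / 9 * h8 -
    2 * r / 23400 * h12 + 2 * r / 1530000 * h16

/-! ### The quartic operator beats the Schrödinger operator -/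

/-- The value of the pairing of the trial density with `dualTest`. -/
lemma integral_pairing_dualTest :
    ∫ q, tripleWeight 2 q * dualProfile (sumRatio q) = (2 : ℝ) ^ (-(5 / 4) : ℝ) *
      ((11 / 12 + 5505 / 121500) * gammaMass ^ 3 -
        (6 / 5 - 10864 / 13500) * gammaMass * gammaSecond ^ 2) := by
  have i0 := integrable_tripleWeight two_pos
  have i1 : Integrable fun q => tripleWeight 2 q * sumRatio q := by
    simpa using integrable_tripleWeight_mul_sumRatio_pow two_pos 1
  have i2 := integrable_tripleWeight_mul_sumRatio_pow two_pos 2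
  have e : ∀ q, tripleWeight 2 q * dualProfile (sumRatio q) = tripleWeight 2 q -
      1 / 12 * (tripleWeight 2 q * sumRatio q) +
      1 / 300 * (tripleWeight 2 q * sumRatio q ^ 2) := fun q => by
    unfold dualProfile; ring
  simp_rw [e]
  have s1 : Integrable fun q => tripleWeight 2 q - 1 / 12 * (tripleWeight 2 q * sumRatio q) :=
    i0.sub (i1.const_mul _)
  rw [integral_add s1 (i2.const_mul _), integral_sub i0 (i1.const_mul _), integral_const_mul,
    integral_const_mul, tripleWeight_moment_zero two_pos, integral_tripleWeight_mul_sumRatio,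
    integral_tripleWeight_mul_sumRatio_sq]
  ring

/-- The comparison of the two constants. The left side is the Schrödinger bound times the squared norm
of the dual test function and the sixth power of the norm of the trial function; the right side is
the square of their pairing; common factors are removed. -/
lemma numerical_threshold :
    parabolaDensity * (Real.Gamma (5 / 4) * (2 * (27 : ℝ) ^ (1 / 4 : ℝ) *
      (1 - 27 / 30 + (1 / 144 + 1 / 150) * 81 - 19683 / 23400 + 531441 / 1530000))) *
        gammaMass ^ 3 <
      ((11 / 12 + 5505 / 121500) * gammaMass ^ 3 -
        (6 / 5 - 10864 / 13500) * gammaMass * gammaSecond ^ 2) ^ 2 := by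
  have hα : 1.0615 ≤ gammaMass := by
    unfold gammaMass; linarith [le_Gamma_five_div_twelve]
  have hα0 : 0 < gammaMass := by linarith
  have hβ0 : 0 < gammaSecond := mul_pos (by norm_num) (Real.Gamma_pos_of_pos (by norm_num))
  have hβ : gammaSecond ≤ 0.52815 := by
    unfold gammaSecond; linarith [Gamma_eleven_div_twelve_le]
  have hβ2 : gammaSecond ^ 2 ≤ 0.52815 ^ 2 := pow_le_pow_left₀ hβ0.le hβ 2
  have h27 : (27 : ℝ) ^ (1 / 4 : ℝ) ≤ 2.2796 := by
    refine le_of_pow_le_pow_left₀ (n := 4) (by norm_num) (by norm_num) ?_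
    rw [← Real.rpow_natCast (_ ^ (1 / 4 : ℝ)), ← Real.rpow_mul (by norm_num)]
    norm_num
  have h3 : (1.73205 : ℝ) ≤ Real.sqrt 3 := Real.le_sqrt_of_sq_le (by norm_num)
  have hD : parabolaDensity ≤ 0.30231 := by
    unfold parabolaDensity
    rw [div_le_iff₀ (by positivity)]
    have := Real.pi_lt_d4
    nlinarith
  have hD0 := parabolaDensity_pos
  have hΓ := Gamma_five_div_four_le
  have hΓ0 := Real.Gamma_pos_of_pos (by norm_num : (0 : ℝ) < 5 / 4)
  have hC : parabolaDensity * (Real.Gamma (5 / 4) * (2 * (27 : ℝ) ^ (1 / 4 : ℝ) *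
      (1 - 27 / 30 + (1 / 144 + 1 / 150) * 81 - 19683 / 23400 + 531441 / 1530000))) ≤
      0.30231 * (0.9079 * (2 * 2.2796 * 0.70871)) := by
    gcongr
    norm_num
  set X := (11 / 12 + 5505 / 121500) * gammaMass ^ 2 -
      (6 / 5 - 10864 / 13500) * gammaSecond ^ 2 with hXdef
  have hX : gammaMass * 0.9172 ≤ X := by
    nlinarith [mul_nonneg (sub_nonneg.2 hα) (sub_nonneg.2 hα)]
  calc _ ≤ 0.30231 * (0.9079 * (2 * 2.2796 * 0.70871)) * gammaMass ^ 3 := by gcongr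
    _ < gammaMass ^ 2 * (gammaMass * 0.9172) ^ 2 := by
        have : 0 < gammaMass ^ 3 := by positivity
        nlinarith
    _ ≤ gammaMass ^ 2 * X ^ 2 := by gcongr
    _ = _ := by rw [hXdef]; ring

/-- The trial function `|ξ|^{1/3} e^{-ξ⁴}`. -/
noncomputable def trialFun (x : ℝ) : ℂ := ((|x| ^ (1 / 3 : ℝ) * Real.exp (-x ^ 4) : ℝ) : ℂ)

lemma continuous_trialFun : Continuous trialFun :=
  Complex.continuous_ofReal.comp ((continuous_abs.rpow_const fun _ => Or.inr (by norm_num)).mul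
    (by fun_prop))

lemma phaseWeight_mul_trialFun (x : ℝ) :
    (phaseWeight 0 1 x : ℂ) * trialFun x = (quarticWeight 1 x : ℂ) := by
  rw [trialFun, phaseWeight, quarticWeight, ← Complex.ofReal_mul, ← mul_assoc, zero_add, one_mul,
    ← Real.rpow_add_of_nonneg (abs_nonneg x) (by norm_num) (by norm_num)]
  norm_num

lemma enorm_trialFun_sq (x : ℝ) : ‖trialFun x‖ₑ ^ 2 = ENNReal.ofReal (quarticWeight 2 x) := by
  have h0 : 0 ≤ |x| ^ (1 / 3 : ℝ) * Real.exp (-x ^ 4) := by positivity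
  rw [trialFun, ← ofReal_norm, Complex.norm_real, Real.norm_of_nonneg h0, ← ENNReal.ofReal_pow h0,
    mul_pow, ← Real.rpow_natCast, ← Real.rpow_mul (abs_nonneg x), ← Real.exp_nat_mul, quarticWeight]
  congr 2
  · norm_num
  · congr 1; push_cast; ring

lemma lintegral_enorm_trialFun_sq :
    ∫⁻ x, ‖trialFun x‖ₑ ^ 2 = ENNReal.ofReal ((2 : ℝ) ^ (-(5 / 12) : ℝ) * gammaMass) := by
  have h := integrable_quarticWeight_mul_pow two_pos 0
  rw [← quarticMoment_zero two_pos, quarticMoment, ofReal_integral_eq_lintegral_ofReal h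
    (ae_of_all _ fun x => by simpa using quarticWeight_nonneg 2 x)]
  simp only [enorm_trialFun_sq, pow_zero, mul_one]

lemma memLp_trialFun : MemLp trialFun 2 := by
  refine ⟨continuous_trialFun.aestronglyMeasurable, ?_⟩
  have h := eLpNorm_two_sq (μ := volume) trialFun
  rw [lintegral_enorm_trialFun_sq] at h
  by_contra hc
  rw [not_lt, top_le_iff] at hc
  rw [hc] at h
  simp at h

/-- The quartic extension operator has a strictly larger norm than the Schrödinger extension
operator, as shown by `trialFun`. -/
theorem norm_extOp_schrodinger_lt : ‖extOp 1 0 (Or.inl one_ne_zero)‖ < quarticNorm := by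
  have hα : 0 < gammaMass := mul_pos (by norm_num) (Real.Gamma_pos_of_pos (by norm_num))
  set f : FreqSpace := memLp_trialFun.toLp trialFun with hf
  have hfae : f =ᵐ[volume] trialFun := memLp_trialFun.coeFn_toLp
  have hq1 : Integrable fun x => (quarticWeight 1 x : ℂ) := by
    have := integrable_quarticWeight_mul_pow one_pos 0
    simp only [pow_zero, mul_one] at this
    exact this.ofReal
  have hwf : Integrable fun η => (phaseWeight 0 1 η : ℂ) * f η := by
    refine hq1.congr (hfae.mono fun x hx => ?_)
    simp only [hx, phaseWeight_mul_trialFun]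
  have hnorm : ‖f‖ₑ ^ 2 = ENNReal.ofReal ((2 : ℝ) ^ (-(5 / 12) : ℝ) * gammaMass) := by
    rw [freq_enorm_sq, ← lintegral_enorm_trialFun_sq]
    exact lintegral_congr_ae (hfae.mono fun x hx => by simp only [hx])
  have hκ : ((2 : ℝ) ^ (-(5 / 12) : ℝ)) ^ 3 = 2 ^ (-(5 / 4) : ℝ) := by
    rw [← Real.rpow_natCast, ← Real.rpow_mul two_pos.le]; norm_num
  set κ : ℝ := (2 : ℝ) ^ (-(5 / 4) : ℝ) with hκdef
  have hκ0 : 0 < κ := by positivity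
  have hnorm6 : ‖f‖ ^ 6 = κ * gammaMass ^ 3 := by
    have h6 : ‖f‖ₑ ^ 6 = ENNReal.ofReal (κ * gammaMass ^ 3) := by
      rw [show (6 : ℕ) = 2 * 3 by norm_num, pow_mul, hnorm, ← ENNReal.ofReal_pow (by positivity),
        mul_pow, hκ]
    rw [← ofReal_norm, ← ENNReal.ofReal_pow (norm_nonneg _)] at h6
    exact (ENNReal.ofReal_eq_ofReal_iff (by positivity) (by positivity)).1 h6
  -- the sextic norm of the extension is the `L²` norm of an oscillatory integral over `ℝ³`
  have hext : ‖extOp 0 1 (Or.inr one_ne_zero) f‖ₑ ^ 6 =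
      ∫⁻ z, ‖oscInt volume (tripleSum 0 1) (fun q => (tripleWeight 1 q : ℂ)) z‖ₑ ^ 2 := by
    rw [enorm_extOp_pow _ f hwf]
    refine lintegral_congr fun z => ?_
    rw [ext_congr_ae hfae, show (6 : ℕ) = 3 * 2 by norm_num, pow_mul, ← enorm_pow,
      ext_cube_eq]
    simp only [phaseWeight_mul_trialFun, ← Complex.ofReal_mul]
    rfl
  -- `dualTest` jumps at the boundary of its support, which only triples on the diagonal reach
  have hdual := sq_lintegral_le_lintegral_oscInt (m := (volume : Measure (ℝ × ℝ × ℝ)))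
    (Φ := tripleSum 0 1) (measurable_tripleSum 0 1) (tripleWeight_nonneg 1) (continuous_tripleWeight 1).measurable
    (integrable_tripleWeight one_pos) dualTest_nonneg measurable_dualTest integrable_dualTest
    (ae_fst_ne.mono fun q hq => continuousAt_dualTest (by
      have := pow_four_sum_lt hq
      rw [tripleSum_quartic]
      exact this))
  -- the factor `e^{-τ}` of `dualTest` raises the exponent of the trial density from `1` to `2`
  have hpair : ∫⁻ q, ENNReal.ofReal (tripleWeight 1 q) * ENNReal.ofReal (dualTest (tripleSum 0 1 q)) =
      ENNReal.ofReal (∫ q, tripleWeight 2 q * dualProfile (sumRatio q)) := by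
    rw [ofReal_integral_eq_lintegral_ofReal]
    · refine lintegral_congr_ae (ae_fst_ne.mono fun q hq => ?_)
      have hmem : tripleSum 0 1 q ∈ {p : ℝ × ℝ | p.1 ^ 4 < 27 * p.2} := by
        rw [tripleSum_quartic]; exact pow_four_sum_lt hq
      simp only
      rw [← ENNReal.ofReal_mul (tripleWeight_nonneg 1 q), dualTest, Set.indicator_of_mem hmem,
        tripleSum_quartic, show (2 : ℝ) = 1 + 1 by norm_num, tripleWeight_add, mul_one, sumRatio,
        mul_assoc]
    · refine (integrable_tripleWeight two_pos).mul_bdd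
        (c := 1 + 27 / 12 + 27 ^ 2 / 300)
        (continuous_dualProfile.measurable.comp measurable_sumRatio).aestronglyMeasurable
        (ae_of_all _ fun q => ?_)
      rw [Real.norm_of_nonneg (dualProfile_pos _).le, dualProfile]
      have h1 := sumRatio_nonneg q
      have h2 := sumRatio_le q
      nlinarith
    · exact ae_of_all _ fun q => mul_nonneg (tripleWeight_nonneg _ _) (dualProfile_pos _).le
  have h27 : ((27 : ℝ) ^ (1 / 4 : ℝ)) ^ 4 = 27 := by
    rw [← Real.rpow_natCast, ← Real.rpow_mul (by norm_num)]; norm_num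
  have hhalf : (1 / ((2 : ℕ) : ℝ)) ^ (5 / 4 : ℝ) = κ := by
    rw [hκdef, Real.rpow_neg two_pos.le, ← Real.inv_rpow two_pos.le]; norm_num
  rw [hpair, integral_pairing_dualTest, lintegral_dualTest_pow 2 two_pos,
    integral_dualProfile_sq h27, hhalf] at hdual
  have hnum := numerical_threshold
  set N : ℝ := (1 - 27 / 30 + (1 / 144 + 1 / 150) * 81 - 19683 / 23400 + 531441 / 1530000) with hN
  set P : ℝ := (11 / 12 + 5505 / 121500) * gammaMass ^ 3 -
        (6 / 5 - 10864 / 13500) * gammaMass * gammaSecond ^ 2 with hP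
  have hP0 : 0 ≤ κ * P := by
    rw [← integral_pairing_dualTest]
    exact integral_nonneg fun q => mul_nonneg (tripleWeight_nonneg _ _) (dualProfile_pos _).le
  have hN0 : 0 < N := by rw [hN]; norm_num
  have hΓ0 := Real.Gamma_pos_of_pos (by norm_num : (0 : ℝ) < 5 / 4)
  have hdual' : (2 * Real.pi) ^ 2 * (κ * P) ^ 2 ≤ ‖extOp 0 1 (Or.inr one_ne_zero) f‖ ^ 6 *
      (κ * Real.Gamma (5 / 4) * (2 * (27 : ℝ) ^ (1 / 4 : ℝ) * N)) := by
    have h1 : ENNReal.ofReal ((2 * Real.pi) ^ 2) * ENNReal.ofReal (κ * P) ^ 2 ≤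
      ‖extOp 0 1 (Or.inr one_ne_zero) f‖ₑ ^ 6 * (ENNReal.ofReal (κ * Real.Gamma (5 / 4)) *
        ENNReal.ofReal (2 * (27 : ℝ) ^ (1 / 4 : ℝ) * N)) := by
      rw [hext]; exact hdual
    rw [← ofReal_norm, ← ENNReal.ofReal_pow (norm_nonneg _), ← ENNReal.ofReal_pow hP0,
      ← ENNReal.ofReal_mul (by positivity), ← ENNReal.ofReal_mul (by positivity),
      ← ENNReal.ofReal_mul (by positivity)] at h1
    exact (ENNReal.ofReal_le_ofReal_iff (by positivity)).1 h1
  have hop : ‖extOp 0 1 (Or.inr one_ne_zero) f‖ ^ 6 ≤ quarticNorm ^ 6 * (κ * gammaMass ^ 3) := by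
    rw [← hnorm6, ← mul_pow]
    exact pow_le_pow_left₀ (norm_nonneg _) ((extOp 0 1 (Or.inr one_ne_zero)).le_opNorm f) 6
  set S : ℝ := Real.Gamma (5 / 4) * (2 * (27 : ℝ) ^ (1 / 4 : ℝ) * N) with hS
  have hS0 : 0 < S := by positivity
  refine lt_of_pow_lt_pow_left₀ 6 (norm_nonneg _) (norm_extOp_schrodinger_pow_le.trans_lt ?_)
  have hpi : 0 < (2 * Real.pi) ^ 2 := by positivity
  refine lt_of_mul_lt_mul_right (a := κ ^ 2 * S * gammaMass ^ 3) ?_ (by positivity)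
  calc (2 * Real.pi) ^ 2 * parabolaDensity * (κ ^ 2 * S * gammaMass ^ 3)
      = (2 * Real.pi) ^ 2 * κ ^ 2 * (parabolaDensity * S * gammaMass ^ 3) := by ring
    _ < (2 * Real.pi) ^ 2 * κ ^ 2 * P ^ 2 := by gcongr
    _ = (2 * Real.pi) ^ 2 * (κ * P) ^ 2 := by ring
    _ ≤ ‖extOp 0 1 (Or.inr one_ne_zero) f‖ ^ 6 * (κ * S) := by
        refine hdual'.trans_eq ?_
        rw [hS]; ring
    _ ≤ quarticNorm ^ 6 * (κ * gammaMass ^ 3) * (κ * S) := by gcongr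
    _ = _ := by ring

/-! ### The extension operator as a distribution -/

lemma planeChar_comm (z p : ℝ × ℝ) : planeChar z p = planeChar p z := by
  simp only [planeChar, mul_comm]

/-- The adjoint extension operator: the weighted trace of the Fourier transform of `φ` on the
quartic curve. -/
noncomputable def curveTrace (φ : ℝ × ℝ → ℂ) (η : ℝ) : ℂ :=
  (phaseWeight 0 1 η : ℂ) * ∫ z, planeChar z (phaseCurve 0 1 η) * φ z

lemma exists_pairing {φ : ℝ × ℝ → ℂ} (hφ : Continuous φ) (hc : HasCompactSupport φ) :
    ∃ L : PlaneSpace →L[ℂ] ℂ, ∀ u : PlaneSpace, L u = ∫ z, u z * φ z := by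
  set q : ℝ≥0∞ := (1 - (6 : ℝ≥0∞)⁻¹)⁻¹ with hq
  have hφq : MemLp φ q := hφ.memLp_of_hasCompactSupport hc
  have : ENNReal.HolderConjugate 6 q := ENNReal.HolderConjugate.inv_one_sub_inv' (by norm_num)
  have : Fact (1 ≤ q) := by simp [q, fact_iff]
  refine ⟨((ContinuousLinearMap.mul ℂ ℂ).lpPairing volume 6 q).flip hφq.toLp, fun u => ?_⟩
  rw [ContinuousLinearMap.flip_apply, ContinuousLinearMap.lpPairing_eq_integral]
  refine integral_congr_ae (hφq.coeFn_toLp.mono fun z hz => ?_)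
  simp only [hz, ContinuousLinearMap.mul_apply']

lemma continuous_curveTrace {φ : ℝ × ℝ → ℂ} (hφ : Integrable φ) : Continuous (curveTrace φ) := by
  have h1 := (continuous_oscInt (m := volume) (Φ := fun z : ℝ × ℝ => z) measurable_id hφ).comp
    (continuous_phaseCurve 0 1)
  have h2 : Continuous fun η => (phaseWeight 0 1 η : ℂ) :=
    Complex.continuous_ofReal.comp (continuous_phaseWeight 0 1)
  refine (h2.mul h1).congr fun η => ?_
  rw [curveTrace, Pi.mul_apply, Function.comp_apply, oscInt]
  congr 1
  exact integral_congr_ae (ae_of_all _ fun z => by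
    simp only [planeChar_comm (phaseCurve 0 1 η)])

lemma integral_ext_mul {g : ℝ → ℂ} (hg : Integrable fun η => (phaseWeight 0 1 η : ℂ) * g η)
    {φ : ℝ × ℝ → ℂ} (hφ : Integrable φ) :
    ∫ z, ext 0 1 g z * φ z = ∫ η, g η * curveTrace φ η := by
  have hmc := measurable_phaseCurve 0 1
  have hint : Integrable (fun p : (ℝ × ℝ) × ℝ => planeChar p.1 (phaseCurve 0 1 p.2) *
      (φ p.1 * ((phaseWeight 0 1 p.2 : ℂ) * g p.2))) (volume.prod volume) := by
    refine (hφ.mul_prod hg).bdd_mul (c := 1) ?_ (ae_of_all _ fun p => ?_)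
    · exact (measurable_planeChar_comp measurable_fst
        (hmc.comp measurable_snd)).aestronglyMeasurable
    · exact (norm_planeChar _ _).le
  have h1 : ∀ z, ext 0 1 g z * φ z = ∫ η, planeChar z (phaseCurve 0 1 η) *
      (φ z * ((phaseWeight 0 1 η : ℂ) * g η)) := fun z => by
    rw [ext, oscInt, ← integral_mul_const]
    exact integral_congr_ae (ae_of_all _ fun η => by ring)
  simp_rw [h1]
  rw [integral_integral_swap hint]
  refine integral_congr_ae (ae_of_all _ fun η => ?_)
  simp only [curveTrace]
  rw [← mul_assoc, ← integral_const_mul]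
  exact integral_congr_ae (ae_of_all _ fun z => by ring)

/-- By duality with the Strichartz estimate, the trace on the curve is square integrable. -/
lemma memLp_curveTrace {φ : ℝ × ℝ → ℂ} (hφ : Continuous φ) (hc : HasCompactSupport φ) :
    MemLp (curveTrace φ) 2 := by
  have hφi : Integrable φ := hφ.integrable_of_hasCompactSupport hc
  have hcont := continuous_curveTrace hφi
  obtain ⟨L, hL⟩ := exists_pairing hφ hc
  set κ := curveTrace φ with hκ
  set C : ℝ := ‖L‖ * ‖extOp 0 1 (Or.inr one_ne_zero)‖ with hC
  have hC0 : 0 ≤ C := by positivity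
  have hbound : ∀ n : ℕ, ∫⁻ η, ‖cutoff n κ η‖ₑ ^ 2 ≤ ENNReal.ofReal C ^ 2 := by
    intro n
    have hm2 : MemLp (cutoff n κ) 2 := by
      refine (memLp_indicator_iff_restrict measurableSet_Icc).2 ?_
      obtain ⟨B, hB⟩ := (isCompact_Icc (a := -(n : ℝ)) (b := n)).exists_bound_of_continuousOn
        hcont.continuousOn
      exact MemLp.of_bound hcont.aestronglyMeasurable B
        ((ae_restrict_mem measurableSet_Icc).mono fun x hx => hB x hx)
    have hg2 : MemLp (fun η => (starRingEnd ℂ) (cutoff n κ η)) 2 := hm2.star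
    set f : FreqSpace := hg2.toLp with hf
    have hfae : f =ᵐ[volume] fun η => (starRingEnd ℂ) (cutoff n κ η) := hg2.coeFn_toLp
    have hfc : cutoff n f =ᵐ[volume] f := by
      filter_upwards [hfae] with x hx
      simp only [cutoff, Set.indicator] at hx ⊢
      rw [hx]
      split_ifs <;> simp
    have hwf : Integrable fun η => (phaseWeight 0 1 η : ℂ) * f η :=
      (integrable_weight_mul_cutoff 0 1 (Lp.memLp f) n).congr
        (hfc.mono fun x hx => by simp only [hx])
    have hpair : L (extOp 0 1 (Or.inr one_ne_zero) f) = ∫ η, f η * κ η := by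
      rw [hL, hκ, ← integral_ext_mul hwf hφi]
      exact integral_congr_ae ((coeFn_extOp (Or.inr one_ne_zero) f hwf).mono fun z hz => by simp only [hz])
    have hval : ∫ η, f η * κ η = ((∫ η, ‖cutoff n κ η‖ ^ 2 : ℝ) : ℂ) := by
      rw [← integral_complex_ofReal]
      refine integral_congr_ae (hfae.mono fun x hx => ?_)
      simp only [hx]
      have hxx : (starRingEnd ℂ) (cutoff n κ x) * κ x =
          (starRingEnd ℂ) (cutoff n κ x) * cutoff n κ x := by
        simp only [cutoff, Set.indicator]
        split_ifs <;> simp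
      rw [hxx, mul_comm, Complex.mul_conj, Complex.normSq_eq_norm_sq]
    have hfn : ‖f‖ ^ 2 = ∫ η, ‖cutoff n κ η‖ ^ 2 := by
      have h1 : ‖f‖ₑ ^ 2 = ENNReal.ofReal (∫ η, ‖cutoff n κ η‖ ^ 2) := by
        rw [freq_enorm_sq, ofReal_integral_eq_lintegral_ofReal (hm2.integrable_norm_pow two_ne_zero)
          (ae_of_all _ fun _ => sq_nonneg _)]
        refine lintegral_congr_ae (hfae.mono fun x hx => ?_)
        simp only [hx]
        rw [RCLike.enorm_conj, ENNReal.ofReal_pow (norm_nonneg _), ofReal_norm]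
      rw [← ofReal_norm, ← ENNReal.ofReal_pow (norm_nonneg _)] at h1
      exact (ENNReal.ofReal_eq_ofReal_iff (by positivity)
        (integral_nonneg fun _ => sq_nonneg _)).1 h1
    have hle : ‖f‖ ^ 2 ≤ C * ‖f‖ := by
      calc ‖f‖ ^ 2 = ‖L (extOp 0 1 (Or.inr one_ne_zero) f)‖ := by
            rw [hpair, hval, Complex.norm_real, ← hfn, Real.norm_of_nonneg (sq_nonneg _)]
        _ ≤ ‖L‖ * (‖extOp 0 1 (Or.inr one_ne_zero)‖ * ‖f‖) := by
            refine (L.le_opNorm _).trans ?_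
            gcongr
            exact ContinuousLinearMap.le_opNorm _ _
        _ = _ := by rw [hC]; ring
    have hle2 : ‖f‖ ≤ C := by
      rcases (norm_nonneg f).eq_or_lt with h | h
      · rw [← h]; exact hC0
      · nlinarith
    have h2 : ∫⁻ η, ‖cutoff n κ η‖ₑ ^ 2 = ‖f‖ₑ ^ 2 := by
      rw [freq_enorm_sq]
      refine lintegral_congr_ae (hfae.mono fun x hx => ?_)
      simp only [hx, RCLike.enorm_conj]
    rw [h2, ← ofReal_norm]
    gcongr
  have hlim : ∫⁻ η, ‖κ η‖ₑ ^ 2 ≤ ENNReal.ofReal C ^ 2 := by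
    refine lintegral_le_of_tendsto_ae (F := fun n η => ‖cutoff n κ η‖ₑ ^ 2)
      (fun n => (measurable_cutoff hcont.measurable n).enorm.pow_const 2 |>.aemeasurable) (ae_of_all _ fun η => ?_) hbound
    refine tendsto_const_nhds.congr' ?_
    obtain ⟨N, hN⟩ := exists_nat_ge |η|
    filter_upwards [Filter.eventually_ge_atTop N] with n hn
    have hn' : (N : ℝ) ≤ n := by exact_mod_cast hn
    rw [cutoff, Set.indicator_of_mem]
    exact abs_le.1 (hN.trans hn')
  refine ⟨hcont.aestronglyMeasurable, ?_⟩
  have h := eLpNorm_two_sq (μ := volume) κ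
  by_contra hc'
  rw [not_lt, top_le_iff] at hc'
  rw [hc'] at h
  have h3 : (⊤ : ℝ≥0∞) ^ 2 = ⊤ := by simp
  rw [h3] at h
  rw [← h] at hlim
  exact absurd hlim (by simp)

/-- The distributional form of the extension operator on all of `L²`. -/
lemma integral_extOp_mul (f : FreqSpace) {φ : ℝ × ℝ → ℂ} (hφ : Continuous φ)
    (hc : HasCompactSupport φ) :
    ∫ z, extOp 0 1 (Or.inr one_ne_zero) f z * φ z = ∫ η, f η * curveTrace φ η := by
  have hφi : Integrable φ := hφ.integrable_of_hasCompactSupport hc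
  obtain ⟨L, hL⟩ := exists_pairing hφ hc
  have hfm : Measurable f := (Lp.stronglyMeasurable f).measurable
  have hK := memLp_curveTrace hφ hc
  have hint : Integrable fun η => f η * curveTrace φ η := (Lp.memLp f).integrable_mul hK
  have h1 := (L.continuous.tendsto _).comp (tendsto_extTrunc 0 1 (Or.inr one_ne_zero) f)
  have h2 : ∀ n, L (extTrunc 0 1 (Or.inr one_ne_zero) n f) =
      ∫ η, cutoff n f η * curveTrace φ η := fun n => by
    rw [hL, ← integral_ext_mul (integrable_weight_mul_cutoff 0 1 (Lp.memLp f) n) hφi]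
    exact integral_congr_ae ((coeFn_extTrunc 0 1 (Or.inr one_ne_zero) n f).mono fun z hz => by simp only [hz])
  have h3 : Filter.Tendsto (fun n => ∫ η, cutoff n f η * curveTrace φ η) Filter.atTop
      (nhds (∫ η, f η * curveTrace φ η)) := by
    refine tendsto_integral_of_dominated_convergence (fun η => ‖f η * curveTrace φ η‖)
      (fun n => ((measurable_cutoff hfm n).mul
        (continuous_curveTrace hφi).measurable).aestronglyMeasurable) hint.norm
      (fun n => ae_of_all _ fun η => ?_) (ae_of_all _ fun η => ?_)
    · rw [norm_mul, norm_mul]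
      gcongr
      exact norm_indicator_le_norm_self _ _
    · refine tendsto_const_nhds.congr' ?_
      obtain ⟨N, hN⟩ := exists_nat_ge |η|
      filter_upwards [Filter.eventually_ge_atTop N] with n hn
      have hn' : (N : ℝ) ≤ n := by exact_mod_cast hn
      rw [cutoff, Set.indicator_of_mem]
      exact abs_le.1 (hN.trans hn')
  rw [← hL]
  refine tendsto_nhds_unique h1 (h3.congr fun n => ?_)
  rw [Function.comp_apply, h2]

/-! ### The evolution in terms of the extension operator -/

lemma lintegral_comp_div_two_pi {F : ℝ → ℝ≥0∞} (hF : Measurable F) :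
    ∫⁻ x, F (x / (2 * Real.pi)) = ENNReal.ofReal (2 * Real.pi) * ∫⁻ x, F x := by
  have h := lintegral_comp_affine (r := (2 * Real.pi)⁻¹) (by positivity) 0 hF
  rw [inv_inv] at h
  rw [← h]
  refine lintegral_congr fun x => ?_
  congr 1
  ring

lemma quasiMeasurePreserving_div_two_pi :
    Measure.QuasiMeasurePreserving (fun x : ℝ => x / (2 * Real.pi)) volume volume := by
  have h := quasiMeasurePreserving_affine (r := (2 * Real.pi)⁻¹) (by positivity) 0
  simpa [div_eq_mul_inv, mul_comm] using h

lemma measurable_angularFourier (f : FreqSpace) : Measurable (angularFourier f) :=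
  (Lp.stronglyMeasurable _).measurable.comp (measurable_id.div_const _)

lemma lintegral_angularFourier (f : FreqSpace) :
    ∫⁻ x, ‖angularFourier f x‖ₑ ^ 2 = ENNReal.ofReal (2 * Real.pi) * ‖f‖ₑ ^ 2 := by
  have h := lintegral_comp_div_two_pi (F := fun x => ‖(𝓕 f : FreqSpace) x‖ₑ ^ 2)
    ((Lp.stronglyMeasurable _).measurable.enorm.pow_const 2)
  rw [← freq_enorm_sq] at h
  rw [show ‖f‖ₑ = ‖(𝓕 f : FreqSpace)‖ₑ by
    rw [← ofReal_norm, ← ofReal_norm, Lp.norm_fourier_eq], ← h]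
  rfl

lemma memLp_angularFourier (f : FreqSpace) : MemLp (angularFourier f) 2 := by
  refine ⟨(measurable_angularFourier f).aestronglyMeasurable, ?_⟩
  have h := eLpNorm_two_sq (μ := volume) (angularFourier f)
  rw [lintegral_angularFourier] at h
  by_contra hc
  rw [not_lt, top_le_iff] at hc
  rw [hc] at h
  have h3 : (⊤ : ℝ≥0∞) ^ 2 = ⊤ := by simp
  rw [h3] at h
  exact (ENNReal.mul_lt_top ENNReal.ofReal_lt_top (ENNReal.pow_lt_top enorm_lt_top)).ne h.symm

/-- `angularFourier f` as an element of `L²`. -/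
noncomputable def freqFourier (f : FreqSpace) : FreqSpace := (memLp_angularFourier f).toLp

lemma coeFn_freqFourier (f : FreqSpace) : freqFourier f =ᵐ[volume] angularFourier f :=
  MemLp.coeFn_toLp _

/-- Plancherel's identity in the angular normalization. -/
lemma enorm_freqFourier (f : FreqSpace) :
    ‖freqFourier f‖ₑ = ENNReal.ofReal (Real.sqrt (2 * Real.pi)) * ‖f‖ₑ := by
  have h : ‖freqFourier f‖ₑ ^ 2 =
      (ENNReal.ofReal (Real.sqrt (2 * Real.pi)) * ‖f‖ₑ) ^ 2 := by
    rw [freq_enorm_sq, mul_pow, ← ENNReal.ofReal_pow (Real.sqrt_nonneg _),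
      Real.sq_sqrt (by positivity), ← lintegral_angularFourier]
    exact lintegral_congr_ae ((coeFn_freqFourier f).mono fun x hx => by simp only [hx])
  exact le_antisymm ((ENNReal.pow_le_pow_left_iff two_ne_zero).1 h.le)
    ((ENNReal.pow_le_pow_left_iff two_ne_zero).1 h.ge)

/-- The Fourier transform maps `L²` onto `L²`, so an extremal amplitude is the transform of an
extremizer. -/
lemma exists_freqFourier_eq (g : FreqSpace) : ∃ f : FreqSpace, freqFourier f = g := by
  have hgm : Measurable g := (Lp.stronglyMeasurable g).measurable
  set h : ℝ → ℂ := fun x => g (x * (2 * Real.pi)) with hh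
  have hhm : Measurable h := hgm.comp (measurable_id.mul_const _)
  have h1 := lintegral_comp_div_two_pi (F := fun x => ‖h x‖ₑ ^ 2) (hhm.enorm.pow_const 2)
  have h2 : ∀ x : ℝ, h (x / (2 * Real.pi)) = g x := fun x => by
    rw [hh]
    simp only
    rw [div_mul_cancel₀ _ (by positivity)]
  simp_rw [h2, ← freq_enorm_sq] at h1
  have hmem : MemLp h 2 := by
    refine ⟨hhm.aestronglyMeasurable, ?_⟩
    have h3 := eLpNorm_two_sq (μ := volume) h
    by_contra hc
    rw [not_lt, top_le_iff] at hc
    rw [hc, show (⊤ : ℝ≥0∞) ^ 2 = ⊤ by simp] at h3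
    rw [← h3, ENNReal.mul_top (by
      rw [Ne, ENNReal.ofReal_eq_zero, not_le]; positivity)] at h1
    exact (ENNReal.pow_lt_top (n := 2) (enorm_lt_top (x := g))).ne h1
  refine ⟨𝓕⁻ hmem.toLp, ?_⟩
  refine Lp.ext ((coeFn_freqFourier _).trans ?_)
  have h4 := quasiMeasurePreserving_div_two_pi.ae_eq_comp hmem.coeFn_toLp
  filter_upwards [h4] with x hx
  rw [angularFourier, FourierTransform.fourier_fourierInv_eq]
  simp only [Function.comp_apply] at hx
  rw [hx, h2]

/-- The constant `6^{1/6} / (2π)` relating the evolution to the extension operator. -/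
noncomputable def evolutionConst : ℝ := 6 ^ (1 / 6 : ℝ) / (2 * Real.pi)

lemma evolutionConst_pos : 0 < evolutionConst := by
  unfold evolutionConst; positivity

/-- The evolution `D₀^{1/3} e^{it∂ₓ⁴} f` as an element of `L⁶`. -/
noncomputable def evolution (f : FreqSpace) : PlaneSpace :=
  (evolutionConst : ℂ) • extOp 0 1 (Or.inr one_ne_zero) (freqFourier f)

/-- The symbol `(6ξ²)^{1/6}` is `6^{1/6}` times the weight of the quartic operator. -/
lemma integral_evolutionSymbol (φ : ℝ × ℝ → ℂ) (ξ : ℝ) :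
    ∫ z : ℝ × ℝ, Complex.exp (Complex.I * (z.1 * ξ : ℝ)) * evolutionSymbol (1 / 3) z.2 ξ * φ z =
      ((6 ^ (1 / 6 : ℝ) : ℝ) : ℂ) * curveTrace φ ξ := by
  have hw : (6 * ξ ^ 2) ^ ((1 / 3 : ℝ) / 2) = 6 ^ (1 / 6 : ℝ) * phaseWeight 0 1 ξ := by
    rw [phaseWeight, Real.mul_rpow (by norm_num) (sq_nonneg _), ← sq_abs, ← Real.rpow_natCast,
      ← Real.rpow_mul (abs_nonneg _), zero_add, one_mul]
    norm_num
  rw [curveTrace, ← mul_assoc, ← integral_const_mul]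
  refine integral_congr_ae (ae_of_all _ fun z => ?_)
  simp only [evolutionSymbol, hw, planeChar, phaseCurve, phasePoly]
  have e : Complex.exp ((z.1 * ξ + z.2 * (6 * 0 ^ 2 * ξ ^ 2 + 4 * 0 * 1 * ξ ^ 3 + 1 ^ 2 * ξ ^ 4) :
      ℝ) * Complex.I) = Complex.exp (Complex.I * (z.1 * ξ : ℝ)) *
        Complex.exp (Complex.I * (z.2 * ξ ^ 4 : ℝ)) := by
    rw [← Complex.exp_add]
    congr 1
    push_cast
    ring
  rw [e]
  push_cast
  ring

lemma isEvolution_evolution (f : FreqSpace) : IsEvolution (1 / 3) f (evolution f) := by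
  refine ⟨(Lp.memLp (evolution f)).locallyIntegrable (by norm_num), fun φ hφ hc => ?_⟩
  have h1 : ∫ z, evolution f z * φ z = (evolutionConst : ℂ) *
      ∫ z, extOp 0 1 (Or.inr one_ne_zero) (freqFourier f) z * φ z := by
    rw [← integral_const_mul]
    refine integral_congr_ae ((Lp.coeFn_smul (evolutionConst : ℂ)
      (extOp 0 1 (Or.inr one_ne_zero) (freqFourier f))).mono fun z hz => ?_)
    simp only [evolution, hz, Pi.smul_apply, smul_eq_mul, mul_assoc]
  rw [h1, integral_extOp_mul _ hφ.continuous hc]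
  simp_rw [integral_evolutionSymbol]
  have h2 : ∫ ξ, angularFourier f ξ * (((6 ^ (1 / 6 : ℝ) : ℝ) : ℂ) * curveTrace φ ξ) =
      ((6 ^ (1 / 6 : ℝ) : ℝ) : ℂ) * ∫ ξ, freqFourier f ξ * curveTrace φ ξ := by
    rw [← integral_const_mul]
    refine integral_congr_ae ((coeFn_freqFourier f).mono fun x hx => ?_)
    simp only [hx]
    ring
  rw [h2, evolutionConst]
  push_cast
  ring

/-- A locally integrable function is determined by its pairings with test functions. -/
lemma IsEvolution.ae_eq {α : ℝ} {f : FreqSpace} {u v : ℝ × ℝ → ℂ} (hu : IsEvolution α f u)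
    (hv : IsEvolution α f v) : u =ᵐ[volume] v := by
  refine ae_eq_of_integral_contDiff_smul_eq hu.1 hv.1 fun g hg hc => ?_
  have hg' : ContDiff ℝ ∞ fun z => (g z : ℂ) := Complex.ofRealCLM.contDiff.comp hg
  have hc' : HasCompactSupport fun z => (g z : ℂ) := hc.comp_left Complex.ofReal_zero
  have e : ∀ w : ℝ × ℝ → ℂ, ∫ z, g z • w z = ∫ z, w z * (g z : ℂ) := fun w =>
    integral_congr_ae (ae_of_all _ fun z => by simp only [Complex.real_smul, mul_comm])
  rw [e, e, hu.2 _ hg' hc', hv.2 _ hg' hc']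

lemma strichartzNorm_eq (f : FreqSpace) :
    strichartzNorm f = ENNReal.ofReal evolutionConst *
      ‖extOp 0 1 (Or.inr one_ne_zero) (freqFourier f)‖ₑ := by
  have h1 : eLpNorm (evolution f) 6 volume = ENNReal.ofReal evolutionConst *
      ‖extOp 0 1 (Or.inr one_ne_zero) (freqFourier f)‖ₑ := by
    rw [← Lp.enorm_def, evolution, enorm_smul, ← ofReal_norm (evolutionConst : ℂ), Complex.norm_real,
      Real.norm_of_nonneg evolutionConst_pos.le]
  rw [← h1]
  refine le_antisymm (iInf₂_le _ (isEvolution_evolution f)) (le_iInf₂ fun u hu => ?_)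
  exact (eLpNorm_congr_ae ((isEvolution_evolution f).ae_eq hu)).le

/-- The value of the optimal constant. -/
noncomputable def optimalConst : ℝ≥0∞ :=
  ENNReal.ofReal (evolutionConst * quarticNorm * Real.sqrt (2 * Real.pi))

lemma quarticNorm_nonneg : 0 ≤ quarticNorm := norm_nonneg _

lemma optimalConst_mul (f : FreqSpace) :
    ENNReal.ofReal evolutionConst * (ENNReal.ofReal quarticNorm * ‖freqFourier f‖ₑ) =
      optimalConst * ‖f‖ₑ := by
  have h := quarticNorm_nonneg
  rw [enorm_freqFourier, optimalConst, ENNReal.ofReal_mul (mul_nonneg evolutionConst_pos.le h),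
    ENNReal.ofReal_mul evolutionConst_pos.le]
  ring

lemma strichartzNorm_le (f : FreqSpace) : strichartzNorm f ≤ optimalConst * ‖f‖ₑ := by
  rw [strichartzNorm_eq, ← optimalConst_mul]
  gcongr
  rw [← ofReal_norm, ← ofReal_norm, ← ENNReal.ofReal_mul quarticNorm_nonneg]
  exact ENNReal.ofReal_le_ofReal (ContinuousLinearMap.le_opNorm _ _)

lemma exists_strichartzNorm_eq :
    ∃ f : FreqSpace, f ≠ 0 ∧ strichartzNorm f = optimalConst * ‖f‖ₑ := by
  obtain ⟨φ, hφ, heq⟩ := exists_extremizer_extOp norm_extOp_schrodinger_lt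
  obtain ⟨f, rfl⟩ := exists_freqFourier_eq φ
  refine ⟨f, ?_, ?_⟩
  · rintro rfl
    have h := enorm_freqFourier 0
    rw [enorm_zero, mul_zero, enorm_eq_zero] at h
    exact hφ h
  · rw [strichartzNorm_eq, ← optimalConst_mul, ← ofReal_norm, heq,
      ENNReal.ofReal_mul quarticNorm_nonneg, ofReal_norm]

lemma strichartzConstant_eq : strichartzConstant = optimalConst := by
  refine le_antisymm (iSup₂_le fun f _ => ENNReal.div_le_of_le_mul (strichartzNorm_le f)) ?_
  obtain ⟨f, hf, heq⟩ := exists_strichartzNorm_eq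
  refine le_trans (le_of_eq ?_) (le_iSup₂ (f := fun (f : FreqSpace) (_ : f ≠ 0) =>
    strichartzNorm f / ‖f‖ₑ) f hf)
  simp only [heq]
  rw [ENNReal.mul_div_cancel_right (enorm_ne_zero.2 hf) enorm_ne_top]

/-- The Strichartz inequality holds with a finite optimal constant, which is attained. -/
theorem theorem1 :
    strichartzConstant < ⊤ ∧
    (∀ f : Lp ℂ 2 (volume : Measure ℝ),
      strichartzNorm f ≤ strichartzConstant * ‖f‖ₑ) ∧
    ∃ f : Lp ℂ 2 (volume : Measure ℝ),
      f ≠ 0 ∧ strichartzNorm f = strichartzConstant * ‖f‖ₑ := by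
  rw [strichartzConstant_eq]
  exact ⟨ENNReal.ofReal_lt_top, strichartzNorm_le, exists_strichartzNorm_eq⟩
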